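/- Let $k$ be an algebraically closed field. A variety over $k$ is a reduced separated scheme of finite type over $k$, identified with its set of $k$-points with the Zariski topology. A toric monoid is an irreducible algebraic monoid $M$ over $k$ (an irreducible variety with an associative multiplication morphism $M\times M\to M$ and a neutral element $1$) whose unit group $T$ (the group of invertible elements, an algebraic group as an open subvariety of $M$) is a torus, i.e. isomorphic to $\mathbb{G}_m^n$ for some $n\ge 0$. Let $E(M)=\{e\in M : e^2=e\}$, partially ordered by $e\le f$ if and only if $e=ef=fe$. A subsemigroup is a nonempty subset stable under multiplication. Let $M$ be a toric monoid with unit group $T$. Then $E(M)$ has a smallest element $e_0$. Let $T_0$ be the reduced neutral component of the isotropy group $T_{e_0}=\{t\in T : te_0=e_0\}$, and let $\overline{T_0}$ be its closure in $M$. Then: (i) Every maximal chain of $E(M)$ is finite, and its length (its number of elements minus one) equals $\dim(T_0)$. (ii) $\overline{T_0}$ is the smallest (for inclusion) closed irreducible subsemigroup of $M$ containing $E(M)$. (iii) $\overline{T_0}$ is the largest (for inclusion) closed irreducible subsemigroup of $M$ having a zero, i.e. an element $z$ with $zx=xz=z$ for all elements $x$ of the subsemigroup. (iv) Let $F$ be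 a subfield of $k$. If the algebraic semigroup $M$ is defined over $F$, that is, the variety $M$ and its multiplication are obtained by extension of scalars from a separated $F$-scheme $M_F$ of finite type and a morphism $M_F\times_F M_F\to M_F$, then so is $\overline{T_0}$: there is a closed subscheme $Y$ of $M_F$, stable under the multiplication, such that $Y\times_F k$ is the closed subvariety $\overline{T_0}$ of $M$ (with its reduced structure). -/

import Mathlib

open CategoryTheory AlgebraicGeometry MonoidalCategory MonObj

universe u

namespace ToricMonoid

noncomputable section

/-- Varieties over `k`: reduced separated schemes of finite type over `k`
(not necessarily irreducible). -/
structure IsVariety {k : Type u} [Field k] (X : Over (Spec (.of k))) : Prop where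
  isSeparated : IsSeparated X.hom
  locallyOfFiniteType : LocallyOfFiniteType X.hom
  quasiCompact : QuasiCompact X.hom
  isReduced : IsReduced X.left

/-- The `k`-rational points of a scheme `X` over `k`. -/
def Pt {k : Type u} [Field k] (X : Over (Spec (.of k))) : Type u :=
  𝟙_ (Over (Spec (.of k))) ⟶ X

/-- The point of the underlying topological space of `X` given by a `k`-rational point. -/
def Pt.toSpace {k : Type u} [Field k] {X : Over (Spec (.of k))} (x : Pt X) : X.left :=
  (CommaMorphism.left x : Spec (.of k) ⟶ X.left) (IsLocalRing.closedPoint k)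

/-- The image of a `k`-rational point under a morphism of `k`-schemes. -/
def Pt.map {k : Type u} [Field k] {X Y : Over (Spec (.of k))} (f : X ⟶ Y) (x : Pt X) : Pt Y :=
  CategoryStruct.comp (obj := Over (Spec (.of k))) x f

/-- The Zariski topology on the set of `k`-rational points. -/
instance {k : Type u} [Field k] (X : Over (Spec (.of k))) : TopologicalSpace (Pt X) :=
  .induced Pt.toSpace inferInstance

/-- The multiplication of `k`-rational points of an algebraic monoid. -/
instance {k : Type u} [Field k] (M : Over (Spec (.of k))) [MonObj M] : Monoid (Pt M) :=
  inferInstanceAs (Monoid (𝟙_ (Over (Spec (.of k))) ⟶ M))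

/-- The `n`-dimensional torus `𝔾ₘⁿ = Spec k[ℤⁿ]` over `k`; it is a group object through the
Hopf algebra structure of the group algebra. -/
abbrev splitTorus (k : Type u) [Field k] (n : ℕ) : Over (Spec (.of k)) :=
  (Spec (.of (AddMonoidAlgebra k (Fin n → ℤ)))).asOver (Spec (.of k))

/-- Toric monoids over an algebraically closed field `k`: irreducible algebraic monoids `M` whose
unit group is a torus. The unit group is an algebraic group as an open subscheme of `M`; so the
condition is that some homomorphism of algebraic monoids `𝔾ₘⁿ ⟶ M` is an isomorphism onto an
open subscheme whose `k`-points are the invertible elements of `M`. -/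
structure IsToricMonoid {k : Type u} [Field k] (M : Over (Spec (.of k))) [MonObj M] : Prop
    extends IsVariety M where
  irreducibleSpace : IrreducibleSpace M.left
  unitGroup_isTorus : ∃ (n : ℕ) (j : splitTorus k n ⟶ M), IsMonHom j ∧ IsOpenImmersion j.left ∧
    ∀ x : Pt M, IsUnit x ↔ ∃ t : Pt (splitTorus k n), Pt.map j t = x

/-- The set `E(S)` of idempotents. -/
abbrev Idempotents (S : Type*) [Mul S] : Type _ := {e : S // IsIdempotentElem e}

/-- The partial order on idempotents: `e ≤ f` if `e = ef = fe`. -/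
def IdemLE {S : Type*} [Mul S] (e f : Idempotents S) : Prop :=
  (e : S) = e * f ∧ (e : S) = f * e

/-- The (points of the) isotropy group `T_e` in the unit group `T`. -/
def isotropy {S : Type*} [Monoid S] (e : S) : Set S := {t | IsUnit t ∧ t * e = e}

/-- The (points of the) reduced neutral component of the isotropy group `T_e`. -/
def neutralIsotropy {S : Type*} [Monoid S] [TopologicalSpace S] (e : S) : Set S :=
  connectedComponentIn (isotropy e) 1

/-- Closed irreducible (in particular nonempty) subsemigroups. -/
structure IsClosedIrreducibleSubsemigroup {S : Type*} [Mul S] [TopologicalSpace S]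
    (A : Set S) : Prop where
  isClosed : IsClosed A
  isIrreducible : IsIrreducible A
  mul_mem : ∀ x ∈ A, ∀ y ∈ A, x * y ∈ A

/-- The subsemigroup `A` has a zero. -/
def HasZeroElement {S : Type*} [Mul S] (A : Set S) : Prop :=
  ∃ z ∈ A, ∀ x ∈ A, z * x = z ∧ x * z = z

/-- Extension of scalars of schemes along a field extension `k / F`. -/
abbrev baseChange (F k : Type u) [Field F] [Field k] [Algebra F k] :
    Over (Spec (.of F)) ⥤ Over (Spec (.of k)) :=
  Over.pullback (Spec.map (CommRingCat.ofHom (algebraMap F k)))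

/-- An `F`-structure on the algebraic semigroup underlying `M`: the variety `M` and its
multiplication are obtained by extension of scalars from a separated `F`-scheme of finite type
and a morphism of `F`-schemes. -/
structure SemigroupForm (F : Type u) {k : Type u} [Field F] [Field k] [Algebra F k]
    (M : Over (Spec (.of k))) [MonObj M] where
  obj : Over (Spec (.of F))
  isSeparated : IsSeparated obj.hom
  locallyOfFiniteType : LocallyOfFiniteType obj.hom
  quasiCompact : QuasiCompact obj.hom
  mul : obj ⊗ obj ⟶ obj
  iso : (baseChange F k).obj obj ≅ M
  iso_mul : Functor.LaxMonoidal.μ (baseChange F k) obj obj ≫ (baseChange F k).map mul ≫ iso.hom =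
    (iso.hom ⊗ₘ iso.hom) ≫ μ[M]

/-- With respect to a given `F`-structure on `M`, a closed subsemigroup `Z` of `M` (regarded as a
reduced subscheme, with the induced multiplication) is defined over `F`: there is a closed
`F`-subscheme `Y`, stable under multiplication, whose extension of scalars to `k` is reduced
and has `Z` as its set of `k`-points. -/
def SemigroupForm.Defines {F k : Type u} [Field F] [Field k] [Algebra F k]
    {M : Over (Spec (.of k))} [MonObj M] (Φ : SemigroupForm F M) (Z : Set (Pt M)) : Prop :=
  ∃ (Y : Over (Spec (.of F))) (i : Y ⟶ Φ.obj) (m : Y ⊗ Y ⟶ Y),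
    IsClosedImmersion i.left ∧ m ≫ i = (i ⊗ₘ i) ≫ Φ.mul ∧
    IsReduced ((baseChange F k).obj Y).left ∧
    ∀ x : Pt M, x ∈ Z ↔
      ∃ y : Pt ((baseChange F k).obj Y), Pt.map ((baseChange F k).map i ≫ Φ.iso.hom) y = x

end

end ToricMonoid

set_option linter.unusedSectionVars false

/-! The theorem is combinatorial once `M` is known to be affine: `M` is the spectrum of `k[S]` for a
finitely generated monoid `S ⊆ ℤⁿ` generating `ℤⁿ`, and its points are the homomorphisms from `S` to
the multiplicative monoid of `k`. An idempotent takes only the values 0 and 1 and is determined by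
the face of `S` where it is 1. So `E(M)` is the poset of faces (`idempotentsIso`), and `e₀`
corresponds to the face of units of `S`. Let `U` be the rational span of these units. A unit of `M`
fixes `e₀` if it is 1 on the units of `S`; up to finitely many roots of unity this says that `χ_s =
χ_s'` whenever `s - s' ∈ U`. These equations define `T₀`, and they also define its closure
(`neutralIsotropy_eq`, `closure_centralTorus`), so `dim T₀ = n - dim U`.

(i) The rank of a face grows by exactly one along consecutive faces, so every maximal chain has
length `n - dim U` (`encard_maxChain_faces`). (ii) Let `A` be closed, irreducible and contain all
idempotents, and let `W` be the span of the differences of characters that agree on the units of `M`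
in `A`. The idempotents force every face to be saturated modulo `W`, so a maximal chain of faces
stays strict modulo `W`. Counting ranks gives `W ⊆ U` (`rank_image_of_saturated`), that is, `A`
satisfies no more equations than the closure of `T₀`. (iii) If `A` has a zero, characters congruent
modulo `U` differ on `A` by a root of unity. It is constant by irreducibility and equals its own
square because `A` is multiplicative. (iv) Let `Q` be the image of `S` modulo `U`. Transporting
characters along a second embedding of `k` gives group-like elements over `Q`. Since `Q` is sharp,
the invertible ones are 1, and since `Q` is torsion free, characters with the same image in `Q` stay
equal. Applied to the two embeddings of `k` in `k ⊗[F] k`, this descends the equations without any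
separability assumption.

Affineness rests on an idempotent `e` that lies in every nonempty closed subset stable under the
torus (`exists_idempotent`). Let `S` be the monoid of characters regular at `e`; they extend to `M`,
and `Γ(M) = k[S]`. Multiplication by `e` induces an endomorphism `π` of the local ring at `e`, whose
invariants are fractions of combinations of units of `S`. A duality argument with infinitesimal
points shows that `k[S]` is dense in this local ring (`exists_section_jet`,
`exists_sub_lift_mem_pow`). Krull's intersection theorem then gives that `S` is finitely generated
and generates `ℤⁿ`, and that germs at `e` are fractions of elements of `k[S]` with denominators not
killed by `π`. Hence `e` has affine neighbourhoods defined by one function whose translates generate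
the unit ideal (`isAffine_of_isCore`). -/

namespace ToricMonoid

/-! ### Faces of monoids in a rational vector space, and their ranks. -/

section Faces

variable {V : Type*} [AddCommGroup V] [Module ℚ V]

/-- `F` is a face of the commutative monoid `S`. -/
structure IsFace (S F : AddSubmonoid V) : Prop where
  le : F ≤ S
  mem_of_add_mem : ∀ a ∈ S, ∀ b ∈ S, a + b ∈ F → a ∈ F

/-- The rank of a submonoid of a rational vector space. -/
noncomputable def monoidRank (F : AddSubmonoid V) : ℕ :=
  Module.finrank ℚ (Submodule.span ℚ (F : Set V))

/-- The smallest face of a monoid: its group of invertible elements. -/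
def unitFace (S : AddSubmonoid V) : AddSubmonoid V where
  carrier := {s | s ∈ S ∧ -s ∈ S}
  zero_mem' := by simp
  add_mem' := by
    rintro a b ⟨ha, ha'⟩ ⟨hb, hb'⟩
    refine ⟨add_mem ha hb, ?_⟩
    rw [neg_add]
    exact add_mem ha' hb'

lemma isFace_self (S : AddSubmonoid V) : IsFace S S := ⟨le_rfl, fun _ ha _ _ _ ↦ ha⟩

lemma isFace_unitFace (S : AddSubmonoid V) : IsFace S (unitFace S) := by
  refine ⟨fun s hs ↦ hs.1, fun a ha b hb hab ↦ ⟨ha, ?_⟩⟩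
  have := add_mem hb hab.2
  rwa [show b + -(a + b) = -a by abel] at this

lemma IsFace.unitFace_le {S F : AddSubmonoid V} (h : IsFace S F) : unitFace S ≤ F := by
  intro s hs
  refine h.mem_of_add_mem s hs.1 (-s) hs.2 ?_
  simp

lemma IsFace.mem_of_nsmul_mem {S F : AddSubmonoid V} (h : IsFace S F) {s : V} (hs : s ∈ S)
    {m : ℕ} (hm : m ≠ 0) (hms : m • s ∈ F) : s ∈ F := by
  obtain ⟨m, rfl⟩ := Nat.exists_eq_succ_of_ne_zero hm
  refine h.mem_of_add_mem s hs (m • s) (nsmul_mem hs m) ?_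
  rwa [succ_nsmul'] at hms

/-- Denominators are cleared and negative coefficients moved to the other side. This turns rational
relations into identities inside the monoid, where the face property applies. -/
lemma exists_nsmul_add_eq_of_mem_span {F : AddSubmonoid V} {v : V}
    (hv : v ∈ Submodule.span ℚ (F : Set V)) :
    ∃ m : ℕ, m ≠ 0 ∧ ∃ f ∈ F, ∃ f' ∈ F, m • v + f = f' := by
  induction hv using Submodule.span_induction with
  | mem x hx => exact ⟨1, one_ne_zero, 0, zero_mem _, x, hx, by simp⟩
  | zero => exact ⟨1, one_ne_zero, 0, zero_mem _, 0, zero_mem _, by simp⟩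
  | add x y _ _ hx hy =>
    obtain ⟨m, hm, f, hf, f', hf', h⟩ := hx
    obtain ⟨n, hn, g, hg, g', hg', h'⟩ := hy
    refine ⟨m * n, mul_ne_zero hm hn, n • f + m • g, add_mem (nsmul_mem hf _) (nsmul_mem hg _),
      n • f' + m • g', add_mem (nsmul_mem hf' _) (nsmul_mem hg' _), ?_⟩
    rw [← h, ← h', smul_add, smul_add, smul_add, smul_smul, smul_smul, mul_comm n m]
    abel
  | smul q x _ hx =>
    obtain ⟨m, hm, f, hf, f', hf', h⟩ := hx
    have hq : (m * q.den) • (q • x) = q.num • (m • x) := by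
      rw [← Nat.cast_smul_eq_nsmul ℚ, ← Int.cast_smul_eq_zsmul ℚ, ← Nat.cast_smul_eq_nsmul ℚ,
        smul_smul, smul_smul]
      congr 1
      push_cast
      have := Rat.den_mul_eq_num q
      rw [_root_.mul_assoc, this, _root_.mul_comm]
    have hx' : m • x = f' - f := by rw [← h]; abel
    refine ⟨m * q.den, mul_ne_zero hm q.den_ne_zero, ?_⟩
    rw [hq, hx']
    obtain ⟨k, hk | hk⟩ := q.num.eq_nat_or_neg
    · refine ⟨k • f, nsmul_mem hf _, k • f', nsmul_mem hf' _, ?_⟩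
      rw [hk, natCast_zsmul, smul_sub]; abel
    · refine ⟨k • f', nsmul_mem hf' _, k • f, nsmul_mem hf _, ?_⟩
      rw [hk, neg_smul, natCast_zsmul, smul_sub]; abel

/-- From `m • s + f = f'` with `f, f' ∈ F`, the element `m • s`, hence `s`, is a summand of an
element of `F`. So a face is cut out of `S` by its rational span, and ranks strictly increase along
strict inclusions of faces. -/
lemma IsFace.mem_of_mem_span {S F : AddSubmonoid V} (h : IsFace S F) {s : V} (hs : s ∈ S)
    (hv : s ∈ Submodule.span ℚ (F : Set V)) : s ∈ F := by
  obtain ⟨m, hm, f, hf, f', hf', e⟩ := exists_nsmul_add_eq_of_mem_span hv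
  refine h.mem_of_nsmul_mem hs hm (h.mem_of_add_mem _ (nsmul_mem hs _) f (h.le hf) ?_)
  rwa [e]

lemma IsFace.rank_lt [Module.Finite ℚ V] {S F G : AddSubmonoid V} (hF : IsFace S F)
    (hG : G ≤ S) (hFG : F < G) : monoidRank F < monoidRank G := by
  refine Submodule.finrank_lt_finrank_of_lt (lt_of_le_of_ne (Submodule.span_mono hFG.le) ?_)
  intro h
  obtain ⟨s, hsG, hsF⟩ := SetLike.exists_of_lt hFG
  exact hsF (hF.mem_of_mem_span (hG hsG) (h ▸ Submodule.subset_span hsG))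

/-- The rational cone with finite set of generators `T`. -/
def finsetCone (T : Finset V) : AddSubmonoid V where
  carrier := {x | ∃ c : V → ℚ, (∀ v, 0 ≤ c v) ∧ x = ∑ v ∈ T, c v • v}
  zero_mem' := ⟨0, fun _ ↦ le_rfl, by simp⟩
  add_mem' := by
    rintro a b ⟨c, hc, rfl⟩ ⟨d, hd, rfl⟩
    refine ⟨c + d, fun v ↦ add_nonneg (hc v) (hd v), ?_⟩
    simp [add_smul, Finset.sum_add_distrib]

lemma smul_mem_finsetCone {T : Finset V} {x : V} (hx : x ∈ finsetCone T) {q : ℚ} (hq : 0 ≤ q) :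
    q • x ∈ finsetCone T := by
  obtain ⟨c, hc, rfl⟩ := hx
  exact ⟨fun v ↦ q * c v, fun v ↦ mul_nonneg hq (hc v), by simp [Finset.smul_sum, smul_smul]⟩

lemma mem_finsetCone {T : Finset V} {v : V} (hv : v ∈ T) : v ∈ finsetCone T := by
  classical
  refine ⟨fun w ↦ if w = v then 1 else 0, fun w ↦ by dsimp only; split_ifs <;> simp, ?_⟩
  simp [hv]

lemma finsetCone_le {T : Finset V} {C : AddSubmonoid V}
    (hC : ∀ x ∈ C, ∀ q : ℚ, 0 ≤ q → q • x ∈ C) (hT : ∀ v ∈ T, v ∈ C) : finsetCone T ≤ C := by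
  rintro _ ⟨c, hc, rfl⟩
  exact sum_mem fun v hv ↦ hC v (hT v hv) _ (hc v)

/-- A nonzero strictly convex finitely generated rational cone has an extremal ray. -/
lemma exists_extremal (T : Finset V) (hne : ∃ v ∈ T, v ≠ 0)
    (hsharp : ∀ x ∈ finsetCone T, -x ∈ finsetCone T → x = 0) :
    ∃ v ∈ finsetCone T, v ≠ 0 ∧ ∀ u ∈ finsetCone T, ∀ w ∈ finsetCone T, u + w = v →
      ∃ q : ℚ, u = q • v := by
  classical
  induction hn : T.card using Nat.strong_induction_on generalizing T with
  | _ n ih =>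
  -- A redundant generator can be dropped; once no generator is redundant, every nonzero generator
  -- spans an extremal ray.
  by_cases hred : ∃ v ∈ T, v ∈ finsetCone (T.erase v)
  · obtain ⟨v, hvT, hv⟩ := hred
    have hle : finsetCone T = finsetCone (T.erase v) := by
      refine le_antisymm (finsetCone_le (fun x hx q hq ↦ smul_mem_finsetCone hx hq) ?_)
        (finsetCone_le (fun x hx q hq ↦ smul_mem_finsetCone hx hq) ?_)
      · intro w hw
        by_cases hwv : w = v
        · exact hwv ▸ hv
        · exact mem_finsetCone (Finset.mem_erase.2 ⟨hwv, hw⟩)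
      · intro w hw
        exact mem_finsetCone (Finset.mem_of_mem_erase hw)
    rw [hle] at hsharp ⊢
    refine ih _ ?_ (T.erase v) ?_ hsharp rfl
    · rw [Finset.card_erase_of_mem hvT, ← hn]
      exact Nat.sub_lt (Finset.card_pos.2 ⟨v, hvT⟩) one_pos
    · by_contra! h0
      obtain ⟨w, hwT, hw0⟩ := hne
      have hz : ∀ x ∈ finsetCone (T.erase v), x = 0 := by
        rintro _ ⟨c, hc, rfl⟩
        exact Finset.sum_eq_zero fun u hu ↦ by rw [h0 u hu, smul_zero]
      by_cases hwv : w = v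
      · exact hw0 (hwv ▸ hz v hv)
      · exact hw0 (h0 w (Finset.mem_erase.2 ⟨hwv, hwT⟩))
  · push Not at hred
    obtain ⟨v, hvT, hv0⟩ := hne
    refine ⟨v, mem_finsetCone hvT, hv0, ?_⟩
    rintro u ⟨c, hc, hu⟩ w ⟨d, hd, hw⟩ huw
    have hle : finsetCone (T.erase v) ≤ finsetCone T :=
      finsetCone_le (fun x hx q hq ↦ smul_mem_finsetCone hx hq)
        fun w hw ↦ mem_finsetCone (Finset.mem_of_mem_erase hw)
    set u' := ∑ x ∈ T.erase v, c x • x with hu'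
    set w' := ∑ x ∈ T.erase v, d x • x with hw'
    have hu'm : u' ∈ finsetCone (T.erase v) := ⟨c, hc, rfl⟩
    have hw'm : w' ∈ finsetCone (T.erase v) := ⟨d, hd, rfl⟩
    have hu2 : u = c v • v + u' := by
      rw [hu, hu', Finset.add_sum_erase T (fun x ↦ c x • x) hvT]
    have hw2 : w = d v • v + w' := by
      rw [hw, hw', Finset.add_sum_erase T (fun x ↦ d x • x) hvT]
    -- If `1 - c v - d v` is positive, `v` lies in the cone of the other generators, against
    -- irredundancy. Otherwise `-(u' + w')` lies in the cone, and strict convexity gives first `u' +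
    -- w' = 0` and then `u' = 0`.
    have key : (1 - c v - d v) • v = u' + w' := by
      rw [sub_smul, sub_smul, one_smul]
      nth_rewrite 1 [← huw]
      rw [hu2, hw2]; abel
    by_cases hpos : 0 < 1 - c v - d v
    · refine absurd ?_ (hred v hvT)
      have := smul_mem_finsetCone (add_mem hu'm hw'm) (inv_nonneg.2 hpos.le)
      rwa [← key, inv_smul_smul₀ hpos.ne'] at this
    · have h1 : -(u' + w') ∈ finsetCone T := by
        rw [← key, ← neg_smul]
        exact smul_mem_finsetCone (mem_finsetCone hvT) (by linarith)
      have h2 : u' + w' = 0 := hsharp _ (hle (add_mem hu'm hw'm)) h1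
      have h3 : u' = 0 := hsharp _ (hle hu'm) (by
        rw [← eq_neg_of_add_eq_zero_right h2]; exact hle hw'm)
      exact ⟨c v, by rw [hu2, h3, add_zero]⟩

/-- The smallest face containing the face `F` and the element `b`. -/
def faceGen (S F : AddSubmonoid V) (b : V) : AddSubmonoid V where
  carrier := {g | g ∈ S ∧ ∃ n : ℕ, ∃ h ∈ S, ∃ f ∈ F, g + h = n • b + f}
  zero_mem' := ⟨zero_mem _, 0, 0, zero_mem _, 0, zero_mem _, by simp⟩
  add_mem' := by
    rintro x y ⟨hx, n, h, hh, f, hf, e⟩ ⟨hy, n', h', hh', f', hf', e'⟩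
    refine ⟨add_mem hx hy, n + n', h + h', add_mem hh hh', f + f', add_mem hf hf', ?_⟩
    rw [add_smul, add_add_add_comm, e, e', add_add_add_comm]

lemma isFace_faceGen (S F : AddSubmonoid V) (b : V) : IsFace S (faceGen S F b) := by
  refine ⟨fun g hg ↦ hg.1, ?_⟩
  rintro a ha c hc ⟨-, n, h, hh, f, hf, e⟩
  exact ⟨ha, n, c + h, add_mem hc hh, f, hf, by rw [← add_assoc, e]⟩

/-- A sum lies in a face only if all its summands do, so the generators of `S` that lie in `F`
generate `F`. -/
lemma IsFace.exists_generators {S F : AddSubmonoid V} (hS : S.FG) (hF : IsFace S F) :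
    ∃ T : Finset V, AddSubmonoid.closure (T : Set V) = F := by
  classical
  obtain ⟨T, rfl⟩ := hS
  refine ⟨T.filter (· ∈ F), le_antisymm (AddSubmonoid.closure_le.2 fun x hx ↦ by
    simpa using (Finset.mem_filter.1 hx).2) fun x hx ↦ ?_⟩
  have hxS := hF.le hx
  revert hx
  induction hxS using AddSubmonoid.closure_induction with
  | mem x hxT =>
    intro hx
    exact AddSubmonoid.subset_closure (by simpa using ⟨hxT, hx⟩)
  | zero => intro _; exact zero_mem _
  | add x y hx hy ihx ihy =>
    intro h
    exact add_mem (ihx (hF.mem_of_add_mem x hx y hy h))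
      (ihy (hF.mem_of_add_mem y hy x hx (by rwa [add_comm])))

/-- The rank jumps by at most one along a pair of consecutive faces. -/
lemma IsFace.rank_le_succ [Module.Finite ℚ V] {S F G : AddSubmonoid V} (hS : S.FG)
    (hF : IsFace S F) (hG : IsFace S G) (hFG : F < G)
    (hcov : ∀ H, IsFace S H → F ≤ H → H ≤ G → H = F ∨ H = G) :
    monoidRank G ≤ monoidRank F + 1 := by
  classical
  -- Modulo `W` the face `G` generates a strictly convex cone. Since `G` covers `F`, an extremal ray
  -- of this cone generates `G` as a face over `F`, so all of `G` projects to the line of that ray.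
  set W := Submodule.span ℚ (F : Set V) with hW
  obtain ⟨T, hT⟩ := hG.exists_generators hS
  let π : V →ₗ[ℚ] V ⧸ W := W.mkQ
  have hπ0 : ∀ g ∈ G, π g = 0 → g ∈ F := fun g hg h ↦
    hF.mem_of_mem_span (hG.le hg) (by simpa [π, hW] using h)
  let T' : Finset (V ⧸ W) := T.image π
  have hGC : ∀ g ∈ G, π g ∈ finsetCone T' := by
    intro g hg
    rw [← hT] at hg
    induction hg using AddSubmonoid.closure_induction with
    | mem x hx => exact mem_finsetCone (Finset.mem_image_of_mem _ hx)
    | zero => simp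
    | add x y _ _ hx hy => rw [map_add]; exact add_mem hx hy
  have hCG : ∀ x ∈ finsetCone T', ∃ N : ℕ, N ≠ 0 ∧ ∃ g ∈ G, N • x = π g := by
    let C : AddSubmonoid (V ⧸ W) :=
      { carrier := {x | ∃ N : ℕ, N ≠ 0 ∧ ∃ g ∈ G, N • x = π g}
        zero_mem' := ⟨1, one_ne_zero, 0, zero_mem _, by simp⟩
        add_mem' := by
          rintro x y ⟨N, hN, g, hg, e⟩ ⟨N', hN', g', hg', e'⟩
          refine ⟨N * N', mul_ne_zero hN hN', N' • g + N • g',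
            add_mem (nsmul_mem hg _) (nsmul_mem hg' _), ?_⟩
          rw [map_add, map_nsmul, map_nsmul, ← e, ← e', smul_smul, smul_smul, smul_add,
            mul_comm N' N] }
    refine finsetCone_le (C := C) ?_ ?_
    · rintro x ⟨N, hN, g, hg, e⟩ q hq
      refine ⟨N * q.den, mul_ne_zero hN q.den_ne_zero, q.num.toNat • g, nsmul_mem hg _, ?_⟩
      rw [map_nsmul, ← e, ← Nat.cast_smul_eq_nsmul ℚ, ← Nat.cast_smul_eq_nsmul ℚ,
        ← Nat.cast_smul_eq_nsmul ℚ, smul_smul, smul_smul]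
      congr 1
      have h1 : ((q.num.toNat : ℕ) : ℚ) = q.num := by
        have : ((q.num.toNat : ℕ) : ℤ) = q.num := Int.toNat_of_nonneg (Rat.num_nonneg.2 hq)
        exact_mod_cast this
      have := Rat.den_mul_eq_num q
      rw [h1, ← this]
      push_cast
      ring
    · intro v hv
      obtain ⟨g, hg, rfl⟩ := Finset.mem_image.1 hv
      exact ⟨1, one_ne_zero, g, hT ▸ AddSubmonoid.subset_closure hg, by simp⟩
  -- Multiples of `x` and `-x` lift to `g, g' ∈ G` with a positive combination of them in `F`; the
  -- face property then puts `g` in `F`.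
  have hsharp : ∀ x ∈ finsetCone T', -x ∈ finsetCone T' → x = 0 := by
    intro x hx hx'
    obtain ⟨N, hN, g, hg, e⟩ := hCG x hx
    obtain ⟨N', hN', g', hg', e'⟩ := hCG _ hx'
    have h1 : N' • g + N • g' ∈ F := by
      refine hπ0 _ (add_mem (nsmul_mem hg _) (nsmul_mem hg' _)) ?_
      rw [map_add, map_nsmul, map_nsmul, ← e, ← e', smul_smul, smul_smul, mul_comm N' N]
      simp
    have h2 : g ∈ F := hF.mem_of_nsmul_mem (hG.le hg) hN' (hF.mem_of_add_mem _
      (nsmul_mem (hG.le hg) _) _ (nsmul_mem (hG.le hg') _) h1)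
    have h3 : π g = 0 := by
      simpa [π] using (Submodule.subset_span h2 : g ∈ W)
    rw [h3] at e
    rw [← Nat.cast_smul_eq_nsmul ℚ] at e
    exact (smul_eq_zero.1 e).resolve_left (by exact_mod_cast hN)
  have hne : ∃ v ∈ T', v ≠ 0 := by
    by_contra! h0
    obtain ⟨s, hsG, hsF⟩ := SetLike.exists_of_lt hFG
    refine hsF (hπ0 s hsG ?_)
    obtain ⟨c, -, h⟩ := hGC s hsG
    rw [h]
    exact Finset.sum_eq_zero fun u hu ↦ by rw [h0 u hu, smul_zero]
  obtain ⟨v, hvC, hv0, hext⟩ := exists_extremal T' hne hsharp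
  obtain ⟨N, hN, b, hb, hNb⟩ := hCG v hvC
  have hbF : b ∉ F := by
    intro hbF
    have h3 : π b = 0 := by simpa [π] using (Submodule.subset_span hbF : b ∈ W)
    rw [h3, ← Nat.cast_smul_eq_nsmul ℚ] at hNb
    exact hv0 ((smul_eq_zero.1 hNb).resolve_left (by exact_mod_cast hN))
  have hHG : faceGen S F b = G := by
    have hFH : F ≤ faceGen S F b := fun f hf ↦
      ⟨hF.le hf, 0, 0, zero_mem _, f, hf, by simp⟩
    have hbH : b ∈ faceGen S F b := ⟨hG.le hb, 1, 0, zero_mem _, 0, zero_mem _, by simp⟩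
    refine (hcov _ (isFace_faceGen S F b) hFH ?_).resolve_left fun h ↦ hbF (h ▸ hbH)
    rintro g ⟨hg, n, h, hh, f, hf, e⟩
    exact hG.mem_of_add_mem g hg h hh (e ▸ add_mem (nsmul_mem hb _) (hFG.le hf))
  -- Modulo `F`, `g` is a summand of a multiple of `b`, so extremality applies after division by `n
  -- * N`. If this number is 0, sharpness of the cone gives `π g = 0` instead.
  have hray : ∀ g ∈ G, ∃ q : ℚ, π g = q • v := by
    intro g hg
    obtain ⟨-, n, h, hh, f, hf, e⟩ : g ∈ faceGen S F b := hHG ▸ hg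
    have hhG : h ∈ G := hG.mem_of_add_mem h hh g (hG.le hg) (by
      rw [add_comm, e]; exact add_mem (nsmul_mem hb _) (hFG.le hf))
    have hf0 : π f = 0 := by simpa [π] using (Submodule.subset_span hf : f ∈ W)
    have e2 : π g + π h = ((n * N : ℕ) : ℚ) • v := by
      rw [← map_add, e, map_add, map_nsmul, hf0, add_zero, ← hNb, smul_smul,
        Nat.cast_smul_eq_nsmul]
    by_cases hnN : n * N = 0
    · rw [hnN, Nat.cast_zero, zero_smul] at e2
      refine ⟨0, ?_⟩
      rw [zero_smul]
      exact hsharp _ (hGC g hg) (by rw [neg_eq_of_add_eq_zero_right e2]; exact hGC h hhG)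
    · have hq : ((n * N : ℕ) : ℚ) ≠ 0 := by exact_mod_cast hnN
      have hq0 : 0 ≤ (((n * N : ℕ) : ℚ))⁻¹ := by positivity
      obtain ⟨q, hq'⟩ := hext _ (smul_mem_finsetCone (hGC g hg) hq0) _
        (smul_mem_finsetCone (hGC h hhG) hq0)
        (by rw [← smul_add, e2, inv_smul_smul₀ hq])
      refine ⟨((n * N : ℕ) : ℚ) * q, ?_⟩
      rw [mul_smul, ← hq', smul_inv_smul₀ hq]
  have hspan : Submodule.span ℚ (G : Set V) ≤ W ⊔ Submodule.span ℚ {b} := by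
    rw [Submodule.span_le]
    intro g hg
    obtain ⟨q, hq⟩ := hray g hg
    have hN' : ((N : ℕ) : ℚ) ≠ 0 := by exact_mod_cast hN
    have hv : v = ((N : ℕ) : ℚ)⁻¹ • π b := by
      rw [← hNb, ← Nat.cast_smul_eq_nsmul ℚ, inv_smul_smul₀ hN']
    have h1 : g - (q * (N : ℚ)⁻¹) • b ∈ W := by
      rw [← Submodule.ker_mkQ W, LinearMap.mem_ker]
      change π _ = 0
      rw [map_sub, map_smul, hq, hv, smul_smul, sub_self]
    have h2 : (q * (N : ℚ)⁻¹) • b ∈ Submodule.span ℚ {b} :=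
      Submodule.smul_mem _ _ (Submodule.mem_span_singleton_self b)
    have := Submodule.add_mem_sup h1 h2
    rwa [sub_add_cancel] at this
  calc monoidRank G ≤ Module.finrank ℚ ↥(W ⊔ Submodule.span ℚ {b}) :=
        Submodule.finrank_mono hspan
    _ ≤ Module.finrank ℚ W + Module.finrank ℚ (Submodule.span ℚ {b}) :=
        Submodule.finrank_add_le_finrank_add_finrank _ _
    _ ≤ monoidRank F + 1 := by
        refine Nat.add_le_add_left ?_ _
        simpa using finrank_span_le_card (R := ℚ) ({b} : Set V)

/-- The ranks of the members of a maximal chain of faces fill an interval. -/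
lemma monoidRank_image_maxChain [Module.Finite ℚ V] {S : AddSubmonoid V} (hS : S.FG)
    {C : Set {F : AddSubmonoid V // IsFace S F}} (hC : IsMaxChain (· ≤ ·) C) :
    (fun F : {F : AddSubmonoid V // IsFace S F} ↦ monoidRank F.1) '' C =
      Set.Icc (monoidRank (unitFace S)) (monoidRank S) := by
  classical
  have hmono : ∀ F G : {F : AddSubmonoid V // IsFace S F}, F < G →
      monoidRank F.1 < monoidRank G.1 := fun F G h ↦ F.2.rank_lt G.2.le h
  -- Maximality in usable form: a face comparable to all members of the chain belongs to it.
  have hmem : ∀ F, (∀ G ∈ C, F ≤ G ∨ G ≤ F) → F ∈ C := by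
    intro F hF
    have := hC.2 (t := insert F C) (hC.1.insert fun G hG _ ↦ hF G hG) (Set.subset_insert _ _)
    rw [this]; exact Set.mem_insert _ _
  have hbot : (⟨unitFace S, isFace_unitFace S⟩ : {F : AddSubmonoid V // IsFace S F}) ∈ C :=
    hmem _ fun G _ ↦ Or.inl G.2.unitFace_le
  have htop : (⟨S, isFace_self S⟩ : {F : AddSubmonoid V // IsFace S F}) ∈ C :=
    hmem _ fun G _ ↦ Or.inr G.2.le
  have hmono' : ∀ F G : {F : AddSubmonoid V // IsFace S F}, F ≤ G →
      monoidRank F.1 ≤ monoidRank G.1 := fun F G h ↦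
    Submodule.finrank_mono (Submodule.span_mono h)
  apply Set.Subset.antisymm
  · rintro _ ⟨F, -, rfl⟩
    exact ⟨hmono' ⟨_, isFace_unitFace S⟩ F F.2.unitFace_le, hmono' F ⟨_, isFace_self S⟩ F.2.le⟩
  · rintro r ⟨hr1, hr2⟩
    -- If the rank `r` were missing, the members of `C` with the closest ranks below and above `r`
    -- would be consecutive faces, and their ranks would differ by at least two.
    let A := {m | ∃ F ∈ C, monoidRank F.1 = m ∧ m ≤ r}
    have hA : A.Nonempty := ⟨_, _, hbot, rfl, hr1⟩
    have hAf : A.Finite := (Set.finite_Iic r).subset fun m hm ↦ hm.choose_spec.2.2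
    obtain ⟨m, ⟨F, hF, hFm, hmr⟩, hmax⟩ := hAf.exists_maximal hA
    by_contra hr
    have hmr' : m < r := lt_of_le_of_ne hmr fun h ↦ hr ⟨F, hF, hFm.trans h⟩
    let B := {m' | ∃ G ∈ C, monoidRank G.1 = m' ∧ m < m'}
    have hB : B.Nonempty := ⟨_, _, htop, rfl, hmr'.trans_le hr2⟩
    obtain ⟨m', ⟨G, hG, hGm, hmm'⟩, hmin⟩ :=
      WellFounded.has_min (wellFounded_lt (α := ℕ)) B hB
    have hFG : F < G := by
      refine lt_of_le_of_ne ((hC.1.total hF hG).resolve_right fun h ↦ ?_) ?_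
      · have := hmono' _ _ h; omega
      · rintro rfl; omega
    have hstep := IsFace.rank_le_succ hS F.2 G.2 hFG (by
      intro H hH hFH hHG
      have hHC : (⟨H, hH⟩ : {F : AddSubmonoid V // IsFace S F}) ∈ C := by
        refine hmem _ fun L hL ↦ ?_
        rcases hC.1.total hL hF with h | h
        · exact Or.inr (h.trans hFH)
        rcases eq_or_lt_of_le h with h | h
        · exact Or.inr (h ▸ hFH)
        rcases hC.1.total hL hG with h' | h'
        · rcases eq_or_lt_of_le h' with h' | h'
          · exact Or.inl (h' ▸ hHG)
          · refine absurd (hmono _ _ h') ?_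
            have h2 := hmin _ ⟨L, hL, rfl, hFm ▸ hmono _ _ h⟩
            omega
        · exact Or.inl (le_trans (b := G) hHG h')
      by_contra! hne
      have h1 : monoidRank F.1 < monoidRank H := hmono F ⟨H, hH⟩ (lt_of_le_of_ne hFH
        fun h ↦ hne.1 (congrArg Subtype.val h).symm)
      have h2 : monoidRank H < monoidRank G.1 := hmono ⟨H, hH⟩ G (lt_of_le_of_ne hHG
        fun h ↦ hne.2 (congrArg Subtype.val h))
      exact hmin (monoidRank H) ⟨⟨H, hH⟩, hHC, rfl, hFm ▸ h1⟩ (hGm ▸ h2))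
    have hm' : m' = m + 1 := by omega
    have h1 := hmax (show m' ∈ A from ⟨G, hG, hGm, by omega⟩) hmm'.le
    omega

/-- Maximal chains of faces all have the same length. -/
lemma encard_maxChain_faces [Module.Finite ℚ V] {S : AddSubmonoid V} (hS : S.FG)
    {C : Set {F : AddSubmonoid V // IsFace S F}} (hC : IsMaxChain (· ≤ ·) C) :
    C.encard = (monoidRank S - monoidRank (unitFace S) : ℕ) + 1 := by
  have hinj : Set.InjOn (fun F : {F : AddSubmonoid V // IsFace S F} ↦ monoidRank F.1) C := by
    intro F hF G hG h
    by_contra hne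
    rcases hC.1.total hF hG with hle | hle
    · exact absurd h (F.2.rank_lt G.2.le (lt_of_le_of_ne (α := Subtype _) hle hne)).ne
    · exact absurd h (G.2.rank_lt F.2.le (lt_of_le_of_ne (α := Subtype _) hle (Ne.symm hne))).ne'
  have hle : monoidRank (unitFace S) ≤ monoidRank S :=
    Submodule.finrank_mono (Submodule.span_mono (isFace_unitFace S).le)
  rw [← hinj.encard_image, monoidRank_image_maxChain hS hC, ← Finset.coe_Icc,
    Set.encard_coe_eq_coe_finsetCard, Nat.card_Icc]
  norm_cast
  omega

/-- If all faces of `S` are saturated for the kernel of `p`, then the smallest face loses as much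
rank under `p` as `S` does. -/
lemma rank_image_of_saturated [Module.Finite ℚ V] {V' : Type*} [AddCommGroup V'] [Module ℚ V']
    [Module.Finite ℚ V'] {S : AddSubmonoid V} (hS : S.FG) (p : V →ₗ[ℚ] V')
    (hsat : ∀ F, IsFace S F → ∀ s ∈ S, ∀ s' ∈ F, p s = p s' → s ∈ F) :
    monoidRank S + monoidRank ((unitFace S).map p.toAddMonoidHom) ≤
      monoidRank (S.map p.toAddMonoidHom) + monoidRank (unitFace S) := by
  classical
  -- Saturation makes images of faces faces of the image and keeps distinct faces distinct. A
  -- maximal chain of faces of `S` therefore yields as many distinct ranks between those of the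
  -- images of `unitFace S` and `S`.
  obtain ⟨C, hC⟩ : ∃ C : Set {F : AddSubmonoid V // IsFace S F}, IsMaxChain (· ≤ ·) C :=
    ⟨_, maxChain_spec⟩
  have hface : ∀ F, IsFace S F → IsFace (S.map p.toAddMonoidHom) (F.map p.toAddMonoidHom) := by
    intro F hF
    refine ⟨AddSubmonoid.monotone_map hF.le, ?_⟩
    rintro _ ⟨a, ha, rfl⟩ _ ⟨b, hb, rfl⟩ ⟨f, hf, hfe⟩
    refine ⟨a, hF.mem_of_add_mem a ha b hb (hsat F hF _ (add_mem ha hb) f hf ?_), rfl⟩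
    simpa using hfe.symm
  have hlt : ∀ F G : {F : AddSubmonoid V // IsFace S F}, F < G →
      monoidRank (F.1.map p.toAddMonoidHom) < monoidRank (G.1.map p.toAddMonoidHom) := by
    intro F G h
    refine (hface F F.2).rank_lt (AddSubmonoid.monotone_map G.2.le)
      (lt_of_le_of_ne (AddSubmonoid.monotone_map h.le) fun he ↦ ?_)
    obtain ⟨s, hsG, hsF⟩ := SetLike.exists_of_lt (show F.1 < G.1 from h)
    obtain ⟨f, hf, hfe⟩ : p s ∈ F.1.map p.toAddMonoidHom := he ▸ ⟨s, hsG, rfl⟩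
    exact hsF (hsat F F.2 s (G.2.le hsG) f hf hfe.symm)
  have hinj : Set.InjOn (fun F : {F : AddSubmonoid V // IsFace S F} ↦
      monoidRank (F.1.map p.toAddMonoidHom)) C := by
    intro F hF G hG h
    by_contra hne
    rcases hC.1.total hF hG with hle | hle
    · exact absurd h (hlt _ _ (lt_of_le_of_ne hle hne)).ne
    · exact absurd h (hlt _ _ (lt_of_le_of_ne hle (Ne.symm hne))).ne'
  have hrank : ∀ F G : AddSubmonoid V, F ≤ G → monoidRank (F.map p.toAddMonoidHom) ≤
      monoidRank (G.map p.toAddMonoidHom) := fun F G h ↦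
    Submodule.finrank_mono (Submodule.span_mono (AddSubmonoid.monotone_map h))
  have hsub : (fun F : {F : AddSubmonoid V // IsFace S F} ↦
      monoidRank (F.1.map p.toAddMonoidHom)) '' C ⊆
      (Finset.Icc (monoidRank ((unitFace S).map p.toAddMonoidHom))
        (monoidRank (S.map p.toAddMonoidHom)) : Finset ℕ) := by
    rintro _ ⟨F, -, rfl⟩
    rw [Finset.coe_Icc]
    exact ⟨hrank _ _ F.2.unitFace_le, hrank _ _ F.2.le⟩
  have h1 := Set.encard_le_encard hsub
  rw [hinj.encard_image, encard_maxChain_faces hS hC, Set.encard_coe_eq_coe_finsetCard,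
    Nat.card_Icc] at h1
  norm_cast at h1
  have h2 := hrank _ _ (isFace_unitFace S).le
  have h3 : monoidRank (unitFace S) ≤ monoidRank S :=
    Submodule.finrank_mono (Submodule.span_mono (isFace_unitFace S).le)
  omega

end Faces

end ToricMonoid

namespace ToricMonoid

/-! ### Zariski topologies on sets of points, and the dimension of a torus. -/

section Zariski

variable {Y A k : Type*} [TopologicalSpace Y] [CommRing A] [Field k]

/-- The closed subsets of `Y` are the zero loci of families in the ring `A`, whose elements
are evaluated at the points of `Y` through `ev`. -/
def IsZariski (ev : Y → A →+* k) : Prop :=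
  ∀ Z : Set Y, IsClosed Z ↔ ∃ I : Set A, Z = {y | ∀ f ∈ I, ev y f = 0}

lemma IsZariski.isClosed_zero {ev : Y → A →+* k} (h : IsZariski ev) (f : A) :
    IsClosed {y | ev y f = 0} := (h _).2 ⟨{f}, by simp⟩

lemma IsZariski.isClosed_eq {ev : Y → A →+* k} (h : IsZariski ev) (f g : A) :
    IsClosed {y | ev y f = ev y g} := by
  have := h.isClosed_zero (f - g)
  simpa [sub_eq_zero] using this

lemma IsZariski.mem_closure {ev : Y → A →+* k} (h : IsZariski ev) {B : Set Y} {x : Y} :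
    x ∈ closure B ↔ ∀ f, (∀ b ∈ B, ev b f = 0) → ev x f = 0 := by
  constructor
  · intro hx f hf
    exact closure_minimal (t := {y | ev y f = 0}) hf (h.isClosed_zero f) hx
  · intro H
    obtain ⟨I, hI⟩ := (h (closure B)).1 isClosed_closure
    rw [hI]
    refine fun f hf ↦ H f fun b hb ↦ ?_
    have : b ∈ closure B := subset_closure hb
    rw [hI] at this
    exact this f hf

lemma IsZariski.subtype {ev : Y → A →+* k} (h : IsZariski ev) (T : Set Y) :
    IsZariski fun y : T ↦ ev y := by
  intro Z
  constructor
  · intro hZ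
    obtain ⟨Z', hZ', rfl⟩ := isClosed_induced_iff.1 hZ
    obtain ⟨I, rfl⟩ := (h _).1 hZ'
    exact ⟨I, rfl⟩
  · rintro ⟨I, rfl⟩
    exact isClosed_induced_iff.2 ⟨_, (h _).2 ⟨I, rfl⟩, rfl⟩

lemma IsZariski.isPreirreducible {ev : Y → A →+* k} (h : IsZariski ev) {B : Set Y}
    (hB : ∀ f g, (∀ b ∈ B, ev b f * ev b g = 0) →
      (∀ b ∈ B, ev b f = 0) ∨ ∀ b ∈ B, ev b g = 0) : IsPreirreducible B := by
  rw [isPreirreducible_iff_isClosed_union_isClosed]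
  intro Z₁ Z₂ h₁ h₂ hZ
  by_contra! hne
  obtain ⟨⟨x, hxB, hx⟩, ⟨y, hyB, hy⟩⟩ := hne.imp Set.not_subset.1 Set.not_subset.1
  obtain ⟨I, rfl⟩ := (h _).1 h₁
  obtain ⟨J, rfl⟩ := (h _).1 h₂
  simp only [Set.mem_setOf_eq, not_forall] at hx hy
  obtain ⟨f, hf, hfx⟩ := hx
  obtain ⟨g, hg, hgy⟩ := hy
  rcases hB f g fun b hb ↦ (hZ hb).elim (fun H ↦ by rw [H f hf, zero_mul])
    (fun H ↦ by rw [H g hg, mul_zero]) with H | H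
  · exact hfx (H x hxB)
  · exact hgy (H y hyB)

open MvPolynomial in
lemma mvPolynomial_eq_zero_of_units {k : Type*} [Field k] [Infinite k] {d : ℕ}
    {F : MvPolynomial (Fin d) k} (h : ∀ w : Fin d → kˣ, eval (fun i ↦ (w i : k)) F = 0) :
    F = 0 := by
  refine MvPolynomial.funext_set (fun _ ↦ {x : k | x ≠ 0}) (fun _ ↦ ?_) fun x hx ↦ ?_
  · exact (Set.finite_singleton (0 : k)).infinite_compl
  · have := h fun i ↦ Units.mk0 (x i) (hx i trivial)
    simpa using this

/-- A space of `d`-tuples of units whose closed sets are defined by Laurent polynomials. -/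
structure IsTorusSpace {d : ℕ} (ev : Y → A →+* k) (w : Y → Fin d → kˣ) : Prop where
  zariski : IsZariski ev
  surjective : Function.Surjective w
  exists_polynomial : ∀ f, ∃ (F : MvPolynomial (Fin d) k) (c : Y → kˣ),
    ∀ y, c y * ev y f = MvPolynomial.eval (fun i ↦ (w y i : k)) F
  exists_fraction : ∀ i, ∃ f g, ∀ y, ev y g ≠ 0 ∧ ev y g * w y i = ev y f
  exists_const : ∀ a, ∃ f, ∀ y, ev y f = a

variable [Infinite k] {d : ℕ} {ev : Y → A →+* k} {w : Y → Fin d → kˣ}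

-- The coordinates are quotients of elements of `A` with nowhere vanishing denominators. Such
-- quotients are stable under sums and products, so every polynomial in the coordinates has the zero
-- locus of an element of `A`.
open MvPolynomial in
lemma IsTorusSpace.isClosed_zero (h : IsTorusSpace ev w) (F : MvPolynomial (Fin d) k) :
    IsClosed {y | eval (fun i ↦ (w y i : k)) F = 0} := by
  suffices H : ∃ f g, ∀ y, ev y g ≠ 0 ∧ ev y g * eval (fun i ↦ (w y i : k)) F = ev y f by
    obtain ⟨f, g, hfg⟩ := H
    convert h.zariski.isClosed_zero f using 1
    ext y
    simp [← (hfg y).2, (hfg y).1]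
  induction F using MvPolynomial.induction_on with
  | C a =>
    obtain ⟨f, hf⟩ := h.exists_const a
    exact ⟨f, 1, fun y ↦ by simp [hf]⟩
  | add p q hp hq =>
    obtain ⟨f, g, hfg⟩ := hp
    obtain ⟨f', g', hfg'⟩ := hq
    refine ⟨g' * f + g * f', g * g', fun y ↦ ⟨?_, ?_⟩⟩
    · rw [map_mul]; exact mul_ne_zero (hfg y).1 (hfg' y).1
    · rw [map_mul, map_add, map_add, map_mul, map_mul, ← (hfg y).2, ← (hfg' y).2]
      ring
  | mul_X p i hp =>
    obtain ⟨f, g, hfg⟩ := hp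
    obtain ⟨f', g', hfg'⟩ := h.exists_fraction i
    refine ⟨f * f', g * g', fun y ↦ ⟨?_, ?_⟩⟩
    · rw [map_mul]; exact mul_ne_zero (hfg y).1 (hfg' y).1
    · rw [map_mul, map_mul, map_mul, ← (hfg y).2, ← (hfg' y).2, eval_X]
      ring

-- Restriction to the subtorus is the substitution `σ`. If `f * g` vanishes on it, then `σ F * σ G`
-- vanishes at all tuples of units, so it is zero and one of the factors is zero. Subtori, and not
-- only the full torus, are needed for the lower bound on the dimension.
open MvPolynomial in
lemma IsTorusSpace.isPreirreducible (h : IsTorusSpace ev w) (J : Set (Fin d)) :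
    IsPreirreducible {y | ∀ j ∈ J, w y j = 1} := by
  classical
  refine h.zariski.isPreirreducible fun f g hfg ↦ ?_
  obtain ⟨F, c, hF⟩ := h.exists_polynomial f
  obtain ⟨G, c', hG⟩ := h.exists_polynomial g
  let σ : MvPolynomial (Fin d) k →ₐ[k] MvPolynomial (Fin d) k :=
    aeval fun j ↦ if j ∈ J then 1 else X j
  have hσ : ∀ (w : Fin d → kˣ) (P : MvPolynomial (Fin d) k), eval (fun i ↦ (w i : k)) (σ P) =
      eval (fun i ↦ if i ∈ J then 1 else (w i : k)) P := by
    intro w P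
    induction P using MvPolynomial.induction_on with
    | C a => simp [σ]
    | add p q hp hq => simp only [map_add, hp, hq]
    | mul_X p i hp =>
      rw [map_mul, map_mul, hp, map_mul, aeval_X, eval_X]
      split_ifs <;> simp
  have key : ∀ P : MvPolynomial (Fin d) k, σ P = 0 →
      ∀ y ∈ {y | ∀ j ∈ J, w y j = 1}, eval (fun i ↦ (w y i : k)) P = 0 := by
    intro P hP y hy
    have := hσ (w y) P
    rw [hP, map_zero] at this
    rw [this]
    congr 2
    ext i
    split_ifs with hi
    · simp [hy i hi]
    · rfl
  have hprod : σ F * σ G = 0 := by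
    refine mvPolynomial_eq_zero_of_units fun v ↦ ?_
    obtain ⟨y, hy⟩ := h.surjective fun i ↦ if i ∈ J then 1 else v i
    have hyJ : ∀ j ∈ J, w y j = 1 := fun j hj ↦ by rw [hy]; simp [hj]
    have := hfg y hyJ
    have e : (fun i ↦ if i ∈ J then 1 else (v i : k)) = fun i ↦ (w y i : k) := by
      ext i; rw [hy]; dsimp only; split_ifs <;> rfl
    rw [map_mul, hσ, hσ, e, ← hF, ← hG, _root_.mul_mul_mul_comm, this, mul_zero]
  rcases mul_eq_zero.1 hprod with h0 | h0
  · left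
    intro y hy
    have := key F h0 y hy
    rw [← hF] at this
    exact (mul_eq_zero.1 this).resolve_left (c y).ne_zero
  · right
    intro y hy
    have := key G h0 y hy
    rw [← hG] at this
    exact (mul_eq_zero.1 this).resolve_left (c' y).ne_zero

-- Upper bound: ideals of vanishing polynomials embed the irreducible closed subsets, with order
-- reversed, into the prime spectrum of a polynomial ring in `d` variables. Lower bound: the subtori
-- where the coordinates of index at least `i` equal 1 form a chain of length `d`, which is strict
-- because `k` has elements other than 0 and 1.
open MvPolynomial TopologicalSpace in
lemma IsTorusSpace.topologicalKrullDim_eq (h : IsTorusSpace ev w) :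
    topologicalKrullDim Y = d := by
  classical
  apply le_antisymm
  · let 𝔭 : IrreducibleCloseds Y → PrimeSpectrum (MvPolynomial (Fin d) k) := fun Z ↦
      ⟨{ carrier := {F | ∀ y ∈ Z, eval (fun i ↦ (w y i : k)) F = 0}
         add_mem' := fun hF hG y hy ↦ by rw [map_add, hF y hy, hG y hy, add_zero]
         zero_mem' := fun y _ ↦ map_zero _
         smul_mem' := fun c F hF y hy ↦ by rw [smul_eq_mul, map_mul, hF y hy, mul_zero] }, by
        constructor
        · intro H
          obtain ⟨y, hy⟩ := Z.isIrreducible.nonempty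
          have := (Ideal.eq_top_iff_one _).1 H y hy
          simp at this
        · intro F G hFG
          rcases isPreirreducible_iff_isClosed_union_isClosed.1 Z.isIrreducible.2 _ _
            (h.isClosed_zero F) (h.isClosed_zero G)
            (fun y hy ↦ mul_eq_zero.1 ((map_mul (MvPolynomial.eval _) F G).symm.trans (hFG y hy))) with H | H
          · exact Or.inl H
          · exact Or.inr H⟩
    have hanti : ∀ Z Z', 𝔭 Z ≤ 𝔭 Z' → Z' ≤ Z := by
      intro Z Z' hle y hy
      obtain ⟨I, hI⟩ := (h.zariski _).1 Z.isClosed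
      change y ∈ (Z : Set Y)
      rw [hI]
      intro f hf
      obtain ⟨F, c, hF⟩ := h.exists_polynomial f
      have hFZ : F ∈ (𝔭 Z).asIdeal := by
        intro z hz
        change z ∈ (Z : Set Y) at hz
        rw [hI] at hz
        rw [← hF, hz f hf, mul_zero]
      have := hle hFZ y hy
      rw [← hF] at this
      exact (mul_eq_zero.1 this).resolve_left (c y).ne_zero
    have hmono : StrictMono (fun Z ↦ OrderDual.toDual (𝔭 Z)) := by
      intro Z Z' hlt
      refine lt_of_le_not_ge (fun F hF y hy ↦ hF y (hlt.le hy)) fun hle ↦ ?_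
      exact hlt.not_ge (hanti _ _ hle)
    refine (Order.krullDim_le_of_strictMono _ hmono).trans ?_
    rw [Order.krullDim_orderDual]
    change ringKrullDim _ ≤ _
    rw [MvPolynomial.ringKrullDim_of_isNoetherianRing]
    simp
  · have hcl : ∀ J : Set (Fin d), IsClosed {y | ∀ j ∈ J, w y j = 1} := by
      intro J
      have : {y | ∀ j ∈ J, w y j = 1} =
          ⋂ j ∈ J, {y | eval (fun i ↦ (w y i : k)) (X j - 1 : MvPolynomial (Fin d) k) = 0} := by
        ext y
        simp [sub_eq_zero]
      rw [this]
      exact isClosed_biInter fun j _ ↦ h.isClosed_zero _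
    have hne : ∀ J : Set (Fin d), {y | ∀ j ∈ J, w y j = 1}.Nonempty := by
      intro J
      obtain ⟨y, hy⟩ := h.surjective 1
      exact ⟨y, fun j _ ↦ by rw [hy]; rfl⟩
    let Z : Fin (d + 1) → IrreducibleCloseds Y := fun i ↦
      ⟨{y | ∀ j ∈ {j : Fin d | i.val ≤ j.val}, w y j = 1}, ⟨hne _, h.isPreirreducible _⟩, hcl _⟩
    have hZ : StrictMono Z := by
      intro i i' hii'
      refine lt_of_le_not_ge (fun y hy j hj ↦ hy j (le_trans (Fin.le_def.1 hii'.le) hj))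
        fun hle ↦ ?_
      obtain ⟨u, hu⟩ := Infinite.exists_notMem_finset ({0, 1} : Finset k)
      simp only [Finset.mem_insert, Finset.mem_singleton, not_or] at hu
      let j₀ : Fin d := ⟨i.val, by have := i'.2; have := Fin.lt_def.1 hii'; omega⟩
      obtain ⟨y, hy⟩ := h.surjective (Function.update 1 j₀ (Units.mk0 u hu.1))
      have hyZ : y ∈ Z i' := by
        intro j hj
        have hj' : i'.val ≤ j.val := hj
        rw [hy, Function.update_of_ne]
        · rfl
        · rintro rfl
          exact absurd hj' (not_le.2 (Fin.lt_def.1 hii'))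
      have := hle hyZ j₀ (show i.val ≤ j₀.val from le_rfl)
      rw [hy, Function.update_self] at this
      exact hu.2 (by simpa using congrArg Units.val this)
    exact Order.LTSeries.length_le_krullDim (LTSeries.mk d Z hZ)

end Zariski

end ToricMonoid

namespace ToricMonoid

/-! ### Points of an affine toric monoid; idempotents as faces. -/

section Affine

/-- The embedding of the lattice `ℤⁿ` into `ℚⁿ`. -/
def toQ (n : ℕ) : (Fin n → ℤ) →+ (Fin n → ℚ) where
  toFun x i := x i
  map_zero' := by ext; simp
  map_add' x y := by ext; simp

lemma toQ_injective (n : ℕ) : Function.Injective (toQ n) := fun x y h ↦ by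
  ext i
  exact Int.cast_injective (α := ℚ) (congrFun h i)

variable {G k : Type*} [Monoid G] [TopologicalSpace G] [Field k] {n : ℕ}
  {S : AddSubmonoid (Fin n → ℤ)}

/-- The monoid `G` is the monoid of points of the affine toric monoid `Spec k[S]`, with its
Zariski topology. -/
structure IsAffineToric (S : AddSubmonoid (Fin n → ℤ)) (φ : G ≃* (Multiplicative S →* k)) :
    Prop where
  fg : S.FG
  closure_eq_top : AddSubgroup.closure (S : Set (Fin n → ℤ)) = ⊤
  zariski : IsZariski fun x ↦ (AddMonoidAlgebra.lift k k S (φ x)).toRingHom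

/-- The value of the character `s` at the point `x`. -/
def chi (φ : G ≃* (Multiplicative S →* k)) (s : S) (x : G) : k := φ x (.ofAdd s)

section

variable (φ : G ≃* (Multiplicative S →* k))

@[simp] lemma chi_zero (x : G) : chi φ 0 x = 1 := map_one (φ x)

@[simp] lemma chi_add (s s' : S) (x : G) : chi φ (s + s') x = chi φ s x * chi φ s' x :=
  map_mul (φ x) (.ofAdd s) (.ofAdd s')

@[simp] lemma chi_nsmul (m : ℕ) (s : S) (x : G) : chi φ (m • s) x = chi φ s x ^ m :=
  map_pow (φ x) (.ofAdd s) m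

@[simp] lemma chi_one (s : S) : chi φ s 1 = 1 := by simp [chi]

@[simp] lemma chi_mul (s : S) (x y : G) : chi φ s (x * y) = chi φ s x * chi φ s y := by
  simp [chi]

lemma chi_sum {J : Type*} (T : Finset J) (f : J → S) (x : G) :
    chi φ (∑ i ∈ T, f i) x = ∏ i ∈ T, chi φ (f i) x := by
  classical
  induction T using Finset.induction_on with
  | empty => simp
  | insert a T ha ih => rw [Finset.sum_insert ha, Finset.prod_insert ha, chi_add, ih]

variable {φ}

lemma chi_ext {x y : G} (h : ∀ s, chi φ s x = chi φ s y) : x = y :=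
  φ.injective (MonoidHom.ext fun s ↦ h s.toAdd)

lemma exists_point (f : S → k) (h0 : f 0 = 1) (hadd : ∀ s s', f (s + s') = f s * f s') :
    ∃ x : G, ∀ s, chi φ s x = f s := by
  refine ⟨φ.symm ⟨⟨fun s ↦ f s.toAdd, h0⟩, fun s s' ↦ hadd _ _⟩, fun s ↦ ?_⟩
  simp [chi]

lemma points_comm (φ : G ≃* (Multiplicative S →* k)) (x y : G) : x * y = y * x :=
  chi_ext (φ := φ) fun s ↦ by rw [chi_mul, chi_mul, _root_.mul_comm]

lemma lift_eq_sum (f : AddMonoidAlgebra k S) (x : G) :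
    (AddMonoidAlgebra.lift k k S (φ x)).toRingHom f =
      f.coeff.sum fun s a ↦ a * chi φ s x := by
  change AddMonoidAlgebra.lift k k S (φ x) f = _
  rw [AddMonoidAlgebra.lift_apply]
  rfl

lemma lift_single (s : S) (a : k) (x : G) :
    (AddMonoidAlgebra.lift k k S (φ x)).toRingHom (.single s a) = a * chi φ s x := by
  simp [chi]

lemma isUnit_iff_chi {x : G} : IsUnit x ↔ ∀ s, chi φ s x ≠ 0 := by
  constructor
  · rintro ⟨u, rfl⟩ s h
    have := chi_mul φ s u (↑u⁻¹ : G)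
    rw [Units.mul_inv, chi_one, h, zero_mul] at this
    exact one_ne_zero this
  · intro h
    obtain ⟨y, hy⟩ := exists_point (φ := φ) (fun s ↦ (chi φ s x)⁻¹) (by simp)
      (fun s s' ↦ by rw [chi_add, mul_inv])
    have hxy : x * y = 1 := chi_ext (φ := φ) fun s ↦ by
      rw [chi_mul, hy, mul_inv_cancel₀ (h s), chi_one]
    exact ⟨⟨x, y, hxy, by rw [points_comm φ, hxy]⟩, rfl⟩

end

variable {φ : G ≃* (Multiplicative S →* k)}

namespace IsAffineToric

lemma isClosed_chi_eq (h : IsAffineToric S φ) (s s' : S) (c : k) :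
    IsClosed {x | chi φ s x = c * chi φ s' x} := by
  have := h.zariski.isClosed_eq (.single s 1) (.single s' c)
  simpa only [lift_single, _root_.one_mul] using this

lemma isClosed_chi_pow_eq (h : IsAffineToric S φ) (s s' : S) (m : ℕ) :
    IsClosed {x | chi φ s x ^ m = chi φ s' x ^ m} := by
  have := h.isClosed_chi_eq (m • s) (m • s') 1
  simpa only [chi_nsmul, _root_.one_mul] using this

/-- The closure of a submonoid is defined by equations between characters. -/
lemma mem_closure_iff (h : IsAffineToric S φ) (B : Submonoid G) {x : G} :
    x ∈ closure (B : Set G) ↔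
      ∀ s s', (∀ b ∈ B, chi φ s b = chi φ s' b) → chi φ s x = chi φ s' x := by
  constructor
  · intro hx s s' hs
    have := h.isClosed_chi_eq s s' 1
    simp only [_root_.one_mul] at this
    exact closure_minimal (t := {x | chi φ s x = chi φ s' x}) hs this hx
  · intro H
    rw [h.zariski.mem_closure]
    intro f hf
    -- The terms of `f` are grouped by the restriction of their characters to `B`. By Dedekind's
    -- independence of characters the coefficients in each group sum to zero, and by `H` the
    -- characters of one group agree at `x`.
    let ψ : S → (B →* k) := fun s ↦
      ⟨⟨fun b ↦ chi φ s b, chi_one φ s⟩, fun b c ↦ chi_mul φ s b c⟩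
    obtain ⟨g, hg⟩ : ∃ g : (B →* k) → k, ∀ s, chi φ s x = g (ψ s) := by
      have : Function.FactorsThrough (fun s ↦ chi φ s x) ψ := fun s s' hs ↦
        H s s' fun b hb ↦ DFunLike.congr_fun hs ⟨b, hb⟩
      obtain ⟨g, hg⟩ := (Function.factorsThrough_iff _).1 this
      exact ⟨g, fun s ↦ congrFun hg s⟩
    have h0 : Finsupp.mapDomain ψ f.coeff = 0 := by
      have hli := linearIndependent_monoidHom (G := B) (L := k)
      rw [linearIndependent_iff] at hli
      refine hli _ (funext fun b ↦ ?_)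
      have := hf b b.2
      rw [lift_eq_sum] at this
      rw [Finsupp.linearCombination_apply, Finsupp.sum_mapDomain_index (by simp)
        (by intros; rw [add_smul]), Finsupp.sum_apply']
      exact this
    rw [lift_eq_sum]
    have : f.coeff.sum (fun s a ↦ a * chi φ s x) =
        (Finsupp.mapDomain ψ f.coeff).sum fun c a ↦ a * g c := by
      rw [Finsupp.sum_mapDomain_index (by simp) (by intros; rw [add_mul])]
      simp only [hg]
    rw [this, h0, Finsupp.sum_zero_index]

end IsAffineToric

/-- The image of `S` in `ℚⁿ`. -/
def ratMonoid (S : AddSubmonoid (Fin n → ℤ)) : AddSubmonoid (Fin n → ℚ) := S.map (toQ n)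

lemma toQ_mem_ratMonoid (s : S) : toQ n s ∈ ratMonoid S := ⟨s, s.2, rfl⟩

/-- The rational span of the units of `S`. -/
def unitSpan (S : AddSubmonoid (Fin n → ℤ)) : Submodule ℚ (Fin n → ℚ) :=
  Submodule.span ℚ (unitFace (ratMonoid S) : Set (Fin n → ℚ))

lemma toQ_mem_unitFace {s : S} : toQ n s ∈ unitFace (ratMonoid S) ↔ -(s : Fin n → ℤ) ∈ S := by
  constructor
  · rintro ⟨-, t, ht, e⟩
    rw [← map_neg] at e
    exact toQ_injective n e ▸ ht
  · intro hs
    exact ⟨toQ_mem_ratMonoid s, _, hs, map_neg _ _⟩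

lemma toQ_mem_unitSpan {s : S} : toQ n s ∈ unitSpan S ↔ -(s : Fin n → ℤ) ∈ S := by
  rw [← toQ_mem_unitFace]
  exact ⟨(isFace_unitFace _).mem_of_mem_span (toQ_mem_ratMonoid s),
    fun hs ↦ Submodule.subset_span hs⟩

/-- A rational relation modulo units becomes a relation in `S` only after multiplication by some
`m`. This `m` is the source of the roots of unity that separate the isotropy group from its neutral
component. -/
lemma exists_nsmul_eq_of_mem_unitSpan {s s' : S} (h : toQ n s - toQ n s' ∈ unitSpan S) :
    ∃ m : ℕ, m ≠ 0 ∧ ∃ l l' : S, -(l : Fin n → ℤ) ∈ S ∧ -(l' : Fin n → ℤ) ∈ S ∧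
      m • s + l = m • s' + l' := by
  obtain ⟨m, hm, f, hf, f', hf', e⟩ := exists_nsmul_add_eq_of_mem_span h
  obtain ⟨l, hl, rfl⟩ := hf.1
  obtain ⟨l', hl', rfl⟩ := hf'.1
  refine ⟨m, hm, ⟨l, hl⟩, ⟨l', hl'⟩, toQ_mem_unitFace.1 hf, toQ_mem_unitFace.1 hf', ?_⟩
  ext1
  apply toQ_injective n
  rw [smul_sub, sub_add_eq_add_sub, sub_eq_iff_eq_add] at e
  simp only [AddSubmonoid.coe_add, AddSubmonoidClass.coe_nsmul, map_add, map_nsmul]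
  rw [e, _root_.add_comm]

/-- An idempotent as a face. -/
def faceOf (φ : G ≃* (Multiplicative S →* k)) (x : G) (hx : IsIdempotentElem x) :
    {F : AddSubmonoid (Fin n → ℚ) // IsFace (ratMonoid S) F} :=
  ⟨(AddSubmonoid.map ((toQ n).comp S.subtype)
    { carrier := {s | chi φ s x = 1}
      zero_mem' := chi_zero φ x
      add_mem' := fun {a b} ha hb ↦ by
        simp only [Set.mem_setOf_eq] at ha hb ⊢; rw [chi_add, ha, hb, _root_.one_mul] }), by
    constructor
    · rintro _ ⟨s, -, rfl⟩
      exact toQ_mem_ratMonoid s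
    · rintro _ ⟨a, ha, rfl⟩ _ ⟨b, hb, rfl⟩ ⟨s, hs, e⟩
      refine ⟨⟨a, ha⟩, ?_, rfl⟩
      have hs' : s = ⟨a, ha⟩ + ⟨b, hb⟩ := by
        ext1; apply toQ_injective n; rw [AddSubmonoid.coe_add, map_add]; exact e
      have h1 : chi φ s x = 1 := hs
      have h2 : chi φ ⟨a, ha⟩ x * chi φ ⟨a, ha⟩ x = chi φ ⟨a, ha⟩ x := by rw [← chi_mul, hx.eq]
      rw [hs', chi_add] at h1
      have h3 : chi φ ⟨a, ha⟩ x ≠ 0 := left_ne_zero_of_mul_eq_one h1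
      exact mul_left_cancel₀ h3 (h2.trans (_root_.mul_one _).symm)⟩

lemma toQ_mem_faceOf {x : G} {hx : IsIdempotentElem x} {s : S} :
    toQ n s ∈ (faceOf φ x hx).1 ↔ chi φ s x = 1 := by
  constructor
  · rintro ⟨t, ht, e⟩
    have : t = s := Subtype.ext (toQ_injective n e)
    exact this ▸ ht
  · intro h; exact ⟨s, h, rfl⟩

lemma chi_idempotent {x : G} (hx : IsIdempotentElem x) (s : S) :
    chi φ s x = 0 ∨ chi φ s x = 1 := by
  have : chi φ s x * chi φ s x = chi φ s x := by rw [← chi_mul, hx.eq]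
  rcases eq_or_ne (chi φ s x) 0 with h | h
  · exact .inl h
  · exact .inr (mul_left_cancel₀ h (this.trans (_root_.mul_one _).symm))

/-- The indicator function of a face is multiplicative because a sum lies in a face exactly when
both summands do. -/
lemma exists_idempotent_of_face (φ : G ≃* (Multiplicative S →* k))
    {F : AddSubmonoid (Fin n → ℚ)} (hF : IsFace (ratMonoid S) F) :
    ∃ x : G, IsIdempotentElem x ∧ ∀ s, chi φ s x = 1 ↔ toQ n s ∈ F := by
  classical
  obtain ⟨x, hx⟩ := exists_point (φ := φ) (fun s : S ↦ if toQ n s ∈ F then 1 else 0)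
    (by simp [zero_mem]) (by
      intro s s'
      have : toQ n ↑(s + s') ∈ F ↔ toQ n s ∈ F ∧ toQ n s' ∈ F := by
        rw [AddSubmonoid.coe_add, map_add]
        refine ⟨fun H ↦ ⟨hF.mem_of_add_mem _ (toQ_mem_ratMonoid s) _ (toQ_mem_ratMonoid s') H,
          hF.mem_of_add_mem _ (toQ_mem_ratMonoid s') _ (toQ_mem_ratMonoid s) ?_⟩,
          fun H ↦ add_mem H.1 H.2⟩
        rwa [_root_.add_comm]
      simp only [this]
      split_ifs <;> simp_all)
  refine ⟨x, chi_ext (φ := φ) fun s ↦ ?_, fun s ↦ ?_⟩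
  · rw [chi_mul, hx]; split_ifs <;> simp
  · rw [hx]; split_ifs with h <;> simp [h]

lemma idemLE_iff {e f : Idempotents G} :
    IdemLE e f ↔ (faceOf φ e.1 e.2) ≤ (faceOf φ f.1 f.2) := by
  constructor
  · rintro ⟨h, -⟩ _ ⟨s, hs, rfl⟩
    refine toQ_mem_faceOf.2 ?_
    have h1 : chi φ s e.1 = 1 := hs
    rw [h, chi_mul] at h1
    exact (chi_idempotent f.2 s).resolve_left (right_ne_zero_of_mul_eq_one h1)
  · intro h
    have key : (e : G) = e * f := by
      refine chi_ext (φ := φ) fun s ↦ ?_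
      rw [chi_mul]
      rcases chi_idempotent (φ := φ) e.2 s with h0 | h1
      · rw [h0, zero_mul]
      · have := toQ_mem_faceOf.1 (h (toQ_mem_faceOf (hx := e.2).2 h1))
        rw [this, _root_.mul_one]
    exact ⟨key, by rwa [points_comm φ]⟩

/-- The idempotents correspond to the faces. -/
noncomputable def idempotentsIso (φ : G ≃* (Multiplicative S →* k)) :
    (IdemLE : Idempotents G → Idempotents G → Prop) ≃r
      ((· ≤ ·) : {F : AddSubmonoid (Fin n → ℚ) // IsFace (ratMonoid S) F} → _ → Prop) where
  toEquiv := Equiv.ofBijective (fun e ↦ faceOf φ e.1 e.2) (by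
    constructor
    · intro e f h
      have h1 := (idemLE_iff (φ := φ) (e := e) (f := f)).2 h.le
      have h2 := (idemLE_iff (φ := φ) (e := f) (f := e)).2 h.ge
      exact Subtype.ext (h1.1.trans h2.2.symm)
    · rintro ⟨F, hF⟩
      obtain ⟨x, hx, H⟩ := exists_idempotent_of_face φ hF
      refine ⟨⟨x, hx⟩, Subtype.ext (SetLike.ext fun v ↦ ⟨?_, fun hv ↦ ?_⟩)⟩
      · rintro ⟨s, hs, rfl⟩
        exact (H s).1 hs
      · obtain ⟨s, hs, rfl⟩ := hF.le hv
        exact toQ_mem_faceOf.2 ((H ⟨s, hs⟩).2 hv))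
  map_rel_iff' := idemLE_iff.symm

end Affine

end ToricMonoid

namespace ToricMonoid

/-! ### The central submonoid, and the character lattice of its torus. -/

section Affine

variable {G k : Type*} [Monoid G] [TopologicalSpace G] [Field k] {n : ℕ}
  {S : AddSubmonoid (Fin n → ℤ)} {φ : G ≃* (Multiplicative S →* k)}

/-- The submonoid of points at which characters differing by a rational combination of units
agree. -/
def centralSubmonoid (φ : G ≃* (Multiplicative S →* k)) : Submonoid G where
  carrier := {x | ∀ s s' : S, toQ n s - toQ n s' ∈ unitSpan S → chi φ s x = chi φ s' x}
  one_mem' s s' _ := by rw [chi_one, chi_one]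
  mul_mem' {x y} hx hy s s' h := by rw [chi_mul, chi_mul, hx s s' h, hy s s' h]

/-- The invertible elements of the central submonoid. -/
def centralTorus (φ : G ≃* (Multiplicative S →* k)) : Submonoid G where
  carrier := {x | IsUnit x ∧ x ∈ centralSubmonoid φ}
  one_mem' := ⟨isUnit_one, one_mem _⟩
  mul_mem' hx hy := ⟨hx.1.mul hy.1, mul_mem hx.2 hy.2⟩

lemma ratMonoid_fg (h : S.FG) : (ratMonoid S).FG := h.map _

lemma toQ_single (i : Fin n) : toQ n (Pi.single i 1) = fun j ↦ if i = j then 1 else 0 := by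
  ext j
  change (((Pi.single i 1 : Fin n → ℤ) j : ℤ) : ℚ) = _
  rcases eq_or_ne i j with rfl | h
  · simp
  · rw [Pi.single_eq_of_ne h.symm, if_neg h, Int.cast_zero]

lemma span_toQ_eq_top (h : AddSubgroup.closure (S : Set (Fin n → ℤ)) = ⊤) :
    Submodule.span ℚ (ratMonoid S : Set (Fin n → ℚ)) = ⊤ := by
  classical
  have key : ∀ x : Fin n → ℤ, toQ n x ∈ Submodule.span ℚ (ratMonoid S : Set (Fin n → ℚ)) := by
    intro x
    have hx : x ∈ AddSubgroup.closure (S : Set (Fin n → ℤ)) := h ▸ AddSubgroup.mem_top x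
    induction hx using AddSubgroup.closure_induction with
    | mem x hx => exact Submodule.subset_span ⟨x, hx, rfl⟩
    | zero => rw [map_zero]; exact zero_mem _
    | add x y _ _ hx hy => rw [map_add]; exact add_mem hx hy
    | neg x _ hx => rw [map_neg]; exact neg_mem hx
  rw [eq_top_iff]
  intro v _
  rw [pi_eq_sum_univ v]
  refine sum_mem fun i _ ↦ Submodule.smul_mem _ _ ?_
  rw [← toQ_single]
  exact key _

lemma exists_eq_sub (h : AddSubgroup.closure (S : Set (Fin n → ℤ)) = ⊤) (x : Fin n → ℤ) :
    ∃ s s' : S, x = s - s' := by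
  have hx : x ∈ AddSubgroup.closure (S : Set (Fin n → ℤ)) := h ▸ AddSubgroup.mem_top x
  induction hx using AddSubgroup.closure_induction with
  | mem x hx => exact ⟨⟨x, hx⟩, 0, by simp⟩
  | zero => exact ⟨0, 0, by simp⟩
  | add x y _ _ hx hy =>
    obtain ⟨a, b, rfl⟩ := hx
    obtain ⟨c, d, rfl⟩ := hy
    exact ⟨a + c, b + d, by simp only [AddSubmonoid.coe_add]; abel⟩
  | neg x _ hx =>
    obtain ⟨a, b, rfl⟩ := hx
    exact ⟨b, a, by abel⟩

/-- The dimension of the central torus. -/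
noncomputable def centralRank (S : AddSubmonoid (Fin n → ℤ)) : ℕ :=
  Module.finrank ℚ ((Fin n → ℚ) ⧸ unitSpan S)

/-- Coordinates on the lattice modulo the saturation of the group of units. -/
lemma exists_coordinates (S : AddSubmonoid (Fin n → ℤ)) :
    ∃ p : (Fin n → ℤ) →+ (Fin (centralRank S) → ℤ), Function.Surjective p ∧
      ∀ x y, p x = p y ↔ toQ n x - toQ n y ∈ unitSpan S := by
  let q : (Fin n → ℤ) →+ (Fin n → ℚ) ⧸ unitSpan S :=
    (unitSpan S).mkQ.toAddMonoidHom.comp (toQ n)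
  -- The image of the lattice in the rational quotient is finitely generated and torsion free, hence
  -- free. A basis of it over `ℤ` is also a basis of the quotient over `ℚ`, which identifies its
  -- rank with `centralRank S`.
  let Q : Submodule ℤ ((Fin n → ℚ) ⧸ unitSpan S) := LinearMap.range q.toIntLinearMap
  have : Module.Finite ℤ Q := Module.Finite.range _
  have : Module.IsTorsionFree ℤ ((Fin n → ℚ) ⧸ unitSpan S) := .trans_faithfulSMul ℤ ℚ _
  have : Module.IsTorsionFree ℤ Q := inferInstance
  have : Module.Free ℤ Q := Module.free_of_finite_type_torsion_free'
  let b := Module.finBasis ℤ Q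
  have hli : LinearIndependent ℚ fun i ↦ (b i : (Fin n → ℚ) ⧸ unitSpan S) := by
    rw [← LinearIndependent.iff_fractionRing ℤ ℚ]
    exact b.linearIndependent.map' Q.subtype (Submodule.ker_subtype _)
  have hmem : ∀ x, q x ∈ Submodule.span ℚ
      (Set.range fun i ↦ (b i : (Fin n → ℚ) ⧸ unitSpan S)) := by
    intro x
    have h := b.sum_repr ⟨q x, x, rfl⟩
    have h' := congrArg Subtype.val h
    rw [AddSubmonoidClass.coe_finset_sum] at h'
    change ((⟨q x, x, rfl⟩ : Q) : (Fin n → ℚ) ⧸ unitSpan S) ∈ _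
    rw [← h']
    refine sum_mem fun i _ ↦ ?_
    rw [Submodule.coe_smul, ← Int.cast_smul_eq_zsmul ℚ]
    exact Submodule.smul_mem _ _ (Submodule.subset_span ⟨i, rfl⟩)
  have hspan : ⊤ ≤ Submodule.span ℚ (Set.range fun i ↦ (b i : (Fin n → ℚ) ⧸ unitSpan S)) := by
    intro v _
    obtain ⟨v, rfl⟩ := (unitSpan S).mkQ_surjective v
    rw [pi_eq_sum_univ v, map_sum]
    refine sum_mem fun i _ ↦ ?_
    rw [map_smul]
    refine Submodule.smul_mem _ _ ?_
    rw [← toQ_single]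
    exact hmem _
  have hd : Module.finrank ℤ Q = centralRank S := by
    have := Module.finrank_eq_card_basis (Module.Basis.mk hli hspan)
    rw [centralRank, this, Fintype.card_fin]
  let e : Q ≃ₗ[ℤ] (Fin (centralRank S) → ℤ) :=
    (b.reindex (finCongr hd)).equivFun
  refine ⟨(e.toLinearMap ∘ₗ q.toIntLinearMap.rangeRestrict).toAddMonoidHom, ?_, ?_⟩
  · intro v
    obtain ⟨x, hx⟩ := q.toIntLinearMap.surjective_rangeRestrict (e.symm v)
    exact ⟨x, (congrArg e hx).trans (e.apply_symm_apply v)⟩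
  · intro x y
    change e (q.toIntLinearMap.rangeRestrict x) = e (q.toIntLinearMap.rangeRestrict y) ↔ _
    rw [e.injective.eq_iff, Subtype.ext_iff, ← map_sub, ← Submodule.Quotient.mk_eq_zero,
      map_sub, Submodule.Quotient.mk_sub, sub_eq_zero]
    rfl

end Affine

end ToricMonoid

namespace ToricMonoid

/-! ### Coordinates on the central torus, and its closure. -/

section Affine

variable {G k : Type*} [Monoid G] [TopologicalSpace G] [Field k] {n : ℕ}
  {S : AddSubmonoid (Fin n → ℤ)} {φ : G ≃* (Multiplicative S →* k)}

lemma mem_centralTorus {x : G} : x ∈ centralTorus φ ↔ (∀ s, chi φ s x ≠ 0) ∧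
    ∀ s s' : S, toQ n s - toQ n s' ∈ unitSpan S → chi φ s x = chi φ s' x := by
  rw [← isUnit_iff_chi]; rfl

lemma pow_mul_pow_mul_inv {α : Type*} [CommGroup α] (a b : α) (m l : ℕ) :
    a ^ m * b ^ l * (b ^ m * a ^ l)⁻¹ = (a * b⁻¹) ^ m * ((a * b⁻¹) ^ l)⁻¹ := by
  simp only [mul_pow, inv_pow, mul_inv, inv_inv]
  generalize a ^ m = a₁
  generalize a ^ l = a₂
  generalize b ^ m = b₁
  generalize b ^ l = b₂
  rw [_root_.mul_assoc, _root_.mul_assoc, _root_.mul_left_comm b₂, _root_.mul_comm b₂]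

/-- Coordinates on the central torus. -/
lemma exists_torus_coordinates (hS : AddSubgroup.closure (S : Set (Fin n → ℤ)) = ⊤) :
    ∃ (p : (Fin n → ℤ) →+ (Fin (centralRank S) → ℤ)) (w : centralTorus φ → Fin (centralRank S) → kˣ)
      (a b : Fin (centralRank S) → S),
      (∀ x y, p x = p y ↔ toQ n x - toQ n y ∈ unitSpan S) ∧ Function.Surjective w ∧
      (∀ s x, chi φ s x.1 = ((∏ i, w x i ^ p s i : kˣ) : k)) ∧
      ∀ i x, chi φ (b i) x.1 * w x i = chi φ (a i) x.1 := by
  classical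
  obtain ⟨p, hp, hpS⟩ := exists_coordinates S
  have hab : ∀ i, ∃ a b : S, p a - p b = Pi.single i 1 := by
    intro i
    obtain ⟨x, hx⟩ := hp (Pi.single i 1)
    obtain ⟨a, b, rfl⟩ := exists_eq_sub hS x
    exact ⟨a, b, by rw [← hx, map_sub]⟩
  choose a b hab using hab
  let u : centralTorus φ → S → kˣ := fun x s ↦
    Units.mk0 (chi φ s x) ((mem_centralTorus.1 x.2).1 s)
  -- The difference `a i - b i` lifts the `i`-th basis vector, so the quotient of the two characters
  -- is the `i`-th coordinate.
  let w : centralTorus φ → Fin (centralRank S) → kˣ := fun x i ↦ u x (a i) * (u x (b i))⁻¹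
  have hu : ∀ x s s', u x (s + s') = u x s * u x s' := fun x s s' ↦
    Units.ext (chi_add φ s s' x)
  have hum : ∀ x (m : ℕ) s, u x (m • s) = u x s ^ m := fun x m s ↦
    Units.ext (by simpa [u] using chi_nsmul φ m s x)
  have hus : ∀ x (f : Fin (centralRank S) → S), u x (∑ i, f i) = ∏ i, u x (f i) :=
    fun x f ↦ Units.ext (by simp [u, chi_sum])
  have hval : ∀ s x, u x s = ∏ i, w x i ^ p s i := by
    intro s x
    have hpm : ∀ i, p s i = ((p s i).toNat : ℤ) - ((-p s i).toNat : ℤ) := fun i ↦ by omega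
    -- The exponents `p s i` may be negative, whereas only elements of `S` give characters. Positive
    -- and negative parts are therefore put on opposite sides, where both become elements of `S`
    -- with the same image under `p`.
    have key : u x (s + ∑ i, ((p s i).toNat • b i + (-p s i).toNat • a i)) =
        u x (∑ i, ((p s i).toNat • a i + (-p s i).toNat • b i)) := by
      refine Units.ext ((mem_centralTorus.1 x.2).2 _ _ ((hpS _ _).1 ?_))
      simp only [AddSubmonoid.coe_add, AddSubmonoidClass.coe_finset_sum,
        AddSubmonoidClass.coe_nsmul, map_add, map_sum, map_nsmul]
      rw [← sub_eq_zero, add_sub_assoc, ← Finset.sum_sub_distrib]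
      have : ∀ i, (p s i).toNat • p (b i) + (-p s i).toNat • p (a i) -
          ((p s i).toNat • p (a i) + (-p s i).toNat • p (b i)) = - (p s i • Pi.single i 1) := by
        intro i
        rw [← hab]
        conv_rhs => rw [hpm i]
        rw [sub_smul, smul_sub, smul_sub, natCast_zsmul, natCast_zsmul, natCast_zsmul,
          natCast_zsmul]
        abel
      rw [Finset.sum_congr rfl fun i _ ↦ this i, Finset.sum_neg_distrib, ← sub_eq_add_neg,
        sub_eq_zero]
      ext j
      rw [Finset.sum_apply, Finset.sum_eq_single j]
      · simp
      · intro i _ hij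
        simp [Pi.single_eq_of_ne hij.symm]
      · simp
    rw [hu, hus, hus] at key
    simp only [hu, hum, Finset.prod_mul_distrib] at key
    rw [← eq_mul_inv_iff_mul_eq] at key
    rw [key, ← Finset.prod_mul_distrib, ← Finset.prod_mul_distrib, ← Finset.prod_inv_distrib,
      ← Finset.prod_mul_distrib]
    refine Finset.prod_congr rfl fun i _ ↦ ?_
    conv_rhs => rw [hpm i]
    rw [zpow_sub, zpow_natCast, zpow_natCast]
    simp only [w]
    exact pow_mul_pow_mul_inv _ _ _ _
  refine ⟨p, w, a, b, hpS, fun v ↦ ?_, fun s x ↦ congrArg Units.val (hval s x), fun i x ↦ ?_⟩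
  · obtain ⟨x, hx⟩ := exists_point (φ := φ) (fun s ↦ ((∏ i, v i ^ p s i : kˣ) : k))
      (by simp) (by
        intro s s'
        rw [← Units.val_mul, ← Finset.prod_mul_distrib]
        congr 2
        ext1 i
        rw [AddSubmonoid.coe_add, map_add, Pi.add_apply, zpow_add])
    have hxT : x ∈ centralTorus φ := by
      refine mem_centralTorus.2 ⟨fun s ↦ by rw [hx]; exact Units.ne_zero _, fun s s' h ↦ ?_⟩
      rw [hx, hx, (hpS _ _).2 h]
    refine ⟨⟨x, hxT⟩, funext fun i ↦ ?_⟩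
    have h1 : ∀ s, u ⟨x, hxT⟩ s = ∏ i, v i ^ p s i := fun s ↦ Units.ext (hx s)
    simp only [w]
    rw [h1, h1, ← Finset.prod_inv_distrib, ← Finset.prod_mul_distrib]
    rw [Finset.prod_eq_single i]
    · rw [← zpow_neg, ← zpow_add, ← sub_eq_add_neg, ← Pi.sub_apply, hab]
      simp
    · intro j _ hj
      rw [← zpow_neg, ← zpow_add, ← sub_eq_add_neg, ← Pi.sub_apply, hab,
        Pi.single_eq_of_ne hj, zpow_zero]
    · simp
  · change ((u x (b i) * (u x (a i) * (u x (b i))⁻¹) : kˣ) : k) = (u x (a i) : k)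
    rw [mul_left_comm, mul_inv_cancel, _root_.mul_one]

variable [IsAlgClosed k]

lemma exists_zpow_ne_one {m : ℤ} (hm : m ≠ 0) : ∃ u : kˣ, u ^ m ≠ 1 := by
  classical
  have : Infinite k := IsAlgClosed.instInfinite
  have hm' : 0 < m.natAbs := Int.natAbs_pos.2 hm
  obtain ⟨a, ha⟩ := Infinite.exists_notMem_finset
    (insert 0 (Polynomial.nthRootsFinset m.natAbs (1 : k)))
  simp only [Finset.mem_insert, not_or, Polynomial.mem_nthRootsFinset hm'] at ha
  refine ⟨Units.mk0 a ha.1, fun h ↦ ha.2 ?_⟩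
  have h1 : Units.mk0 a ha.1 ^ m.natAbs = 1 := by
    generalize Units.mk0 a ha.1 = v at h
    obtain ⟨l, rfl | rfl⟩ := Int.eq_nat_or_neg m
    · simpa using h
    · simpa using h
  simpa using congrArg Units.val h1

namespace IsAffineToric

/-- On the central torus a character of `S` is the Laurent monomial with exponents `p s`.
Multiplying by a large power of the product of all coordinates makes the exponents in a given `f`
nonnegative. -/
lemma isTorusSpace (h : IsAffineToric S φ) : ∃ w : ↥(centralTorus φ) → Fin (centralRank S) → kˣ,
    IsTorusSpace (fun y : ↥(centralTorus φ) ↦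
      (AddMonoidAlgebra.lift k k S (φ y)).toRingHom) w := by
  classical
  obtain ⟨p, w, a, b, hpS, hsurj, hval, hab⟩ := exists_torus_coordinates (φ := φ) h.closure_eq_top
  refine ⟨w, h.zariski.subtype _, hsurj, fun f ↦ ?_, fun i ↦ ⟨.single (a i) 1, .single (b i) 1,
    fun y ↦ ?_⟩, fun c ↦ ⟨.single 0 c, fun y ↦ by rw [lift_single]; simp⟩⟩
  · let N : ℕ := ∑ s ∈ f.coeff.support, ∑ i, (p s i).natAbs
    have hN : ∀ s ∈ f.coeff.support, ∀ i, 0 ≤ p s i + N := by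
      intro s hs i
      have h1 : (p s i).natAbs ≤ ∑ i, (p s i).natAbs :=
        Finset.single_le_sum (f := fun i ↦ (p s i).natAbs) (fun _ _ ↦ Nat.zero_le _)
          (Finset.mem_univ i)
      have h2 : ∑ i, (p s i).natAbs ≤ N :=
        Finset.single_le_sum (f := fun s : S ↦ ∑ i, (p s i).natAbs) (fun _ _ ↦ Nat.zero_le _) hs
      omega
    refine ⟨∑ s ∈ f.coeff.support, MvPolynomial.C (f.coeff s) *
      ∏ i, MvPolynomial.X i ^ (p s i + N).toNat, fun y ↦ ∏ i, w y i ^ N, fun y ↦ ?_⟩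
    rw [lift_eq_sum, Finsupp.sum, Finset.mul_sum, map_sum]
    refine Finset.sum_congr rfl fun s hs ↦ ?_
    rw [map_mul, MvPolynomial.eval_C, map_prod, hval s y, mul_left_comm, ← Units.val_mul,
      ← Finset.prod_mul_distrib, Units.coe_prod]
    congr 1
    refine Finset.prod_congr rfl fun i _ ↦ ?_
    rw [map_pow, MvPolynomial.eval_X, ← Units.val_pow_eq_pow_val, ← zpow_natCast, ← zpow_natCast,
      Int.toNat_of_nonneg (hN s hs i), ← zpow_add, _root_.add_comm]
  · rw [lift_single, lift_single, _root_.one_mul, _root_.one_mul]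
    exact ⟨(mem_centralTorus.1 y.2).1 _, hab i y⟩

lemma isPreirreducible_centralTorus (h : IsAffineToric S φ) :
    IsPreirreducible (centralTorus φ : Set G) := by
  have : Infinite k := IsAlgClosed.instInfinite
  obtain ⟨w, hw⟩ := h.isTorusSpace
  have := hw.isPreirreducible ∅
  have h2 := this.image Subtype.val continuous_subtype_val.continuousOn
  convert h2 using 1
  ext x
  simp

lemma topologicalKrullDim_centralTorus (h : IsAffineToric S φ) :
    topologicalKrullDim ↥(centralTorus φ) = centralRank S := by
  have : Infinite k := IsAlgClosed.instInfinite
  obtain ⟨w, hw⟩ := h.isTorusSpace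
  exact hw.topologicalKrullDim_eq

/-- By `mem_closure_iff` only equalities of characters on the torus matter. Two characters with
different images under `p` are distinguished by moving a single coordinate, so these equalities are
exactly the ones defining `centralSubmonoid`. -/
lemma closure_centralTorus (h : IsAffineToric S φ) :
    closure (centralTorus φ : Set G) = centralSubmonoid φ := by
  classical
  ext x
  rw [h.mem_closure_iff]
  constructor
  · intro H s s' hs
    exact H s s' fun b hb ↦ hb.2 s s' hs
  · intro hx s s' hs
    refine hx s s' ?_
    obtain ⟨p, w, a, b, hpS, hsurj, hval, hab⟩ := exists_torus_coordinates (φ := φ) h.closure_eq_top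
    rw [← hpS]
    by_contra hne
    obtain ⟨i, hi⟩ := Function.ne_iff.1 hne
    obtain ⟨u, hu⟩ := exists_zpow_ne_one (k := k) (sub_ne_zero.2 hi)
    obtain ⟨y, hy⟩ := hsurj (Function.update 1 i u)
    have h1 := hs y y.2
    have h2 : ∀ s, ∏ j, w y j ^ p s j = u ^ p s i := by
      intro s
      rw [Finset.prod_eq_single i]
      · rw [hy, Function.update_self]
      · intro j _ hj
        rw [hy, Function.update_of_ne hj, Pi.one_apply, one_zpow]
      · simp
    rw [hval, hval, h2, h2] at h1
    apply hu
    rw [zpow_sub, Units.ext h1, mul_inv_cancel]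

end IsAffineToric

end Affine

end ToricMonoid

namespace ToricMonoid

/-! ### Assertions (i), (ii) and (iii) for affine toric monoids. -/

section Affine

variable {G k : Type*} [Monoid G] [TopologicalSpace G] [Field k] {n : ℕ}
  {S : AddSubmonoid (Fin n → ℤ)} {φ : G ≃* (Multiplicative S →* k)}

/-- Lying below the idempotent of the smallest face, `e₀` can be 1 only on units; on a unit its
value is invertible, hence not 0. -/
lemma chi_smallest {e₀ : Idempotents G} (he : ∀ f, IdemLE e₀ f) (s : S) :
    chi φ s e₀.1 = 1 ↔ -(s : Fin n → ℤ) ∈ S := by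
  classical
  constructor
  · intro h
    obtain ⟨x, hx, H⟩ := exists_idempotent_of_face φ (isFace_unitFace (ratMonoid S))
    have h1 := (he ⟨x, hx⟩).1
    rw [h1, chi_mul] at h
    have h2 := (chi_idempotent (φ := φ) hx s).resolve_left (right_ne_zero_of_mul_eq_one h)
    exact toQ_mem_unitFace.1 ((H s).1 h2)
  · intro hs
    refine (chi_idempotent e₀.2 s).resolve_left fun h0 ↦ ?_
    have := chi_add φ s ⟨_, hs⟩ e₀.1
    have h1 : s + ⟨_, hs⟩ = 0 := Subtype.ext (add_neg_cancel _)
    rw [h1, h0, zero_mul, chi_zero] at this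
    exact one_ne_zero this

lemma chi_smallest_eq_zero {e₀ : Idempotents G} (he : ∀ f, IdemLE e₀ f) {s : S}
    (hs : -(s : Fin n → ℤ) ∉ S) : chi φ s e₀.1 = 0 :=
  (chi_idempotent e₀.2 s).resolve_right fun h ↦ hs ((chi_smallest he s).1 h)

lemma exists_smallest (φ : G ≃* (Multiplicative S →* k)) :
    ∃ e₀ : Idempotents G, ∀ f, IdemLE e₀ f := by
  obtain ⟨x, hx, H⟩ := exists_idempotent_of_face φ (isFace_unitFace (ratMonoid S))
  refine ⟨⟨x, hx⟩, fun f ↦ (idemLE_iff (φ := φ)).2 ?_⟩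
  intro v hv
  obtain ⟨s, hs, rfl⟩ := (faceOf φ x hx).2.le hv
  exact ((faceOf φ f.1 f.2).2.unitFace_le) ((H ⟨s, hs⟩).1 (toQ_mem_faceOf (s := ⟨s, hs⟩).1 hv))

lemma mul_smallest_eq_iff {e₀ : Idempotents G} (he : ∀ f, IdemLE e₀ f) {x : G} :
    x * e₀ = e₀ ↔ ∀ s : S, -(s : Fin n → ℤ) ∈ S → chi φ s x = 1 := by
  constructor
  · intro h s hs
    have := chi_mul φ s x e₀
    rw [h, (chi_smallest he s).2 hs, _root_.mul_one] at this
    exact this.symm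
  · intro h
    refine chi_ext (φ := φ) fun s ↦ ?_
    rw [chi_mul]
    by_cases hs : -(s : Fin n → ℤ) ∈ S
    · rw [h s hs, _root_.one_mul]
    · rw [chi_smallest_eq_zero he hs, mul_zero]

lemma chi_eq_one_of_mem {x : G} (hx : x ∈ centralSubmonoid φ) {s : S}
    (hs : -(s : Fin n → ℤ) ∈ S) : chi φ s x = 1 := by
  rw [hx s 0, chi_zero]
  rw [AddSubmonoid.coe_zero, map_zero, sub_zero]
  exact toQ_mem_unitSpan.2 hs

/-- The face of an idempotent contains the units and is cut out by its rational span, so it cannot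
separate two elements whose difference lies in `unitSpan S`. -/
lemma idempotent_mem {x : G} (hx : IsIdempotentElem x) : x ∈ centralSubmonoid φ := by
  have key : ∀ s s' : S, toQ n s - toQ n s' ∈ unitSpan S → chi φ s' x = 1 → chi φ s x = 1 := by
    intro s s' h h1
    have hF := (faceOf φ x hx).2
    refine toQ_mem_faceOf (hx := hx).1 (hF.mem_of_mem_span (toQ_mem_ratMonoid s) ?_)
    have h2 := Submodule.span_mono (R := ℚ) (SetLike.coe_subset_coe.2 hF.unitFace_le) h
    have h3 := Submodule.subset_span (R := ℚ) (toQ_mem_faceOf (hx := hx).2 h1)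
    simpa using add_mem h2 h3
  intro s s' h
  have h' : toQ n s' - toQ n s ∈ unitSpan S := by rw [← neg_sub]; exact neg_mem h
  rcases chi_idempotent (φ := φ) hx s with h0 | h1
  · rcases chi_idempotent (φ := φ) hx s' with h0' | h1'
    · rw [h0, h0']
    · rw [key s s' h h1', h1']
  · rw [h1, key s' s h' h1]

/-- Power relations between the values of characters which differ by a rational combination of
units. -/
lemma exists_pow_eq {s s' : S} (h : toQ n s - toQ n s' ∈ unitSpan S) :
    ∃ m : ℕ, 0 < m ∧ ∀ x : G, (∀ l : S, -(l : Fin n → ℤ) ∈ S → chi φ l x = 1) →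
      chi φ s x ^ m = chi φ s' x ^ m := by
  obtain ⟨m, hm, l, l', hl, hl', e⟩ := exists_nsmul_eq_of_mem_unitSpan h
  refine ⟨m, Nat.pos_of_ne_zero hm, fun x hx ↦ ?_⟩
  have := congrArg (fun t ↦ chi φ t x) e
  simpa [hx l hl, hx l' hl'] using this

lemma exists_root {m : ℕ} (hm : 0 < m) {a b : k} (h : a ^ m = b ^ m) :
    ∃ ζ ∈ Polynomial.nthRootsFinset m (1 : k), a = ζ * b := by
  rcases eq_or_ne b 0 with rfl | hb
  · rw [zero_pow hm.ne'] at h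
    exact ⟨1, by simp [Polynomial.mem_nthRootsFinset hm], by simpa using eq_zero_of_pow_eq_zero h⟩
  · exact ⟨a / b, by rw [Polynomial.mem_nthRootsFinset hm, div_pow, h, div_self (pow_ne_zero _ hb)],
      (div_mul_cancel₀ a hb).symm⟩

namespace IsAffineToric

/-- It suffices to test that the finitely many generators of `S` do not vanish. -/
lemma isOpen_units (h : IsAffineToric S φ) : IsOpen {x : G | IsUnit x} := by
  obtain ⟨T, hT, hfin⟩ := (AddSubmonoid.fg_iff S).1 h.fg
  have hTS : T ⊆ S := hT ▸ AddSubmonoid.subset_closure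
  have : {x : G | IsUnit x} = ⋂ s ∈ T, {x | ∀ hs : s ∈ S, chi φ ⟨s, hs⟩ x ≠ 0} := by
    ext x
    simp only [Set.mem_setOf_eq, Set.mem_iInter, isUnit_iff_chi (φ := φ)]
    refine ⟨fun H s _ hs ↦ H _, fun H ↦ ?_⟩
    have key : ∀ s (hs : s ∈ AddSubmonoid.closure T), chi φ ⟨s, hT ▸ hs⟩ x ≠ 0 := by
      intro s hs
      induction hs using AddSubmonoid.closure_induction with
      | mem s hs => exact H s hs _
      | zero =>
        have := chi_zero φ x
        exact fun h0 ↦ one_ne_zero (this.symm.trans h0)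
      | add s t hs ht h1 h2 =>
        have := chi_add φ ⟨s, hT ▸ hs⟩ ⟨t, hT ▸ ht⟩ x
        exact fun h0 ↦ mul_ne_zero h1 h2 (this.symm.trans h0)
    intro s
    exact key s (by rw [hT]; exact s.2)
  rw [this]
  refine hfin.isOpen_biInter fun s hs ↦ ?_
  have hc := h.isClosed_chi_eq ⟨s, hTS hs⟩ 0 0
  have : {x : G | ∀ hs : s ∈ S, chi φ ⟨s, hs⟩ x ≠ 0} = {x | chi φ ⟨s, hTS hs⟩ x = 0 * chi φ 0 x}ᶜ := by
    ext x
    simp only [zero_mul, Set.mem_setOf_eq, Set.mem_compl_iff]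
    exact ⟨fun H ↦ H _, fun H _ ↦ H⟩
  rw [this]
  exact hc.isOpen_compl

variable [IsAlgClosed k]

/-- On the isotropy group, characters congruent modulo `unitSpan S` have equal `m`-th powers, so
their quotient takes finitely many values and is 1 on the component of the neutral element.
Conversely the central torus is irreducible, contains 1 and fixes `e₀`. -/
lemma neutralIsotropy_eq (h : IsAffineToric S φ) {e₀ : Idempotents G}
    (he : ∀ f, IdemLE e₀ f) : neutralIsotropy (e₀ : G) = centralTorus φ := by
  classical
  apply subset_antisymm
  · intro x hx
    have hsub : connectedComponentIn (isotropy e₀.1) 1 ⊆ isotropy e₀.1 :=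
      connectedComponentIn_subset _ _
    have h1 : (1 : G) ∈ connectedComponentIn (isotropy e₀.1) 1 :=
      mem_connectedComponentIn ⟨isUnit_one, _root_.one_mul _⟩
    refine ⟨(hsub hx).1, fun s s' hs ↦ ?_⟩
    obtain ⟨m, hm, H⟩ := exists_pow_eq (φ := φ) hs
    by_contra hne
    have hcov := isPreconnected_closed_iff.1
      (isPreconnected_connectedComponentIn (x := (1 : G)) (F := isotropy e₀.1))
      {y | chi φ s y = 1 * chi φ s' y}
      (⋃ ζ ∈ (Polynomial.nthRootsFinset m (1 : k)).erase 1, {y | chi φ s y = ζ * chi φ s' y})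
      (h.isClosed_chi_eq s s' 1)
      (Set.Finite.isClosed_biUnion (Finset.finite_toSet _) fun ζ _ ↦ h.isClosed_chi_eq s s' ζ)
    have hroot : ∀ y ∈ connectedComponentIn (isotropy e₀.1) 1,
        ∃ ζ ∈ Polynomial.nthRootsFinset m (1 : k), chi φ s y = ζ * chi φ s' y := fun y hy ↦
      exists_root hm (H y ((mul_smallest_eq_iff he).1 (hsub hy).2))
    obtain ⟨y, hy, hy1, hy2⟩ := hcov (fun y hy ↦ by
        obtain ⟨ζ, hζ, e⟩ := hroot y hy
        rcases eq_or_ne ζ 1 with rfl | hζ1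
        · exact .inl e
        · exact .inr (Set.mem_biUnion (Finset.mem_erase.2 ⟨hζ1, hζ⟩) e))
      ⟨1, h1, by simp⟩ (by
        obtain ⟨ζ, hζ, e⟩ := hroot x hx
        refine ⟨x, hx, Set.mem_biUnion (Finset.mem_erase.2 ⟨?_, hζ⟩) e⟩
        rintro rfl
        exact hne (by rwa [_root_.one_mul] at e))
    obtain ⟨ζ, hζ, e⟩ := Set.mem_iUnion₂.1 hy2
    have hy1' : chi φ s y = 1 * chi φ s' y := hy1
    have e' : chi φ s y = ζ * chi φ s' y := e
    have hu := isUnit_iff_chi (φ := φ).1 (hsub hy).1 s'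
    exact (Finset.mem_erase.1 hζ).1 (mul_right_cancel₀ hu (e'.symm.trans hy1'))
  · refine h.isPreirreducible_centralTorus.isPreconnected.subset_connectedComponentIn
      (one_mem (centralTorus φ)) fun x hx ↦ ⟨hx.1, ?_⟩
    exact (mul_smallest_eq_iff he).2 fun s hs ↦ chi_eq_one_of_mem hx.2 hs

lemma isClosed_centralSubmonoid (h : IsAffineToric S φ) :
    IsClosed (centralSubmonoid φ : Set G) := by
  rw [← h.closure_centralTorus]; exact isClosed_closure

lemma isClosedIrreducibleSubsemigroup (h : IsAffineToric S φ) :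
    IsClosedIrreducibleSubsemigroup (centralSubmonoid φ : Set G) where
  isClosed := h.isClosed_centralSubmonoid
  isIrreducible := by
    rw [← h.closure_centralTorus]
    exact IsIrreducible.closure ⟨⟨1, one_mem (centralTorus φ)⟩, h.isPreirreducible_centralTorus⟩
  mul_mem := fun _ hx _ hy ↦ mul_mem (S := Submonoid G) hx hy

/-- A zero `z` of `A` is idempotent, hence 1 on the units of `S`, and `z * a = z` gives the same for
every `a ∈ A`. Then `A` is covered by the finitely many closed sets `chi s = ζ * chi s'` with `ζ` a
root of unity. Irreducibility selects one `ζ`, and comparing `x` with `x * x` gives `ζ ^ 2 = ζ`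
where `chi s'` does not vanish. -/
lemma isGreatest (h : IsAffineToric S φ) :
    IsGreatest {A : Set G | IsClosedIrreducibleSubsemigroup A ∧ HasZeroElement A}
      (centralSubmonoid φ) := by
  classical
  obtain ⟨e₀, he⟩ := exists_smallest φ
  refine ⟨⟨h.isClosedIrreducibleSubsemigroup, e₀, idempotent_mem e₀.2, fun x hx ↦ ?_⟩, ?_⟩
  · have : x * e₀ = e₀ := (mul_smallest_eq_iff (φ := φ) he).2 fun s hs ↦ chi_eq_one_of_mem hx hs
    exact ⟨by rw [points_comm φ, this], this⟩
  · rintro A ⟨hA, z, hz, hzA⟩ x hx s s' hs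
    obtain ⟨m, hm, H⟩ := exists_pow_eq (φ := φ) hs
    have hz1 : ∀ l : S, -(l : Fin n → ℤ) ∈ S → chi φ l z = 1 := by
      intro l hl
      have hzz : IsIdempotentElem z := (hzA z hz).1
      exact chi_eq_one_of_mem (idempotent_mem hzz) hl
    have hA1 : ∀ a ∈ A, ∀ l : S, -(l : Fin n → ℤ) ∈ S → chi φ l a = 1 := by
      intro a ha l hl
      have := chi_mul φ l z a
      rw [(hzA a ha).1, hz1 l hl, _root_.one_mul] at this
      exact this.symm
    obtain ⟨ζ, hζ⟩ : ∃ ζ : k, ∀ a ∈ A, chi φ s a = ζ * chi φ s' a := by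
      have := isIrreducible_iff_sUnion_isClosed.1 hA.isIrreducible
        ((Polynomial.nthRootsFinset m (1 : k)).image fun ζ ↦ {y | chi φ s y = ζ * chi φ s' y})
        (by
          intro Z hZ
          obtain ⟨ζ, -, rfl⟩ := Finset.mem_image.1 hZ
          exact h.isClosed_chi_eq s s' ζ)
        (by
          intro a ha
          obtain ⟨ζ, hζ, e⟩ := exists_root hm (H a (hA1 a ha))
          exact ⟨_, Finset.mem_coe.2 (Finset.mem_image_of_mem _ hζ), e⟩)
      obtain ⟨Z, hZ, hAZ⟩ := this
      obtain ⟨ζ, -, rfl⟩ := Finset.mem_image.1 hZ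
      exact ⟨ζ, fun a ha ↦ hAZ ha⟩
    have h1 := hζ x hx
    have h2 := hζ (x * x) (hA.mul_mem x hx x hx)
    rw [chi_mul, chi_mul, h1] at h2
    rcases eq_or_ne (chi φ s' x) 0 with h0 | h0
    · rw [h1, h0, mul_zero]
    · rcases eq_or_ne ζ 0 with rfl | hζ0
      · have := H x (hA1 x hx)
        rw [h1, zero_mul, zero_pow hm.ne'] at this
        exact absurd this.symm (pow_ne_zero _ h0)
      · have h3 : ζ * (chi φ s' x * chi φ s' x) * ζ = ζ * (chi φ s' x * chi φ s' x) * 1 := by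
          rw [_root_.mul_one]; nth_rewrite 2 [← h2]; ring
        have := mul_left_cancel₀ (mul_ne_zero hζ0 (mul_ne_zero h0 h0)) h3
        rw [h1, this, _root_.one_mul]

/-- The units `B` of `M` in `A` are dense in `A`. Characters congruent modulo the span `W` of the
relations on `B` have equal powers on `A`, in particular at all idempotents, so every face is
saturated modulo `W`. The rank inequality then forces `W ≤ unitSpan S`: every equality of characters
on `B` already holds on the central submonoid, which therefore lies in the closure of `B`. -/
lemma isLeast (h : IsAffineToric S φ) :
    IsLeast {A : Set G | IsClosedIrreducibleSubsemigroup A ∧ ∀ f : G, IsIdempotentElem f → f ∈ A}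
      (centralSubmonoid φ) := by
  classical
  refine ⟨⟨h.isClosedIrreducibleSubsemigroup, fun f hf ↦ idempotent_mem hf⟩, ?_⟩
  rintro A ⟨hA, hEA⟩
  let B : Submonoid G :=
    { carrier := A ∩ {x | IsUnit x}
      one_mem' := ⟨hEA 1 (_root_.one_mul 1), isUnit_one⟩
      mul_mem' := fun hx hy ↦ ⟨hA.mul_mem _ hx.1 _ hy.1, hx.2.mul hy.2⟩ }
  have hBA : closure (B : Set G) ⊆ A := closure_minimal Set.inter_subset_left hA.isClosed
  have hAB : A ⊆ closure (B : Set G) :=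
    subset_closure_inter_of_isPreirreducible_of_isOpen hA.isIrreducible.2 h.isOpen_units
      ⟨1, B.one_mem'⟩
  let D : AddSubmonoid (Fin n → ℚ) :=
    { carrier := {v | ∃ s s' : S, toQ n s - toQ n s' = v ∧ ∀ b ∈ B, chi φ s b = chi φ s' b}
      zero_mem' := ⟨0, 0, by simp, fun _ _ ↦ rfl⟩
      add_mem' := by
        rintro _ _ ⟨s, s', rfl, hs⟩ ⟨t, t', rfl, ht⟩
        refine ⟨s + t, s' + t', ?_, fun b hb ↦ by rw [chi_add, chi_add, hs b hb, ht b hb]⟩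
        simp only [AddSubmonoid.coe_add, map_add]
        abel }
  set W : Submodule ℚ (Fin n → ℚ) := Submodule.span ℚ (D : Set (Fin n → ℚ)) with hW
  have hrel : ∀ s s' : S, toQ n s - toQ n s' ∈ W →
      ∃ m : ℕ, m ≠ 0 ∧ ∀ x ∈ A, chi φ s x ^ m = chi φ s' x ^ m := by
    intro s s' hs
    obtain ⟨m, hm, _, ⟨a, a', rfl, ha⟩, _, ⟨b, b', rfl, hb⟩, e⟩ :=
      exists_nsmul_add_eq_of_mem_span hs
    refine ⟨m, hm, ?_⟩
    have key : ∀ x ∈ B, chi φ s x ^ m = chi φ s' x ^ m := by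
      intro x hx
      have e' : m • s + a + b' = m • s' + a' + b := by
        ext1
        apply toQ_injective n
        simp only [AddSubmonoid.coe_add, AddSubmonoidClass.coe_nsmul, map_add, map_nsmul]
        rw [smul_sub] at e
        linear_combination (exp := 1) e
      have := congrArg (fun t ↦ chi φ t x) e'
      simp only [chi_add, chi_nsmul, ha x hx, hb x hx] at this
      rw [_root_.mul_assoc, _root_.mul_assoc] at this
      exact mul_right_cancel₀ (mul_ne_zero (isUnit_iff_chi.1 hx.2 _) (isUnit_iff_chi.1 hx.2 _)) this
    intro x hx
    exact closure_minimal (t := {x | chi φ s x ^ m = chi φ s' x ^ m}) key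
      (h.isClosed_chi_pow_eq s s' m) (hAB hx)
  have hsat : ∀ F, IsFace (ratMonoid S) F → ∀ s ∈ ratMonoid S, ∀ s' ∈ F,
      W.mkQ s = W.mkQ s' → s ∈ F := by
    rintro F hF _ ⟨s, hs, rfl⟩ s' hs' e
    obtain ⟨s', hs'S, rfl⟩ := hF.le hs'
    obtain ⟨x, hx, H⟩ := exists_idempotent_of_face φ hF
    obtain ⟨m, hm, hms⟩ := hrel ⟨s, hs⟩ ⟨s', hs'S⟩ ((Submodule.Quotient.eq W).1 e)
    have h1 := hms x (hEA x hx)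
    rw [(H ⟨s', hs'S⟩).2 hs', one_pow] at h1
    rcases chi_idempotent (φ := φ) hx ⟨s, hs⟩ with h0 | h0
    · rw [h0, zero_pow hm] at h1
      exact absurd h1 zero_ne_one
    · exact (H ⟨s, hs⟩).1 h0
  have hrank := rank_image_of_saturated (ratMonoid_fg h.fg) W.mkQ hsat
  -- For the quotient map by `W`, `rank_image_of_saturated` amounts to `dim W ≤ dim (W ⊓ unitSpan
  -- S)`.
  have hWle : W ≤ unitSpan S := by
    have hmap : ∀ F : AddSubmonoid (Fin n → ℚ), monoidRank (F.map W.mkQ.toAddMonoidHom) =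
        Module.finrank ℚ ((Submodule.span ℚ (F : Set (Fin n → ℚ))).map W.mkQ) := by
      intro F
      rw [monoidRank, AddSubmonoid.coe_map, Submodule.map_span]
      rfl
    have e1 : ∀ U : Submodule ℚ (Fin n → ℚ),
        Module.finrank ℚ (U.map W.mkQ) + Module.finrank ℚ (W ⊓ U : Submodule ℚ (Fin n → ℚ)) =
          Module.finrank ℚ U := by
      intro U
      have := LinearMap.finrank_range_add_finrank_ker (W.mkQ.domRestrict U)
      rw [LinearMap.range_domRestrict, LinearMap.ker_domRestrict, Submodule.ker_mkQ] at this
      rw [← this, ← Submodule.finrank_map_subtype_eq U (W.comap U.subtype),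
        Submodule.map_comap_subtype, inf_comm]
    rw [hmap, hmap] at hrank
    have e2 := e1 (Submodule.span ℚ (ratMonoid S : Set (Fin n → ℚ)))
    have e3 := e1 (Submodule.span ℚ (unitFace (ratMonoid S) : Set (Fin n → ℚ)))
    rw [span_toQ_eq_top h.closure_eq_top, inf_top_eq] at e2
    rw [span_toQ_eq_top h.closure_eq_top] at hrank
    simp only [monoidRank] at hrank
    rw [span_toQ_eq_top h.closure_eq_top] at hrank
    have hle : Module.finrank ℚ W ≤ Module.finrank ℚ (W ⊓ unitSpan S : Submodule ℚ (Fin n → ℚ)) := by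
      change _ + Module.finrank ℚ (W ⊓ unitSpan S : Submodule ℚ (Fin n → ℚ)) = _ at e3
      omega
    have := Submodule.eq_of_le_of_finrank_le (inf_le_left (a := W) (b := unitSpan S)) hle
    exact inf_eq_left.1 this
  intro x hx
  rw [SetLike.mem_coe] at hx
  refine hBA ((h.mem_closure_iff B).2 fun s s' hs ↦ hx s s' (hWle ?_))
  exact Submodule.subset_span ⟨s, s', rfl, hs⟩

/-- Both numbers equal `n - dim (unitSpan S)`: the dimension through coordinates on the central
torus, the length through the ranks of faces. -/
lemma exists_dim (h : IsAffineToric S φ) {e₀ : Idempotents G} (he : ∀ f, IdemLE e₀ f) :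
    ∃ d : ℕ, topologicalKrullDim (neutralIsotropy (e₀ : G)) = d ∧
      ∀ C : Set (Idempotents G), IsMaxChain IdemLE C → C.encard = d + 1 := by
  refine ⟨centralRank S, ?_, fun C hC ↦ ?_⟩
  · rw [h.neutralIsotropy_eq he]
    exact h.topologicalKrullDim_centralTorus
  · have h1 := encard_maxChain_faces (ratMonoid_fg h.fg) (hC.image (idempotentsIso φ))
    rw [(idempotentsIso φ).injective.encard_image] at h1
    rw [h1]
    congr 2
    rw [monoidRank, span_toQ_eq_top h.closure_eq_top, finrank_top, centralRank]
    have := Submodule.finrank_quotient_add_finrank (unitSpan S)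
    rw [monoidRank]
    change _ - Module.finrank ℚ (unitSpan S) = _
    omega

lemma closure_neutralIsotropy (h : IsAffineToric S φ) {e₀ : Idempotents G}
    (he : ∀ f, IdemLE e₀ f) : closure (neutralIsotropy (e₀ : G)) = centralSubmonoid φ := by
  rw [h.neutralIsotropy_eq he, h.closure_centralTorus]

end IsAffineToric

end Affine

end ToricMonoid

namespace ToricMonoid

/-! ### Generic points of a torus, and fields with a torus action. -/

section Generic

variable {k : Type*} [Field k] [IsAlgClosed k] {n : ℕ}

/-- A property holding for the points of a nonempty principal open subset of the torus. -/
def Generic (p : (Multiplicative (Fin n → ℤ) →* k) → Prop) : Prop :=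
  ∃ g : AddMonoidAlgebra k (Fin n → ℤ), g ≠ 0 ∧
    ∀ t, AddMonoidAlgebra.lift k k (Fin n → ℤ) t g ≠ 0 → p t

lemma exists_torus_point_ne {χ χ' : Fin n → ℤ} (h : χ ≠ χ') :
    ∃ t : Multiplicative (Fin n → ℤ) →* k, t (.ofAdd χ) ≠ t (.ofAdd χ') := by
  obtain ⟨i, hi⟩ := Function.ne_iff.1 h
  obtain ⟨u, hu⟩ := exists_zpow_ne_one (k := k) (sub_ne_zero.2 hi)
  refine ⟨(Units.coeHom k).comp ((zpowersHom kˣ u).comp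
    (AddMonoidHom.toMultiplicative (Pi.evalAddMonoidHom (fun _ : Fin n ↦ ℤ) i))), fun e ↦ hu ?_⟩
  have e' : u ^ χ i = u ^ χ' i := Units.ext e
  rw [zpow_sub, e', mul_inv_cancel]

/-- Elements of the lattice are distinct as characters of the group of torus points, so Dedekind's
lemma makes them independent. -/
lemma eq_zero_of_lift_eq_zero {f : AddMonoidAlgebra k (Fin n → ℤ)}
    (h : ∀ t, AddMonoidAlgebra.lift k k (Fin n → ℤ) t f = 0) : f = 0 := by
  let T := Multiplicative (Fin n → ℤ) →* k
  let ψ : (Fin n → ℤ) → (T →* k) := fun χ ↦ ⟨⟨fun t ↦ t (.ofAdd χ), rfl⟩, fun _ _ ↦ rfl⟩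
  have hψ : Function.Injective ψ := fun χ χ' e ↦ by
    by_contra hne
    obtain ⟨t, ht⟩ := exists_torus_point_ne (k := k) hne
    exact ht (DFunLike.congr_fun e t)
  have hli := (linearIndependent_monoidHom T k).comp ψ hψ
  rw [linearIndependent_iff] at hli
  rw [← AddMonoidAlgebra.coeff_eq_zero]
  refine hli _ (funext fun t ↦ ?_)
  have := h t
  rw [AddMonoidAlgebra.lift_apply] at this
  rw [Finsupp.linearCombination_apply, Finsupp.sum_apply']
  exact this

namespace Generic

variable {p q : (Multiplicative (Fin n → ℤ) →* k) → Prop}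

lemma and (hp : Generic p) (hq : Generic q) : Generic fun t ↦ p t ∧ q t := by
  obtain ⟨g, hg, hp⟩ := hp
  obtain ⟨g', hg', hq⟩ := hq
  refine ⟨g * g', mul_ne_zero hg hg', fun t ht ↦ ?_⟩
  rw [map_mul] at ht
  exact ⟨hp t (left_ne_zero_of_mul ht), hq t (right_ne_zero_of_mul ht)⟩

lemma mono (hp : Generic p) (h : ∀ t, p t → q t) : Generic q := by
  obtain ⟨g, hg, hp⟩ := hp
  exact ⟨g, hg, fun t ht ↦ h t (hp t ht)⟩

lemma of_forall (h : ∀ t, p t) : Generic p := ⟨1, one_ne_zero, fun t _ ↦ h t⟩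

lemma exists_point (hp : Generic p) : ∃ t, p t := by
  obtain ⟨g, hg, hp⟩ := hp
  by_contra! H
  exact hg (eq_zero_of_lift_eq_zero fun t ↦ by_contra fun ht ↦ H t (hp t ht))

lemma finset_forall {J : Type*} (s : Finset J) {p : J → (Multiplicative (Fin n → ℤ) →* k) → Prop}
    (hp : ∀ i ∈ s, Generic (p i)) : Generic fun t ↦ ∀ i ∈ s, p i t := by
  classical
  induction s using Finset.induction_on with
  | empty => exact of_forall fun t i hi ↦ absurd hi (Finset.notMem_empty i)
  | insert a s ha ih =>
    refine ((hp a (Finset.mem_insert_self a s)).and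
      (ih fun i hi ↦ hp i (Finset.mem_insert_of_mem hi))).mono fun t ht i hi ↦ ?_
    rcases Finset.mem_insert.1 hi with rfl | hi
    · exact ht.1
    · exact ht.2 i hi

/-- Distinct characters are independent on a nonempty principal open subset of the torus. -/
lemma eq_zero_of_sum {V : Type*} [AddCommGroup V] [Module k V] {v : (Fin n → ℤ) →₀ V}
    (h : Generic fun t : Multiplicative (Fin n → ℤ) →* k ↦
      v.sum (fun χ w ↦ t (.ofAdd χ) • w) = 0) : v = 0 := by
  obtain ⟨g, hg, h⟩ := h
  ext χ
  rw [Finsupp.zero_apply, ← Module.forall_dual_apply_eq_zero_iff k]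
  intro l
  -- Applying a linear form reduces to scalar coefficients: `a * g` vanishes at every point of the
  -- torus, and the group algebra has no zero divisors.
  let a : AddMonoidAlgebra k (Fin n → ℤ) := .ofCoeff (v.mapRange l (map_zero l))
  have ha : a = 0 := by
    have : a * g = 0 := by
      refine eq_zero_of_lift_eq_zero fun t ↦ ?_
      rw [map_mul]
      by_cases ht : AddMonoidAlgebra.lift k k (Fin n → ℤ) t g = 0
      · rw [ht, mul_zero]
      · have h1 := congrArg l (h t ht)
        rw [map_zero, map_finsuppSum] at h1
        rw [AddMonoidAlgebra.lift_apply, AddMonoidAlgebra.coeff_ofCoeff,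
          Finsupp.sum_mapRange_index (by simp)]
        simp only [map_smul, smul_eq_mul] at h1 ⊢
        simp only [_root_.mul_comm (l _)]
        rw [h1, zero_mul]
    exact (mul_eq_zero.1 this).resolve_right hg
  have := DFunLike.congr_fun (congrArg AddMonoidAlgebra.coeff ha) χ
  simpa [a] using this

end Generic

variable {K : Type*} [Field K] [Algebra k K]

/-- A field generated by the characters of a torus, on which the torus acts. -/
structure IsToricField (ch : Multiplicative (Fin n → ℤ) →* K)
    (ρ : (Multiplicative (Fin n → ℤ) →* k) → K →ₐ[k] K) : Prop where
  rho_ch : ∀ t χ, ρ t (ch χ) = t χ • ch χ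
  exists_fraction : ∀ θ, ∃ g h : AddMonoidAlgebra k (Fin n → ℤ),
    AddMonoidAlgebra.lift k K _ ch h ≠ 0 ∧
      θ * AddMonoidAlgebra.lift k K _ ch h = AddMonoidAlgebra.lift k K _ ch g

variable {ch : Multiplicative (Fin n → ℤ) →* K}
  {ρ : (Multiplicative (Fin n → ℤ) →* k) → K →ₐ[k] K}

lemma ch_ne_zero (χ : Multiplicative (Fin n → ℤ)) : ch χ ≠ 0 := by
  intro h
  have := map_mul ch χ χ⁻¹
  rw [mul_inv_cancel, h, zero_mul, map_one] at this
  exact one_ne_zero this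

namespace IsToricField

lemma rho_lift (hK : IsToricField ch ρ) (t : Multiplicative (Fin n → ℤ) →* k)
    (g : AddMonoidAlgebra k (Fin n → ℤ)) :
    ρ t (AddMonoidAlgebra.lift k K _ ch g) =
      g.coeff.sum fun χ c ↦ t (.ofAdd χ) • c • ch (.ofAdd χ) := by
  rw [AddMonoidAlgebra.lift_apply, map_finsuppSum]
  refine Finsupp.sum_congr fun χ _ ↦ ?_
  rw [map_smul, hK.rho_ch, smul_comm]

lemma lift_injective (hK : IsToricField ch ρ) :
    Function.Injective (AddMonoidAlgebra.lift k K _ ch) := by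
  rw [injective_iff_map_eq_zero]
  intro g hg
  have : g.coeff.mapRange (fun c ↦ c • (1 : K)) (by simp) = 0 := by
    have h0 : (Finsupp.onFinset g.coeff.support (fun χ ↦ g.coeff χ • ch (.ofAdd χ))
        (by intro χ h; simp only [Finsupp.mem_support_iff]; rintro h0; simp [h0] at h) :
          (Fin n → ℤ) →₀ K) = 0 := by
      refine Generic.eq_zero_of_sum (k := k) (.of_forall fun t ↦ ?_)
      have := hK.rho_lift t g
      rw [hg, map_zero] at this
      rw [Finsupp.onFinset_sum _ (by simp)]
      exact this.symm
    ext χ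
    have := DFunLike.congr_fun h0 χ
    simp only [Finsupp.onFinset_apply, Finsupp.coe_zero, Pi.zero_apply, smul_eq_zero,
      ch_ne_zero, or_false] at this
    simp [this]
  ext χ
  simpa using DFunLike.congr_fun this χ

/-- Semi-invariant elements are multiples of characters. -/
lemma eq_smul_ch (hK : IsToricField ch ρ) {θ : K} {χ : Multiplicative (Fin n → ℤ)}
    (h : Generic fun t ↦ ρ t θ = t χ • θ) : ∃ c : k, θ = c • ch χ := by
  classical
  obtain ⟨g, d, hd, e⟩ := hK.exists_fraction θ
  rcases eq_or_ne g 0 with rfl | hg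
  · rw [map_zero] at e
    exact ⟨0, by rw [zero_smul]; exact (mul_eq_zero.1 e).resolve_right hd⟩
  set gg := AddMonoidAlgebra.lift k K _ ch g with hgg
  set dd := AddMonoidAlgebra.lift k K _ ch d with hdd
  have hgg0 : gg ≠ 0 := by
    rw [hgg, Ne, ← map_zero (AddMonoidAlgebra.lift k K _ ch)]
    exact fun h ↦ hg (hK.lift_injective h)
  let v : (Fin n → ℤ) →₀ K := Finsupp.onFinset g.coeff.support
      (fun ψ ↦ (g.coeff ψ • ch (.ofAdd ψ)) * dd)
      (by intro ψ h; simp only [Finsupp.mem_support_iff]; rintro h0; simp [h0] at h)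
  let w : (Fin n → ℤ) →₀ K := Finsupp.onFinset d.coeff.support
      (fun ψ ↦ (d.coeff ψ • ch (.ofAdd ψ)) * gg)
      (by intro ψ h; simp only [Finsupp.mem_support_iff]; rintro h0; simp [h0] at h)
  -- Applying `ρ t` to `θ * dd = gg`, multiplying by `dd` and comparing weights gives `g_ψ ch(ψ) dd
  -- = d_(ψ-χ) ch(ψ-χ) gg`. Any `ψ` with `g_ψ ≠ 0` then shows that `θ = gg / dd` is a multiple of
  -- `ch χ`.
  have key : v - w.mapDomain (χ.toAdd + ·) = 0 := by
    refine Generic.eq_zero_of_sum (k := k) (h.mono fun t ht ↦ ?_)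
    have h1 := congrArg (ρ t) e
    rw [map_mul, ht, hgg, hdd, hK.rho_lift, hK.rho_lift] at h1
    rw [Finsupp.sum_sub_index (by intros; rw [smul_sub]), Finsupp.sum_mapDomain_index (by simp)
      (by intros; rw [smul_add]), Finsupp.onFinset_sum _ (by simp),
      Finsupp.onFinset_sum _ (by simp), sub_eq_zero]
    have h2 := congrArg (· * dd) h1
    rw [Finsupp.sum, Finsupp.sum, Finset.sum_mul] at h2
    simp only [smul_mul_assoc] at h2 ⊢
    rw [← h2]
    have : ∀ s : K, t χ • (θ * s * dd) = t χ • (s * gg) := by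
      intro s; rw [← e]; congr 1; ring
    rw [this, Finset.sum_mul, Finset.smul_sum]
    refine Finset.sum_congr rfl fun ψ _ ↦ ?_
    rw [smul_mul_assoc, smul_mul_assoc, smul_smul, ofAdd_add, map_mul, ofAdd_toAdd]
  obtain ⟨ψ, hψ⟩ : ∃ ψ, g.coeff ψ ≠ 0 := by
    by_contra! H
    exact hg (by ext ψ; simpa using H ψ)
  have h1 := DFunLike.congr_fun key ψ
  have hψ' : ψ = χ.toAdd + (ψ - χ.toAdd) := by abel
  rw [Finsupp.sub_apply, hψ', Finsupp.mapDomain_apply (add_right_injective _), ← hψ',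
    Finsupp.zero_apply, sub_eq_zero] at h1
  have h2 : (g.coeff ψ • ch (.ofAdd ψ)) * dd =
      (d.coeff (ψ - χ.toAdd) • ch (.ofAdd (ψ - χ.toAdd))) * gg := h1
  have h3 : ch (.ofAdd ψ) = ch (.ofAdd (ψ - χ.toAdd)) * ch χ := by
    rw [← map_mul, ofAdd_sub, ofAdd_toAdd, div_mul_cancel]
  have hd0 : d.coeff (ψ - χ.toAdd) ≠ 0 := by
    intro h0
    rw [h0, zero_smul, zero_mul] at h2
    exact mul_ne_zero (smul_ne_zero hψ (ch_ne_zero _)) hd h2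
  refine ⟨g.coeff ψ / d.coeff (ψ - χ.toAdd), ?_⟩
  have h4 : (d.coeff (ψ - χ.toAdd) • ch (.ofAdd (ψ - χ.toAdd)) * dd) * θ =
      (d.coeff (ψ - χ.toAdd) • ch (.ofAdd (ψ - χ.toAdd)) * dd) *
        ((g.coeff ψ / d.coeff (ψ - χ.toAdd)) • ch χ) := by
    calc _ = d.coeff (ψ - χ.toAdd) • ch (.ofAdd (ψ - χ.toAdd)) * (θ * dd) := by ring
      _ = g.coeff ψ • ch (.ofAdd ψ) * dd := by rw [e, ← h2]
      _ = _ := by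
        rw [h3, Algebra.smul_def, Algebra.smul_def, Algebra.smul_def, map_div₀]
        have : algebraMap k K (d.coeff (ψ - χ.toAdd)) ≠ 0 := by simpa using hd0
        field_simp
  exact mul_left_cancel₀ (mul_ne_zero (smul_ne_zero hd0 (ch_ne_zero _)) hd) h4

end IsToricField

end Generic

end ToricMonoid

namespace ToricMonoid

/-! ### The local ring at an idempotent: characters over the invariants of `π`. -/

section LocalAlgebra

/-- A form of Krull's intersection theorem. -/
lemma exists_mul_mem_of_forall_pow {R : Type*} [CommRing R] [IsNoetherianRing R]
    (p I : Ideal R) [p.IsPrime] {g : R} (h : ∀ N : ℕ, ∃ s ∉ p, s * g ∈ I ⊔ p ^ N) :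
    ∃ s ∉ p, s * g ∈ I := by
  let B := Localization.AtPrime p
  let J := I.map (algebraMap R B)
  -- In the localization at `p` the multipliers `s` become units, so Krull's theorem for the
  -- quotient by the extension of `I` applies.
  have hbot := Ideal.iInf_pow_smul_eq_bot_of_isLocalRing (M := B ⧸ J)
    (IsLocalRing.maximalIdeal B) (Ideal.IsPrime.ne_top inferInstance)
  have hmem : Ideal.Quotient.mk J (algebraMap R B g) ∈
      (⨅ N : ℕ, IsLocalRing.maximalIdeal B ^ N • ⊤ : Submodule B (B ⧸ J)) := by
    rw [Submodule.mem_iInf]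
    intro N
    obtain ⟨s, hs, hsg⟩ := h N
    obtain ⟨a, ha, b, hb, e⟩ := Submodule.mem_sup.1 hsg
    have hu : IsUnit (algebraMap R B s) := IsLocalization.map_units B (⟨s, hs⟩ : p.primeCompl)
    have hb' : algebraMap R B b ∈ IsLocalRing.maximalIdeal B ^ N := by
      rw [← Localization.AtPrime.map_eq_maximalIdeal, ← Ideal.map_pow]
      exact Ideal.mem_map_of_mem _ hb
    have ha' : Ideal.Quotient.mk J (algebraMap R B a) = 0 :=
      Ideal.Quotient.eq_zero_iff_mem.2 (Ideal.mem_map_of_mem _ ha)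
    obtain ⟨u, hu⟩ := hu
    have e' : Ideal.Quotient.mk J (algebraMap R B g) =
        (algebraMap R B b) • Ideal.Quotient.mk J (↑u⁻¹ : B) := by
      have e1 : algebraMap R B g = ↑u⁻¹ * (algebraMap R B a + algebraMap R B b) := by
        rw [← map_add, e, map_mul, ← hu, Units.inv_mul_cancel_left]
      rw [e1, map_mul, map_add, ha', zero_add, _root_.mul_comm, ← map_mul]
      rfl
    rw [e']
    exact Submodule.smul_mem_smul hb' trivial
  rw [hbot, Submodule.mem_bot, Ideal.Quotient.eq_zero_iff_mem,
    IsLocalization.algebraMap_mem_map_algebraMap_iff p.primeCompl] at hmem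
  exact hmem

variable {k : Type*} [Field k] [IsAlgClosed k] {n : ℕ} {K : Type*} [Field K] [Algebra k K]
  {R : Type*} [CommRing R] [IsDomain R] [Algebra k R] [Algebra R K] [IsScalarTower k R K]
  [IsFractionRing R K]

/-- The local ring of a toric monoid at an idempotent: its field of fractions is the function field
of the torus, `S` consists of the characters which are regular at the idempotent, and `π`
is induced by multiplication with the idempotent. -/
structure IsLocalToric (S : AddSubmonoid (Fin n → ℤ)) (ch : Multiplicative (Fin n → ℤ) →* K)
    (ρ : (Multiplicative (Fin n → ℤ) →* k) → K →ₐ[k] K) (σ : Multiplicative S →* R)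
    (π : R →ₐ[k] R) : Prop extends IsToricField ch ρ where
  sigma_eq : ∀ s : S, algebraMap R K (σ (.ofAdd s)) = ch (.ofAdd (s : Fin n → ℤ))
  mem_of : ∀ χ r, algebraMap R K r = ch (.ofAdd χ) → χ ∈ S
  pi_sigma : ∀ s : S, -(s : Fin n → ℤ) ∈ S → π (σ (.ofAdd s)) = σ (.ofAdd s)
  pi_sigma_eq_zero : ∀ s : S, -(s : Fin n → ℤ) ∉ S → π (σ (.ofAdd s)) = 0
  pi_pi : ∀ r, π (π r) = π r
  generic_mem : ∀ r, Generic fun t ↦ ∃ r', algebraMap R K r' = ρ t (algebraMap R K r) ∧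
    algebraMap R K (π r') = ρ t (algebraMap R K (π r))
  generic_unit : ∀ r, r ≠ 0 → π r = r →
    Generic fun t ↦ ∃ r', IsUnit r' ∧ algebraMap R K r' = ρ t (algebraMap R K r)

variable {S : AddSubmonoid (Fin n → ℤ)} {ch : Multiplicative (Fin n → ℤ) →* K}
  {ρ : (Multiplicative (Fin n → ℤ) →* k) → K →ₐ[k] K} {σ : Multiplicative S →* R} {π : R →ₐ[k] R}

lemma algebraMap_lift (h : IsLocalToric S ch ρ σ π) (a : AddMonoidAlgebra k S) :
    algebraMap R K (AddMonoidAlgebra.lift k R S σ a) =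
      a.coeff.sum fun s c ↦ c • ch (.ofAdd (s : Fin n → ℤ)) := by
  rw [AddMonoidAlgebra.lift_apply, map_finsuppSum]
  refine Finsupp.sum_congr fun s _ ↦ ?_
  rw [← h.sigma_eq, Algebra.smul_def, map_mul, ← IsScalarTower.algebraMap_apply,
    ← Algebra.smul_def]

namespace IsLocalToric

lemma injective : Function.Injective (algebraMap R K) := IsFractionRing.injective R K

/-- A generic translate of the fixed element `f` is a unit of `R`. So the translate of `g / f`,
which is still a scalar multiple of the character `χ`, lies in `R`. -/
lemma mem_of_fixed (h : IsLocalToric S ch ρ σ π) {f g : R} (hf : f ≠ 0) (hfπ : π f = f)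
    {c : k} (hc : c ≠ 0) {χ : Fin n → ℤ}
    (e : algebraMap R K g = c • ch (.ofAdd χ) * algebraMap R K f) : χ ∈ S := by
  obtain ⟨t, ⟨u, hu, hut⟩, r, hr, -⟩ := ((h.generic_unit f hf hfπ).and (h.generic_mem g)).exists_point
  obtain ⟨u, rfl⟩ := hu
  have ht : t (.ofAdd χ) ≠ 0 := by
    intro h0
    have := map_mul t (.ofAdd χ) (.ofAdd (-χ))
    rw [h0, zero_mul, ← ofAdd_add, add_neg_cancel, ofAdd_zero, map_one] at this
    exact one_ne_zero this
  refine h.mem_of χ ((c * t (.ofAdd χ))⁻¹ • (r * ↑u⁻¹)) ?_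
  have hu1 : algebraMap R K ↑u * algebraMap R K ↑u⁻¹ = 1 := by
    rw [← map_mul, Units.mul_inv, map_one]
  rw [Algebra.smul_def, map_mul, ← IsScalarTower.algebraMap_apply, ← Algebra.smul_def, map_mul, hr,
    e, map_mul, map_smul, h.rho_ch, ← hut, smul_smul, _root_.mul_assoc, hu1, _root_.mul_one,
    smul_smul, inv_mul_cancel₀ (mul_ne_zero hc ht), one_smul]

/-- Characters which are distinct modulo the units are independent over the elements fixed
by `π`. -/
lemma eq_zero_of_sum_ch (h : IsLocalToric S ch ρ σ π) (s : Finset (Fin n → ℤ))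
    (hs : ∀ χ ∈ s, ∀ χ' ∈ s, χ - χ' ∈ S → χ' - χ ∈ S → χ = χ') (f : (Fin n → ℤ) → R)
    (hf : ∀ χ ∈ s, π (f χ) = f χ)
    (e : ∑ χ ∈ s, algebraMap R K (f χ) * ch (.ofAdd χ) = 0) : ∀ χ ∈ s, f χ = 0 := by
  classical
  induction s using Finset.induction_on generalizing f with
  | empty => simp
  | insert a s ha ih =>
    have hs' : ∀ χ ∈ s, ∀ χ' ∈ s, χ - χ' ∈ S → χ' - χ ∈ S → χ = χ' := fun χ hχ χ' hχ' ↦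
      hs χ (Finset.mem_insert_of_mem hχ) χ' (Finset.mem_insert_of_mem hχ')
    have hfs : ∀ χ ∈ s, π (f χ) = f χ := fun χ hχ ↦ hf χ (Finset.mem_insert_of_mem hχ)
    have hfa : π (f a) = f a := hf a (Finset.mem_insert_self a s)
    rw [Finset.sum_insert ha] at e
    rcases eq_or_ne (f a) 0 with h0 | h0
    · rw [h0, map_zero, zero_mul, zero_add] at e
      intro χ hχ
      rcases Finset.mem_insert.1 hχ with rfl | hχ
      · exact h0
      · exact ih hs' f hfs e χ hχ
    -- As in Dedekind's lemma, the relation times `t(a) ρ_t(f a)` is subtracted from its translate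
    -- times `f a`. The term at `a` disappears, and the coefficients of the shorter relation are
    -- again fixed by `π`.
    have key : ∀ χ ∈ s, Generic fun t ↦ t (.ofAdd χ) • ρ t (algebraMap R K (f χ)) *
        algebraMap R K (f a) = t (.ofAdd a) • ρ t (algebraMap R K (f a)) *
        algebraMap R K (f χ) := by
      intro χ₀ hχ₀
      have hgen : Generic fun t ↦ ∀ χ ∈ insert a s, ∃ r', algebraMap R K r' =
          ρ t (algebraMap R K (f χ)) ∧ algebraMap R K (π r') = ρ t (algebraMap R K (π (f χ))) :=
        Generic.finset_forall _ fun χ _ ↦ h.generic_mem (f χ)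
      refine hgen.mono fun t ht ↦ ?_
      choose! g hg hgπ using ht
      have hgfix : ∀ χ ∈ insert a s, π (g χ) = g χ := fun χ hχ ↦ injective (K := K) <| by
        rw [hgπ χ hχ, hf χ hχ, hg χ hχ]
      have e2 := congrArg (ρ t) e
      rw [map_add, map_zero, map_sum] at e2
      simp only [map_mul, h.rho_ch] at e2
      have := ih hs' (fun χ ↦ t (.ofAdd χ) • (g χ * f a) - t (.ofAdd a) • (g a * f χ))
        (fun χ hχ ↦ by
          rw [map_sub, map_smul, map_smul, map_mul, map_mul,
            hgfix χ (Finset.mem_insert_of_mem hχ), hfa, hgfix a (Finset.mem_insert_self a s),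
            hfs χ hχ])
        (by
          have hterm : ∀ χ ∈ s, algebraMap R K (t (.ofAdd χ) • (g χ * f a) -
              t (.ofAdd a) • (g a * f χ)) * ch (.ofAdd χ) =
              algebraMap R K (f a) * (ρ t (algebraMap R K (f χ)) * t (.ofAdd χ) • ch (.ofAdd χ)) -
              t (.ofAdd a) • ρ t (algebraMap R K (f a)) *
                (algebraMap R K (f χ) * ch (.ofAdd χ)) := by
            intro χ hχ
            rw [map_sub, Algebra.smul_def, Algebra.smul_def, Algebra.smul_def, Algebra.smul_def,
              map_mul, map_mul, map_mul, map_mul, ← IsScalarTower.algebraMap_apply,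
              ← IsScalarTower.algebraMap_apply, hg χ (Finset.mem_insert_of_mem hχ),
              hg a (Finset.mem_insert_self a s)]
            ring
          rw [Finset.sum_congr rfl hterm, Finset.sum_sub_distrib, ← Finset.mul_sum,
            ← Finset.mul_sum, eq_neg_of_add_eq_zero_right e, eq_neg_of_add_eq_zero_right e2]
          simp only [Algebra.smul_def]
          ring) χ₀ hχ₀
      have h3 := congrArg (algebraMap R K) (sub_eq_zero.1 this)
      simp only [Algebra.smul_def, map_mul] at h3 ⊢
      rw [← IsScalarTower.algebraMap_apply, ← IsScalarTower.algebraMap_apply,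
        hg χ₀ (Finset.mem_insert_of_mem hχ₀), hg a (Finset.mem_insert_self a s)] at h3
      linear_combination h3
    have hzero : ∀ χ ∈ s, f χ = 0 := by
      intro χ hχ
      by_contra hne
      have hne' : algebraMap R K (f χ) ≠ 0 := by
        rw [Ne, ← map_zero (algebraMap R K)]; exact fun H ↦ hne (injective H)
      have h0' : algebraMap R K (f a) ≠ 0 := by
        rw [Ne, ← map_zero (algebraMap R K)]; exact fun H ↦ h0 (injective H)
      -- By `key` the quotient `f χ / f a` has weight `a - χ`, so it is a multiple of that
      -- character. Applying `mem_of_fixed` in both directions puts `a - χ` and `χ - a` in `S`,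
      -- against the distinctness of `a` and `χ` modulo units.
      obtain ⟨c, hc⟩ := h.eq_smul_ch (θ := algebraMap R K (f χ) / algebraMap R K (f a))
        (χ := .ofAdd (a - χ)) ((key χ hχ).mono fun t ht ↦ by
          have hta : ρ t (algebraMap R K (f a)) ≠ 0 := (map_ne_zero _).2 h0'
          have ht1 : t (.ofAdd a) = t (.ofAdd (a - χ)) * t (.ofAdd χ) := by
            rw [← map_mul, ← ofAdd_add, sub_add_cancel]
          have htχ : t (.ofAdd χ) ≠ 0 := by
            intro h0
            have := map_mul t (.ofAdd χ) (.ofAdd (-χ))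
            rw [h0, zero_mul, ← ofAdd_add, add_neg_cancel, ofAdd_zero, map_one] at this
            exact one_ne_zero this
          have htχ' : algebraMap k K (t (.ofAdd χ)) ≠ 0 := by simpa using htχ
          rw [map_div₀, Algebra.smul_def, ← mul_div_assoc, div_eq_div_iff hta h0']
          simp only [Algebra.smul_def] at ht
          rw [ht1, map_mul] at ht
          refine mul_left_cancel₀ htχ' ?_
          linear_combination ht)
      have hc0 : c ≠ 0 := by
        rintro rfl
        rw [zero_smul] at hc
        exact div_ne_zero hne' h0' hc
      have hc' : algebraMap k K c ≠ 0 := by simpa using hc0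
      rw [div_eq_iff h0'] at hc
      have m1 := h.mem_of_fixed h0 hfa hc0 hc
      have m2 : χ - a ∈ S := h.mem_of_fixed (g := f a) hne (hfs χ hχ) (inv_ne_zero hc0) (by
        rw [hc, ← _root_.mul_assoc, smul_mul_smul_comm, inv_mul_cancel₀ hc0, ← map_mul, ← ofAdd_add,
          show χ - a + (a - χ) = 0 by abel, ofAdd_zero, map_one, one_smul, _root_.one_mul])
      exact ha (hs a (Finset.mem_insert_self a s) χ (Finset.mem_insert_of_mem hχ) m1 m2 ▸ hχ)
    intro χ hχ
    rcases Finset.mem_insert.1 hχ with rfl | hχ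
    · rw [Finset.sum_eq_zero (fun χ hχ ↦ by rw [hzero χ hχ, map_zero, zero_mul]), add_zero] at e
      exact absurd ((mul_eq_zero.1 e).resolve_right (ch_ne_zero _))
        (by rw [← map_zero (algebraMap R K)]; exact fun H ↦ h0 (injective H))
    · exact hzero χ hχ

end IsLocalToric

end LocalAlgebra

end ToricMonoid

namespace ToricMonoid

/-! ### Invariants of `π` as fractions, and ideals stable under translation. -/

section LocalAlgebra

variable {k : Type*} [Field k] [IsAlgClosed k] {n : ℕ} {K : Type*} [Field K] [Algebra k K]
  {R : Type*} [CommRing R] [IsDomain R] [Algebra k R] [Algebra R K] [IsScalarTower k R K]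
  [IsFractionRing R K]

variable {S : AddSubmonoid (Fin n → ℤ)} {ch : Multiplicative (Fin n → ℤ) →* K}
  {ρ : (Multiplicative (Fin n → ℤ) →* k) → K →ₐ[k] K} {σ : Multiplicative S →* R} {π : R →ₐ[k] R}

/-- The projection of the monoid algebra onto the span of the units. -/
noncomputable def unitPart (S : AddSubmonoid (Fin n → ℤ)) (a : AddMonoidAlgebra k S) :
    AddMonoidAlgebra k S := by
  classical
  exact .ofCoeff (a.coeff.filter fun s ↦ -(s : Fin n → ℤ) ∈ S)

namespace IsLocalToric

lemma pi_lift (h : IsLocalToric S ch ρ σ π) (a : AddMonoidAlgebra k S) :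
    π (AddMonoidAlgebra.lift k R S σ a) = AddMonoidAlgebra.lift k R S σ (unitPart S a) := by
  classical
  rw [AddMonoidAlgebra.lift_apply, AddMonoidAlgebra.lift_apply, map_finsuppSum, unitPart,
    AddMonoidAlgebra.coeff_ofCoeff, Finsupp.sum_filter_index, Finsupp.sum, Finsupp.support_filter, Finset.sum_filter]
  refine Finset.sum_congr rfl fun s _ ↦ ?_
  rw [map_smul]
  split_ifs with hs
  · rw [h.pi_sigma s hs]
  · rw [h.pi_sigma_eq_zero s hs, smul_zero]

lemma exists_unit_of_fixed (h : IsLocalToric S ch ρ σ π) {a : AddMonoidAlgebra k S}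
    (ha : π (AddMonoidAlgebra.lift k R S σ a) ≠ 0) :
    ∃ s : S, a.coeff s ≠ 0 ∧ -(s : Fin n → ℤ) ∈ S := by
  classical
  by_contra! H
  apply ha
  rw [h.pi_lift]
  convert map_zero (AddMonoidAlgebra.lift k R S σ)
  ext s
  by_cases hs : -(s : Fin n → ℤ) ∈ S
  · by_cases h0 : a.coeff s = 0
    · simp [unitPart, Finsupp.filter_apply, h0]
    · exact absurd hs (H s h0)
  · simp [unitPart, hs]

/-- Elements fixed by `π` are fractions of combinations of units. -/
lemma exists_fixed_fraction (h : IsLocalToric S ch ρ σ π) {f : R} (hf : π f = f) :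
    ∃ s a : AddMonoidAlgebra k S, AddMonoidAlgebra.lift k R S σ s ≠ 0 ∧
      π (AddMonoidAlgebra.lift k R S σ s) = AddMonoidAlgebra.lift k R S σ s ∧
      AddMonoidAlgebra.lift k R S σ s * f = AddMonoidAlgebra.lift k R S σ a := by
  classical
  obtain ⟨g, d, hd, e⟩ := h.exists_fraction (algebraMap R K f)
  -- Numerator and denominator are split along cosets of the units `Λ`: each part is a coset
  -- representative times a combination of units, which `π` fixes. Independence of the
  -- representatives over the invariants yields one equation `d_c * f = g_c` for each coset.
  let Λ : AddSubgroup (Fin n → ℤ) :=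
    { carrier := {χ | χ ∈ S ∧ -χ ∈ S}
      zero_mem' := by simp
      add_mem' := fun {a b} ha hb ↦ ⟨add_mem ha.1 hb.1, by rw [neg_add]; exact add_mem ha.2 hb.2⟩
      neg_mem' := fun {a} ha ↦ ⟨ha.2, by simpa using ha.1⟩ }
  let rep : (Fin n → ℤ) → (Fin n → ℤ) := fun χ ↦ (QuotientAddGroup.mk χ : (Fin n → ℤ) ⧸ Λ).out
  have hrep : ∀ χ, χ - rep χ ∈ Λ := fun χ ↦ by
    have : (QuotientAddGroup.mk (rep χ) : (Fin n → ℤ) ⧸ Λ) = QuotientAddGroup.mk χ :=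
      Quotient.out_eq' _
    rw [QuotientAddGroup.eq] at this
    rwa [neg_add_eq_sub] at this
  have hrepeq : ∀ χ χ', χ - χ' ∈ Λ → rep χ = rep χ' := fun χ χ' hχ ↦ by
    have : (QuotientAddGroup.mk χ' : (Fin n → ℤ) ⧸ Λ) = QuotientAddGroup.mk χ := by
      rw [QuotientAddGroup.eq, neg_add_eq_sub]; exact hχ
    simp only [rep, this]
  let C : Finset (Fin n → ℤ) := (d.coeff.support ∪ g.coeff.support).image rep
  let q : (Fin n → ℤ) → S := fun χ ↦ ⟨χ - rep χ, (hrep χ).1⟩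
  have hq : ∀ χ, π (σ (.ofAdd (q χ))) = σ (.ofAdd (q χ)) := fun χ ↦ h.pi_sigma _ (hrep χ).2
  let part : AddMonoidAlgebra k (Fin n → ℤ) → (Fin n → ℤ) → AddMonoidAlgebra k S := fun b c ↦
    ∑ χ ∈ (d.coeff.support ∪ g.coeff.support) with rep χ = c, .single (q χ) (b.coeff χ)
  have hlp : ∀ b c, AddMonoidAlgebra.lift k R S σ (part b c) =
      ∑ χ ∈ (d.coeff.support ∪ g.coeff.support) with rep χ = c,
        b.coeff χ • σ (.ofAdd (q χ)) := by
    intro b c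
    simp only [part, map_sum, AddMonoidAlgebra.lift_single]
  have hpart : ∀ b c, π (AddMonoidAlgebra.lift k R S σ (part b c)) =
      AddMonoidAlgebra.lift k R S σ (part b c) := by
    intro b c
    rw [hlp, map_sum]
    exact Finset.sum_congr rfl fun χ _ ↦ by rw [map_smul, hq]
  have hsum : ∀ b : AddMonoidAlgebra k (Fin n → ℤ),
      b.coeff.support ⊆ d.coeff.support ∪ g.coeff.support →
      AddMonoidAlgebra.lift k K _ ch b =
        ∑ c ∈ C, algebraMap R K (AddMonoidAlgebra.lift k R S σ (part b c)) * ch (.ofAdd c) := by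
    intro b hb
    rw [AddMonoidAlgebra.lift_apply, Finsupp.sum_of_support_subset _ hb _ (by simp),
      ← Finset.sum_fiberwise_of_maps_to (g := rep) (t := C)
        (fun χ hχ ↦ Finset.mem_image_of_mem _ hχ)]
    refine Finset.sum_congr rfl fun c _ ↦ ?_
    rw [hlp, map_sum, Finset.sum_mul]
    refine Finset.sum_congr rfl fun χ hχ ↦ ?_
    rw [Algebra.smul_def (b.coeff χ) (σ _), map_mul, ← IsScalarTower.algebraMap_apply, h.sigma_eq,
      _root_.mul_assoc, ← map_mul, ← ofAdd_add, ← (Finset.mem_filter.1 hχ).2, sub_add_cancel,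
      Algebra.smul_def]
  have hzero := h.eq_zero_of_sum_ch C (by
      intro χ hχ χ' hχ' h1 h2
      obtain ⟨a, -, rfl⟩ := Finset.mem_image.1 hχ
      obtain ⟨b, -, rfl⟩ := Finset.mem_image.1 hχ'
      refine hrepeq a b ?_
      have h3 : rep a - rep b ∈ Λ := ⟨h1, by rwa [neg_sub]⟩
      have : a - b = (a - rep a) + (rep a - rep b) - (b - rep b) := by abel
      rw [this]
      exact sub_mem (add_mem (hrep a) h3) (hrep b))
    (fun c ↦ AddMonoidAlgebra.lift k R S σ (part d c) * f - AddMonoidAlgebra.lift k R S σ (part g c))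
    (fun c _ ↦ by rw [map_sub, map_mul, hpart, hpart, hf])
    (by
      simp only [map_sub, map_mul, sub_mul]
      rw [Finset.sum_sub_distrib, ← hsum g Finset.subset_union_right, ← e,
        hsum d Finset.subset_union_left, Finset.mul_sum, sub_eq_zero]
      exact Finset.sum_congr rfl fun c _ ↦ by ring)
  obtain ⟨c, hc, hc0⟩ : ∃ c ∈ C, AddMonoidAlgebra.lift k R S σ (part d c) ≠ 0 := by
    by_contra! H
    refine hd ?_
    rw [hsum d Finset.subset_union_left]
    exact Finset.sum_eq_zero fun c hc ↦ by rw [H c hc, map_zero, zero_mul]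
  exact ⟨part d c, part g c, hc0, hpart d c, sub_eq_zero.1 (hzero c hc)⟩

section

/-- Ideals stable under generic translations. -/
def _root_.ToricMonoid.IsStableIdeal (ρ : (Multiplicative (Fin n → ℤ) →* k) → K →ₐ[k] K)
    (J : Ideal R) : Prop :=
  ∀ x ∈ J, Generic fun t ↦ ∃ x' ∈ J, algebraMap R K x' = ρ t (algebraMap R K x)

lemma isStableIdeal_mul {I J : Ideal R} (hI : IsStableIdeal (K := K) ρ I)
    (hJ : IsStableIdeal (K := K) ρ J) : IsStableIdeal (K := K) ρ (I * J) := by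
  intro x hx
  induction hx using Submodule.mul_induction_on' with
  | mem_mul_mem a ha b hb =>
    refine ((hI a ha).and (hJ b hb)).mono ?_
    rintro t ⟨⟨a', ha', ea⟩, b', hb', eb⟩
    exact ⟨a' * b', Ideal.mul_mem_mul ha' hb', by rw [map_mul, map_mul, map_mul, ea, eb]⟩
  | add a _ b _ ha hb =>
    refine (ha.and hb).mono ?_
    rintro t ⟨⟨a', ha', ea⟩, b', hb', eb⟩
    exact ⟨a' + b', add_mem ha' hb', by rw [map_add, map_add, map_add, ea, eb]⟩

lemma isStableIdeal_ker_pow (h : IsLocalToric S ch ρ σ π) (N : ℕ) :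
    IsStableIdeal (K := K) ρ (RingHom.ker π ^ N) := by
  induction N with
  | zero =>
    intro x _
    refine (h.generic_mem x).mono ?_
    rintro t ⟨r, hr, -⟩
    exact ⟨r, by simp, hr⟩
  | succ N ih =>
    rw [pow_succ]
    refine isStableIdeal_mul ih fun x hx ↦ (h.generic_mem x).mono ?_
    rintro t ⟨r, hr, hr'⟩
    refine ⟨r, ?_, hr⟩
    rw [RingHom.mem_ker] at hx ⊢
    rw [hx, map_zero, map_zero, ← map_zero (algebraMap R K)] at hr'
    exact injective hr'

lemma rho_algebraMap_lift (h : IsLocalToric S ch ρ σ π) (t : Multiplicative (Fin n → ℤ) →* k)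
    (a : AddMonoidAlgebra k S) : ρ t (algebraMap R K (AddMonoidAlgebra.lift k R S σ a)) =
      algebraMap R K (a.coeff.sum fun s c ↦
        t (.ofAdd (s : Fin n → ℤ)) • c • σ (.ofAdd s)) := by
  rw [algebraMap_lift h, map_finsuppSum, map_finsuppSum]
  refine Finsupp.sum_congr fun s _ ↦ ?_
  rw [map_smul, h.rho_ch, Algebra.smul_def, Algebra.smul_def, Algebra.smul_def, Algebra.smul_def,
    map_mul, map_mul, ← IsScalarTower.algebraMap_apply, ← IsScalarTower.algebraMap_apply,
    h.sigma_eq, mul_left_comm]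

/-- Stable ideals contain the components of their elements. -/
lemma component_mem (h : IsLocalToric S ch ρ σ π) {J : Ideal R}
    (hJ : IsStableIdeal (K := K) ρ J) {a : AddMonoidAlgebra k S}
    (ha : AddMonoidAlgebra.lift k R S σ a ∈ J) (s : S) (hs : a.coeff s ≠ 0) :
    σ (.ofAdd s) ∈ J := by
  classical
  let v : S →₀ (R ⧸ J) := Finsupp.onFinset a.coeff.support
    (fun s ↦ a.coeff s • Ideal.Quotient.mk J (σ (.ofAdd s)))
    (by intro ψ h; simp only [Finsupp.mem_support_iff]; rintro h0; simp [h0] at h)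
  -- Generic translates of the element vanish modulo `J`, hence so does each of its weight
  -- components.
  have key : v.mapDomain (Subtype.val : S → (Fin n → ℤ)) = 0 := by
    refine Generic.eq_zero_of_sum (k := k) ((hJ _ ha).mono ?_)
    rintro t ⟨x, hx, e⟩
    rw [h.rho_algebraMap_lift] at e
    have e' := injective e
    rw [Finsupp.sum_mapDomain_index (by simp) (by intros; rw [smul_add]),
      Finsupp.onFinset_sum _ (by simp)]
    rw [← Ideal.Quotient.eq_zero_iff_mem, e', Finsupp.sum, map_sum] at hx
    rw [← hx]
    refine Finset.sum_congr rfl fun s _ ↦ ?_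
    rw [← Ideal.Quotient.mkₐ_eq_mk k, map_smul, map_smul]
  have h1 := DFunLike.congr_fun key s.1
  rw [Finsupp.mapDomain_apply Subtype.val_injective] at h1
  have h2 : a.coeff s • Ideal.Quotient.mk J (σ (.ofAdd s)) = 0 := h1
  exact Ideal.Quotient.eq_zero_iff_mem.1 ((smul_eq_zero.1 h2).resolve_left hs)

end

end IsLocalToric

end LocalAlgebra

end ToricMonoid

namespace ToricMonoid

/-! ### Consequences of Krull's theorem: finiteness, generation of the lattice, fractions. -/

section LocalAlgebra

variable {k : Type*} [Field k] [IsAlgClosed k] {n : ℕ} {K : Type*} [Field K] [Algebra k K]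
  {R : Type*} [CommRing R] [IsDomain R] [Algebra k R] [Algebra R K] [IsScalarTower k R K]
  [IsFractionRing R K]

variable {S : AddSubmonoid (Fin n → ℤ)} {ch : Multiplicative (Fin n → ℤ) →* K}
  {ρ : (Multiplicative (Fin n → ℤ) →* k) → K →ₐ[k] K} {σ : Multiplicative S →* R} {π : R →ₐ[k] R}

namespace IsLocalToric

lemma isPrime_ker (π : R →ₐ[k] R) : (RingHom.ker π).IsPrime := RingHom.ker_isPrime _

lemma sub_pi_mem (h : IsLocalToric S ch ρ σ π) (r : R) : r - π r ∈ RingHom.ker π := by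
  rw [RingHom.mem_ker, map_sub, h.pi_pi, sub_self]

lemma sigma_mem_ker (h : IsLocalToric S ch ρ σ π) {s : S} (hs : -(s : Fin n → ℤ) ∉ S) :
    σ (.ofAdd s) ∈ RingHom.ker π := h.pi_sigma_eq_zero s hs

lemma isUnit_sigma {s : S} (hs : -(s : Fin n → ℤ) ∈ S) : IsUnit (σ (.ofAdd s)) := by
  refine IsUnit.of_mul_eq_one (σ (.ofAdd ⟨_, hs⟩)) ?_
  rw [← map_mul, ← ofAdd_add, show s + ⟨_, hs⟩ = 0 from Subtype.ext (add_neg_cancel _), ofAdd_zero,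
    map_one]

variable [IsNoetherianRing R]

section

variable [IsLocalRing R]

/-- Modulo `𝔪 ^ N` the element `r` is `lift a`. The nonunit part of `a` lies in the span, and its
unit part is `π (lift a)`, which is congruent to `π r = 0` because `π` preserves `𝔪`. Krull's
theorem removes the error term. -/
lemma ker_eq_span (h : IsLocalToric S ch ρ σ π)
    (hα : ∀ (N : ℕ) (r : R), ∃ a, r - AddMonoidAlgebra.lift k R S σ a ∈
      IsLocalRing.maximalIdeal R ^ N) :
    RingHom.ker π = Ideal.span ((fun s ↦ σ (.ofAdd s)) '' {s : S | -(s : Fin n → ℤ) ∉ S}) := by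
  have := isPrime_ker π
  apply le_antisymm
  · intro r hr
    obtain ⟨u, hu, hur⟩ := exists_mul_mem_of_forall_pow (IsLocalRing.maximalIdeal R)
      (Ideal.span ((fun s ↦ σ (.ofAdd s)) '' {s : S | -(s : Fin n → ℤ) ∉ S})) (g := r) (by
      intro N
      obtain ⟨a, ha⟩ := hα N r
      refine ⟨1, by simp, ?_⟩
      rw [_root_.one_mul]
      have hle : (IsLocalRing.maximalIdeal R).map π ≤ IsLocalRing.maximalIdeal R := by
        rw [Ideal.map_le_iff_le_comap]
        intro x hx
        have h1 : x - π x ∈ IsLocalRing.maximalIdeal R :=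
          IsLocalRing.le_maximalIdeal this.ne_top (h.sub_pi_mem x)
        have h2 := sub_mem hx h1
        rwa [sub_sub_cancel] at h2
      have hπ : π (AddMonoidAlgebra.lift k R S σ a) ∈ IsLocalRing.maximalIdeal R ^ N := by
        have h1 := Ideal.mem_map_of_mem π ha
        rw [Ideal.map_pow] at h1
        have h2 := Ideal.pow_right_mono hle N h1
        rw [map_sub, (RingHom.mem_ker).1 hr, zero_sub] at h2
        simpa using h2
      have hspan : AddMonoidAlgebra.lift k R S σ a - π (AddMonoidAlgebra.lift k R S σ a) ∈
          Ideal.span ((fun s ↦ σ (.ofAdd s)) '' {s : S | -(s : Fin n → ℤ) ∉ S}) := by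
        rw [AddMonoidAlgebra.lift_apply, map_finsuppSum, Finsupp.sum, Finsupp.sum,
          ← Finset.sum_sub_distrib]
        refine sum_mem fun s _ ↦ ?_
        rw [map_smul, ← smul_sub]
        by_cases hs : -(s : Fin n → ℤ) ∈ S
        · rw [h.pi_sigma s hs, sub_self, smul_zero]; exact zero_mem _
        · rw [h.pi_sigma_eq_zero s hs, sub_zero, Algebra.smul_def]
          exact Ideal.mul_mem_left _ _ (Ideal.subset_span ⟨s, hs, rfl⟩)
      have : r = (AddMonoidAlgebra.lift k R S σ a - π (AddMonoidAlgebra.lift k R S σ a)) +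
          ((r - AddMonoidAlgebra.lift k R S σ a) + π (AddMonoidAlgebra.lift k R S σ a)) := by ring
      rw [this]
      exact Submodule.add_mem_sup hspan (add_mem ha hπ))
    have hu' : IsUnit u := by simpa using hu
    exact (Ideal.unit_mul_mem_iff_mem _ hu').1 hur
  · rw [Ideal.span_le]
    rintro _ ⟨s, hs, rfl⟩
    exact h.sigma_mem_ker hs

end

/-- Approximation of the elements of the local ring by regular functions. -/
lemma exists_approx (h : IsLocalToric S ch ρ σ π) (hker : RingHom.ker π =
    Ideal.span ((fun s ↦ σ (.ofAdd s)) '' {s : S | -(s : Fin n → ℤ) ∉ S})) (N : ℕ) (f : R) :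
    ∃ s a : AddMonoidAlgebra k S, AddMonoidAlgebra.lift k R S σ s ≠ 0 ∧
      π (AddMonoidAlgebra.lift k R S σ s) = AddMonoidAlgebra.lift k R S σ s ∧
      AddMonoidAlgebra.lift k R S σ s * f - AddMonoidAlgebra.lift k R S σ a ∈
        RingHom.ker π ^ N := by
  induction N generalizing f with
  | zero => exact ⟨1, 0, by simp, by simp, by simp⟩
  | succ N ih =>
    obtain ⟨s₀, a₀, hs₀, hs₀π, e₀⟩ := h.exists_fixed_fraction (h.pi_pi f)
    -- In `f = π f + (f - π f)` the fixed part is an exact fraction. The other part is a combination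
    -- of nonunit characters, and each of these supplies the extra factor in `ker π` that raises the
    -- precision from `N` to `N + 1`.
    have key : ∀ x ∈ RingHom.ker π, ∀ r : R, ∃ s a : AddMonoidAlgebra k S,
        AddMonoidAlgebra.lift k R S σ s ≠ 0 ∧
        π (AddMonoidAlgebra.lift k R S σ s) = AddMonoidAlgebra.lift k R S σ s ∧
        AddMonoidAlgebra.lift k R S σ s * (r * x) - AddMonoidAlgebra.lift k R S σ a ∈
          RingHom.ker π ^ (N + 1) := by
      intro x hx
      have hx' := hx
      rw [hker] at hx'
      clear hx
      induction hx' using Submodule.span_induction with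
      | mem x hx =>
        obtain ⟨c, hc, rfl⟩ := hx
        intro r
        obtain ⟨s, a, hs, hsπ, e⟩ := ih r
        refine ⟨s, a * .single c 1, hs, hsπ, ?_⟩
        have := Ideal.mul_mem_mul e (h.sigma_mem_ker hc)
        rw [← pow_succ] at this
        convert this using 1
        rw [map_mul, AddMonoidAlgebra.lift_single, one_smul]
        ring
      | zero => exact fun r ↦ ⟨1, 0, by simp, by simp, by simp⟩
      | add x y _ _ hx hy =>
        intro r
        obtain ⟨s, a, hs, hsπ, e⟩ := hx r
        obtain ⟨s', a', hs', hsπ', e'⟩ := hy r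
        refine ⟨s * s', s' * a + s * a', ?_, ?_, ?_⟩
        · rw [map_mul]; exact mul_ne_zero hs hs'
        · rw [map_mul, map_mul, hsπ, hsπ']
        · have := add_mem (Ideal.mul_mem_left _ (AddMonoidAlgebra.lift k R S σ s') e)
            (Ideal.mul_mem_left _ (AddMonoidAlgebra.lift k R S σ s) e')
          convert this using 1
          simp only [map_mul, map_add]
          ring
      | smul c x _ hx =>
        intro r
        obtain ⟨s, a, hs, hsπ, e⟩ := hx (r * c)
        exact ⟨s, a, hs, hsπ, by rwa [smul_eq_mul, ← _root_.mul_assoc r]⟩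
    obtain ⟨s₁, a₁, hs₁, hs₁π, e₁⟩ := key _ (h.sub_pi_mem f) 1
    refine ⟨s₀ * s₁, s₁ * a₀ + s₀ * a₁, ?_, ?_, ?_⟩
    · rw [map_mul]; exact mul_ne_zero hs₀ hs₁
    · rw [map_mul, map_mul, hs₀π, hs₁π]
    · have := Ideal.mul_mem_left _ (AddMonoidAlgebra.lift k R S σ s₀) e₁
      convert this using 1
      simp only [map_mul, map_add, ← e₀]
      ring

/-- The characters which are regular at the idempotent generate the character group. -/
lemma closure_eq_top (h : IsLocalToric S ch ρ σ π) (hker : RingHom.ker π =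
    Ideal.span ((fun s ↦ σ (.ofAdd s)) '' {s : S | -(s : Fin n → ℤ) ∉ S})) :
    AddSubgroup.closure (S : Set (Fin n → ℤ)) = ⊤ := by
  classical
  have hp := isPrime_ker π
  rw [eq_top_iff]
  intro ψ _
  by_contra hψ
  obtain ⟨x, d, hd, e⟩ := IsFractionRing.div_surjective R (ch (.ofAdd ψ))
  have hd0 : d ≠ 0 := nonZeroDivisors.ne_zero hd
  have hd0' : algebraMap R K d ≠ 0 := by
    rw [Ne, ← map_zero (algebraMap R K)]; exact fun H ↦ hd0 (injective H)
  rw [div_eq_iff hd0'] at e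
  have hx0 : x ≠ 0 := by
    rintro rfl
    rw [map_zero] at e
    exact mul_ne_zero (ch_ne_zero _) hd0' e.symm
  -- Here the character `ψ` equals `x / d`. After approximation of `d` and `x`, translating the
  -- relation `X = ψ * D` gives weights in `S` on one side and in `ψ + S` on the other. These sets
  -- are disjoint because `ψ` is not in the group generated by `S`, so each component vanishes
  -- modulo `ker π ^ N`. Hence `d * x` would be zero by Krull's theorem.
  obtain ⟨u, hu, hux⟩ := exists_mul_mem_of_forall_pow (RingHom.ker π) ⊥ (g := d * x) (by
    intro N
    obtain ⟨s₁, a₁, hs₁, hs₁π, e₁⟩ := h.exists_approx hker N d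
    obtain ⟨s₂, a₂, hs₂, hs₂π, e₂⟩ := h.exists_approx hker N x
    set u := AddMonoidAlgebra.lift k R S σ s₁ * AddMonoidAlgebra.lift k R S σ s₂ with hu
    set α := s₂ * a₁ with hα
    set β := s₁ * a₂ with hβ
    have hu0 : u ≠ 0 := mul_ne_zero hs₁ hs₂
    have huπ : π u = u := by rw [hu, map_mul, hs₁π, hs₂π]
    have hαm : u * d - AddMonoidAlgebra.lift k R S σ α ∈ RingHom.ker π ^ N := by
      convert Ideal.mul_mem_left _ (AddMonoidAlgebra.lift k R S σ s₂) e₁ using 1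
      rw [hα, hu, map_mul]; ring
    have hβm : u * x - AddMonoidAlgebra.lift k R S σ β ∈ RingHom.ker π ^ N := by
      convert Ideal.mul_mem_left _ (AddMonoidAlgebra.lift k R S σ s₁) e₂ using 1
      rw [hβ, hu, map_mul]; ring
    have hDX : algebraMap R K (u * x) = ch (.ofAdd ψ) * algebraMap R K (u * d) := by
      rw [map_mul _ u x, map_mul _ u d, e]; ring
    generalize hD : u * d = D at hαm hDX
    generalize hX : u * x = X at hβm hDX
    let q := Ideal.Quotient.mk (RingHom.ker π ^ N)
    let v : S →₀ (R ⧸ RingHom.ker π ^ N) := Finsupp.onFinset β.coeff.support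
      (fun s ↦ β.coeff s • q (σ (.ofAdd s) * D))
      (by intro ψ h; simp only [Finsupp.mem_support_iff]; rintro h0; simp [h0] at h)
    let w : S →₀ (R ⧸ RingHom.ker π ^ N) := Finsupp.onFinset α.coeff.support
      (fun s ↦ α.coeff s • q (σ (.ofAdd s) * X))
      (by intro ψ h; simp only [Finsupp.mem_support_iff]; rintro h0; simp [h0] at h)
    have key : v.mapDomain (Subtype.val : S → (Fin n → ℤ)) -
        w.mapDomain (fun s : S ↦ ψ + (s : Fin n → ℤ)) = 0 := by
      refine Generic.eq_zero_of_sum (k := k)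
        (((h.isStableIdeal_ker_pow N _ hαm).and (h.isStableIdeal_ker_pow N _ hβm)).mono ?_)
      rintro t ⟨⟨p₁, hp₁, hp₁e⟩, p₂, hp₂, hp₂e⟩
      rw [map_sub, map_sub, h.rho_algebraMap_lift, eq_sub_iff_add_eq, ← map_add] at hp₁e hp₂e
      set α' : R := α.coeff.sum fun s c ↦ t (.ofAdd (s : Fin n → ℤ)) • c • σ (.ofAdd s) with hα'
      set β' : R := β.coeff.sum fun s c ↦ t (.ofAdd (s : Fin n → ℤ)) • c • σ (.ofAdd s) with hβ'
      have h1 : (p₂ + β') * D = t (.ofAdd ψ) • ((p₁ + α') * X) := by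
        apply injective (K := K)
        rw [Algebra.smul_def, map_mul, map_mul, map_mul, hp₁e, hp₂e,
          ← IsScalarTower.algebraMap_apply, hDX, map_mul, h.rho_ch, Algebra.smul_def]
        ring
      have h2 := congrArg q h1
      have hq : ∀ p ∈ RingHom.ker π ^ N, q p = 0 := fun p hp ↦ Ideal.Quotient.eq_zero_iff_mem.2 hp
      have hqs : ∀ (c : k) (r : R), q (c • r) = c • q r := fun c r ↦ rfl
      rw [hqs, map_mul, map_mul q, map_add, map_add, hq _ hp₁, hq _ hp₂, zero_add, zero_add,
        ← map_mul, ← map_mul] at h2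
      rw [Finsupp.sum_sub_index (by intros; rw [smul_sub]), Finsupp.sum_mapDomain_index (by simp)
        (by intros; rw [smul_add]), Finsupp.sum_mapDomain_index (by simp)
        (by intros; rw [smul_add]), Finsupp.onFinset_sum _ (by simp),
        Finsupp.onFinset_sum _ (by simp), sub_eq_zero]
      have h3 : ∀ (γ' : AddMonoidAlgebra k S) (r : R), q ((γ'.coeff.sum fun s c ↦
          t (.ofAdd (s : Fin n → ℤ)) • c • σ (.ofAdd s)) * r) =
          ∑ s ∈ γ'.coeff.support, t (.ofAdd (s : Fin n → ℤ)) •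
            γ'.coeff s • q (σ (.ofAdd s) * r) := by
        intro γ' r
        rw [Finsupp.sum, Finset.sum_mul, map_sum]
        refine Finset.sum_congr rfl fun s _ ↦ ?_
        rw [smul_mul_assoc, smul_mul_assoc, hqs, hqs]
      rw [hα', hβ', h3, h3, Finset.smul_sum] at h2
      rw [h2]
      refine Finset.sum_congr rfl fun s _ ↦ ?_
      rw [smul_smul, ← map_mul, ← ofAdd_add]
    have hcomp : ∀ s : S, β.coeff s • q (σ (.ofAdd s) * D) = 0 := by
      intro s
      have h1 := DFunLike.congr_fun key s.1
      rw [Finsupp.sub_apply, Finsupp.mapDomain_apply Subtype.val_injective,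
        Finsupp.mapDomain_notin_range, sub_zero] at h1
      · exact h1
      · rintro ⟨s', e'⟩
        apply hψ
        rw [← eq_sub_iff_add_eq] at e'
        rw [e']
        exact sub_mem (AddSubgroup.subset_closure s.2) (AddSubgroup.subset_closure s'.2)
    have hβd : AddMonoidAlgebra.lift k R S σ β * D ∈ RingHom.ker π ^ N := by
      rw [← Ideal.Quotient.eq_zero_iff_mem, AddMonoidAlgebra.lift_apply, Finsupp.sum,
        Finset.sum_mul, map_sum]
      refine Finset.sum_eq_zero fun s _ ↦ ?_
      rw [smul_mul_assoc]
      exact hcomp s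
    refine ⟨u * u, ?_, ?_⟩
    · rw [RingHom.mem_ker, map_mul, huπ]
      exact mul_ne_zero hu0 hu0
    · rw [bot_sup_eq]
      have := add_mem (Ideal.mul_mem_left _ D hβm) hβd
      convert this using 1
      rw [← hD, ← hX]
      ring)
  rw [Ideal.mem_bot] at hux
  rcases mul_eq_zero.1 hux with h0 | h0
  · exact hu (h0 ▸ zero_mem _)
  · exact mul_ne_zero hd0 hx0 h0

lemma iInf_pow_eq_bot (h : IsLocalToric S ch ρ σ π) {x : R}
    (hx : ∀ N : ℕ, x ∈ RingHom.ker π ^ N) : x = 0 := by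
  have := isPrime_ker π
  obtain ⟨u, hu, hux⟩ := exists_mul_mem_of_forall_pow (RingHom.ker π) ⊥ (g := x) fun N ↦
    ⟨1, by rw [RingHom.mem_ker, map_one]; exact one_ne_zero, by
      rw [bot_sup_eq, _root_.one_mul]; exact hx N⟩
  exact (mul_eq_zero.1 ((Ideal.mem_bot).1 hux)).resolve_left fun h0 ↦ hu (h0 ▸ zero_mem _)

lemma sigma_ne_zero (h : IsLocalToric S ch ρ σ π) (s : S) : σ (.ofAdd s) ≠ 0 := by
  intro h0
  have := h.sigma_eq s
  rw [h0, map_zero] at this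
  exact ch_ne_zero _ this.symm

/-- Membership of characters in ideals generated by characters. -/
lemma mem_of_sigma_mem_span (h : IsLocalToric S ch ρ σ π) (hker : RingHom.ker π =
    Ideal.span ((fun s ↦ σ (.ofAdd s)) '' {s : S | -(s : Fin n → ℤ) ∉ S})) {C : Set S}
    (hC : ∀ c ∈ C, ∀ s, c + s ∈ C) {χ : S}
    (hχ : σ (.ofAdd χ) ∈ Ideal.span ((fun s ↦ σ (.ofAdd s)) '' C)) : χ ∈ C := by
  classical
  have approx : ∀ N : ℕ, ∀ x ∈ Ideal.span ((fun s ↦ σ (.ofAdd s)) '' C), ∀ r : R,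
      ∃ s a : AddMonoidAlgebra k S, AddMonoidAlgebra.lift k R S σ s ≠ 0 ∧
        π (AddMonoidAlgebra.lift k R S σ s) = AddMonoidAlgebra.lift k R S σ s ∧
        a ∈ Ideal.span (AddMonoidAlgebra.of' k S '' C) ∧
        AddMonoidAlgebra.lift k R S σ s * (r * x) - AddMonoidAlgebra.lift k R S σ a ∈
          RingHom.ker π ^ N := by
    intro N x hx
    induction hx using Submodule.span_induction with
    | mem x hx =>
      obtain ⟨c, hc, rfl⟩ := hx
      intro r
      obtain ⟨s, a, hs, hsπ, e⟩ := h.exists_approx hker N r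
      refine ⟨s, a * AddMonoidAlgebra.of' k S c, hs, hsπ,
        Ideal.mul_mem_left _ _ (Ideal.subset_span ⟨c, hc, rfl⟩), ?_⟩
      have := Ideal.mul_mem_right (σ (.ofAdd c)) _ e
      convert this using 1
      rw [map_mul, AddMonoidAlgebra.of'_apply, AddMonoidAlgebra.lift_single, one_smul]
      ring
    | zero => exact fun r ↦ ⟨1, 0, by simp, by simp, zero_mem _, by simp⟩
    | add x y _ _ hx hy =>
      intro r
      obtain ⟨s, a, hs, hsπ, ha, e⟩ := hx r
      obtain ⟨s', a', hs', hsπ', ha', e'⟩ := hy r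
      refine ⟨s * s', s' * a + s * a', ?_, ?_, add_mem (Ideal.mul_mem_left _ _ ha)
        (Ideal.mul_mem_left _ _ ha'), ?_⟩
      · rw [map_mul]; exact mul_ne_zero hs hs'
      · rw [map_mul, map_mul, hsπ, hsπ']
      · have := add_mem (Ideal.mul_mem_left _ (AddMonoidAlgebra.lift k R S σ s') e)
          (Ideal.mul_mem_left _ (AddMonoidAlgebra.lift k R S σ s) e')
        convert this using 1
        simp only [map_mul, map_add]
        ring
    | smul c x _ hx =>
      intro r
      obtain ⟨s, a, hs, hsπ, ha, e⟩ := hx (r * c)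
      exact ⟨s, a, hs, hsπ, ha, by rwa [smul_eq_mul, ← _root_.mul_assoc r]⟩
  by_contra hχC
  -- The multiplier `s` has a term at a unit `l`, and the coefficient of `s * χ - a` at `l + χ` is
  -- untouched by `a`, whose terms lie in `C`. Stability of `ker π ^ N` then puts `σ χ` in it, for
  -- every `N`.
  refine h.sigma_ne_zero χ (h.iInf_pow_eq_bot fun N ↦ ?_)
  obtain ⟨s, a, hs, hsπ, ha, e⟩ := approx N _ hχ 1
  rw [AddMonoidAlgebra.mem_ideal_span_of'_image] at ha
  obtain ⟨l, hl, hlS⟩ := h.exists_unit_of_fixed (a := s) (by rwa [hsπ])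
  have hlC : l + χ ∉ C := by
    intro hmem
    apply hχC
    have := hC _ hmem ⟨_, hlS⟩
    convert this using 1
    ext1
    simp only [AddSubmonoid.coe_add]
    abel
  have e' : AddMonoidAlgebra.lift k R S σ (s * .single χ 1 - a) ∈ RingHom.ker π ^ N := by
    convert e using 1
    rw [map_sub, map_mul, AddMonoidAlgebra.lift_single, one_smul, _root_.one_mul]
  have hcoeff : (s * .single χ 1 - a : AddMonoidAlgebra k S).coeff (l + χ) = s.coeff l := by
    rw [AddMonoidAlgebra.coeff_sub, Finsupp.sub_apply,
      AddMonoidAlgebra.coeff_mul_single_eq_coeff_mul (m₂ := l), _root_.mul_one, sub_eq_self]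
    · by_contra h0
      obtain ⟨c, hc, d, hd⟩ := ha _ (Finsupp.mem_support_iff.2 h0)
      exact hlC (by rw [hd, _root_.add_comm]; exact hC c hc d)
    · intro m _
      exact ⟨fun h ↦ add_right_cancel h, fun h ↦ by rw [h]⟩
  have h1 := h.component_mem (h.isStableIdeal_ker_pow N) e' (l + χ) (by rwa [hcoeff])
  rw [ofAdd_add, map_mul] at h1
  exact (Ideal.unit_mul_mem_iff_mem _ (isUnit_sigma hlS)).1 h1

/-- The ideal `ker π` is generated by finitely many nonunit characters, so every nonunit of `S` has
one of them as a summand. Splitting them off must end at a unit: otherwise the character would lie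
in all powers of `ker π`. The units form a subgroup of `ℤⁿ`, hence are finitely generated. -/
lemma fg (h : IsLocalToric S ch ρ σ π) (hker : RingHom.ker π =
    Ideal.span ((fun s ↦ σ (.ofAdd s)) '' {s : S | -(s : Fin n → ℤ) ∉ S})) : S.FG := by
  classical
  obtain ⟨T, hT, hTspan⟩ := (Submodule.fg_span_iff_fg_span_finset_subset _).1
    (hker ▸ IsNoetherian.noetherian (RingHom.ker π))
  obtain ⟨T, hTS, rfl⟩ := Finset.subset_set_image_iff.1 hT
  have hdec : ∀ χ : S, -(χ : Fin n → ℤ) ∉ S → ∃ c ∈ T, ∃ s, χ = c + s := by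
    intro χ hχ
    have := h.mem_of_sigma_mem_span hker (C := {χ | ∃ c ∈ T, ∃ s, χ = c + s}) (χ := χ)
      (by rintro _ ⟨c, hc, s, rfl⟩ s'; exact ⟨c, hc, s + s', by rw [_root_.add_assoc]⟩) (by
        have h1 := h.sigma_mem_ker hχ
        rw [hker] at h1
        change _ ∈ Submodule.span R _ at h1
        rw [hTspan] at h1
        refine Submodule.span_mono ?_ h1
        rintro _ hx
        obtain ⟨c, hc, rfl⟩ := Finset.mem_image.1 hx
        exact ⟨c, ⟨c, hc, 0, (add_zero c).symm⟩, rfl⟩)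
    exact this
  let Λ : AddSubgroup (Fin n → ℤ) :=
    { carrier := {χ | χ ∈ S ∧ -χ ∈ S}
      zero_mem' := by simp
      add_mem' := fun {a b} ha hb ↦ ⟨add_mem ha.1 hb.1, by rw [neg_add]; exact add_mem ha.2 hb.2⟩
      neg_mem' := fun {a} ha ↦ ⟨ha.2, by simpa using ha.1⟩ }
  have hΛ : Λ.toAddSubmonoid.FG := (AddSubgroup.fg_iff_addSubmonoid_fg Λ).1 (by
    have := IsNoetherian.noetherian (AddSubgroup.toIntSubmodule Λ)
    rwa [Submodule.fg_iff_addSubgroup_fg] at this)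
  have hT' : (AddSubmonoid.closure ((T.image (Subtype.val : S → _) : Finset _) : Set (Fin n → ℤ))).FG :=
    ⟨_, rfl⟩
  have key : ∀ N : ℕ, ∀ χ : S, σ (.ofAdd χ) ∉ RingHom.ker π ^ N → (χ : Fin n → ℤ) ∈
      Λ.toAddSubmonoid ⊔
        AddSubmonoid.closure ((T.image (Subtype.val : S → _) : Finset _) : Set (Fin n → ℤ)) := by
    intro N
    induction N with
    | zero => intro χ hχ; simp at hχ
    | succ N ih =>
      intro χ hχ
      by_cases hu : -(χ : Fin n → ℤ) ∈ S
      · exact AddSubmonoid.mem_sup_left ⟨χ.2, hu⟩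
      · obtain ⟨c, hc, s, rfl⟩ := hdec χ hu
        rw [AddSubmonoid.coe_add]
        refine add_mem (AddSubmonoid.mem_sup_right (AddSubmonoid.subset_closure
          (Finset.mem_coe.2 (Finset.mem_image_of_mem _ hc)))) (ih s fun hs ↦ hχ ?_)
        rw [ofAdd_add, map_mul, pow_succ']
        exact Ideal.mul_mem_mul (h.sigma_mem_ker (hTS (Finset.mem_coe.2 hc))) hs
  have hS : S = Λ.toAddSubmonoid ⊔
      AddSubmonoid.closure ((T.image (Subtype.val : S → _) : Finset _) : Set (Fin n → ℤ)) := by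
    apply le_antisymm
    · intro χ hχ
      by_contra hne
      refine h.sigma_ne_zero ⟨χ, hχ⟩ (h.iInf_pow_eq_bot fun N ↦ ?_)
      by_contra hN
      exact hne (key N _ hN)
    · refine sup_le (fun χ hχ ↦ hχ.1) (AddSubmonoid.closure_le.2 fun χ hχ ↦ ?_)
      obtain ⟨c, -, rfl⟩ := Finset.mem_image.1 (Finset.mem_coe.1 hχ)
      exact c.2
  rw [hS]
  exact hΛ.sup hT'

/-- The elements of the local ring are fractions of regular functions, with denominators which
do not vanish at all points of the closed orbit. -/
lemma exists_global_fraction (h : IsLocalToric S ch ρ σ π) (hker : RingHom.ker π =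
    Ideal.span ((fun s ↦ σ (.ofAdd s)) '' {s : S | -(s : Fin n → ℤ) ∉ S})) (f : R) :
    ∃ s a : AddMonoidAlgebra k S, π (AddMonoidAlgebra.lift k R S σ s) ≠ 0 ∧
      AddMonoidAlgebra.lift k R S σ s * f = AddMonoidAlgebra.lift k R S σ a := by
  classical
  have hfg := h.fg hker
  have : AddMonoid.FG S := (AddMonoid.fg_iff_addSubmonoid_fg S).2 hfg
  have hnoeth : IsNoetherianRing (AddMonoidAlgebra k S) :=
    Algebra.FiniteType.isNoetherianRing k _
  let aR := AddMonoidAlgebra.lift k R S σ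
  -- With `f = g / d`, approximations of `f` give `s * g ∈ (d) + ker π ^ N` with `s ∉ P`. By
  -- `hcontr` the error lies in `P ^ N` already in `k[S]`, which is Noetherian, so Krull's theorem
  -- provides an exact relation `s * g ∈ (d)`.
  let P : Ideal (AddMonoidAlgebra k S) := (RingHom.ker π).comap aR
  have hker_prime := isPrime_ker π
  have hP : P.IsPrime := Ideal.comap_isPrime _ _
  have hinj : Function.Injective aR := by
    rw [injective_iff_map_eq_zero]
    intro a ha
    ext s
    by_contra h0
    have hs : IsStableIdeal (K := K) ρ (⊥ : Ideal R) := by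
      intro x hx
      rw [Ideal.mem_bot] at hx
      exact .of_forall fun t ↦ ⟨0, zero_mem _, by rw [hx]; simp⟩
    have := h.component_mem hs (a := a) (by rw [Ideal.mem_bot]; exact ha) s (by simpa using h0)
    exact h.sigma_ne_zero s (by simpa using this)
  obtain ⟨g, d, hd, e⟩ : ∃ g d : AddMonoidAlgebra k S, aR d ≠ 0 ∧ f * aR d = aR g := by
    obtain ⟨g, d, hd, e⟩ := h.exists_fraction (algebraMap R K f)
    have hgen := h.closure_eq_top hker
    -- As `S` generates the lattice, one shift moves the finitely many characters in `d` and `g`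
    -- into `S`.
    obtain ⟨s₀, hs₀⟩ : ∃ s₀ : S, ∀ χ ∈ d.coeff.support ∪ g.coeff.support, (s₀ : Fin n → ℤ) + χ ∈ S := by
      generalize d.coeff.support ∪ g.coeff.support = B
      induction B using Finset.induction_on with
      | empty => exact ⟨0, by simp⟩
      | insert a B ha ih =>
        obtain ⟨s₀, hs₀⟩ := ih
        obtain ⟨s, s', hss'⟩ := exists_eq_sub hgen a
        refine ⟨s₀ + s', fun χ hχ ↦ ?_⟩
        rcases Finset.mem_insert.1 hχ with rfl | hχ
        · have : ((s₀ + s' : S) : Fin n → ℤ) + χ = s₀ + s := by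
            rw [hss', AddSubmonoid.coe_add]; abel
          rw [this]; exact add_mem s₀.2 s.2
        · have : ((s₀ + s' : S) : Fin n → ℤ) + χ = (s₀ + χ) + s' := by
            rw [AddSubmonoid.coe_add]; abel
          rw [this]; exact add_mem (hs₀ χ hχ) s'.2
    have hlift : ∀ b : AddMonoidAlgebra k (Fin n → ℤ),
        b.coeff.support ⊆ d.coeff.support ∪ g.coeff.support →
        ∃ b' : AddMonoidAlgebra k S, algebraMap R K (aR b') =
          ch (.ofAdd (s₀ : Fin n → ℤ)) * AddMonoidAlgebra.lift k K _ ch b := by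
      intro b hb
      refine ⟨∑ χ ∈ b.coeff.support.attach,
        .single ⟨s₀ + χ.1, hs₀ χ.1 (hb χ.2)⟩ (b.coeff χ.1), ?_⟩
      rw [map_sum, map_sum, AddMonoidAlgebra.lift_apply, Finsupp.sum, Finset.mul_sum,
        ← Finset.sum_attach (s := b.coeff.support)]
      refine Finset.sum_congr rfl fun χ _ ↦ ?_
      simp only [aR]
      rw [AddMonoidAlgebra.lift_single, Algebra.smul_def, map_mul,
        ← IsScalarTower.algebraMap_apply, h.sigma_eq, ofAdd_add, map_mul, Algebra.smul_def]
      ring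
    obtain ⟨d', hd'⟩ := hlift d Finset.subset_union_left
    obtain ⟨g', hg'⟩ := hlift g Finset.subset_union_right
    refine ⟨g', d', fun h0 ↦ ?_, injective (K := K) ?_⟩
    · rw [h0, map_zero] at hd'
      exact mul_ne_zero (ch_ne_zero _) hd hd'.symm
    · rw [map_mul, hd', hg', ← e]; ring
  have hpow : ∀ N : ℕ, RingHom.ker π ^ N ≤ Ideal.span ((fun s ↦ σ (.ofAdd s)) ''
      {s : S | (.single s 1 : AddMonoidAlgebra k S) ∈ P ^ N}) := by
    intro N
    induction N with
    | zero =>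
      rw [pow_zero, Ideal.one_eq_top, top_le_iff, Ideal.eq_top_iff_one]
      exact Ideal.subset_span ⟨0, by simp, by simp⟩
    | succ N ih =>
      rw [pow_succ]
      refine (Ideal.mul_mono ih hker.le).trans ?_
      rw [Ideal.span_mul_span', Ideal.span_le]
      rintro _ ⟨_, ⟨s, hs, rfl⟩, _, ⟨c, hc, rfl⟩, rfl⟩
      refine Ideal.subset_span ⟨s + c, ?_, by simp⟩
      have hcP : (.single c 1 : AddMonoidAlgebra k S) ∈ P := by
        change aR _ ∈ RingHom.ker π
        simp only [aR, AddMonoidAlgebra.lift_single, one_smul]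
        exact h.sigma_mem_ker hc
      have := Ideal.mul_mem_mul hs hcP
      rwa [AddMonoidAlgebra.single_mul_single, _root_.mul_one, ← pow_succ] at this
  have hcontr : ∀ (N : ℕ) (a : AddMonoidAlgebra k S), aR a ∈ RingHom.ker π ^ N → a ∈ P ^ N := by
    intro N a ha
    rw [← AddMonoidAlgebra.sum_coeff_single a]
    refine sum_mem fun s hs ↦ ?_
    have h1 := h.component_mem (h.isStableIdeal_ker_pow N) ha s (Finsupp.mem_support_iff.1 hs)
    have h2 := h.mem_of_sigma_mem_span hker
      (C := {s : S | (.single s 1 : AddMonoidAlgebra k S) ∈ P ^ N}) (χ := s) (by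
        intro c hc s
        have := Ideal.mul_mem_right (.single s 1 : AddMonoidAlgebra k S) _ hc
        rwa [AddMonoidAlgebra.single_mul_single, _root_.mul_one] at this) (hpow N h1)
    have h3 : (.single s (a.coeff s) : AddMonoidAlgebra k S) =
        a.coeff s • .single s 1 := by
      rw [AddMonoidAlgebra.smul_single, smul_eq_mul, _root_.mul_one]
    rw [h3, Algebra.smul_def]
    exact Ideal.mul_mem_left _ _ h2
  obtain ⟨s, hs, hsg⟩ := exists_mul_mem_of_forall_pow P (Ideal.span {d}) (g := g) (by
    intro N
    obtain ⟨s, a, hs, hsπ, es⟩ := h.exists_approx hker N f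
    refine ⟨s, ?_, ?_⟩
    · change ¬ (π (aR s) = 0)
      rw [hsπ]; exact hs
    · have h1 : s * g - d * a ∈ P ^ N := by
        refine hcontr N _ ?_
        have := Ideal.mul_mem_left _ (aR d) es
        convert this using 1
        rw [map_sub, map_mul, map_mul, ← e]
        ring
      have h2 : s * g = d * a + (s * g - d * a) := by ring
      rw [h2]
      exact Submodule.add_mem_sup (Ideal.mul_mem_right _ _ (Ideal.mem_span_singleton_self d)) h1)
  obtain ⟨a, ha⟩ := Ideal.mem_span_singleton'.1 hsg
  refine ⟨s, a, hs, ?_⟩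
  have := congrArg aR ha
  rw [map_mul, map_mul, ← e] at this
  refine mul_right_cancel₀ hd ?_
  rw [this]
  ring

end IsLocalToric

end LocalAlgebra

end ToricMonoid

namespace ToricMonoid

/-! ### Rational points and values of sections. -/

section Values

variable {k : Type u} [Field k] {X Y : Over (Spec (.of k))}

/-- The underlying morphism of schemes of a `k`-rational point. -/
def Pt.hom (x : Pt X) : Spec (.of k) ⟶ X.left := CommaMorphism.left x

lemma Pt.hom_comp (x : Pt X) : x.hom ≫ X.hom = 𝟙 _ :=
  Over.w (show 𝟙_ (Over (Spec (.of k))) ⟶ X from x)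

lemma Pt.toSpace_eq (x : Pt X) : x.toSpace = x.hom (IsLocalRing.closedPoint k) := rfl

lemma Pt.hom_apply (x : Pt X) (a : Spec (.of k)) : x.hom a = x.toSpace :=
  congr(x.hom $(Subsingleton.elim _ _))

lemma Pt.hom_map (f : X ⟶ Y) (x : Pt X) : (Pt.map f x).hom = x.hom ≫ f.left := rfl

lemma Pt.toSpace_map (f : X ⟶ Y) (x : Pt X) : (Pt.map f x).toSpace = f.left x.toSpace := rfl

/-- The `k`-rational point given by a section of the structure morphism. -/
noncomputable def Pt.mk (f : Spec (.of k) ⟶ X.left) (hf : f ≫ X.hom = 𝟙 _) : Pt X :=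
  Over.homMk (U := 𝟙_ (Over (Spec (.of k)))) f hf

lemma Pt.ext_hom {x y : Pt X} (h : x.hom = y.hom) : x = y :=
  Over.OverMorphism.ext (U := 𝟙_ (Over (Spec (.of k)))) h

lemma Pt.le_preimage (x : Pt X) {W : X.left.Opens} (hx : x.toSpace ∈ W) : ⊤ ≤ x.hom ⁻¹ᵁ W :=
  fun a _ ↦ by
    change x.hom a ∈ W
    rwa [x.hom_apply]

/-- The pull-back of a section to the spectrum of a ring. -/
noncomputable def secVal {Z : Scheme.{u}} {Ω : CommRingCat.{u}} (f : Spec Ω ⟶ Z) (W : Z.Opens)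
    (h : ⊤ ≤ f ⁻¹ᵁ W) : Γ(Z, W) →+* Ω :=
  (f.appLE W ⊤ h ≫ (Scheme.ΓSpecIso Ω).hom).hom

lemma secVal_res {Z : Scheme.{u}} {Ω : CommRingCat.{u}} (f : Spec Ω ⟶ Z) {W W' : Z.Opens}
    (hW : W' ≤ W) (h : ⊤ ≤ f ⁻¹ᵁ W') (s : Γ(Z, W)) :
    secVal f W' h (Z.presheaf.map (homOfLE hW).op s) =
      secVal f W (h.trans fun _ hx ↦ hW hx) s := by
  have := f.map_appLE h (homOfLE hW).op
  have := congr($(this) ≫ (Scheme.ΓSpecIso Ω).hom)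
  exact congr($(this).hom s)

lemma secVal_comp {Z Z' : Scheme.{u}} {Ω : CommRingCat.{u}} (f : Spec Ω ⟶ Z) (g : Z ⟶ Z')
    (W : Z'.Opens) (V : Z.Opens) (e : V ≤ g ⁻¹ᵁ W) (h : ⊤ ≤ f ⁻¹ᵁ V) (s : Γ(Z', W)) :
    secVal (f ≫ g) W (h.trans fun _ hx ↦ e hx) s = secVal f V h (g.appLE W V e s) := by
  have := Scheme.Hom.appLE_comp_appLE f g W V ⊤ e h
  have := congr($(this) ≫ (Scheme.ΓSpecIso Ω).hom)
  exact congr($(this.symm).hom s)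

lemma secVal_specMap {Z : Scheme.{u}} {Ω Ω' : CommRingCat.{u}} (φ : Ω ⟶ Ω') (f : Spec Ω ⟶ Z)
    (W : Z.Opens) (h : ⊤ ≤ f ⁻¹ᵁ W) (h' : ⊤ ≤ (Spec.map φ ≫ f) ⁻¹ᵁ W) (s : Γ(Z, W)) :
    secVal (Spec.map φ ≫ f) W h' s = φ (secVal f W h s) := by
  have h1 := Scheme.Hom.appLE_comp_appLE (Spec.map φ) f W ⊤ ⊤ h le_top
  have h2 : (Spec.map φ).appLE ⊤ ⊤ le_top ≫ (Scheme.ΓSpecIso Ω').hom =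
      (Scheme.ΓSpecIso Ω).hom ≫ φ := by
    rw [← Scheme.ΓSpecIso_naturality]
    congr 1
  have := congr(f.appLE W ⊤ h ≫ $h2)
  rw [← Category.assoc, h1] at this
  exact congr($(this).hom s)

lemma secVal_congr {Z : Scheme.{u}} {Ω : CommRingCat.{u}} {f g : Spec Ω ⟶ Z} (hfg : f = g)
    (W : Z.Opens) (h : ⊤ ≤ f ⁻¹ᵁ W) (s : Γ(Z, W)) :
    secVal f W h s = secVal g W (hfg ▸ h) s := by
  subst hfg
  rfl

/-- The value of a section at a `k`-rational point. -/
noncomputable def Pt.ev (x : Pt X) (W : X.left.Opens) (hx : x.toSpace ∈ W) : Γ(X.left, W) →+* k :=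
  secVal x.hom W (x.le_preimage hx)

lemma Pt.ev_res (x : Pt X) {W W' : X.left.Opens} (hW : W' ≤ W) (hx : x.toSpace ∈ W')
    (s : Γ(X.left, W)) :
    x.ev W' hx (X.left.presheaf.map (homOfLE hW).op s) = x.ev W (hW hx) s :=
  secVal_res x.hom hW _ s

lemma Pt.ev_map (f : X ⟶ Y) (x : Pt X) {W : Y.left.Opens} {V : X.left.Opens}
    (e : V ≤ f.left ⁻¹ᵁ W) (hx : x.toSpace ∈ V) (s : Γ(Y.left, W)) :
    x.ev V hx (f.left.appLE W V e s) = (Pt.map f x).ev W (e hx) s :=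
  (secVal_comp x.hom f.left W V e _ s).symm

/-- The structure morphism of sections. -/
noncomputable def scalar (X : Over (Spec (.of k))) (W : X.left.Opens) : k →+* Γ(X.left, W) :=
  ((Scheme.ΓSpecIso (.of k)).inv ≫ X.hom.appLE ⊤ W le_top).hom

lemma scalar_res {W W' : X.left.Opens} (hW : W' ≤ W) (c : k) :
    X.left.presheaf.map (homOfLE hW).op (scalar X W c) = scalar X W' c := by
  have := X.hom.appLE_map (U := ⊤) (V := W) le_top (homOfLE hW).op
  have := congr((Scheme.ΓSpecIso (.of k)).inv ≫ $this)
  exact congr($(this).hom c)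

lemma appLE_scalar (f : X ⟶ Y) {W : Y.left.Opens} {V : X.left.Opens}
    (e : V ≤ f.left ⁻¹ᵁ W) (c : k) : f.left.appLE W V e (scalar Y W c) = scalar X V c := by
  have h1 := Scheme.Hom.appLE_comp_appLE f.left Y.hom ⊤ W V le_top e
  have h2 : (f.left ≫ Y.hom).appLE ⊤ V (le_top) = X.hom.appLE ⊤ V le_top := by
    simp only [Over.w f]
  have := congr((Scheme.ΓSpecIso (.of k)).inv ≫ $(h1.trans h2))
  exact congr($(this).hom c)

lemma Pt.ev_scalar (x : Pt X) (W : X.left.Opens) (hx : x.toSpace ∈ W) (c : k) :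
    x.ev W hx (scalar X W c) = c := by
  have h1 := Scheme.Hom.appLE_comp_appLE x.hom X.hom ⊤ W ⊤ le_top (x.le_preimage hx)
  have h2 : (x.hom ≫ X.hom).appLE ⊤ ⊤ le_top = 𝟙 _ := by
    simp only [x.hom_comp]
    simp only [Scheme.Hom.appLE, Scheme.Hom.id_app, Category.id_comp]
    exact (Spec (.of k)).presheaf.map_id _
  have h3 := h1.trans h2
  have := congr((Scheme.ΓSpecIso (.of k)).inv ≫ $h3 ≫ (Scheme.ΓSpecIso (.of k)).hom)
  rw [Category.id_comp, Iso.inv_hom_id] at this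
  exact congr($(this).hom c)

lemma Pt.mem_basicOpen (x : Pt X) (W : X.left.Opens) (hx : x.toSpace ∈ W) (s : Γ(X.left, W)) :
    x.toSpace ∈ X.left.basicOpen s ↔ x.ev W hx s ≠ 0 := by
  have h1 : x.hom ⁻¹ᵁ (X.left.basicOpen s) = (Spec (.of k)).basicOpen (x.hom.appLE W ⊤
    (x.le_preimage hx) s) := by
    rw [Scheme.basicOpen_appLE, top_inf_eq]
  have h2 : x.toSpace ∈ X.left.basicOpen s ↔
      IsLocalRing.closedPoint k ∈ x.hom ⁻¹ᵁ (X.left.basicOpen s) := Iff.rfl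
  rw [h2, h1]
  constructor
  · intro h h0
    have h4 : x.hom.appLE W ⊤ (x.le_preimage hx) s = 0 := by
      refine (ConcreteCategory.bijective_of_isIso (Scheme.ΓSpecIso (.of k)).hom).1 ?_
      rw [map_zero]
      exact h0
    rw [h4, Scheme.basicOpen_zero] at h
    exact h
  · intro h
    have h5 : IsUnit (x.hom.appLE W ⊤ (x.le_preimage hx) s) := by
      have h6 : IsUnit ((Scheme.ΓSpecIso (.of k)).inv (x.ev W hx s)) :=
        (isUnit_iff_ne_zero.2 h).map (Scheme.ΓSpecIso (.of k)).inv.hom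
      have h7 := congr($((Scheme.ΓSpecIso (.of k)).hom_inv_id).hom
        (x.hom.appLE W ⊤ (x.le_preimage hx) s))
      rw [← show _ = x.hom.appLE W ⊤ (x.le_preimage hx) s from h7]
      exact h6
    rw [Scheme.basicOpen_of_isUnit _ h5]
    trivial

end Values

/-! ### Sections and morphisms are determined on rational points. -/

section Jacobson

variable {k : Type u} [Field k] [IsAlgClosed k] {X Y : Over (Spec (.of k))}

lemma exists_pt_of_isClosed [LocallyOfFiniteType X.hom] {x : X.left} (hx : IsClosed {x}) :
    ∃ y : Pt X, y.toSpace = x :=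
  ⟨Pt.mk (pointOfClosedPoint X.hom x hx) (pointOfClosedPoint_comp _ _ _),
    pointOfClosedPoint_apply X.hom x hx _⟩

lemma isClosed_toSpace [LocallyOfFiniteType X.hom] (x : Pt X) : IsClosed {x.toSpace} :=
  (pointEquivClosedPoint X.hom ⟨x.hom, x.hom_comp⟩).2

lemma Pt.toSpace_injective [LocallyOfFiniteType X.hom] :
    Function.Injective (Pt.toSpace (X := X)) := fun x y h ↦
  Pt.ext_hom (ext_of_apply_closedPoint_eq X.hom x.hom_comp y.hom_comp h)

lemma exists_pt_mem [LocallyOfFiniteType X.hom] {Z : Set X.left} (hZ : IsLocallyClosed Z)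
    (hne : Z.Nonempty) : ∃ y : Pt X, y.toSpace ∈ Z := by
  have : JacobsonSpace X.left := LocallyOfFiniteType.jacobsonSpace (Y := Spec (.of k)) X.hom
  obtain ⟨x, hx, hx'⟩ := nonempty_inter_closedPoints hne hZ
  obtain ⟨y, rfl⟩ := exists_pt_of_isClosed (X := X) hx'
  exact ⟨y, hx⟩

/-- An open subset is determined by its `k`-rational points. -/
lemma opens_le_of_pt [LocallyOfFiniteType X.hom] {W W' : X.left.Opens}
    (h : ∀ x : Pt X, x.toSpace ∈ W → x.toSpace ∈ W') : W ≤ W' := by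
  by_contra hW
  obtain ⟨x, hx, hx'⟩ := Set.not_subset.1 hW
  obtain ⟨y, hy, hy'⟩ := exists_pt_mem (X := X) (Z := (W : Set X.left) ∩ (W' : Set X.left)ᶜ)
    (W.2.isLocallyClosed.inter W'.2.isClosed_compl.isLocallyClosed) ⟨x, hx, hx'⟩
  exact hy' (h y hy)

/-- A section of a reduced scheme is determined by its values at `k`-rational points. -/
lemma section_ext [LocallyOfFiniteType X.hom] [IsReduced X.left] {W : X.left.Opens}
    {s t : Γ(X.left, W)} (h : ∀ (x : Pt X) (hx : x.toSpace ∈ W), x.ev W hx s = x.ev W hx t) :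
    s = t := by
  rw [← sub_eq_zero, ← basicOpen_eq_bot_iff, eq_bot_iff]
  refine opens_le_of_pt fun x hx ↦ ?_
  have hxW := X.left.basicOpen_le _ hx
  exact absurd (by rw [map_sub, h x hxW, sub_self]) ((x.mem_basicOpen W hxW _).1 hx)

/-- Two morphisms to a separated scheme agree if they agree on the `k`-rational points of a dense
open subset. -/
lemma hom_ext_of_pt [LocallyOfFiniteType X.hom] [IsReduced X.left] [LocallyOfFiniteType Y.hom]
    [IsSeparated Y.hom] {f g : X ⟶ Y} (W : X.left.Opens) (hW : Dense (W : Set X.left))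
    (h : ∀ x : Pt X, x.toSpace ∈ W → Pt.map f x = Pt.map g x) : f = g := by
  have hf : f.left ≫ Y.hom = X.hom := Over.w f
  have hg : g.left ≫ Y.hom = X.hom := Over.w g
  have : LocallyOfFiniteType (f.left ≫ Y.hom) := by rw [hf]; infer_instance
  refine Over.OverMorphism.ext (ext_of_apply_eq (X := X.left) (Y := Y.left) (K := k) Y.hom W
    W.2.isLocallyClosed hW ?_ (hf.trans hg.symm))
  intro x hx hx'
  obtain ⟨y, rfl⟩ := exists_pt_of_isClosed (X := X) hx'
  exact congr(Pt.toSpace $(h y hx))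

end Jacobson

end ToricMonoid

namespace ToricMonoid

/-! ### Gluing functions on rational points. -/

section Gluing

variable {k : Type u} [Field k] [IsAlgClosed k] {X : Over (Spec (.of k))}

/-- A function on the `k`-rational points of an open subset which is locally given by sections is
given by a section. -/
lemma exists_section [LocallyOfFiniteType X.hom] [IsReduced X.left] (V : X.left.Opens)
    (F : Pt X → k)
    (h : ∀ x : Pt X, x.toSpace ∈ V → ∃ (W : X.left.Opens) (s : Γ(X.left, W)), x.toSpace ∈ W ∧
      ∀ (y : Pt X) (hy : y.toSpace ∈ W), y.toSpace ∈ V → y.ev W hy s = F y) :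
    ∃ s : Γ(X.left, V), ∀ (y : Pt X) (hy : y.toSpace ∈ V), y.ev V hy s = F y := by
  choose W s hW hs using h
  let J := {x : Pt X // x.toSpace ∈ V}
  let U : J → X.left.Opens := fun i ↦ W i.1 i.2 ⊓ V
  let sf : ∀ i : J, Γ(X.left, U i) := fun i ↦
    X.left.presheaf.map (homOfLE inf_le_left).op (s i.1 i.2)
  have hsf (i : J) (y : Pt X) (hy : y.toSpace ∈ U i) : y.ev (U i) hy (sf i) = F y :=
    (y.ev_res _ hy _).trans (hs i.1 i.2 y hy.1 hy.2)
  obtain ⟨g, hg, -⟩ := X.left.sheaf.existsUnique_gluing' U V (fun i ↦ homOfLE inf_le_right)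
    (opens_le_of_pt fun x hx ↦ TopologicalSpace.Opens.mem_iSup.2 ⟨⟨x, hx⟩, hW x hx, hx⟩) sf (by
      intro i i'
      refine section_ext fun x hx ↦ ?_
      exact (x.ev_res (W := U i) inf_le_left hx (sf i)).trans
        (((hsf i x hx.1).trans (hsf i' x hx.2).symm).trans
          (x.ev_res (W := U i') inf_le_right hx (sf i')).symm))
  refine ⟨g, fun y hy ↦ ?_⟩
  have hyU : y.toSpace ∈ U ⟨y, hy⟩ := ⟨hW y hy, hy⟩
  rw [← hsf ⟨y, hy⟩ y hyU, ← hg ⟨y, hy⟩]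
  exact (y.ev_res (W := V) inf_le_right hyU g).symm

end Gluing

/-! ### Translations in an algebraic monoid. -/

section Monoid

variable {k : Type u} [Field k] {M : Over (Spec (.of k))} [MonObj M]

/-- A `k`-rational point as a morphism. -/
def Pt.toHom {k : Type u} [Field k] {X : Over (Spec (.of k))} (x : Pt X) :
    𝟙_ (Over (Spec (.of k))) ⟶ X := x

/-- Left translation by a point. -/
noncomputable def leftMul (y : Pt M) : M ⟶ M :=
  (CartesianMonoidalCategory.toUnit M ≫ y.toHom) * 𝟙 M

/-- Right translation by a point. -/
noncomputable def rightMul (y : Pt M) : M ⟶ M :=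
  𝟙 M * (CartesianMonoidalCategory.toUnit M ≫ y.toHom)

lemma comp_leftMul {Z : Over (Spec (.of k))} (f : Z ⟶ M) (y : Pt M) :
    f ≫ leftMul y = (CartesianMonoidalCategory.toUnit Z ≫
      y.toHom) * f := by
  rw [leftMul, MonObj.comp_mul, Category.comp_id, ← Category.assoc]
  congr 2
  exact CartesianMonoidalCategory.toUnit_unique _ _

lemma comp_rightMul {Z : Over (Spec (.of k))} (f : Z ⟶ M) (y : Pt M) :
    f ≫ rightMul y = f * (CartesianMonoidalCategory.toUnit Z ≫
      y.toHom) := by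
  rw [rightMul, MonObj.comp_mul, Category.comp_id, ← Category.assoc]
  congr 2
  exact CartesianMonoidalCategory.toUnit_unique _ _

lemma map_leftMul (x y : Pt M) : Pt.map (leftMul y) x = y * x := by
  refine (comp_leftMul x.toHom y).trans ?_
  rw [CartesianMonoidalCategory.toUnit_unique (CartesianMonoidalCategory.toUnit _) (𝟙 _),
    Category.id_comp]
  rfl

lemma map_rightMul (x y : Pt M) : Pt.map (rightMul y) x = x * y := by
  refine (comp_rightMul x.toHom y).trans ?_
  rw [CartesianMonoidalCategory.toUnit_unique (CartesianMonoidalCategory.toUnit _) (𝟙 _),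
    Category.id_comp]
  rfl

end Monoid

/-! ### Rational points of the torus, and its embedding in the monoid. -/

section Torus

variable {k : Type u} [Field k] {n : ℕ}

/-- The canonical isomorphism between the two incarnations of the point. -/
noncomputable def unitIso (k : Type u) [Field k] :
    𝟙_ (Over (Spec (.of k))) ≅ (Spec (.of k)).asOver (Spec (.of k)) :=
  Over.isoMk (Iso.refl _) (by
    change 𝟙 _ ≫ Spec.map (CommRingCat.ofHom (algebraMap k k)) = 𝟙 _
    rw [Category.id_comp]
    exact Spec.map_id _)

/-- The `k`-rational point of the torus given by a character of the character group. -/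
noncomputable def torusPt (t : Multiplicative (Fin n → ℤ) →* k) : Pt (splitTorus k n) :=
  (unitIso k).hom ≫ Spec.mapMulEquiv (WithConv.toConv (AddMonoidAlgebra.lift k k (Fin n → ℤ) t))

lemma torusPt_hom (t : Multiplicative (Fin n → ℤ) →* k) :
    (torusPt t).hom =
      Spec.map (CommRingCat.ofHom (AddMonoidAlgebra.lift k k (Fin n → ℤ) t).toRingHom) := by
  refine (Over.comp_left _ _ _ _ _).trans ?_
  exact Category.id_comp _

lemma torusPt_surjective (x : Pt (splitTorus k n)) : ∃ t, torusPt t = x := by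
  obtain ⟨f, hf⟩ := (Spec.mapMulEquiv (R := k) (S := AddMonoidAlgebra k (Fin n → ℤ))
    (T := k)).surjective ((unitIso k).inv ≫ x.toHom)
  refine ⟨(AddMonoidAlgebra.lift k k (Fin n → ℤ)).symm f.ofConv, ?_⟩
  unfold torusPt
  rw [Equiv.apply_symm_apply, WithConv.toConv_ofConv, hf, Iso.hom_inv_id_assoc]
  rfl

lemma torusPt_mul (t t' : Multiplicative (Fin n → ℤ) →* k) :
    torusPt (t * t') = torusPt t * torusPt t' := by
  have h : WithConv.toConv (AddMonoidAlgebra.lift k k (Fin n → ℤ) (t * t')) =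
      WithConv.toConv (AddMonoidAlgebra.lift k k (Fin n → ℤ) t) *
        WithConv.toConv (AddMonoidAlgebra.lift k k (Fin n → ℤ) t') := by
    apply WithConv.ofConv_injective
    rw [AlgHom.convMul_def]
    refine AddMonoidAlgebra.algHom_ext (fun χ ↦ ?_) (Subsingleton.elim _ _)
    simp [AddMonoidAlgebra.lift_single, AddMonoidAlgebra.comul_single]
  unfold torusPt
  rw [h, map_mul, MonObj.comp_mul]
  rfl

end Torus

end ToricMonoid

namespace ToricMonoid

section TorusPoints

variable {k : Type u} [Field k] {n : ℕ}

lemma torusPt_one : torusPt (1 : Multiplicative (Fin n → ℤ) →* k) = 1 := by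
  have h : WithConv.toConv (AddMonoidAlgebra.lift k k (Fin n → ℤ) 1) = 1 := by
    apply WithConv.ofConv_injective
    rw [AlgHom.convOne_def]
    refine AddMonoidAlgebra.algHom_ext (fun χ ↦ ?_) (Subsingleton.elim _ _)
    simp [AddMonoidAlgebra.lift_single]
  unfold torusPt
  rw [h, map_one, MonObj.comp_one]
  rfl

lemma map_mul_of_isMonHom {M N : Over (Spec (.of k))} [MonObj M] [MonObj N] (f : M ⟶ N)
    [IsMonHom f] (x y : Pt M) : Pt.map f (x * y) = Pt.map f x * Pt.map f y :=
  MonObj.mul_comp x.toHom y.toHom f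

lemma map_one_of_isMonHom {M N : Over (Spec (.of k))} [MonObj M] [MonObj N] (f : M ⟶ N)
    [IsMonHom f] : Pt.map f 1 = 1 :=
  MonObj.one_comp f

variable {M : Over (Spec (.of k))} [MonObj M] (j : splitTorus k n ⟶ M) [IsMonHom j]

/-- The points of the torus as points of the monoid. -/
noncomputable def tpt : (Multiplicative (Fin n → ℤ) →* k) →* Pt M where
  toFun t := Pt.map j (torusPt t)
  map_one' := by rw [torusPt_one, map_one_of_isMonHom]
  map_mul' t t' := by rw [torusPt_mul, map_mul_of_isMonHom]

lemma torus_isUnit (t : Multiplicative (Fin n → ℤ) →* k) : IsUnit t := by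
  refine IsUnit.of_mul_eq_one (t.comp invMonoidHom) (MonoidHom.ext fun χ ↦ ?_)
  change t χ * t χ⁻¹ = 1
  rw [← map_mul, mul_inv_cancel, map_one]

lemma exists_tpt_mul_eq_one (t : Multiplicative (Fin n → ℤ) →* k) :
    ∃ t', tpt j t * tpt j t' = 1 ∧ tpt j t' * tpt j t = 1 := by
  obtain ⟨u, rfl⟩ := torus_isUnit t
  exact ⟨(u⁻¹ : Units _), by rw [← map_mul, Units.mul_inv, map_one],
    by rw [← map_mul, Units.inv_mul, map_one]⟩

variable [IsOpenImmersion j.left]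

/-- The open subscheme underlying the torus. -/
noncomputable def torusOpen (j : splitTorus k n ⟶ M) [IsOpenImmersion j.left] : M.left.Opens :=
  j.left ''ᵁ ⊤

lemma mem_torusOpen_iff {x : M.left} : x ∈ torusOpen j ↔ ∃ y, j.left y = x := by
  constructor
  · rintro ⟨y, -, h⟩
    exact ⟨y, h⟩
  · rintro ⟨y, h⟩
    exact ⟨y, trivial, h⟩

lemma tpt_mem (t : Multiplicative (Fin n → ℤ) →* k) : (tpt j t).toSpace ∈ torusOpen j :=
  (mem_torusOpen_iff j).2 ⟨_, rfl⟩

lemma exists_tpt [IsAlgClosed k] [LocallyOfFiniteType M.hom] {x : Pt M}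
    (hx : x.toSpace ∈ torusOpen j) : ∃ t, tpt j t = x := by
  obtain ⟨y, hy⟩ := (mem_torusOpen_iff j).1 hx
  have hcl : IsClosed {y} := by
    have := (isClosed_toSpace x).preimage j.left.continuous
    rw [← hy] at this
    convert this
    ext z
    exact ⟨fun h ↦ congr(j.left $h), fun h ↦ j.left.isOpenEmbedding.injective h⟩
  have : LocallyOfFiniteType (splitTorus k n).hom := by
    rw [← Over.w j]
    infer_instance
  obtain ⟨y, rfl⟩ := exists_pt_of_isClosed hcl
  obtain ⟨t, rfl⟩ := torusPt_surjective y
  exact ⟨t, Pt.toSpace_injective hy⟩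

/-- The section over the torus given by an element of the group algebra. -/
noncomputable def torusSec (j : splitTorus k n ⟶ M) [IsOpenImmersion j.left] :
    AddMonoidAlgebra k (Fin n → ℤ) →+* Γ(M.left, torusOpen j) :=
  ((Scheme.ΓSpecIso (.of (AddMonoidAlgebra k (Fin n → ℤ)))).inv ≫ (j.left.appIso ⊤).inv).hom

lemma torusSec_bijective : Function.Bijective (torusSec j) :=
  (ConcreteCategory.bijective_of_isIso (j.left.appIso ⊤).inv).comp
    (ConcreteCategory.bijective_of_isIso
      (Scheme.ΓSpecIso (.of (AddMonoidAlgebra k (Fin n → ℤ)))).inv)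

lemma torusPt_ev (t : Multiplicative (Fin n → ℤ) →* k) (a : AddMonoidAlgebra k (Fin n → ℤ)) :
    (torusPt t).ev ⊤ trivial ((Scheme.ΓSpecIso (.of (AddMonoidAlgebra k (Fin n → ℤ)))).inv a) =
      AddMonoidAlgebra.lift k k (Fin n → ℤ) t a := by
  have h := secVal_specMap (CommRingCat.ofHom (AddMonoidAlgebra.lift k k (Fin n → ℤ) t).toRingHom)
    (𝟙 (Spec (.of (AddMonoidAlgebra k (Fin n → ℤ))))) ⊤ le_top le_top
    ((Scheme.ΓSpecIso (.of (AddMonoidAlgebra k (Fin n → ℤ)))).inv a)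
  have h2 : secVal (𝟙 (Spec (.of (AddMonoidAlgebra k (Fin n → ℤ))))) ⊤ le_top
      ((Scheme.ΓSpecIso (.of (AddMonoidAlgebra k (Fin n → ℤ)))).inv a) = a := by
    have h3 : Scheme.Hom.appLE (𝟙 (Spec (.of (AddMonoidAlgebra k (Fin n → ℤ))))) ⊤ ⊤ le_top =
        𝟙 _ := by
      simp only [Scheme.Hom.appLE, Scheme.Hom.id_app, Category.id_comp]
      exact (Spec (.of (AddMonoidAlgebra k (Fin n → ℤ)))).presheaf.map_id _
    have h4 := congr((Scheme.ΓSpecIso (.of (AddMonoidAlgebra k (Fin n → ℤ)))).inv ≫ $h3 ≫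
      (Scheme.ΓSpecIso (.of (AddMonoidAlgebra k (Fin n → ℤ)))).hom)
    rw [Category.id_comp, Iso.inv_hom_id] at h4
    exact congr($(h4).hom a)
  rw [h2] at h
  refine (secVal_congr ?_ _ _ _).trans h
  rw [torusPt_hom, Category.comp_id]

lemma tpt_ev (t : Multiplicative (Fin n → ℤ) →* k) (a : AddMonoidAlgebra k (Fin n → ℤ)) :
    (tpt j t).ev (torusOpen j) (tpt_mem j t) (torusSec j a) =
      AddMonoidAlgebra.lift k k (Fin n → ℤ) t a := by
  rw [← torusPt_ev]
  have h := (torusPt t).ev_map j (W := torusOpen j) (V := ⊤) (j.left.preimage_image_eq ⊤).ge trivial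
    (torusSec j a)
  refine h.symm.trans ?_
  congr 1
  have h1 := j.left.appIso_inv_appLE (U := ⊤) (V := ⊤) (j.left.preimage_image_eq ⊤).ge
  have h2 : (splitTorus k n).left.presheaf.map (homOfLE le_rfl).op =
      𝟙 Γ((splitTorus k n).left, ⊤) := (splitTorus k n).left.presheaf.map_id _
  have h3 := congr((Scheme.ΓSpecIso (.of (AddMonoidAlgebra k (Fin n → ℤ)))).inv ≫ $(h1.trans h2))
  exact congr($(h3).hom a)

/-- By irreducibility `W` meets the open torus, where it contains a nonempty principal open subset.
-/
lemma generic_mem_of_nonempty [IrreducibleSpace M.left] (W : M.left.Opens)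
    (hW : (W : Set M.left).Nonempty) : Generic fun t ↦ (tpt j t).toSpace ∈ W := by
  have hne : (torusOpen j : Set M.left).Nonempty := ⟨_, tpt_mem j 1⟩
  obtain ⟨x, hxW, hx⟩ := nonempty_preirreducible_inter W.2 (torusOpen j).2 hW hne
  obtain ⟨y, rfl⟩ := (mem_torusOpen_iff j).1 hx
  let W' : TopologicalSpace.Opens (PrimeSpectrum (AddMonoidAlgebra k (Fin n → ℤ))) := j.left ⁻¹ᵁ W
  obtain ⟨_, ⟨g, rfl⟩, hyg, hg⟩ := PrimeSpectrum.isTopologicalBasis_basic_opens.exists_subset_of_mem_open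
    (show (y : PrimeSpectrum (AddMonoidAlgebra k (Fin n → ℤ))) ∈ W' from hxW) W'.2
  refine ⟨g, ?_, fun t ht ↦ ?_⟩
  · rintro rfl
    exact hyg (Ideal.zero_mem _)
  · refine hg (?_ : (torusPt t).toSpace ∈ _)
    rw [Pt.toSpace_eq, torusPt_hom]
    change (AddMonoidAlgebra.lift k k (Fin n → ℤ) t) g ∉ (IsLocalRing.closedPoint k).asIdeal
    change _ ∉ IsLocalRing.maximalIdeal k
    rw [IsLocalRing.mem_maximalIdeal, mem_nonunits_iff, not_not]
    exact isUnit_iff_ne_zero.2 ht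

end TorusPoints

/-! ### Commutativity of toric monoids. -/

section Commutativity

variable {k : Type u} [Field k] [IsAlgClosed k] {n : ℕ} {M : Over (Spec (.of k))} [MonObj M]
  [IsSeparated M.hom] [LocallyOfFiniteType M.hom] [IsReduced M.left] [IrreducibleSpace M.left]

lemma torusOpen_dense (j : splitTorus k n ⟶ M) [IsMonHom j] [IsOpenImmersion j.left] :
    Dense (torusOpen j : Set M.left) :=
  (torusOpen j).2.dense ⟨_, tpt_mem j 1⟩

/-- Left and right translation by a torus point agree on the dense torus, hence everywhere, as `M`
is reduced and separated. Repeating the argument with an arbitrary point makes the whole monoid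
commutative. -/
lemma tpt_comm (j : splitTorus k n ⟶ M) [IsMonHom j] [IsOpenImmersion j.left]
    (t : Multiplicative (Fin n → ℤ) →* k) (y : Pt M) :
    tpt j t * y = y * tpt j t := by
  have h : leftMul (tpt j t) = rightMul (tpt j t) := by
    refine hom_ext_of_pt (torusOpen j) (torusOpen_dense j) fun x hx ↦ ?_
    obtain ⟨t', rfl⟩ := exists_tpt j hx
    rw [map_leftMul, map_rightMul, ← map_mul, ← map_mul, _root_.mul_comm]
  rw [← map_leftMul, ← map_rightMul, h]

lemma leftMul_eq_rightMul (j : splitTorus k n ⟶ M) [IsMonHom j] [IsOpenImmersion j.left]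
    (y : Pt M) : leftMul y = rightMul y := by
  refine hom_ext_of_pt (torusOpen j) (torusOpen_dense j) fun x hx ↦ ?_
  obtain ⟨t, rfl⟩ := exists_tpt j hx
  rw [map_leftMul, map_rightMul, tpt_comm]

lemma pt_comm (j : splitTorus k n ⟶ M) [IsMonHom j] [IsOpenImmersion j.left]
    (x y : Pt M) : x * y = y * x := by
  rw [← map_leftMul, ← map_rightMul, leftMul_eq_rightMul j]

end Commutativity

end ToricMonoid

namespace ToricMonoid

/-! ### Torus orbits and the existence of the idempotent. -/

section Constructible

/-- Near each point, a constructible set contains or misses the closure of that point. -/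
lemma exists_inter_closure_subset {X : Type*} [TopologicalSpace X] {S : Set X}
    (hS : Topology.IsConstructible S) (x : X) :
    ∃ O : Set X, IsOpen O ∧ x ∈ O ∧ (O ∩ closure {x} ⊆ S ∨ O ∩ closure {x} ⊆ Sᶜ) := by
  induction hS using Topology.IsConstructible.empty_union_induction with
  | open_retrocompact U hU _ =>
    by_cases hx : x ∈ U
    · exact ⟨U, hU, hx, .inl Set.inter_subset_left⟩
    · refine ⟨Set.univ, isOpen_univ, trivial, .inr ?_⟩
      rw [Set.univ_inter]
      exact closure_minimal (Set.singleton_subset_iff.2 hx) hU.isClosed_compl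
  | union s _ t _ hs ht =>
    obtain ⟨O, hO, hxO, h⟩ := hs
    obtain ⟨O', hO', hxO', h'⟩ := ht
    refine ⟨O ∩ O', hO.inter hO', ⟨hxO, hxO'⟩, ?_⟩
    rcases h with h | h
    · exact .inl fun y hy ↦ .inl (h ⟨hy.1.1, hy.2⟩)
    rcases h' with h' | h'
    · exact .inl fun y hy ↦ .inr (h' ⟨hy.1.2, hy.2⟩)
    · refine .inr fun y hy hy' ↦ ?_
      rcases hy' with hy' | hy'
      · exact h ⟨hy.1.1, hy.2⟩ hy'
      · exact h' ⟨hy.1.2, hy.2⟩ hy'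
  | compl s _ hs =>
    obtain ⟨O, hO, hxO, h⟩ := hs
    refine ⟨O, hO, hxO, ?_⟩
    rcases h with h | h
    · right
      rwa [compl_compl]
    · exact .inl h

end Constructible

section Points

variable {k : Type u} [Field k] {X Y : Over (Spec (.of k))}

lemma Pt.continuous_toSpace : Continuous (Pt.toSpace (X := X)) := continuous_induced_dom

lemma Pt.isInducing_toSpace : Topology.IsInducing (Pt.toSpace (X := X)) := ⟨rfl⟩

lemma Pt.continuous_map (f : X ⟶ Y) : Continuous (Pt.map f) :=
  Pt.isInducing_toSpace.continuous_iff.2 (f.left.continuous.comp Pt.continuous_toSpace)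

end Points

section Idempotent

variable {k : Type u} [Field k] [IsAlgClosed k] {n : ℕ} {M : Over (Spec (.of k))} [MonObj M]

lemma leftMul_apply (y x : Pt M) : (leftMul y).left x.toSpace = (y * x).toSpace := by
  rw [← map_leftMul, Pt.toSpace_map]

lemma rightMul_apply (y x : Pt M) : (rightMul y).left x.toSpace = (x * y).toSpace := by
  rw [← map_rightMul, Pt.toSpace_map]

lemma isNoetherian_left [LocallyOfFiniteType M.hom] [QuasiCompact M.hom] :
    AlgebraicGeometry.IsNoetherian M.left where
  toIsLocallyNoetherian := LocallyOfFiniteType.isLocallyNoetherian (Y := Spec (.of k)) M.hom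
  toCompactSpace := QuasiCompact.compactSpace_of_compactSpace (Y := Spec (.of k)) M.hom

/-- The orbit map of a point. -/
noncomputable def orbitMap (j : splitTorus k n ⟶ M) (x : Pt M) : splitTorus k n ⟶ M :=
  j ≫ rightMul x

lemma map_orbitMap (j : splitTorus k n ⟶ M) [IsMonHom j] (x : Pt M)
    (t : Multiplicative (Fin n → ℤ) →* k) :
    Pt.map (orbitMap j x) (torusPt t) = tpt j t * x := by
  rw [← map_rightMul]
  exact (Category.assoc _ _ _).symm

lemma locallyOfFiniteType_splitTorus [LocallyOfFiniteType M.hom] (j : splitTorus k n ⟶ M)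
    [IsOpenImmersion j.left] : LocallyOfFiniteType (splitTorus k n).hom := by
  rw [← Over.w j]
  infer_instance

variable [IsSeparated M.hom] [LocallyOfFiniteType M.hom] [QuasiCompact M.hom]
  [IsReduced M.left] [IrreducibleSpace M.left]

/-- Each orbit contains a relatively open subset of its closure. -/
lemma exists_orbit_open (j : splitTorus k n ⟶ M) [IsMonHom j] [IsOpenImmersion j.left]
    (x : Pt M) : ∃ O : Set (Pt M), IsOpen O ∧ (∃ t, tpt j t * x ∈ O) ∧
      ∀ y ∈ O, y ∈ closure (Set.range fun t ↦ tpt j t * x) → ∃ t, y = tpt j t * x := by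
  have := isNoetherian_left (M := M)
  have := locallyOfFiniteType_splitTorus j
  let f := (orbitMap j x).left
  have hf : f ≫ M.hom = (splitTorus k n).hom := Over.w (orbitMap j x)
  have : LocallyOfFiniteType (f ≫ M.hom) := by rw [hf]; infer_instance
  have : LocallyOfFiniteType f := locallyOfFiniteType_of_comp f M.hom
  have : QuasiCompact (f ≫ M.hom) := by
    rw [hf]
    change QuasiCompact (Spec.map _)
    infer_instance
  have : QuasiCompact f := QuasiCompact.of_comp f M.hom
  -- By Chevalley's theorem the image of the orbit map is constructible. Containing the image `f ξ`
  -- of the generic point, it contains a neighbourhood of `f ξ` in the closure of the orbit.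
  have hC : Topology.IsConstructible (Set.range f) := by
    rw [← Set.image_univ]
    exact f.isConstructible_image .univ
  have : IrreducibleSpace (splitTorus k n).left := by
    change IrreducibleSpace (PrimeSpectrum (AddMonoidAlgebra k (Fin n → ℤ)))
    infer_instance
  let ξ := genericPoint (splitTorus k n).left
  obtain ⟨O, hO, hξ, h⟩ := exists_inter_closure_subset hC (f ξ)
  have h : O ∩ closure {f ξ} ⊆ Set.range f := by
    rcases h with h | h
    · exact h
    · exact absurd ⟨ξ, rfl⟩ (h ⟨hξ, subset_closure rfl⟩)
  have hcl (z) : f z ∈ closure {f ξ} :=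
    (((genericPoint_spec (splitTorus k n).left).specializes trivial).map
      f.continuous).mem_closure
  refine ⟨Pt.toSpace ⁻¹' O, hO.preimage Pt.continuous_toSpace, ?_, fun y hy hy' ↦ ?_⟩
  · obtain ⟨z, hz⟩ := exists_pt_mem (X := splitTorus k n) (hO.preimage f.continuous).isLocallyClosed
      ⟨ξ, hξ⟩
    obtain ⟨t, rfl⟩ := torusPt_surjective z
    refine ⟨t, ?_⟩
    rw [← map_orbitMap]
    exact hz
  · have h1 : y.toSpace ∈ closure {f ξ} := by
      refine closure_minimal ?_ (isClosed_closure.preimage Pt.continuous_toSpace) hy'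
      rintro _ ⟨t, rfl⟩
      have h2 : (tpt j t * x).toSpace ∈ closure {f ξ} := by
        rw [← map_orbitMap]
        exact hcl _
      exact h2
    obtain ⟨z, hz⟩ := h ⟨hy, h1⟩
    obtain ⟨w, hw⟩ := exists_pt_mem (X := splitTorus k n)
      ((isClosed_toSpace y).preimage f.continuous).isLocallyClosed ⟨z, hz⟩
    obtain ⟨t, rfl⟩ := torusPt_surjective w
    refine ⟨t, ?_⟩
    rw [← map_orbitMap]
    refine Pt.toSpace_injective ?_
    rw [Pt.toSpace_map]
    exact (Set.mem_singleton_iff.1 hw).symm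

/-- The condition `m * z ∈ Z` is closed in `m` and holds on the dense torus. -/
lemma mul_mem_of_torus_stable (j : splitTorus k n ⟶ M) [IsMonHom j] [IsOpenImmersion j.left]
    {Z : Set (Pt M)} (hZ : IsClosed Z) {z : Pt M} (h : ∀ t, tpt j t * z ∈ Z) (m : Pt M) :
    m * z ∈ Z := by
  obtain ⟨C, hC, rfl⟩ := (Pt.isInducing_toSpace.isClosed_iff).1 hZ
  let W : M.left.Opens := (rightMul z).left ⁻¹ᵁ ⟨Cᶜ, hC.isOpen_compl⟩
  have hW (y : Pt M) : y.toSpace ∈ W ↔ (y * z).toSpace ∉ C := by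
    rw [← rightMul_apply]
    rfl
  by_contra hm
  obtain ⟨t, ht⟩ := (generic_mem_of_nonempty j W ⟨m.toSpace, (hW m).2 hm⟩).exists_point
  exact (hW _).1 ht (h t)

/-- There is an idempotent which lies in every nonempty closed subset stable under the torus. -/
lemma exists_idempotent (j : splitTorus k n ⟶ M) [IsMonHom j] [IsOpenImmersion j.left] :
    ∃ e : Pt M, e * e = e ∧ ∀ Z : Set (Pt M), IsClosed Z → Z.Nonempty →
      (∀ z ∈ Z, ∀ t, tpt j t * z ∈ Z) → e ∈ Z := by
  have := isNoetherian_left (M := M)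
  have : TopologicalSpace.NoetherianSpace (Pt M) := Pt.isInducing_toSpace.noetherianSpace
  have wf : WellFounded fun C C' : TopologicalSpace.Closeds (Pt M) ↦ C < C' := wellFounded_lt
  -- In a minimal nonempty closed stable subset all orbits are dense. The orbit of `x` contains a
  -- relatively open part of `Z`, which the dense orbit of `x * x` meets; so `x * x` is a torus
  -- multiple of `x`, and rescaling `x` gives an idempotent.
  obtain ⟨Z, ⟨hne, hst⟩, hmin⟩ := wf.has_min
    {C : TopologicalSpace.Closeds (Pt M) | (C : Set (Pt M)).Nonempty ∧
      ∀ z ∈ C, ∀ t, tpt j t * z ∈ C} ⟨⊤, ⟨1, trivial⟩, fun _ _ _ ↦ trivial⟩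
  have hmin' (Z' : Set (Pt M)) (hZ' : IsClosed Z') (hne' : (Z' ∩ Z).Nonempty)
      (hst' : ∀ z ∈ Z', ∀ t, tpt j t * z ∈ Z') : (Z : Set (Pt M)) ⊆ Z' := by
    have h1 := hmin ⟨Z' ∩ Z, hZ'.inter Z.2⟩ ⟨hne', fun z hz t ↦ ⟨hst' z hz.1 t, hst z hz.2 t⟩⟩
    intro z hz
    by_contra hzZ
    refine h1 (lt_of_le_of_ne (fun _ hy ↦ hy.2) fun h ↦ hzZ ?_)
    have : z ∈ (⟨Z' ∩ Z, hZ'.inter Z.2⟩ : TopologicalSpace.Closeds (Pt M)) := by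
      rw [h]
      exact hz
    exact this.1
  have hdense (x : Pt M) (hx : x ∈ Z) :
      (Z : Set (Pt M)) ⊆ closure (Set.range fun t ↦ tpt j t * x) := by
    refine hmin' _ isClosed_closure ⟨x, subset_closure ⟨1, by simp⟩, hx⟩ fun z hz t ↦ ?_
    have hcont : Continuous fun y : Pt M ↦ tpt j t * y := by
      simp_rw [← map_leftMul]
      exact Pt.continuous_map _
    refine closure_mono ?_ (image_closure_subset_closure_image hcont ⟨z, hz, rfl⟩)
    rintro _ ⟨_, ⟨t', rfl⟩, rfl⟩
    exact ⟨t * t', by simp only [map_mul, _root_.mul_assoc]⟩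
  have hmul (m z : Pt M) (hz : z ∈ Z) : m * z ∈ Z :=
    mul_mem_of_torus_stable j Z.2 (fun t ↦ hst z hz t) m
  obtain ⟨x, hx⟩ := hne
  obtain ⟨O, hO, ⟨t₁, ht₁⟩, h⟩ := exists_orbit_open j x
  obtain ⟨_, hyO, t₂, rfl⟩ := mem_closure_iff.1 (hdense (x * x) (hmul x x hx) (hst x hx t₁)) O hO ht₁
  obtain ⟨t₃, ht₃⟩ := h _ hyO (hdense x hx (hst _ (hmul x x hx) t₂))
  obtain ⟨s₂, hs₂, hs₂'⟩ := exists_tpt_mul_eq_one j t₂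
  obtain ⟨s₃, hs₃, hs₃'⟩ := exists_tpt_mul_eq_one j t₃
  have hxx : x * x = tpt j s₂ * tpt j t₃ * x := by
    rw [_root_.mul_assoc, ← ht₃, ← _root_.mul_assoc, hs₂', _root_.one_mul]
  have hinv : tpt j s₃ * tpt j t₂ * (tpt j s₂ * tpt j t₃) = 1 := by
    rw [_root_.mul_assoc, ← _root_.mul_assoc (tpt j t₂), hs₂, _root_.one_mul, hs₃']
  refine ⟨tpt j s₃ * tpt j t₂ * x, ?_, fun Z' hZ' hne' hst' ↦ ?_⟩
  · rw [_root_.mul_assoc, ← _root_.mul_assoc x, pt_comm j x, _root_.mul_assoc _ x x, hxx,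
      ← _root_.mul_assoc (tpt j s₃ * tpt j t₂) (tpt j s₂ * tpt j t₃), hinv, _root_.one_mul]
  · obtain ⟨y, hy⟩ := hne'
    -- The product `x * y` lies in both `Z` and `Z'`, so minimality gives `Z ⊆ Z'`.
    have h1 : x * y ∈ Z' := mul_mem_of_torus_stable j hZ' (fun t ↦ hst' y hy t) x
    have h2 : x * y ∈ Z := by
      rw [pt_comm j]
      exact hmul y x hx
    refine hmin' Z' hZ' ⟨_, h1, h2⟩ hst' (hmul _ _ hx)

end Idempotent

end ToricMonoid

namespace ToricMonoid

/-! ### Germs of sections and rational functions. -/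

section Germs

variable {k : Type u} [Field k] {X : Over (Spec (.of k))}

/-- The germ of a section at a point. -/
noncomputable def germAt (x : X.left) (W : X.left.Opens) (hx : x ∈ W) :
    Γ(X.left, W) →+* X.left.presheaf.stalk x :=
  (X.left.presheaf.germ W x hx).hom

lemma germAt_res (x : X.left) {W W' : X.left.Opens} (hW : W' ≤ W) (hx : x ∈ W')
    (s : Γ(X.left, W)) :
    germAt x W' hx (X.left.presheaf.map (homOfLE hW).op s) = germAt x W (hW hx) s :=
  X.left.presheaf.germ_res_apply (homOfLE hW) x hx s

lemma exists_germAt_eq {x : X.left} (r : X.left.presheaf.stalk x) :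
    ∃ (W : X.left.Opens) (hx : x ∈ W) (s : Γ(X.left, W)), germAt x W hx s = r :=
  X.left.presheaf.exists_germ_eq r

noncomputable instance stalkAlgebra (x : X.left) : Algebra k (X.left.presheaf.stalk x) :=
  ((germAt x ⊤ trivial).comp (scalar X ⊤)).toAlgebra

lemma germAt_scalar (x : X.left) (W : X.left.Opens) (hx : x ∈ W) (c : k) :
    germAt x W hx (scalar X W c) = algebraMap k (X.left.presheaf.stalk x) c := by
  rw [← scalar_res (le_top : W ≤ ⊤), germAt_res]
  rfl

/-- The endomorphism of the stalk at a fixed point of an endomorphism. -/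
noncomputable def stalkEndo (f : X ⟶ X) (x : X.left) (hx : f.left x = x) :
    X.left.presheaf.stalk x →ₐ[k] X.left.presheaf.stalk x where
  toRingHom := (X.left.presheaf.stalkSpecializes (specializes_of_eq hx) ≫ f.left.stalkMap x).hom
  commutes' c := by
    have h1 := X.left.presheaf.germ_stalkSpecializes (U := ⊤) trivial (specializes_of_eq hx)
    have h2 := f.left.germ_stalkMap ⊤ x trivial
    have h3 := congr($h1 ≫ f.left.stalkMap x)
    rw [h2, Category.assoc] at h3
    have h4 := congr($(h3).hom (scalar X ⊤ c))
    refine h4.trans ?_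
    have h5 : f.left.app ⊤ (scalar X ⊤ c) = scalar X ⊤ c := by
      rw [Scheme.Hom.app_eq_appLE]
      exact appLE_scalar f (W := ⊤) (V := ⊤) le_rfl c
    exact congr(X.left.presheaf.germ ⊤ x trivial $h5)

lemma stalkEndo_germAt (f : X ⟶ X) (x : X.left) (hx : f.left x = x) (W : X.left.Opens)
    (hxW : x ∈ W) (V : X.left.Opens) (hxV : x ∈ V) (e : V ≤ f.left ⁻¹ᵁ W) (s : Γ(X.left, W)) :
    stalkEndo f x hx (germAt x W hxW s) = germAt x V hxV (f.left.appLE W V e s) := by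
  have hxW' : f.left x ∈ W := by rwa [hx]
  have h1 := X.left.presheaf.germ_stalkSpecializes (U := W) hxW (specializes_of_eq hx)
  have h2 := f.left.germ_stalkMap W x hxW'
  have h3 := congr($h1 ≫ f.left.stalkMap x)
  rw [h2, Category.assoc] at h3
  refine (congr($(h3).hom s)).trans ?_
  exact (X.left.presheaf.germ_res_apply (homOfLE e) x hxV (f.left.app W s)).symm

lemma isUnit_germAt [IsAlgClosed k] (x : Pt X) (W : X.left.Opens) (hx : x.toSpace ∈ W)
    (s : Γ(X.left, W)) : IsUnit (germAt x.toSpace W hx s) ↔ x.ev W hx s ≠ 0 := by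
  rw [← x.mem_basicOpen]
  exact (Scheme.mem_basicOpen _ _ _ _).symm

end Germs

section FunctionField

variable {k : Type u} [Field k] {X : Over (Spec (.of k))} [IsIntegral X.left]

lemma genericPoint_mem {W : X.left.Opens} (hW : (W : Set X.left).Nonempty) :
    genericPoint X.left ∈ W :=
  ((genericPoint_spec X.left).mem_open_set_iff W.2).2 (by simpa using hW)

/-- The rational function defined by a section. -/
noncomputable abbrev toRat (W : X.left.Opens) (hW : (W : Set X.left).Nonempty) :
    Γ(X.left, W) →+* X.left.functionField :=
  germAt (genericPoint X.left) W (genericPoint_mem hW)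

lemma algebraMap_germAt (x : X.left) (W : X.left.Opens) (hx : x ∈ W) (s : Γ(X.left, W)) :
    algebraMap (X.left.presheaf.stalk x) X.left.functionField (germAt x W hx s) =
      toRat W ⟨x, hx⟩ s :=
  X.left.presheaf.germ_stalkSpecializes_apply hx
    ((genericPoint_spec X.left).specializes trivial) s

instance (x : X.left) :
    IsScalarTower k (X.left.presheaf.stalk x) X.left.functionField :=
  .of_algebraMap_eq fun c ↦ (algebraMap_germAt x ⊤ trivial (scalar X ⊤ c)).symm

lemma toRat_injective (W : X.left.Opens) (hW : (W : Set X.left).Nonempty) :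
    Function.Injective (toRat W hW) :=
  germ_injective_of_isIntegral X.left (genericPoint X.left) (genericPoint_mem hW)

lemma inter_nonempty {W W' : X.left.Opens} (hW : (W : Set X.left).Nonempty)
    (hW' : (W' : Set X.left).Nonempty) : ((W ⊓ W' : X.left.Opens) : Set X.left).Nonempty :=
  nonempty_preirreducible_inter W.2 W'.2 hW hW'

variable [IsAlgClosed k] [LocallyOfFiniteType X.hom]

/-- Two sections define the same rational function if they agree on some nonempty open subset. -/
lemma toRat_eq {W W' O : X.left.Opens} (hO : (O : Set X.left).Nonempty)
    (hW : (W : Set X.left).Nonempty) (hW' : (W' : Set X.left).Nonempty)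
    (s : Γ(X.left, W)) (s' : Γ(X.left, W'))
    (h : ∀ (x : Pt X) (hx : x.toSpace ∈ W) (hx' : x.toSpace ∈ W'), x.toSpace ∈ O →
      x.ev W hx s = x.ev W' hx' s') : toRat W hW s = toRat W' hW' s' := by
  have h1 : O ⊓ (W ⊓ W') ≤ W := inf_le_right.trans inf_le_left
  have h2 : O ⊓ (W ⊓ W') ≤ W' := inf_le_right.trans inf_le_right
  have hne := inter_nonempty hO (inter_nonempty hW hW')
  have h3 : X.left.presheaf.map (homOfLE h1).op s = X.left.presheaf.map (homOfLE h2).op s' := by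
    refine section_ext fun x hx ↦ ?_
    rw [Pt.ev_res, Pt.ev_res]
    exact h x _ _ hx.1
  unfold toRat
  rw [← germAt_res _ h1 (genericPoint_mem hne), ← germAt_res _ h2 (genericPoint_mem hne), h3]

/-- Sections defining the same rational function have the same values. -/
lemma ev_eq_of_toRat_eq {W W' : X.left.Opens}
    (hW : (W : Set X.left).Nonempty) (hW' : (W' : Set X.left).Nonempty)
    (s : Γ(X.left, W)) (s' : Γ(X.left, W')) (h : toRat W hW s = toRat W' hW' s')
    (x : Pt X) (hx : x.toSpace ∈ W) (hx' : x.toSpace ∈ W') : x.ev W hx s = x.ev W' hx' s' := by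
  have hne : ((W ⊓ W' : X.left.Opens) : Set X.left).Nonempty := ⟨x.toSpace, hx, hx'⟩
  unfold toRat at h
  rw [← germAt_res _ inf_le_left (genericPoint_mem hne),
    ← germAt_res _ inf_le_right (genericPoint_mem hne)] at h
  have := toRat_injective (W ⊓ W') hne h
  have hxx : x.toSpace ∈ W ⊓ W' := ⟨hx, hx'⟩
  rw [← x.ev_res inf_le_left hxx, this, x.ev_res inf_le_right hxx]

lemma ev_eq_of_dense {W W' O : X.left.Opens} (hO : (O : Set X.left).Nonempty)
    (s : Γ(X.left, W)) (s' : Γ(X.left, W'))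
    (h : ∀ (x : Pt X) (hx : x.toSpace ∈ W) (hx' : x.toSpace ∈ W'), x.toSpace ∈ O →
      x.ev W hx s = x.ev W' hx' s')
    (x : Pt X) (hx : x.toSpace ∈ W) (hx' : x.toSpace ∈ W') : x.ev W hx s = x.ev W' hx' s' :=
  ev_eq_of_toRat_eq ⟨_, hx⟩ ⟨_, hx'⟩ s s' (toRat_eq hO _ _ s s' h) x hx hx'

end FunctionField

/-! ### The action of the torus on rational functions. -/

section ToricField

variable {k : Type u} [Field k] [IsAlgClosed k] {n : ℕ} {M : Over (Spec (.of k))} [MonObj M]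
  [IsSeparated M.hom] [LocallyOfFiniteType M.hom] [IsIntegral M.left]

lemma ev_leftMul (y x : Pt M) {W V : M.left.Opens} (e : V ≤ (leftMul y).left ⁻¹ᵁ W)
    (hx : x.toSpace ∈ V) (s : Γ(M.left, W)) :
    x.ev V hx ((leftMul y).left.appLE W V e s) =
      (y * x).ev W (by rw [← leftMul_apply]; exact e hx) s := by
  rw [Pt.ev_map]
  congr 1
  simp only [map_leftMul]

lemma leftMul_leftMul (x y : Pt M) : leftMul x ≫ leftMul y = leftMul (y * x) := by
  refine hom_ext_of_pt ⊤ dense_univ fun z _ ↦ ?_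
  rw [map_leftMul, _root_.mul_assoc, ← map_leftMul (y := x), ← map_leftMul]
  exact (Category.assoc _ _ _).symm

lemma leftMul_one : leftMul (1 : Pt M) = 𝟙 M := by
  refine hom_ext_of_pt ⊤ dense_univ fun z _ ↦ ?_
  rw [map_leftMul, _root_.one_mul]
  exact (Category.comp_id _).symm

variable (j : splitTorus k n ⟶ M) [IsMonHom j] [IsOpenImmersion j.left]

lemma leftMul_genericPoint (t : Multiplicative (Fin n → ℤ) →* k) :
    (leftMul (tpt j t)).left (genericPoint M.left) = genericPoint M.left := by
  obtain ⟨t', ht, -⟩ := exists_tpt_mul_eq_one j t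
  refine ((genericPoint_spec M.left).eq ?_).symm
  rw [isGenericPoint_def, ← Set.univ_subset_iff]
  intro z _
  have hz : (leftMul (tpt j t)).left ((leftMul (tpt j t')).left z) = z := by
    have := leftMul_leftMul (tpt j t') (tpt j t)
    rw [ht, leftMul_one] at this
    exact congr($(this).left z)
  rw [← hz]
  exact (((genericPoint_spec M.left).specializes (Set.mem_univ
    ((leftMul (tpt j t')).left z))).map (leftMul (tpt j t)).left.continuous).mem_closure

/-- The action of the torus on rational functions. -/
noncomputable def torusAct (t : Multiplicative (Fin n → ℤ) →* k) :
    M.left.functionField →ₐ[k] M.left.functionField :=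
  stalkEndo (leftMul (tpt j t)) (genericPoint M.left) (leftMul_genericPoint j t)

lemma torusAct_toRat (t : Multiplicative (Fin n → ℤ) →* k) {W V : M.left.Opens}
    (hW : (W : Set M.left).Nonempty) (hV : (V : Set M.left).Nonempty)
    (e : V ≤ (leftMul (tpt j t)).left ⁻¹ᵁ W) (s : Γ(M.left, W)) :
    torusAct j t (toRat W hW s) = toRat V hV ((leftMul (tpt j t)).left.appLE W V e s) :=
  stalkEndo_germAt _ _ _ _ _ _ _ _ _

lemma torusOpen_nonempty : (torusOpen j : Set M.left).Nonempty := ⟨_, tpt_mem j 1⟩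

/-- The rational function defined by a character. -/
noncomputable def charRat : Multiplicative (Fin n → ℤ) →* M.left.functionField :=
  ((toRat (torusOpen j) (torusOpen_nonempty j)).comp (torusSec j)).toMonoidHom.comp
    (AddMonoidAlgebra.of k (Fin n → ℤ))

lemma torusSec_algebraMap (c : k) : torusSec j (algebraMap k _ c) = scalar M _ c := by
  refine section_ext fun x hx ↦ ?_
  obtain ⟨t, rfl⟩ := exists_tpt j hx
  rw [tpt_ev, Pt.ev_scalar, AlgHom.commutes]
  rfl

lemma lift_charRat (a : AddMonoidAlgebra k (Fin n → ℤ)) :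
    AddMonoidAlgebra.lift k M.left.functionField _ (charRat j) a =
      toRat (torusOpen j) (torusOpen_nonempty j) (torusSec j a) := by
  let f : AddMonoidAlgebra k (Fin n → ℤ) →ₐ[k] M.left.functionField :=
    { (toRat (torusOpen j) (torusOpen_nonempty j)).comp (torusSec j) with
      commutes' := fun c ↦ by
        change toRat (torusOpen j) (torusOpen_nonempty j) (torusSec j (algebraMap k _ c)) = _
        rw [torusSec_algebraMap]
        exact germAt_scalar _ _ _ _ }
  change _ = f a
  congr 1
  refine AddMonoidAlgebra.algHom_ext (fun χ ↦ ?_) (Subsingleton.elim _ _)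
  rw [AddMonoidAlgebra.lift_single, one_smul]
  rfl

lemma isAffineOpen_torusOpen : IsAffineOpen (torusOpen j) := by
  have : IsAffineOpen (⊤ : (splitTorus k n).left.Opens) := by
    have : IsAffine (splitTorus k n).left := by
      change IsAffine (Spec _)
      infer_instance
    exact isAffineOpen_top _
  exact this.image_of_isOpenImmersion j.left

lemma isToricField : IsToricField (charRat j) (torusAct j) where
  rho_ch t χ := by
    change torusAct j t (toRat (torusOpen j) (torusOpen_nonempty j) (torusSec j _)) = _
    have hV : (torusOpen j) ≤ (leftMul (tpt j t)).left ⁻¹ᵁ (torusOpen j) := by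
      refine opens_le_of_pt fun x hx ↦ ?_
      obtain ⟨t', rfl⟩ := exists_tpt j hx
      have h := tpt_mem j (t * t')
      rw [map_mul, ← leftMul_apply] at h
      exact h
    rw [torusAct_toRat j t (torusOpen_nonempty j) (torusOpen_nonempty j) hV, Algebra.smul_def,
      ← germAt_scalar _ _ (genericPoint_mem (torusOpen_nonempty j))]
    change _ = toRat (torusOpen j) (torusOpen_nonempty j) _ *
      toRat (torusOpen j) (torusOpen_nonempty j) (torusSec j _)
    rw [← map_mul]
    congr 1
    refine section_ext fun x hx ↦ ?_
    obtain ⟨t', rfl⟩ := exists_tpt j hx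
    rw [ev_leftMul, map_mul, Pt.ev_scalar, tpt_ev]
    simp only [← map_mul]
    rw [tpt_ev, AddMonoidAlgebra.of_apply, AddMonoidAlgebra.lift_single,
      AddMonoidAlgebra.lift_single]
    simp
  exists_fraction θ := by
    have : Nonempty (torusOpen j) := ⟨⟨_, tpt_mem j 1⟩⟩
    have := functionField_isFractionRing_of_isAffineOpen M.left _ (isAffineOpen_torusOpen j)
    obtain ⟨a, b, hb, hab⟩ := IsFractionRing.div_surjective (A := Γ(M.left, torusOpen j)) θ
    obtain ⟨a, rfl⟩ := (torusSec_bijective j).2 a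
    obtain ⟨b, rfl⟩ := (torusSec_bijective j).2 b
    have hb' : toRat (torusOpen j) (torusOpen_nonempty j) (torusSec j b) ≠ 0 := fun h0 ↦
      nonZeroDivisors.ne_zero hb (toRat_injective _ _ (h0.trans (map_zero _).symm))
    refine ⟨a, b, ?_, ?_⟩
    · rwa [lift_charRat]
    · rw [lift_charRat, lift_charRat, ← hab]
      exact div_mul_cancel₀ _ hb'

end ToricField

end ToricMonoid

namespace ToricMonoid

/-! ### Characters regular at the idempotent, and their extension to the monoid. -/

section Characters

variable {k : Type u} [Field k] [IsAlgClosed k] {n : ℕ} {M : Over (Spec (.of k))} [MonObj M]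
  [IsSeparated M.hom] [LocallyOfFiniteType M.hom] [IsIntegral M.left]
  (j : splitTorus k n ⟶ M) [IsMonHom j] [IsOpenImmersion j.left]

lemma charRat_eq (χ : Fin n → ℤ) : charRat j (.ofAdd χ) =
    toRat (torusOpen j) (torusOpen_nonempty j) (torusSec j (AddMonoidAlgebra.single χ 1)) := rfl

lemma tpt_ev_single (t : Multiplicative (Fin n → ℤ) →* k) (χ : Fin n → ℤ) :
    (tpt j t).ev (torusOpen j) (tpt_mem j t) (torusSec j (AddMonoidAlgebra.single χ 1)) =
      t (.ofAdd χ) := by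
  rw [tpt_ev, AddMonoidAlgebra.lift_single, one_smul]

lemma ev_tpt_of_toRat_eq {W : M.left.Opens} (hW : (W : Set M.left).Nonempty) (s : Γ(M.left, W))
    (χ : Fin n → ℤ) (h : toRat W hW s = charRat j (.ofAdd χ))
    (t : Multiplicative (Fin n → ℤ) →* k) (ht : (tpt j t).toSpace ∈ W) :
    (tpt j t).ev W ht s = t (.ofAdd χ) := by
  rw [← tpt_ev_single j]
  exact ev_eq_of_toRat_eq hW (torusOpen_nonempty j) s _ (h.trans (charRat_eq j χ)) _ _ _

lemma toRat_eq_charRat {W : M.left.Opens} (hW : (W : Set M.left).Nonempty) (s : Γ(M.left, W))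
    (χ : Fin n → ℤ)
    (h : ∀ t (ht : (tpt j t).toSpace ∈ W), (tpt j t).ev W ht s = t (.ofAdd χ)) :
    toRat W hW s = charRat j (.ofAdd χ) := by
  rw [charRat_eq]
  refine toRat_eq (torusOpen_nonempty j) _ _ _ _ fun x hx hx' _ ↦ ?_
  obtain ⟨t, rfl⟩ := exists_tpt j hx'
  rw [h, tpt_ev_single]

/-- The characters of the torus which are regular at a given point. -/
noncomputable def charMonoid (x : M.left) : AddSubmonoid (Fin n → ℤ) where
  carrier := {χ | ∃ r : M.left.presheaf.stalk x,
    algebraMap _ M.left.functionField r = charRat j (.ofAdd χ)}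
  zero_mem' := ⟨1, by rw [map_one, ofAdd_zero, map_one]⟩
  add_mem' := by
    rintro _ _ ⟨r, hr⟩ ⟨r', hr'⟩
    exact ⟨r * r', by rw [map_mul, hr, hr', ofAdd_add, map_mul]⟩

variable {e : Pt M} (hst : ∀ Z : Set (Pt M), IsClosed Z → Z.Nonempty →
      (∀ z ∈ Z, ∀ t, tpt j t * z ∈ Z) → e ∈ Z)

/-- The points whose whole orbit avoids `W` form a closed stable subset; if it were nonempty, it
would contain `e`, which lies in `W`. -/
lemma exists_translate_mem
    (hst : ∀ Z : Set (Pt M), IsClosed Z → Z.Nonempty → (∀ z ∈ Z, ∀ t, tpt j t * z ∈ Z) → e ∈ Z)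
    {W : M.left.Opens} (hW : e.toSpace ∈ W) (y : Pt M) :
    ∃ t, (tpt j t * y).toSpace ∈ W := by
  by_contra! H
  have h := hst {y | ∀ t, (tpt j t * y).toSpace ∉ W} ?_ ⟨y, H⟩ ?_ 1
  · rw [map_one, _root_.one_mul] at h
    exact h hW
  · simp only [Set.ofPred_forall]
    refine isClosed_iInter fun t ↦ ?_
    have h1 : {y : Pt M | (tpt j t * y).toSpace ∉ W} =
        (Pt.map (leftMul (tpt j t))) ⁻¹' (Pt.toSpace ⁻¹' (W : Set M.left)ᶜ) := by
      ext y
      rw [Set.mem_preimage, map_leftMul]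
      rfl
    rw [h1]
    exact (W.2.isClosed_compl.preimage Pt.continuous_toSpace).preimage (Pt.continuous_map _)
  · intro z hz t t'
    rw [← _root_.mul_assoc, ← map_mul]
    exact hz _

/-- The translate of a section by an element of the torus, normalised by a character. -/
lemma exists_translate_section (χ : Fin n → ℤ) (t : Multiplicative (Fin n → ℤ) →* k)
    {W : M.left.Opens} (s : Γ(M.left, W)) :
    ∃ s' : Γ(M.left, (leftMul (tpt j t)).left ⁻¹ᵁ W),
      ∀ (y : Pt M) (hy : y.toSpace ∈ (leftMul (tpt j t)).left ⁻¹ᵁ W),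
        y.ev _ hy s' = t (.ofAdd (-χ)) *
          (tpt j t * y).ev W (by rw [← leftMul_apply]; exact hy) s := by
  refine ⟨scalar M _ (t (.ofAdd (-χ))) * (leftMul (tpt j t)).left.appLE W _ le_rfl s,
    fun y hy ↦ ?_⟩
  rw [map_mul, Pt.ev_scalar, ev_leftMul]

/-- A character which is regular at the idempotent `e` extends to a global section. -/
lemma exists_char_section
    (hst : ∀ Z : Set (Pt M), IsClosed Z → Z.Nonempty → (∀ z ∈ Z, ∀ t, tpt j t * z ∈ Z) → e ∈ Z)
    {χ : Fin n → ℤ} (hχ : χ ∈ charMonoid j e.toSpace) :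
    ∃ s : Γ(M.left, ⊤), ∀ t, (tpt j t).ev ⊤ (TopologicalSpace.Opens.mem_top _) s = t (.ofAdd χ) := by
  obtain ⟨r, hr⟩ := hχ
  obtain ⟨W, hW, s, rfl⟩ := exists_germAt_eq r
  rw [algebraMap_germAt] at hr
  have hs := ev_tpt_of_toRat_eq j _ s χ hr
  -- The value at `y` is `χ(t)⁻¹ χ(t y)` for any torus point `t` moving `y` into `W`. Independence
  -- of `t` is clear on the torus and extends by density.
  choose τ hτ using exists_translate_mem j hst hW
  have hnorm (t t' : Multiplicative (Fin n → ℤ) →* k) :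
      t (.ofAdd (-χ)) * (t * t') (.ofAdd χ) = t' (.ofAdd χ) := by
    rw [MonoidHom.mul_apply, ← _root_.mul_assoc, ← map_mul, ← ofAdd_add, neg_add_cancel, ofAdd_zero,
      map_one, _root_.one_mul]
  have key (t t' : Multiplicative (Fin n → ℤ) →* k) (y : Pt M) (h : (tpt j t * y).toSpace ∈ W)
      (h' : (tpt j t' * y).toSpace ∈ W) : t (.ofAdd (-χ)) * (tpt j t * y).ev W h s =
        t' (.ofAdd (-χ)) * (tpt j t' * y).ev W h' s := by
    obtain ⟨s₁, hs₁⟩ := exists_translate_section j χ t s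
    obtain ⟨s₂, hs₂⟩ := exists_translate_section j χ t' s
    rw [← leftMul_apply] at h h'
    rw [← hs₁ y h, ← hs₂ y h']
    refine ev_eq_of_dense (torusOpen_nonempty j) s₁ s₂ (fun x hx hx' hxO ↦ ?_) y h h'
    obtain ⟨t₀, rfl⟩ := exists_tpt j hxO
    rw [hs₁, hs₂]
    simp only [← map_mul]
    rw [hs, hs, hnorm, hnorm]
  obtain ⟨s', hs'⟩ := exists_section (X := M) ⊤
    (fun y ↦ τ y (.ofAdd (-χ)) * (tpt j (τ y) * y).ev W (hτ y) s) (fun x _ ↦ by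
      obtain ⟨s₁, hs₁⟩ := exists_translate_section j χ (τ x) s
      refine ⟨_, s₁, ?_, fun y hy _ ↦ (hs₁ y hy).trans (key _ _ _ _ _)⟩
      have h := hτ x
      rw [← leftMul_apply] at h
      exact h)
  refine ⟨s', fun t ↦ ?_⟩
  rw [hs']
  simp only [← map_mul]
  rw [hs, hnorm]

end Characters

/-! ### Values of characters, and the local ring at the idempotent. -/

section Data

variable {k : Type u} [Field k] [IsAlgClosed k] {n : ℕ} {M : Over (Spec (.of k))} [MonObj M]

/-- An idempotent of the monoid which lies in every nonempty closed subset stable under the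
torus. -/
structure IsCore (j : splitTorus k n ⟶ M) [IsMonHom j] (e : Pt M) : Prop where
  idem : e * e = e
  mem_of_stable : ∀ Z : Set (Pt M), IsClosed Z → Z.Nonempty → (∀ z ∈ Z, ∀ t, tpt j t * z ∈ Z) →
    e ∈ Z

variable [IsSeparated M.hom] [LocallyOfFiniteType M.hom] [IsIntegral M.left]
  {j : splitTorus k n ⟶ M} [IsMonHom j] [IsOpenImmersion j.left] {e : Pt M}

lemma IsCore.exists_section (h : IsCore j e) (χ : charMonoid j e.toSpace) :
    ∃ s : Γ(M.left, ⊤), ∀ t, (tpt j t).ev ⊤ (TopologicalSpace.Opens.mem_top _) s = t (.ofAdd (χ : Fin n → ℤ)) :=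
  exists_char_section j h.mem_of_stable χ.2

lemma ev_leftMul_top (y x : Pt M) (s : Γ(M.left, ⊤)) :
    x.ev ⊤ (TopologicalSpace.Opens.mem_top _) ((leftMul y).left.appLE ⊤ ⊤ le_top s) =
      (y * x).ev ⊤ (TopologicalSpace.Opens.mem_top _) s :=
  ev_leftMul y x _ _ s

/-- Global sections agreeing on the torus are equal. -/
lemma global_ext (j : splitTorus k n ⟶ M) [IsMonHom j] [IsOpenImmersion j.left]
    {s s' : Γ(M.left, ⊤)} (h : ∀ t, (tpt j t).ev ⊤ (TopologicalSpace.Opens.mem_top _) s = (tpt j t).ev ⊤ (TopologicalSpace.Opens.mem_top _) s') :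
    s = s' := by
  refine section_ext fun x hx ↦ ev_eq_of_dense (torusOpen_nonempty j) s s' (fun y _ _ hy ↦ ?_) x _ _
  obtain ⟨t, rfl⟩ := exists_tpt j hy
  exact h t

/-- The global section given by a character which is regular at `e`. -/
noncomputable def charSec (h : IsCore j e) :
    Multiplicative (charMonoid j e.toSpace) →* Γ(M.left, ⊤) where
  toFun χ := (h.exists_section χ.toAdd).choose
  map_one' := global_ext j fun t ↦
    ((h.exists_section _).choose_spec t).trans ((map_one t).trans (map_one _).symm)
  map_mul' χ χ' := global_ext j fun t ↦
    ((h.exists_section _).choose_spec t).trans ((map_mul t _ _).trans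
      ((congrArg₂ (· * ·) ((h.exists_section _).choose_spec t).symm
        ((h.exists_section _).choose_spec t).symm).trans (map_mul _ _ _).symm))

lemma ev_charSec (h : IsCore j e) (t : Multiplicative (Fin n → ℤ) →* k)
    (χ : Multiplicative (charMonoid j e.toSpace)) :
    (tpt j t).ev ⊤ (TopologicalSpace.Opens.mem_top _) (charSec h χ) = t (.ofAdd (χ.toAdd : Fin n → ℤ)) :=
  (h.exists_section χ.toAdd).choose_spec t

/-- The value of a character at a point. -/
noncomputable def charVal (h : IsCore j e) (x : Pt M) :
    Multiplicative (charMonoid j e.toSpace) →* k :=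
  (x.ev ⊤ (TopologicalSpace.Opens.mem_top _) : Γ(M.left, ⊤) →+* k).toMonoidHom.comp (charSec h)

lemma charVal_tpt (h : IsCore j e) (t : Multiplicative (Fin n → ℤ) →* k)
    (χ : Multiplicative (charMonoid j e.toSpace)) :
    charVal h (tpt j t) χ = t (.ofAdd (χ.toAdd : Fin n → ℤ)) := ev_charSec h t χ

/-- As functions of `x` both sides are global sections, so the identity is checked on the torus.
Using commutativity, the same density argument then extends it to all products of points. -/
lemma charVal_mul_tpt (h : IsCore j e) (t : Multiplicative (Fin n → ℤ) →* k) (x : Pt M)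
    (χ : Multiplicative (charMonoid j e.toSpace)) :
    charVal h (tpt j t * x) χ = charVal h (tpt j t) χ * charVal h x χ := by
  have h1 : (leftMul (tpt j t)).left.appLE ⊤ ⊤ le_top (charSec h χ) =
      scalar M ⊤ (charVal h (tpt j t) χ) * charSec h χ := by
    refine global_ext j fun t' ↦ ?_
    rw [map_mul, Pt.ev_scalar, ev_leftMul_top]
    change charVal h (tpt j t * tpt j t') χ = _ * charVal h _ χ
    rw [← map_mul, charVal_tpt, charVal_tpt, charVal_tpt, MonoidHom.mul_apply]
  have h2 := congr(x.ev ⊤ (TopologicalSpace.Opens.mem_top _) $h1)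
  rw [map_mul, Pt.ev_scalar, ev_leftMul_top] at h2
  exact h2

lemma appLE_charSec (h : IsCore j e) (x : Pt M)
    (χ : Multiplicative (charMonoid j e.toSpace)) :
    (leftMul x).left.appLE ⊤ ⊤ le_top (charSec h χ) =
      scalar M ⊤ (charVal h x χ) * charSec h χ := by
  refine global_ext j fun t' ↦ ?_
  rw [map_mul, Pt.ev_scalar, ev_leftMul_top]
  change charVal h (x * tpt j t') χ = _ * charVal h _ χ
  rw [pt_comm j, charVal_mul_tpt, _root_.mul_comm]

lemma charVal_mul (h : IsCore j e) (x y : Pt M) : charVal h (x * y) = charVal h x * charVal h y := by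
  refine MonoidHom.ext fun χ ↦ ?_
  have h2 := congr(y.ev ⊤ (TopologicalSpace.Opens.mem_top _) $(appLE_charSec h x χ))
  rw [map_mul, Pt.ev_scalar, ev_leftMul_top] at h2
  exact h2

lemma charVal_one (h : IsCore j e) : charVal h (1 : Pt M) = 1 := by
  refine MonoidHom.ext fun χ ↦ ?_
  rw [← map_one (tpt j), charVal_tpt]
  rfl

/-- The germ at `e` of the section given by a character. -/
noncomputable def charGerm (h : IsCore j e) :
    Multiplicative (charMonoid j e.toSpace) →* M.left.presheaf.stalk e.toSpace :=
  (germAt e.toSpace ⊤ (TopologicalSpace.Opens.mem_top _)).toMonoidHom.comp (charSec h)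

/-- The endomorphism of the local ring at the idempotent `e` given by multiplication by `e`. -/
noncomputable def idemAct (h : IsCore j e) :
    M.left.presheaf.stalk e.toSpace →ₐ[k] M.left.presheaf.stalk e.toSpace :=
  stalkEndo (leftMul e) e.toSpace (by rw [leftMul_apply, h.idem])

lemma idemAct_germAt (h : IsCore j e) {W V : M.left.Opens}
    (hW : e.toSpace ∈ W) (hV : e.toSpace ∈ V)
    (le : V ≤ (leftMul e).left ⁻¹ᵁ W) (s : Γ(M.left, W)) :
    idemAct h (germAt e.toSpace W hW s) =
      germAt e.toSpace V hV ((leftMul e).left.appLE W V le s) :=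
  stalkEndo_germAt _ _ _ _ _ _ _ _ _

lemma algebraMap_charGerm (h : IsCore j e) (χ : charMonoid j e.toSpace) :
    algebraMap _ M.left.functionField (charGerm h (.ofAdd χ)) =
      charRat j (.ofAdd (χ : Fin n → ℤ)) := by
  refine (algebraMap_germAt _ _ _ _).trans (toRat_eq_charRat j _ _ _ fun t ht ↦ ?_)
  exact ev_charSec h t (.ofAdd χ)

lemma idemAct_charGerm (h : IsCore j e) (χ : Multiplicative (charMonoid j e.toSpace)) :
    idemAct h (charGerm h χ) = algebraMap k _ (charVal h e χ) * charGerm h χ := by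
  refine (idemAct_germAt h (W := ⊤) (V := ⊤) (TopologicalSpace.Opens.mem_top _)
    (TopologicalSpace.Opens.mem_top _) le_top _).trans ?_
  rw [appLE_charSec, map_mul, germAt_scalar]
  rfl

lemma charVal_idem (h : IsCore j e) (χ : Multiplicative (charMonoid j e.toSpace)) :
    charVal h e χ = 0 ∨ charVal h e χ = 1 := by
  have h1 : charVal h e χ * charVal h e χ = charVal h e χ := by
    have h2 := congr(charVal h $(h.idem) χ)
    rwa [charVal_mul] at h2
  rcases eq_or_ne (charVal h e χ) 0 with h0 | h0
  · exact .inl h0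
  · exact .inr (mul_left_cancel₀ h0 (h1.trans (_root_.mul_one _).symm))

lemma charVal_core_eq_one (h : IsCore j e) {s : charMonoid j e.toSpace}
    (hs : -(s : Fin n → ℤ) ∈ charMonoid j e.toSpace) : charVal h e (.ofAdd s) = 1 := by
  refine (charVal_idem h _).resolve_left fun h0 ↦ ?_
  have h1 : charVal h e (.ofAdd s) * charVal h e (.ofAdd ⟨_, hs⟩) = 1 := by
    rw [← map_mul, ← ofAdd_add, show s + ⟨_, hs⟩ = 0 from Subtype.ext (add_neg_cancel _),
      ofAdd_zero, map_one]
  rw [h0, zero_mul] at h1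
  exact zero_ne_one h1

/-- A character with nonzero value at `e` has an invertible germ there, so its inverse is regular at
`e` too. -/
lemma charVal_core_eq_zero (h : IsCore j e) {s : charMonoid j e.toSpace}
    (hs : -(s : Fin n → ℤ) ∉ charMonoid j e.toSpace) : charVal h e (.ofAdd s) = 0 := by
  by_contra h0
  obtain ⟨u, hu⟩ := (isUnit_germAt e ⊤ (TopologicalSpace.Opens.mem_top _) (charSec h (.ofAdd s))).2 h0
  refine hs ⟨(u⁻¹ : Units _), ?_⟩
  have h1 : algebraMap _ M.left.functionField (u : M.left.presheaf.stalk e.toSpace) =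
      charRat j (.ofAdd (s : Fin n → ℤ)) := by
    rw [hu]
    exact algebraMap_charGerm h s
  have h2 : charRat j (.ofAdd (s : Fin n → ℤ)) * charRat j (.ofAdd (-(s : Fin n → ℤ))) = 1 := by
    rw [← map_mul, ← ofAdd_add, add_neg_cancel, ofAdd_zero, map_one]
  have h3 : algebraMap _ M.left.functionField (u : M.left.presheaf.stalk e.toSpace) *
      algebraMap _ M.left.functionField ((u⁻¹ : Units _) : M.left.presheaf.stalk e.toSpace) = 1 := by
    rw [← map_mul, Units.mul_inv, map_one]
  rw [h1] at h3
  exact mul_left_cancel₀ (left_ne_zero_of_mul_eq_one h2) (h3.trans h2.symm)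

lemma IsCore.tpt_mul_comm (x y z : Pt M) (j : splitTorus k n ⟶ M) [IsMonHom j]
    [IsOpenImmersion j.left] : x * (y * z) = y * (x * z) := by
  rw [← _root_.mul_assoc, ← _root_.mul_assoc, pt_comm j x]

lemma exists_mem_translate (W : M.left.Opens) (hW : e.toSpace ∈ W) (j : splitTorus k n ⟶ M)
    [IsMonHom j] [IsOpenImmersion j.left] :
    Generic fun t ↦ (tpt j t * e).toSpace ∈ W := by
  have h1 (x : Pt M) : x.toSpace ∈ (rightMul e).left ⁻¹ᵁ W ↔ (x * e).toSpace ∈ W := by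
    rw [← rightMul_apply]
    rfl
  refine (generic_mem_of_nonempty j ((rightMul e).left ⁻¹ᵁ W) ⟨(1 : Pt M).toSpace, ?_⟩).mono
    fun t ht ↦ (h1 _).1 ht
  refine (h1 1).2 ?_
  rwa [_root_.one_mul]

/-- For `generic_mem`: a translate of a germ is regular at `e` as soon as `t * e` lies in its
domain. For `generic_unit`: invariance gives `s(t * e) = s(t)`, which is nonzero for generic `t`, so
the translated germ does not vanish at `e`. -/
lemma isLocalToric (h : IsCore j e) :
    IsLocalToric (charMonoid j e.toSpace) (charRat j) (torusAct j) (charGerm h) (idemAct h) where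
  toIsToricField := isToricField j
  sigma_eq := algebraMap_charGerm h
  mem_of χ r hr := ⟨r, hr⟩
  pi_sigma s hs := by rw [idemAct_charGerm, charVal_core_eq_one h hs, map_one, _root_.one_mul]
  pi_sigma_eq_zero s hs := by rw [idemAct_charGerm, charVal_core_eq_zero h hs, map_zero, zero_mul]
  pi_pi r := by
    obtain ⟨W, hW, s, rfl⟩ := exists_germAt_eq r
    have hV : e.toSpace ∈ (leftMul e).left ⁻¹ᵁ W := by
      change (leftMul e).left _ ∈ W
      rwa [leftMul_apply, h.idem]
    have hV' : e.toSpace ∈ (leftMul e).left ⁻¹ᵁ ((leftMul e).left ⁻¹ᵁ W) := by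
      change (leftMul e).left _ ∈ (leftMul e).left ⁻¹ᵁ W
      rwa [leftMul_apply, h.idem]
    rw [idemAct_germAt h hW hV le_rfl, idemAct_germAt h hV hV' le_rfl]
    apply IsFractionRing.injective _ M.left.functionField
    rw [algebraMap_germAt, algebraMap_germAt]
    refine toRat_eq (torusOpen_nonempty j) _ _ _ _ fun x hx hx' _ ↦ ?_
    rw [ev_leftMul, ev_leftMul, ev_leftMul]
    simp only [← _root_.mul_assoc, h.idem]
  generic_mem r := by
    obtain ⟨W, hW, s, rfl⟩ := exists_germAt_eq r
    refine (exists_mem_translate W hW j).mono fun t ht ↦ ?_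
    have hV : e.toSpace ∈ (leftMul e).left ⁻¹ᵁ W := by
      change (leftMul e).left _ ∈ W
      rwa [leftMul_apply, h.idem]
    have ht' : e.toSpace ∈ (leftMul (tpt j t)).left ⁻¹ᵁ W := by
      change (leftMul (tpt j t)).left _ ∈ W
      rwa [leftMul_apply]
    have hV' : e.toSpace ∈ (leftMul e).left ⁻¹ᵁ ((leftMul (tpt j t)).left ⁻¹ᵁ W) := by
      change (leftMul e).left _ ∈ (leftMul (tpt j t)).left ⁻¹ᵁ W
      rwa [leftMul_apply, h.idem]
    have ht'' : e.toSpace ∈ (leftMul (tpt j t)).left ⁻¹ᵁ ((leftMul e).left ⁻¹ᵁ W) := by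
      change (leftMul e).left ((leftMul (tpt j t)).left _) ∈ W
      rwa [leftMul_apply, leftMul_apply, IsCore.tpt_mul_comm _ _ _ j, h.idem]
    refine ⟨germAt _ _ ht' ((leftMul (tpt j t)).left.appLE W _ le_rfl s), ?_, ?_⟩
    · rw [algebraMap_germAt, algebraMap_germAt, torusAct_toRat j t ⟨_, hW⟩ ⟨_, ht'⟩ le_rfl]
    · rw [idemAct_germAt h hW hV le_rfl, idemAct_germAt h ht' hV' le_rfl, algebraMap_germAt,
        algebraMap_germAt, torusAct_toRat j t ⟨_, hV⟩ ⟨_, ht''⟩ le_rfl]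
      refine toRat_eq (torusOpen_nonempty j) _ _ _ _ fun x hx hx' _ ↦ ?_
      rw [ev_leftMul, ev_leftMul, ev_leftMul, ev_leftMul]
      simp only [IsCore.tpt_mul_comm (tpt j t) _ _ j]
  generic_unit r hr hπ := by
    obtain ⟨W, hW, s, rfl⟩ := exists_germAt_eq r
    have hV : e.toSpace ∈ (leftMul e).left ⁻¹ᵁ W := by
      change (leftMul e).left _ ∈ W
      rwa [leftMul_apply, h.idem]
    have hs : ((M.left.basicOpen s : M.left.Opens) : Set M.left).Nonempty := by
      rw [Set.nonempty_iff_ne_empty]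
      intro h0
      have h1 : M.left.basicOpen s = ⊥ := TopologicalSpace.Opens.ext h0
      rw [basicOpen_eq_bot_iff] at h1
      rw [h1, map_zero] at hr
      exact hr rfl
    refine ((exists_mem_translate W hW j).and (generic_mem_of_nonempty j _ hs)).mono ?_
    rintro t ⟨ht, hts⟩
    have htW := M.left.basicOpen_le s hts
    have ht' : e.toSpace ∈ (leftMul (tpt j t)).left ⁻¹ᵁ W := by
      change (leftMul (tpt j t)).left _ ∈ W
      rwa [leftMul_apply]
    have htV : (tpt j t).toSpace ∈ (leftMul e).left ⁻¹ᵁ W := by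
      change (leftMul e).left _ ∈ W
      rwa [leftMul_apply, pt_comm j]
    refine ⟨germAt _ _ ht' ((leftMul (tpt j t)).left.appLE W _ le_rfl s), ?_, ?_⟩
    · rw [isUnit_germAt, ev_leftMul]
      rw [(tpt j t).mem_basicOpen W htW] at hts
      rw [idemAct_germAt h hW hV le_rfl] at hπ
      have h1 := congr(algebraMap _ M.left.functionField $hπ)
      rw [algebraMap_germAt, algebraMap_germAt] at h1
      have h2 := ev_eq_of_toRat_eq _ _ _ _ h1 (tpt j t) htV htW
      rw [ev_leftMul] at h2
      rw [← h2] at hts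
      simpa only [pt_comm j e] using hts
    · rw [algebraMap_germAt, algebraMap_germAt, torusAct_toRat j t ⟨_, hW⟩ ⟨_, ht'⟩ le_rfl]

end Data

end ToricMonoid

namespace ToricMonoid

/-! ### Morphisms into affine open subsets. -/

section AffineTarget

lemma toSpecΓ_Spec (Ω : CommRingCat.{u}) :
    (Spec Ω).toSpecΓ = Spec.map (Scheme.ΓSpecIso Ω).hom := by
  rw [← Scheme.isoSpec_hom, Scheme.isoSpec_Spec_hom]

lemma comp_toSpecΓ {Z : Scheme.{u}} {Ω : CommRingCat.{u}} (V : Z.Opens) (y : Spec Ω ⟶ V.toScheme)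
    (h : ⊤ ≤ (y ≫ V.ι) ⁻¹ᵁ V) :
    y ≫ V.toSpecΓ = Spec.map (CommRingCat.ofHom (secVal (y ≫ V.ι) V h)) := by
  have h1 := Scheme.Opens.toSpecΓ_SpecMap_appLE (y ≫ V.ι) _ _ h
  have h2 : (y ≫ V.ι).resLE V ⊤ h = (⊤ : (Spec Ω).Opens).ι ≫ y := by
    rw [← cancel_mono V.ι, Scheme.Hom.resLE_comp_ι, Category.assoc]
  have : IsIso (⊤ : (Spec Ω).Opens).ι := inferInstanceAs (IsIso (Spec Ω).topIso.hom)
  rw [h2, Scheme.Opens.toSpecΓ_top, Category.assoc, Category.assoc, cancel_epi, toSpecΓ_Spec,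
    ← Spec.map_comp] at h1
  exact h1.symm

/-- A morphism to an open subscheme. -/
lemma exists_lift_opens {Z : Scheme.{u}} {Ω : CommRingCat.{u}} (V : Z.Opens) (p : Spec Ω ⟶ Z)
    (h : ⊤ ≤ p ⁻¹ᵁ V) : ∃ y : Spec Ω ⟶ V.toScheme, y ≫ V.ι = p := by
  refine ⟨IsOpenImmersion.lift V.ι p ?_, IsOpenImmersion.lift_fac _ _ _⟩
  rintro _ ⟨z, rfl⟩
  rw [Scheme.Opens.range_ι]
  exact h (TopologicalSpace.Opens.mem_top z)

/-- A morphism landing in an affine open subset is determined by the pull-backs of sections. -/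
lemma eq_specMap_fromSpec {Z : Scheme.{u}} {Ω : CommRingCat.{u}} {U : Z.Opens}
    (hU : IsAffineOpen U) (p : Spec Ω ⟶ Z) (h : ⊤ ≤ p ⁻¹ᵁ U) :
    Spec.map (CommRingCat.ofHom (secVal p U h)) ≫ hU.fromSpec = p := by
  obtain ⟨y, rfl⟩ := exists_lift_opens U p h
  rw [← comp_toSpecΓ, Category.assoc, hU.toSpecΓ_fromSpec]

variable {k : Type u} [Field k] {X : Over (Spec (.of k))}

lemma toSpecΓ_scalar (V : X.left.Opens) :
    V.toSpecΓ ≫ Spec.map (CommRingCat.ofHom (scalar X V)) = V.ι ≫ X.hom := by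
  have h1 := Scheme.Opens.toSpecΓ_SpecMap_appLE X.hom ⊤ V le_top
  have h2 : Spec.map (CommRingCat.ofHom (scalar X V)) = Spec.map (X.hom.appLE ⊤ V le_top) ≫
      Spec.map (Scheme.ΓSpecIso (.of k)).inv := (Spec.map_comp _ _).symm ▸ rfl
  rw [h2, ← Category.assoc, h1, Scheme.Opens.toSpecΓ_top, Category.assoc, Category.assoc]
  have h3 : (Spec (.of k)).toSpecΓ ≫ Spec.map (Scheme.ΓSpecIso (.of k)).inv = 𝟙 _ := by
    rw [toSpecΓ_Spec, ← Spec.map_comp, Iso.inv_hom_id, Spec.map_id]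
  rw [h3, Category.comp_id]
  exact Scheme.Hom.resLE_comp_ι _ _

lemma fromSpec_comp_hom {U : X.left.Opens} (hU : IsAffineOpen U) :
    hU.fromSpec ≫ X.hom = Spec.map (CommRingCat.ofHom (scalar X U)) := by
  have h := toSpecΓ_scalar (X := X) U
  rw [← hU.isoSpec_inv_ι, Category.assoc, ← h, IsAffineOpen.isoSpec_inv_toSpecΓ_assoc]

lemma range_fromSpec_le {U : X.left.Opens} (hU : IsAffineOpen U) {Z : Scheme.{u}}
    (g : Z ⟶ Spec Γ(X.left, U)) (z : Z) : (g ≫ hU.fromSpec) z ∈ U := by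
  have h := hU.range_fromSpec
  change _ ∈ (U : Set X.left)
  rw [← h]
  exact ⟨g z, rfl⟩

end AffineTarget

section Extension

variable {k : Type u} [Field k] [IsAlgClosed k] {X : Over (Spec (.of k))}
  [IsSeparated X.hom] [LocallyOfFiniteType X.hom] [IsIntegral X.left]

/-- If the pull-backs of the sections of an affine open subset `U` under an endomorphism extend to
`V`, then the endomorphism maps `V` to `U`. -/
lemma le_preimage_of_sections_extend (f : X ⟶ X) {U V O : X.left.Opens} (hU : IsAffineOpen U)
    (hO : ((O ⊓ V : X.left.Opens) : Set X.left).Nonempty) (hOU : O ⊓ V ≤ f.left ⁻¹ᵁ U)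
    (h : ∀ a : Γ(X.left, U), ∃ g : Γ(X.left, V), ∀ (x : Pt X) (hx : x.toSpace ∈ O ⊓ V),
      x.ev V hx.2 g = (Pt.map f x).ev U (hOU hx) a) : V ≤ f.left ⁻¹ᵁ U := by
  choose g hg using h
  have hext {s s' : Γ(X.left, V)} (hs : ∀ (x : Pt X) (hx : x.toSpace ∈ O ⊓ V),
      x.ev V hx.2 s = x.ev V hx.2 s') : s = s' :=
    section_ext fun x hx ↦ ev_eq_of_dense hO s s' (fun y _ _ hy ↦ hs y hy) x _ _
  -- The extended sections form a ring homomorphism, hence a morphism from `V` to `U`. It agrees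
  -- with `f` on the dense subset `O ⊓ V`, therefore on all of `V`.
  let Φ : Γ(X.left, U) →+* Γ(X.left, V) :=
    { toFun := g
      map_one' := hext fun x hx ↦ by rw [hg _ x hx, map_one, map_one]
      map_zero' := hext fun x hx ↦ by rw [hg _ x hx, map_zero, map_zero]
      map_add' := fun a b ↦ hext fun x hx ↦ by
        rw [hg _ x hx, map_add, map_add, hg _ x hx, hg _ x hx]
      map_mul' := fun a b ↦ hext fun x hx ↦ by
        rw [hg _ x hx, map_mul, map_mul, hg _ x hx, hg _ x hx] }
  have hΦ : Φ.comp (scalar X U) = scalar X V := RingHom.ext fun c ↦ hext fun x hx ↦ by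
    rw [Pt.ev_scalar]
    exact (hg _ x hx).trans (Pt.ev_scalar _ _ _ _)
  let ψ : V.toScheme ⟶ X.left := V.toSpecΓ ≫ Spec.map (CommRingCat.ofHom Φ) ≫ hU.fromSpec
  have hψ : ψ ≫ X.hom = V.ι ≫ X.hom := by
    rw [← toSpecΓ_scalar]
    simp only [ψ, Category.assoc]
    rw [fromSpec_comp_hom, ← Spec.map_comp, ← CommRingCat.ofHom_comp, hΦ]
  let XV : Over (Spec (.of k)) := Over.mk (V.ι ≫ X.hom)
  let ι' : XV ⟶ X := Over.homMk V.ι rfl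
  let ψ' : XV ⟶ X := Over.homMk ψ hψ
  have : LocallyOfFiniteType XV.hom := by
    change LocallyOfFiniteType (V.ι ≫ X.hom)
    infer_instance
  have : Nonempty V := by
    obtain ⟨x, hx⟩ := hO
    exact ⟨⟨x, hx.2⟩⟩
  have : IsIntegral XV.left := by
    change IsIntegral V.toScheme
    infer_instance
  have hι (y : Pt XV) : (Pt.map ι' y).toSpace ∈ V := by
    rw [Pt.toSpace_map]
    exact Subtype.prop (p := (· ∈ V)) y.toSpace
  have heq : ι' ≫ f = ψ' := by
    refine hom_ext_of_pt (ι'.left ⁻¹ᵁ O) (TopologicalSpace.Opens.isOpen _ |>.dense ?_)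
      fun y hy ↦ ?_
    · obtain ⟨x, hx⟩ := hO
      exact ⟨⟨x, hx.2⟩, hx.1⟩
    · set x := Pt.map ι' y with hx
      have hxO : x.toSpace ∈ O ⊓ V := ⟨hy, hι y⟩
      refine Pt.ext_hom ?_
      have h1 : (Pt.map ψ' y).hom = y.hom ≫ ψ := rfl
      have h2 : (Pt.map (ι' ≫ f) y).hom = (Pt.map f x).hom := by
        rw [Pt.hom_map, Pt.hom_map, hx, Pt.hom_map, Over.comp_left, Category.assoc]
      have h3 : y.hom ≫ V.toSpecΓ = Spec.map (CommRingCat.ofHom (x.ev V hxO.2)) :=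
        comp_toSpecΓ V y.hom (x.le_preimage hxO.2)
      have h4 : (x.ev V hxO.2).comp Φ = (Pt.map f x).ev U (hOU hxO) :=
        RingHom.ext fun a ↦ hg a x hxO
      rw [h1, h2]
      simp only [ψ]
      rw [reassoc_of% h3, ← Spec.map_comp_assoc, ← CommRingCat.ofHom_comp, h4]
      exact (eq_specMap_fromSpec hU _ ((Pt.map f x).le_preimage (hOU hxO))).symm
  intro x hx
  have h1 := congr($(heq).left ⟨x, hx⟩)
  change f.left x ∈ U
  have h2 : f.left x = ψ ⟨x, hx⟩ := h1
  rw [h2]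
  exact range_fromSpec_le hU (V.toSpecΓ ≫ Spec.map (CommRingCat.ofHom Φ)) _

end Extension

end ToricMonoid

namespace ToricMonoid

/-! ### Weight components, and pull-backs of sections as fractions. -/

section Components

variable {k : Type*} [Field k] [IsAlgClosed k] {n : ℕ}

/-- A subspace containing generic translates of a sum of weight vectors contains its
components. -/
lemma Generic.apply_mem {V : Type*} [AddCommGroup V] [Module k V] {v : (Fin n → ℤ) →₀ V}
    (N : Submodule k V)
    (h : Generic fun t : Multiplicative (Fin n → ℤ) →* k ↦
      v.sum (fun χ w ↦ t (.ofAdd χ) • w) ∈ N) (χ : Fin n → ℤ) : v χ ∈ N := by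
  have h0 : v.mapRange N.mkQ (map_zero _) = 0 := by
    refine Generic.eq_zero_of_sum (k := k) (h.mono fun t ht ↦ ?_)
    rw [← Submodule.Quotient.mk_eq_zero, ← Submodule.mkQ_apply, map_finsuppSum] at ht
    rw [Finsupp.sum_mapRange_index (by simp), ← ht]
    exact Finsupp.sum_congr fun χ _ ↦ (map_smul _ _ _).symm
  have := DFunLike.congr_fun h0 χ
  rwa [Finsupp.mapRange_apply, Finsupp.zero_apply, Submodule.mkQ_apply,
    Submodule.Quotient.mk_eq_zero] at this

lemma map_lift {A B G : Type*} [CommRing A] [CommRing B] [Algebra k A] [Algebra k B]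
    [AddCommMonoid G] (f : A →ₐ[k] B) (F : Multiplicative G →* A) (a : AddMonoidAlgebra k G) :
    f (AddMonoidAlgebra.lift k A G F a) =
      AddMonoidAlgebra.lift k B G ((f : A →* B).comp F) a := by
  rw [AddMonoidAlgebra.lift_apply, AddMonoidAlgebra.lift_apply, map_finsuppSum]
  exact Finsupp.sum_congr fun χ _ ↦ map_smul _ _ _

end Components

section Sections

variable {k : Type u} [Field k] {X : Over (Spec (.of k))}

noncomputable instance secAlgebra (W : X.left.Opens) : Algebra k Γ(X.left, W) :=
  (scalar X W).toAlgebra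

/-- Evaluation at a point as a homomorphism of algebras. -/
noncomputable def Pt.evₐ (x : Pt X) (W : X.left.Opens) (hx : x.toSpace ∈ W) :
    Γ(X.left, W) →ₐ[k] k :=
  { x.ev W hx with commutes' := x.ev_scalar W hx }

/-- The germ as a homomorphism of algebras. -/
noncomputable def germAtₐ (x : X.left) (W : X.left.Opens) (hx : x ∈ W) :
    Γ(X.left, W) →ₐ[k] X.left.presheaf.stalk x :=
  { germAt x W hx with commutes' := germAt_scalar x W hx }

lemma finiteType_sections [LocallyOfFiniteType X.hom] {U : X.left.Opens} (hU : IsAffineOpen U) :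
    Algebra.FiniteType k Γ(X.left, U) := by
  have h1 := X.hom.finiteType_appLE (U := ⊤) (isAffineOpen_top _) hU le_top
  have h2 : RingHom.FiniteType (Scheme.ΓSpecIso (.of k)).inv.hom :=
    RingHom.FiniteType.of_surjective _
      (ConcreteCategory.bijective_of_isIso (Scheme.ΓSpecIso (.of k)).inv).2
  exact h1.comp h2

lemma exists_mul_res_eq_one {Z : Scheme.{u}} {V : Z.Opens} {s : Γ(Z, ⊤)}
    (h : V ≤ Z.basicOpen s) :
    ∃ s' : Γ(Z, V), Z.presheaf.map (homOfLE le_top).op s * s' = 1 := by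
  have hu : IsUnit (Z.presheaf.map (homOfLE (Z.basicOpen_le s)).op s) :=
    RingedSpace.isUnit_res_basicOpen _ s
  obtain ⟨s', hs'⟩ := hu.exists_right_inv
  refine ⟨Z.presheaf.map (homOfLE h).op s', ?_⟩
  have h1 := congr(Z.presheaf.map (homOfLE h).op $hs')
  rw [map_mul, map_one] at h1
  refine Eq.trans ?_ h1
  congr 1
  exact (congr($(Z.presheaf.map_comp (homOfLE (Z.basicOpen_le s)).op (homOfLE h).op) s))

variable [IsAlgClosed k] [IsSeparated X.hom] [LocallyOfFiniteType X.hom] [IsIntegral X.left]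

/-- If the pull-backs of generators of the sections of an affine open subset `U` under an
endomorphism are fractions on `V`, then the endomorphism maps `V` to `U`. -/
lemma le_preimage_of_fractions (f : X ⟶ X) {U V O : X.left.Opens} (hU : IsAffineOpen U)
    (hO : ((O ⊓ V : X.left.Opens) : Set X.left).Nonempty) (hOU : O ⊓ V ≤ f.left ⁻¹ᵁ U)
    {F : Set Γ(X.left, U)} (hF : Algebra.adjoin k F = ⊤)
    (h : ∀ a ∈ F, ∃ s b : Γ(X.left, ⊤), V ≤ X.left.basicOpen s ∧
      ∀ (x : Pt X) (hx : x.toSpace ∈ O ⊓ V),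
        x.ev ⊤ (TopologicalSpace.Opens.mem_top _) s * (Pt.map f x).ev U (hOU hx) a =
          x.ev ⊤ (TopologicalSpace.Opens.mem_top _) b) :
    V ≤ f.left ⁻¹ᵁ U := by
  refine le_preimage_of_sections_extend f hU hO hOU fun a ↦ ?_
  have ha : a ∈ Algebra.adjoin k F := by
    rw [hF]
    exact Algebra.mem_top
  induction ha using Algebra.adjoin_induction with
  | mem a ha =>
    obtain ⟨s, b, hs, hsb⟩ := h a ha
    obtain ⟨s', hs'⟩ := exists_mul_res_eq_one hs
    refine ⟨X.left.presheaf.map (homOfLE le_top).op b * s', fun x hx ↦ ?_⟩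
    have h1 := congr(x.ev V hx.2 $hs')
    rw [map_mul, map_one, x.ev_res] at h1
    rw [map_mul, x.ev_res, ← hsb x hx, mul_right_comm, h1, _root_.one_mul]
  | algebraMap c => exact ⟨scalar X V c, fun x hx ↦ (x.ev_scalar _ _ _).trans
      ((Pt.map f x).ev_scalar _ _ _).symm⟩
  | add a b _ _ ha hb =>
    obtain ⟨g, hg⟩ := ha
    obtain ⟨g', hg'⟩ := hb
    exact ⟨g + g', fun x hx ↦ by rw [map_add, map_add, hg x hx, hg' x hx]⟩
  | mul a b _ _ ha hb =>
    obtain ⟨g, hg⟩ := ha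
    obtain ⟨g', hg'⟩ := hb
    exact ⟨g * g', fun x hx ↦ by rw [map_mul, map_mul, hg x hx, hg' x hx]⟩

lemma ev_mul_eq_of_germ {y : X.left} {W : X.left.Opens} (hy : y ∈ W) {s b : Γ(X.left, ⊤)}
    {w : Γ(X.left, W)} (h : germAt y ⊤ (TopologicalSpace.Opens.mem_top _) s * germAt y W hy w =
      germAt y ⊤ (TopologicalSpace.Opens.mem_top _) b) (x : Pt X) (hx : x.toSpace ∈ W) :
    x.ev ⊤ (TopologicalSpace.Opens.mem_top _) s * x.ev W hx w =
      x.ev ⊤ (TopologicalSpace.Opens.mem_top _) b := by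
  rw [← germAt_res y (le_top : W ≤ ⊤) hy, ← map_mul] at h
  have h1 := congr(algebraMap _ X.left.functionField $h)
  rw [algebraMap_germAt, algebraMap_germAt] at h1
  have h2 := ev_eq_of_toRat_eq _ _ _ _ h1 x hx (TopologicalSpace.Opens.mem_top _)
  rwa [map_mul, x.ev_res] at h2

end Sections

/-! ### Global sections form the monoid algebra. -/

section GlobalSections

variable {k : Type u} [Field k] [IsAlgClosed k] {n : ℕ} {M : Over (Spec (.of k))} [MonObj M]
  [IsSeparated M.hom] [LocallyOfFiniteType M.hom] [IsIntegral M.left]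
  {j : splitTorus k n ⟶ M} [IsMonHom j] [IsOpenImmersion j.left] {e : Pt M}

/-- The global section given by an element of the monoid algebra. -/
noncomputable def monSec (h : IsCore j e) :
    AddMonoidAlgebra k (charMonoid j e.toSpace) →ₐ[k] Γ(M.left, ⊤) :=
  AddMonoidAlgebra.lift k Γ(M.left, ⊤) (charMonoid j e.toSpace) (charSec h)

lemma ev_monSec (h : IsCore j e) (x : Pt M) (a : AddMonoidAlgebra k (charMonoid j e.toSpace)) :
    x.ev ⊤ (TopologicalSpace.Opens.mem_top _) (monSec h a) =
      AddMonoidAlgebra.lift k k (charMonoid j e.toSpace) (charVal h x) a :=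
  map_lift (x.evₐ ⊤ (TopologicalSpace.Opens.mem_top _)) (charSec h) a

lemma germ_monSec (h : IsCore j e) (a : AddMonoidAlgebra k (charMonoid j e.toSpace)) :
    germAt e.toSpace ⊤ (TopologicalSpace.Opens.mem_top _) (monSec h a) =
      AddMonoidAlgebra.lift k _ (charMonoid j e.toSpace) (charGerm h) a :=
  map_lift (germAtₐ e.toSpace ⊤ (TopologicalSpace.Opens.mem_top _)) (charSec h) a

/-- On the torus `f` is a combination of characters. All translates of `f` are regular at `e`, hence
so are its weight components, and the characters that occur belong to `charMonoid`. -/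
lemma exists_monSec_eq (h : IsCore j e) (f : Γ(M.left, ⊤)) : ∃ a, monSec h a = f := by
  classical
  obtain ⟨b, hb⟩ := (torusSec_bijective j).2 (M.left.presheaf.map (homOfLE le_top).op f)
  have hne : ((⊤ : M.left.Opens) : Set M.left).Nonempty := ⟨_, TopologicalSpace.Opens.mem_top e.toSpace⟩
  have hev (t) : (tpt j t).ev ⊤ (TopologicalSpace.Opens.mem_top _) f =
      AddMonoidAlgebra.lift k k _ t b := by
    rw [← tpt_ev j t, hb, Pt.ev_res]
  have hfb : toRat ⊤ hne f = AddMonoidAlgebra.lift k _ _ (charRat j) b := by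
    rw [lift_charRat, hb]
    exact (germAt_res (k := k) (X := M) _ le_top _ f).symm
  let v : (Fin n → ℤ) →₀ M.left.functionField := Finsupp.onFinset b.coeff.support
    (fun χ ↦ b.coeff χ • charRat j (.ofAdd χ))
    (by intro ψ h; simp only [Finsupp.mem_support_iff]; rintro h0; simp [h0] at h)
  let N : Submodule k M.left.functionField :=
    LinearMap.range (IsScalarTower.toAlgHom k (M.left.presheaf.stalk e.toSpace)
      M.left.functionField).toLinearMap
  have hv (χ : Fin n → ℤ) : v χ ∈ N := by
    refine Generic.apply_mem (k := k) N (Generic.of_forall fun (t : Multiplicative (Fin n → ℤ) →* k) ↦ ?_) χ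
    refine ⟨germAt e.toSpace ⊤ (TopologicalSpace.Opens.mem_top _)
      ((leftMul (tpt j t)).left.appLE ⊤ ⊤ le_top f), ?_⟩
    refine (algebraMap_germAt _ _ _ _).trans ?_
    rw [← torusAct_toRat j t hne hne le_top f, hfb, (isToricField j).rho_lift,
      Finsupp.onFinset_sum _ (by simp)]
    rfl
  have hS (χ : Fin n → ℤ) (hχ : b.coeff χ ≠ 0) : χ ∈ charMonoid j e.toSpace := by
    obtain ⟨r, hr⟩ := hv χ
    refine ⟨(b.coeff χ)⁻¹ • r, ?_⟩
    have hr' : algebraMap _ M.left.functionField r = b.coeff χ • charRat j (.ofAdd χ) := hr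
    rw [Algebra.smul_def, map_mul, ← IsScalarTower.algebraMap_apply, ← Algebra.smul_def, hr',
      smul_smul, inv_mul_cancel₀ hχ, one_smul]
  refine ⟨.ofCoeff (b.coeff.subtypeDomain _), global_ext j fun t ↦ ?_⟩
  rw [ev_monSec, hev, AddMonoidAlgebra.lift_apply, AddMonoidAlgebra.lift_apply]
  refine (Finsupp.sum_congr (g2 := fun (s : charMonoid j e.toSpace) c ↦
    (fun (χ : Fin n → ℤ) c ↦ c • t (.ofAdd χ)) s.1 c) fun s _ ↦ ?_).trans
    (Finsupp.sum_subtypeDomain_index (p := fun χ ↦ χ ∈ charMonoid j e.toSpace)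
      (h := fun (χ : Fin n → ℤ) c ↦ c • t (.ofAdd χ))
      fun χ hχ ↦ hS χ (Finsupp.mem_support_iff.1 hχ))
  rw [charVal_tpt]
  rfl

/-- A neighbourhood of `1` and `e` defined by a function is mapped to an affine open subset by
multiplication with `e`. -/
lemma exists_affine_of_core (h : IsCore j e) :
    ∃ (U : M.left.Opens) (q : AddMonoidAlgebra k (charMonoid j e.toSpace)), IsAffineOpen U ∧
      M.left.basicOpen (monSec h q) ≤ (leftMul e).left ⁻¹ᵁ U ∧
      (1 : Pt M).toSpace ∈ M.left.basicOpen (monSec h q) ∧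
      e.toSpace ∈ M.left.basicOpen (monSec h q) := by
  classical
  obtain ⟨_, ⟨U, hU, rfl⟩, heU, -⟩ := M.left.isBasis_affineOpens.exists_subset_of_mem_open
    (Set.mem_univ e.toSpace) isOpen_univ
  have hloc := isLocalToric h
  have := finiteType_sections (X := M) hU
  obtain ⟨F, hF⟩ := this.out
  have heO : e.toSpace ∈ (leftMul e).left ⁻¹ᵁ U := by
    change (leftMul e).left _ ∈ U
    rwa [leftMul_apply, h.idem]
  -- The germs of `x ↦ a(e * x)` are fixed by `idemAct`, so they are fractions with fixed
  -- denominators. The product `q` of the denominators over generators of `Γ(U)` satisfies `q(e * x)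
  -- = q(x)`, so translating by a point where `q` does not vanish brings both `1` and `e` into its
  -- nonvanishing locus.
  let r (a : Γ(M.left, U)) := germAt e.toSpace _ heO ((leftMul e).left.appLE U _ le_rfl a)
  have hr (a) : idemAct h (r a) = r a := by
    rw [show r a = idemAct h (germAt e.toSpace U heU a) from
      (idemAct_germAt h heU heO le_rfl a).symm, hloc.pi_pi]
  choose s b hs hsπ hsb using fun a ↦ hloc.exists_fixed_fraction (hr a)
  let q := ∏ a ∈ F, s a
  have hq0 : AddMonoidAlgebra.lift k _ _ (charGerm h) q ≠ 0 := by
    rw [map_prod]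
    exact Finset.prod_ne_zero_iff.2 fun a _ ↦ hs a
  have hqπ : idemAct h (AddMonoidAlgebra.lift k _ _ (charGerm h) q) =
      AddMonoidAlgebra.lift k _ _ (charGerm h) q := by
    rw [map_prod, map_prod]
    exact Finset.prod_congr rfl fun a _ ↦ hsπ a
  let V := M.left.basicOpen (monSec h q)
  have hV : (V : Set M.left).Nonempty := by
    rw [Set.nonempty_iff_ne_empty]
    intro h0
    have h1 : V = ⊥ := TopologicalSpace.Opens.ext h0
    rw [basicOpen_eq_bot_iff] at h1
    rw [← germ_monSec, h1, map_zero] at hq0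
    exact hq0 rfl
  have hVU : V ≤ (leftMul e).left ⁻¹ᵁ U := by
    refine le_preimage_of_fractions (leftMul e) hU (inter_nonempty ⟨_, heO⟩ hV) inf_le_left hF
      fun a ha ↦ ⟨monSec h (s a), monSec h (b a), ?_, fun x hx ↦ ?_⟩
    · have h1 : q = s a * ∏ a ∈ F.erase a, s a := (Finset.mul_prod_erase F s ha).symm
      change M.left.basicOpen _ ≤ _
      rw [h1, map_mul, Scheme.basicOpen_mul]
      exact inf_le_left
    · have h1 := ev_mul_eq_of_germ (X := M) heO (s := monSec h (s a)) (b := monSec h (b a))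
        (by rw [germ_monSec, germ_monSec]; exact hsb a) x hx.1
      rwa [x.ev_map] at h1
  have hqe (x : Pt M) : (e * x).ev ⊤ (TopologicalSpace.Opens.mem_top _) (monSec h q) =
      x.ev ⊤ (TopologicalSpace.Opens.mem_top _) (monSec h q) := by
    rw [← germ_monSec, idemAct_germAt h (W := ⊤) (V := ⊤) _ (TopologicalSpace.Opens.mem_top _)
      le_top] at hqπ
    have h1 := germ_injective_of_isIntegral M.left e.toSpace (TopologicalSpace.Opens.mem_top _) hqπ
    rw [← ev_leftMul_top, h1]
  obtain ⟨t, ht⟩ := (generic_mem_of_nonempty j V hV).exists_point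
  have htq := ((tpt j t).mem_basicOpen ⊤ (TopologicalSpace.Opens.mem_top _) _).1 ht
  obtain ⟨q', hq'⟩ := exists_monSec_eq h ((leftMul (tpt j t)).left.appLE ⊤ ⊤ le_top (monSec h q))
  have hmem (x : Pt M) : x.toSpace ∈ M.left.basicOpen (monSec h q') ↔
      (tpt j t * x).toSpace ∈ V := by
    rw [x.mem_basicOpen ⊤ (TopologicalSpace.Opens.mem_top _), hq', ev_leftMul_top,
      ← Pt.mem_basicOpen]
  obtain ⟨t', ht', ht''⟩ := exists_tpt_mul_eq_one j t
  have hiso : IsIso (leftMul (tpt j t)).left := by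
    have h1 := leftMul_leftMul (tpt j t) (tpt j t')
    have h2 := leftMul_leftMul (tpt j t') (tpt j t)
    rw [ht'', leftMul_one] at h1
    rw [ht', leftMul_one] at h2
    exact ⟨(leftMul (tpt j t')).left, congr($(h1).left), congr($(h2).left)⟩
  refine ⟨(leftMul (tpt j t)).left ⁻¹ᵁ U, q', hU.preimage_of_isIso _, ?_, ?_, ?_⟩
  · refine opens_le_of_pt fun x hx ↦ ?_
    have h1 : (leftMul e).left (tpt j t * x).toSpace ∈ U := hVU ((hmem x).1 hx)
    change (leftMul (tpt j t)).left ((leftMul e).left _) ∈ U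
    rw [leftMul_apply, leftMul_apply, IsCore.tpt_mul_comm _ _ _ j, ← leftMul_apply]
    exact h1
  · rw [hmem, _root_.mul_one]
    exact ht
  · rw [hmem, pt_comm j]
    refine ((e * tpt j t).mem_basicOpen ⊤ (TopologicalSpace.Opens.mem_top _) _).2 ?_
    rwa [hqe]

end GlobalSections

end ToricMonoid

namespace ToricMonoid

/-! ### Tensor products with algebras having a nil augmentation ideal. -/

section Infinitesimal

open TensorProduct

variable {k : Type u} [Field k] {Λ C C' : Type u} [CommRing Λ] [Algebra k Λ] [CommRing C]
  [Algebra k C] [CommRing C'] [Algebra k C']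

/-- An element of a subalgebra whose image under an augmentation with nil kernel does not vanish
is invertible in the subalgebra. -/
lemma mem_of_mul_mem {ε : Λ →ₐ[k] k} (hε : ∀ x, ε x = 0 → IsNilpotent x) (L : Subalgebra k Λ)
    {x y : Λ} (hx : x ∈ L) (hx0 : ε x ≠ 0) (hxy : x * y ∈ L) : y ∈ L := by
  let x' : L := ⟨(ε x)⁻¹ • x, L.smul_mem hx _⟩
  have h1 : IsNilpotent (1 - x') := by
    obtain ⟨N, hN⟩ := hε (1 - (ε x)⁻¹ • x) (by
      rw [map_sub, map_one, map_smul, smul_eq_mul, inv_mul_cancel₀ hx0, sub_self])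
    exact ⟨N, Subtype.ext hN⟩
  have h2 := h1.isUnit_one_sub
  rw [sub_sub_cancel] at h2
  obtain ⟨z, hz⟩ := h2.exists_right_inv
  have hz' : (ε x)⁻¹ • x * z = 1 := congr_arg Subtype.val hz
  have h3 : y = (ε x)⁻¹ • (z * (x * y)) := by
    rw [← _root_.mul_assoc, _root_.mul_comm (z : Λ), ← smul_mul_assoc, ← smul_mul_assoc, hz',
      _root_.one_mul]
  rw [h3]
  exact L.smul_mem (L.mul_mem z.2 hxy) _

/-- The specialisation of a tensor product along an augmentation. -/
noncomputable def specialise (ε : Λ →ₐ[k] k) (C : Type u) [CommRing C] [Algebra k C] :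
    Λ ⊗[k] C →ₐ[k] C :=
  Algebra.TensorProduct.lift ((Algebra.ofId k C).comp ε) (AlgHom.id k C) fun _ _ ↦ .all _ _

lemma specialise_tmul (ε : Λ →ₐ[k] k) (x : Λ) (c : C) : specialise ε C (x ⊗ₜ c) = ε x • c := by
  rw [Algebra.smul_def]
  exact Algebra.TensorProduct.lift_tmul _ _ _ _ _

lemma isNilpotent_sub_specialise {ε : Λ →ₐ[k] k} (hε : ∀ x, ε x = 0 → IsNilpotent x)
    (z : Λ ⊗[k] C) : IsNilpotent (z - 1 ⊗ₜ specialise ε C z) := by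
  induction z using TensorProduct.induction_on with
  | zero => simp
  | tmul x c =>
    obtain ⟨N, hN⟩ := hε (x - algebraMap k Λ (ε x)) (by rw [map_sub, AlgHom.commutes]; exact sub_self _)
    have h1 : x ⊗ₜ[k] c - 1 ⊗ₜ specialise ε C (x ⊗ₜ c) = (x - algebraMap k Λ (ε x)) ⊗ₜ c := by
      rw [specialise_tmul, ← TensorProduct.smul_tmul, TensorProduct.sub_tmul,
        Algebra.algebraMap_eq_smul_one]
    refine ⟨N, ?_⟩
    rw [h1, Algebra.TensorProduct.tmul_pow, hN, TensorProduct.zero_tmul]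
  | add z z' h h' =>
    have h1 := (Commute.all _ _).isNilpotent_add h h'
    rwa [sub_add_sub_comm, ← TensorProduct.tmul_add, ← map_add] at h1

/-- Every `z` differs from `1 ⊗ₜ specialise ε C z` by a nilpotent, so the tensor product is an
infinitesimal thickening of `C` with the same primes. -/
lemma comap_specialise_surjective {ε : Λ →ₐ[k] k} (hε : ∀ x, ε x = 0 → IsNilpotent x)
    (p : PrimeSpectrum (Λ ⊗[k] C)) :
    ∃ q, PrimeSpectrum.comap (specialise ε C : Λ ⊗[k] C →+* C) q = p := by
  refine ⟨PrimeSpectrum.comap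
    (Algebra.TensorProduct.includeRight : C →ₐ[k] Λ ⊗[k] C).toRingHom p, PrimeSpectrum.ext ?_⟩
  ext z
  change 1 ⊗ₜ specialise ε C z ∈ p.asIdeal ↔ z ∈ p.asIdeal
  have h1 : z - 1 ⊗ₜ specialise ε C z ∈ p.asIdeal := by
    obtain ⟨N, hN⟩ := isNilpotent_sub_specialise hε z
    exact p.2.mem_of_pow_mem N (hN ▸ p.asIdeal.zero_mem)
  exact ⟨fun h ↦ (Submodule.sub_mem_iff_left _ h).1 h1, fun h ↦ (Submodule.sub_mem_iff_right _ h).1 h1⟩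

/-- The contraction with a linear form in the first factor. -/
noncomputable def contract (l : Λ →ₗ[k] k) (C : Type u) [CommRing C] [Algebra k C] :
    Λ ⊗[k] C →ₗ[k] C :=
  (TensorProduct.lid k C).toLinearMap ∘ₗ l.rTensor C

lemma contract_tmul (l : Λ →ₗ[k] k) (x : Λ) (c : C) : contract l C (x ⊗ₜ c) = l x • c := by
  simp [contract]

lemma contract_map (l : Λ →ₗ[k] k) (f : C →ₐ[k] C') (z : Λ ⊗[k] C) :
    contract l C' (Algebra.TensorProduct.map (AlgHom.id k Λ) f z) = f (contract l C z) := by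
  induction z using TensorProduct.induction_on with
  | zero => simp
  | tmul x c => simp [contract_tmul]
  | add z z' h h' => rw [map_add, map_add, map_add, map_add, h, h']

/-- Contractions in the two factors commute. This is what exchanges the roles of two infinitesimal
points in `exists_section_jet`. -/
lemma contract_comm (l : Λ →ₗ[k] k) (l' : C →ₗ[k] k) (z : Λ ⊗[k] C) :
    l' (contract l C z) = l (contract l' Λ (Algebra.TensorProduct.comm k Λ C z)) := by
  induction z using TensorProduct.induction_on with
  | zero => simp
  | tmul x c => simp [contract_tmul, _root_.mul_comm]
  | add z z' h h' => rw [map_add, map_add, map_add, map_add, map_add, h, h']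

end Infinitesimal

/-! ### Products with infinitesimal points. -/

section Convolution

open TensorProduct

variable {k : Type u} [Field k]

/-- The spectrum of an algebra. -/
noncomputable def specOver (k : Type u) [Field k] (Ω : Type u) [CommRing Ω] [Algebra k Ω] :
    Over (Spec (.of k)) :=
  Over.mk (Spec.map (CommRingCat.ofHom (algebraMap k Ω)))

variable {Ω Ω' Ω'' Λ C C' : Type u} [CommRing Ω] [Algebra k Ω] [CommRing Ω'] [Algebra k Ω']
  [CommRing Ω''] [Algebra k Ω''] [CommRing Λ] [Algebra k Λ] [CommRing C] [Algebra k C]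
  [CommRing C'] [Algebra k C']

/-- The morphism of spectra given by a homomorphism of algebras. -/
noncomputable def specOverMap (f : Ω →ₐ[k] Ω') : specOver k Ω' ⟶ specOver k Ω :=
  Over.homMk (Spec.map (CommRingCat.ofHom f.toRingHom)) (by
    change Spec.map _ ≫ Spec.map _ = Spec.map _
    rw [← Spec.map_comp, ← CommRingCat.ofHom_comp]
    congr 2
    exact f.comp_algebraMap)

lemma specOverMap_comp (f : Ω →ₐ[k] Ω') (g : Ω' →ₐ[k] Ω'') :
    specOverMap g ≫ specOverMap f = specOverMap (g.comp f) := by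
  refine Over.OverMorphism.ext ?_
  change Spec.map _ ≫ Spec.map _ = Spec.map _
  rw [← Spec.map_comp, ← CommRingCat.ofHom_comp]
  rfl

lemma specOverMap_id : specOverMap (AlgHom.id k Ω) = 𝟙 _ :=
  Over.OverMorphism.ext (Spec.map_id _)

variable {M : Over (Spec (.of k))}

/-- The product of a `Λ`-valued and a `C`-valued point. -/
noncomputable def conv (m : M ⊗ M ⟶ M) (φ : specOver k Λ ⟶ M) (w : specOver k C ⟶ M) :
    specOver k (Λ ⊗[k] C) ⟶ M :=
  CartesianMonoidalCategory.lift (specOverMap Algebra.TensorProduct.includeLeft ≫ φ)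
    (specOverMap Algebra.TensorProduct.includeRight ≫ w) ≫ m

lemma conv_map (m : M ⊗ M ⟶ M) (φ : specOver k Λ ⟶ M) (f : C →ₐ[k] C') (w : specOver k C ⟶ M) :
    conv m φ (specOverMap f ≫ w) =
      specOverMap (Algebra.TensorProduct.map (AlgHom.id k Λ) f) ≫ conv m φ w := by
  rw [conv, conv, ← Category.assoc (specOverMap (Algebra.TensorProduct.map (AlgHom.id k Λ) f)),
    CartesianMonoidalCategory.comp_lift, ← Category.assoc, ← Category.assoc, ← Category.assoc,
    specOverMap_comp, specOverMap_comp, specOverMap_comp, Algebra.TensorProduct.map_comp_includeLeft,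
    Algebra.TensorProduct.map_comp_includeRight]
  rfl

lemma conv_comm (m : M ⊗ M ⟶ M) (φ : specOver k Λ ⟶ M) (w : specOver k C ⟶ M) :
    conv ((β_ M M).hom ≫ m) w φ =
      specOverMap (Algebra.TensorProduct.comm k Λ C).toAlgHom ≫ conv m φ w := by
  rw [conv, conv, ← Category.assoc, CartesianMonoidalCategory.lift_braiding_hom,
    ← Category.assoc (specOverMap (Algebra.TensorProduct.comm k Λ C).toAlgHom),
    CartesianMonoidalCategory.comp_lift, ← Category.assoc (specOverMap _) (specOverMap _),
    ← Category.assoc (specOverMap _) (specOverMap _), specOverMap_comp, specOverMap_comp]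
  congr 4

/-- Multiplication with a point. -/
noncomputable def pointAct (m : M ⊗ M ⟶ M) (e : Pt M) : M ⟶ M :=
  CartesianMonoidalCategory.lift (CartesianMonoidalCategory.toUnit M ≫ e.toHom) (𝟙 M) ≫ m

lemma specialise_conv (m : M ⊗ M ⟶ M) (e : Pt M) {ε : Λ →ₐ[k] k} {φ : specOver k Λ ⟶ M}
    (hφ : specOverMap ε ≫ φ = CartesianMonoidalCategory.toUnit _ ≫ e.toHom)
    (w : specOver k C ⟶ M) :
    specOverMap (specialise ε C) ≫ conv m φ w = w ≫ pointAct m e := by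
  have h1 : (specialise ε C).comp Algebra.TensorProduct.includeLeft = (Algebra.ofId k C).comp ε :=
    Algebra.TensorProduct.lift_comp_includeLeft _ _ fun _ _ ↦ .all _ _
  have h2 : (specialise ε C).comp Algebra.TensorProduct.includeRight = AlgHom.id k C :=
    Algebra.TensorProduct.lift_comp_includeRight _ _ fun _ _ ↦ .all _ _
  rw [conv, pointAct, ← Category.assoc, CartesianMonoidalCategory.comp_lift,
    ← Category.assoc (specOverMap _) (specOverMap _), ← Category.assoc (specOverMap _)
    (specOverMap _), specOverMap_comp, specOverMap_comp, h1, h2, specOverMap_id, ← specOverMap_comp,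
    Category.assoc, hφ, Category.id_comp, ← Category.assoc w,
    CartesianMonoidalCategory.comp_lift, Category.comp_id, ← Category.assoc, ← Category.assoc]
  congr 3
  exact CartesianMonoidalCategory.toUnit_unique _ _

/-- The product with an infinitesimal point lands in an open subset if the product with the
point does. -/
lemma conv_le (m : M ⊗ M ⟶ M) (e : Pt M) {ε : Λ →ₐ[k] k} (hε : ∀ x, ε x = 0 → IsNilpotent x)
    {φ : specOver k Λ ⟶ M}
    (hφ : specOverMap ε ≫ φ = CartesianMonoidalCategory.toUnit _ ≫ e.toHom)
    {U V : M.left.Opens} (hVU : V ≤ (pointAct m e).left ⁻¹ᵁ U) (w : specOver k C ⟶ M)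
    (hw : ⊤ ≤ w.left ⁻¹ᵁ V) : ⊤ ≤ (conv m φ w).left ⁻¹ᵁ U := by
  intro p _
  obtain ⟨q, rfl⟩ := comap_specialise_surjective hε p
  have h2 : (pointAct m e).left (w.left q) ∈ U := hVU (hw (TopologicalSpace.Opens.mem_top q))
  have h3 : (specOverMap (specialise ε C) ≫ conv m φ w).left q ∈ U := by
    rw [specialise_conv m e hφ w]
    exact h2
  exact h3

/-- The value of a section at the product with a point in an affine open subset. -/
lemma contract_secVal_conv (m : M ⊗ M ⟶ M) (e : Pt M) {ε : Λ →ₐ[k] k}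
    (hε : ∀ x, ε x = 0 → IsNilpotent x) {φ : specOver k Λ ⟶ M}
    (hφ : specOverMap ε ≫ φ = CartesianMonoidalCategory.toUnit _ ≫ e.toHom)
    {U V : M.left.Opens} (hV : IsAffineOpen V) (hVU : V ≤ (pointAct m e).left ⁻¹ᵁ U)
    (a : Γ(M.left, U)) (l : Λ →ₗ[k] k) :
    ∃ g : Γ(M.left, V), ∀ (C : Type u) [CommRing C] [Algebra k C] (w : specOver k C ⟶ M)
      (hw : ⊤ ≤ w.left ⁻¹ᵁ V), secVal w.left V hw g =
        contract l C (secVal (conv m φ w).left U (conv_le m e hε hφ hVU w hw) a) := by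
  -- The inclusion `w₀` of `V` is the universal case: every `w` landing in `V` is a pull-back of it,
  -- and contraction commutes with pull-backs.
  let w₀ : specOver k Γ(M.left, V) ⟶ M := Over.homMk hV.fromSpec (fromSpec_comp_hom hV)
  have hw₀ : ⊤ ≤ w₀.left ⁻¹ᵁ V := fun z _ ↦ by
    have := range_fromSpec_le hV (𝟙 _) z
    rwa [Category.id_comp] at this
  refine ⟨contract l _ (secVal (conv m φ w₀).left U (conv_le m e hε hφ hVU w₀ hw₀) a),
    fun C _ _ w hw ↦ ?_⟩
  have hcomp := eq_specMap_fromSpec hV w.left hw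
  let f : Γ(M.left, V) →ₐ[k] C :=
    { secVal w.left V hw with
      commutes' := fun c ↦ by
        have h1 : Spec.map (CommRingCat.ofHom ((secVal w.left V hw).comp (scalar M V))) =
            Spec.map (CommRingCat.ofHom (algebraMap k C)) := by
          rw [CommRingCat.ofHom_comp, Spec.map_comp, ← fromSpec_comp_hom hV, ← Category.assoc,
            hcomp]
          exact Over.w w
        exact congr($(Spec.map_injective h1).hom c) }
  have hwf : w = specOverMap f ≫ w₀ := Over.OverMorphism.ext hcomp.symm
  have h2 : conv m φ w = specOverMap (Algebra.TensorProduct.map (AlgHom.id k Λ) f) ≫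
      conv m φ w₀ := by
    rw [← conv_map, ← hwf]
  have h3 := secVal_congr congr(Over.Hom.left $h2) U (conv_le m e hε hφ hVU w hw) a
  rw [h3]
  refine Eq.trans ?_ (congr_arg (contract l C) (secVal_specMap (CommRingCat.ofHom
    (Algebra.TensorProduct.map (AlgHom.id k Λ) f).toRingHom) (conv m φ w₀).left U
    (conv_le m e hε hφ hVU w₀ hw₀) _ a).symm)
  exact (contract_map l f _).symm

end Convolution

end ToricMonoid

namespace ToricMonoid

/-! ### Jets at a rational point. -/

section InfinitesimalPoints

variable {k : Type u} [Field k] {X : Over (Spec (.of k))}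

/-- A `k`-rational point as a morphism from the spectrum of `k`. -/
noncomputable def Pt.overHom (y : Pt X) : specOver k k ⟶ X :=
  CartesianMonoidalCategory.toUnit _ ≫ y.toHom

lemma Pt.overHom_left (y : Pt X) : y.overHom.left = y.hom := by
  change Spec.map (𝟙 _) ≫ y.hom = _
  rw [Spec.map_id, Category.id_comp]

lemma Pt.le_overHom_preimage (y : Pt X) {W : X.left.Opens} (hy : y.toSpace ∈ W) :
    ⊤ ≤ y.overHom.left ⁻¹ᵁ W := by
  rw [y.overHom_left]
  exact y.le_preimage hy

lemma Pt.secVal_overHom (y : Pt X) {W : X.left.Opens} (hy : y.toSpace ∈ W) (s : Γ(X.left, W)) :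
    secVal y.overHom.left W (y.le_overHom_preimage hy) s = y.ev W hy s :=
  secVal_congr y.overHom_left W _ s

/-- The evaluation of germs at a `k`-rational point. -/
noncomputable def Pt.evGerm (e : Pt X) : X.left.presheaf.stalk e.toSpace →+* k :=
  (Scheme.stalkClosedPointTo e.hom).hom

lemma Pt.evGerm_germAt (e : Pt X) (W : X.left.Opens) (hW : e.toSpace ∈ W) (s : Γ(X.left, W)) :
    e.evGerm (germAt e.toSpace W hW s) = e.ev W hW s := by
  have h1 := congr(($(Scheme.germ_stalkClosedPointTo e.hom W hW)).hom s)
  refine h1.trans ?_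
  change ((e.hom.app W ≫ _ ≫ _) : Γ(X.left, W) ⟶ _).hom s = _
  rw [← Category.assoc]
  rfl

/-- The evaluation of germs as a homomorphism of algebras. -/
noncomputable def Pt.evGermₐ (e : Pt X) : X.left.presheaf.stalk e.toSpace →ₐ[k] k :=
  { e.evGerm with
    commutes' := fun c ↦ (congr_arg e.evGerm (germAt_scalar _ _
      (TopologicalSpace.Opens.mem_top _) c).symm).trans
      ((e.evGerm_germAt _ _ _).trans (e.ev_scalar _ _ c)) }

lemma Pt.evGerm_eq_zero_iff (e : Pt X) (r : X.left.presheaf.stalk e.toSpace) :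
    e.evGermₐ r = 0 ↔ r ∈ IsLocalRing.maximalIdeal _ := by
  have : IsLocalHom e.evGerm := inferInstanceAs (IsLocalHom (Scheme.stalkClosedPointTo e.hom).hom)
  rw [IsLocalRing.mem_maximalIdeal, mem_nonunits_iff, ← isUnit_map_iff e.evGerm,
    isUnit_iff_ne_zero, not_not]
  rfl

/-- The infinitesimal neighbourhoods of a point. -/
abbrev jets (e : Pt X) (N : ℕ) : Type u :=
  X.left.presheaf.stalk e.toSpace ⧸ IsLocalRing.maximalIdeal (X.left.presheaf.stalk e.toSpace) ^
    (N + 1)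

/-- The augmentation of an infinitesimal neighbourhood. -/
noncomputable def jetEv (e : Pt X) (N : ℕ) : jets e N →ₐ[k] k :=
  Ideal.Quotient.liftₐ _ e.evGermₐ fun r hr ↦
    (e.evGerm_eq_zero_iff r).2 (Ideal.pow_le_self N.succ_ne_zero hr)

lemma isNilpotent_of_jetEv (e : Pt X) (N : ℕ) (x : jets e N) (hx : jetEv e N x = 0) :
    IsNilpotent x := by
  obtain ⟨r, rfl⟩ := Ideal.Quotient.mk_surjective x
  have hr : r ∈ IsLocalRing.maximalIdeal _ := (e.evGerm_eq_zero_iff r).1 hx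
  exact ⟨N + 1, by
    rw [← map_pow, Ideal.Quotient.eq_zero_iff_mem]
    exact Ideal.pow_mem_pow hr _⟩

lemma fromSpecStalk_hom (x : X.left) :
    X.left.fromSpecStalk x ≫ X.hom =
      Spec.map (CommRingCat.ofHom (algebraMap k (X.left.presheaf.stalk x))) := by
  obtain ⟨_, ⟨U, hU, rfl⟩, hx, -⟩ := X.left.isBasis_affineOpens.exists_subset_of_mem_open
    (Set.mem_univ x) isOpen_univ
  have h1 : hU.fromSpecStalk hx = Spec.map (X.left.presheaf.germ U x hx) ≫ hU.fromSpec := rfl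
  rw [← hU.fromSpecStalk_eq_fromSpecStalk hx, h1, Category.assoc]
  refine (congr_arg _ (fromSpec_comp_hom hU)).trans ?_
  rw [← Spec.map_comp]
  congr 1
  ext c
  exact germAt_scalar _ _ _ c

/-- The inclusion of an infinitesimal neighbourhood. -/
noncomputable def jetHom (e : Pt X) (N : ℕ) : specOver k (jets e N) ⟶ X :=
  Over.homMk (Spec.map (CommRingCat.ofHom (Ideal.Quotient.mk _)) ≫ X.left.fromSpecStalk e.toSpace)
    ((Category.assoc _ _ _).trans
      ((congr_arg _ (fromSpecStalk_hom _)).trans (Spec.map_comp _ _).symm))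

lemma jetEv_jetHom (e : Pt X) (N : ℕ) : specOverMap (jetEv e N) ≫ jetHom e N = e.overHom := by
  refine Over.OverMorphism.ext ?_
  rw [e.overHom_left]
  change Spec.map _ ≫ Spec.map _ ≫ _ = _
  rw [← Category.assoc, ← Spec.map_comp]
  exact Scheme.Spec_stalkClosedPointTo_fromSpecStalk e.hom

lemma le_fromSpecStalk_preimage {x : X.left} {W : X.left.Opens} (hx : x ∈ W) :
    ⊤ ≤ X.left.fromSpecStalk x ⁻¹ᵁ W := by
  intro z _
  have h1 : X.left.fromSpecStalk x z ∈ Set.range (X.left.fromSpecStalk x) := ⟨z, rfl⟩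
  rw [Scheme.range_fromSpecStalk] at h1
  replace h1 : X.left.fromSpecStalk x z ⤳ x := h1
  exact h1.mem_open W.2 hx

lemma le_jetHom_preimage (e : Pt X) (N : ℕ) {W : X.left.Opens} (hW : e.toSpace ∈ W) :
    ⊤ ≤ (jetHom e N).left ⁻¹ᵁ W := fun z _ ↦
  le_fromSpecStalk_preimage hW (TopologicalSpace.Opens.mem_top
    ((Spec.map (CommRingCat.ofHom (Ideal.Quotient.mk (IsLocalRing.maximalIdeal
      (X.left.presheaf.stalk e.toSpace) ^ (N + 1))))) z))

lemma secVal_fromSpecStalk {x : X.left} {W : X.left.Opens} (hx : x ∈ W) (s : Γ(X.left, W)) :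
    secVal (X.left.fromSpecStalk x) W (le_fromSpecStalk_preimage hx) s = germAt x W hx s := by
  have h1 : (X.left.fromSpecStalk x).appLE W ⊤ (le_fromSpecStalk_preimage hx) ≫
      (Scheme.ΓSpecIso _).hom = X.left.presheaf.germ W x hx := by
    rw [Scheme.Hom.appLE, Scheme.fromSpecStalk_app hx]
    simp only [Category.assoc, ← Functor.map_comp_assoc]
    have h0 (f : Opposite.op (⊤ : (Spec (X.left.presheaf.stalk x)).Opens) ⟶ .op ⊤) :
        (Spec (X.left.presheaf.stalk x)).presheaf.map f = 𝟙 _ := by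
      rw [Subsingleton.elim f (𝟙 _), CategoryTheory.Functor.map_id]
    rw [h0, Category.id_comp, Iso.inv_hom_id, Category.comp_id]
  exact congr($(h1).hom s)

lemma secVal_jetHom (e : Pt X) (N : ℕ) {W : X.left.Opens} (hW : e.toSpace ∈ W)
    (s : Γ(X.left, W)) : secVal (jetHom e N).left W (le_jetHom_preimage e N hW) s =
      Ideal.Quotient.mk _ (germAt e.toSpace W hW s) :=
  (secVal_specMap (CommRingCat.ofHom (Ideal.Quotient.mk (IsLocalRing.maximalIdeal
    (X.left.presheaf.stalk e.toSpace) ^ (N + 1)))) _ W (le_fromSpecStalk_preimage hW) _ s).trans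
    congr(Ideal.Quotient.mk _ $(secVal_fromSpecStalk hW s))

end InfinitesimalPoints

/-! ### Density of the monoid algebra in the local ring at the idempotent. -/

section Approximation

variable {k : Type u} [Field k] [IsAlgClosed k] {M : Over (Spec (.of k))}
  [LocallyOfFiniteType M.hom] [IsReduced M.left] {Λ : Type u} [CommRing Λ] [Algebra k Λ]

/-- The contractions of the values of a section at products with an infinitesimal point are the
values of a section. -/
lemma exists_conv_section (m : M ⊗ M ⟶ M) (e : Pt M) {ε : Λ →ₐ[k] k}
    (hε : ∀ x, ε x = 0 → IsNilpotent x) {φ : specOver k Λ ⟶ M}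
    (hφ : specOverMap ε ≫ φ = e.overHom)
    {U V : M.left.Opens} (hVU : V ≤ (pointAct m e).left ⁻¹ᵁ U)
    (a : Γ(M.left, U)) (l : Λ →ₗ[k] k) :
    ∃ g : Γ(M.left, V), ∀ (V₀ : M.left.Opens), IsAffineOpen V₀ → ∀ (hV : V₀ ≤ V)
      (C : Type u) [CommRing C] [Algebra k C] (w : specOver k C ⟶ M) (hw : ⊤ ≤ w.left ⁻¹ᵁ V₀),
      secVal w.left V (fun _ h ↦ hV (hw h)) g = contract l C (secVal (conv m φ w).left U
        (conv_le m e hε hφ (hV.trans hVU) w hw) a) := by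
  classical
  have hc (y : Pt M) (hy : y.toSpace ∈ V) :=
    conv_le m e hε hφ hVU y.overHom (y.le_overHom_preimage hy)
  obtain ⟨g, hg⟩ := exists_section V
    (fun y ↦ if hy : y.toSpace ∈ V then
      contract l k (secVal (conv m φ y.overHom).left U (hc y hy) a) else 0) fun x hx ↦ by
    obtain ⟨_, ⟨V₀, hV₀, rfl⟩, hx₀, hV⟩ := M.left.isBasis_affineOpens.exists_subset_of_mem_open
      (show x.toSpace ∈ (V : Set M.left) from hx) V.2
    obtain ⟨g₀, hg₀⟩ := contract_secVal_conv m e hε hφ hV₀ (le_trans hV hVU) a l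
    refine ⟨V₀, g₀, hx₀, fun y hy hyV ↦ ?_⟩
    rw [dif_pos hyV, ← hg₀ k y.overHom (y.le_overHom_preimage hy), y.secVal_overHom]
  refine ⟨g, fun V₀ hV₀ hV C _ _ w hw ↦ ?_⟩
  obtain ⟨g₀, hg₀⟩ := contract_secVal_conv m e hε hφ hV₀ (le_trans hV hVU) a l
  rw [← hg₀ C w hw, ← secVal_res w.left hV hw]
  congr 1
  refine section_ext fun x hx ↦ ?_
  rw [x.ev_res, hg x (hV hx), dif_pos (hV hx), ← hg₀ k x.overHom (x.le_overHom_preimage hx),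
    x.secVal_overHom]

end Approximation

section Density

variable {k : Type u} [Field k] [IsAlgClosed k] {n : ℕ} {M : Over (Spec (.of k))} [MonObj M]
  [IsSeparated M.hom] [LocallyOfFiniteType M.hom] [IsIntegral M.left]

lemma pointAct_braiding (e : Pt M) : pointAct ((β_ M M).hom ≫ μ[M]) e = rightMul e := by
  rw [pointAct, ← Category.assoc, CartesianMonoidalCategory.lift_braiding_hom]
  rfl

open TensorProduct in
lemma conv_one {Λ : Type u} [CommRing Λ] [Algebra k Λ] (φ : specOver k Λ ⟶ M) :
    conv μ φ (1 : Pt M).overHom = specOverMap Algebra.TensorProduct.includeLeft ≫ φ := by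
  have h1 : (specOverMap Algebra.TensorProduct.includeRight : specOver k (Λ ⊗[k] k) ⟶ _) ≫
      (1 : Pt M).overHom = 1 := by
    rw [Pt.overHom, ← Category.assoc]
    exact MonObj.comp_one _
  change (_ : specOver k (Λ ⊗[k] k) ⟶ M) * _ = _
  rw [h1, _root_.mul_one]

open TensorProduct in
lemma contract_conv_one {Λ : Type u} [CommRing Λ] [Algebra k Λ] (φ : specOver k Λ ⟶ M)
    (U : M.left.Opens) (h : ⊤ ≤ (conv μ φ (1 : Pt M).overHom).left ⁻¹ᵁ U)
    (h' : ⊤ ≤ φ.left ⁻¹ᵁ U) (a : Γ(M.left, U)) (l : Λ →ₗ[k] k) :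
    contract l k (secVal (conv μ φ (1 : Pt M).overHom).left U h a) =
      l (secVal φ.left U h' a) := by
  rw [secVal_congr congr(Over.Hom.left $(conv_one φ)) U h a]
  have h2 := secVal_specMap (CommRingCat.ofHom (Algebra.TensorProduct.includeLeft :
    Λ →ₐ[k] Λ ⊗[k] k).toRingHom) φ.left U h' (by rwa [conv_one] at h) a
  refine (congr_arg (contract l k) h2).trans ?_
  have h1 := contract_tmul l (secVal φ.left U h' a) (1 : k)
  rw [smul_eq_mul, _root_.mul_one] at h1
  exact h1

lemma contract_conv_comm {Λ Λ' : Type u} [CommRing Λ] [Algebra k Λ] [CommRing Λ'] [Algebra k Λ']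
    (m : M ⊗ M ⟶ M) (φ : specOver k Λ ⟶ M) (φ' : specOver k Λ' ⟶ M)
    (U : M.left.Opens) (h : ⊤ ≤ (conv m φ φ').left ⁻¹ᵁ U)
    (h' : ⊤ ≤ (conv ((β_ M M).hom ≫ m) φ' φ).left ⁻¹ᵁ U) (a : Γ(M.left, U)) (l : Λ →ₗ[k] k)
    (l' : Λ' →ₗ[k] k) :
    l' (contract l Λ' (secVal (conv m φ φ').left U h a)) =
      l (contract l' Λ (secVal (conv ((β_ M M).hom ≫ m) φ' φ).left U h' a)) := by
  rw [contract_comm, secVal_congr congr(Over.Hom.left $(conv_comm m φ φ')) U h' a]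
  exact congr_arg (fun z ↦ l (contract l' Λ z)) (secVal_specMap (CommRingCat.ofHom
    (Algebra.TensorProduct.comm k Λ Λ').toAlgHom.toRingHom) (conv m φ φ').left U h _ a).symm

/-- The value at `1` of a function which is regular in a neighbourhood of `e` and `1`. -/
lemma exists_section_jet (j : splitTorus k n ⟶ M) [IsMonHom j] [IsOpenImmersion j.left] {e : Pt M}
    {U V : M.left.Opens} (hVU : V ≤ (leftMul e).left ⁻¹ᵁ U) (h1 : (1 : Pt M).toSpace ∈ V)
    (he : e.toSpace ∈ V) (heU : e.toSpace ∈ U) (N : ℕ) (a : Γ(M.left, U)) :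
    ∃ g : Γ(M.left, V), (Ideal.Quotient.mk _ (germAt e.toSpace V he g) : jets e N) =
      Ideal.Quotient.mk _ (germAt e.toSpace U heU a) := by
  -- By duality, a linear form `l` on jets kills the jets of sections over `V` but not the jet of
  -- `a`. With `φ` the jet at `e`, the contraction `g(w) = l(a(φ * w))` is a section over `V`.
  by_contra H
  let L : Submodule k (jets e N) := LinearMap.range
    ((Ideal.Quotient.mkₐ k _).comp (germAtₐ e.toSpace V he)).toLinearMap
  have hL : (Ideal.Quotient.mk _ (germAt e.toSpace U heU a) : jets e N) ∉ L := H
  obtain ⟨l, hl, hlL⟩ := L.exists_dual_map_eq_bot_of_notMem hL inferInstance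
  replace hlL (g : Γ(M.left, V)) : l (Ideal.Quotient.mk _ (germAt e.toSpace V he g)) = 0 := by
    rw [← Submodule.mem_bot k, ← hlL]
    exact ⟨_, ⟨g, rfl⟩, rfl⟩
  obtain ⟨g, hg⟩ := exists_conv_section μ e (isNilpotent_of_jetEv e N) (jetEv_jetHom e N)
    (V := V) hVU a l
  obtain ⟨_, ⟨V₀, hV₀, rfl⟩, he₀, hV⟩ := M.left.isBasis_affineOpens.exists_subset_of_mem_open
    (show e.toSpace ∈ (V : Set M.left) from he) V.2
  obtain ⟨_, ⟨V₁, hV₁, rfl⟩, he₁, hV'⟩ := M.left.isBasis_affineOpens.exists_subset_of_mem_open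
    (show (1 : Pt M).toSpace ∈ (V : Set M.left) from h1) V.2
  -- For a form `l'` on jets of order `N'`, exchanging the two contractions turns `l'(g)` into `l`
  -- of the jet of another section `g'` over `V`, which is zero. So `g` vanishes to all orders at
  -- `e`, hence `g = 0`.
  have key (N' : ℕ) : (Ideal.Quotient.mk _ (germAt e.toSpace V he g) : jets e N') = 0 := by
    rw [← Module.forall_dual_apply_eq_zero_iff k]
    intro l'
    have hVU' : V ≤ (pointAct ((β_ M M).hom ≫ μ[M]) e).left ⁻¹ᵁ U := by
      rwa [pointAct_braiding, ← leftMul_eq_rightMul j]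
    obtain ⟨g', hg'⟩ := exists_conv_section ((β_ M M).hom ≫ μ[M]) e (isNilpotent_of_jetEv e N')
      (jetEv_jetHom e N') hVU' a l'
    have h2 := hg V₀ hV₀ hV _ (jetHom e N') (le_jetHom_preimage e N' he₀)
    have h3 := hg' V₀ hV₀ hV _ (jetHom e N) (le_jetHom_preimage e N he₀)
    have h4 := secVal_jetHom e N' he g
    have h5 := secVal_jetHom e N he g'
    rw [h5] at h3
    rw [h4] at h2
    rw [h2, ← hlL g', h3]
    exact contract_conv_comm _ _ _ _ _ _ _ l l'
  have hg0 : g = 0 := by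
    refine germ_injective_of_isIntegral M.left e.toSpace he ?_
    rw [map_zero, ← Submodule.mem_bot (R := M.left.presheaf.stalk e.toSpace)]
    have : IsNoetherianRing (M.left.presheaf.stalk e.toSpace) := by
      have := LocallyOfFiniteType.isLocallyNoetherian M.hom
      infer_instance
    rw [← Ideal.iInf_pow_eq_bot_of_isLocalRing (IsLocalRing.maximalIdeal
      (M.left.presheaf.stalk e.toSpace)) Ideal.IsPrime.ne_top', Submodule.mem_iInf]
    intro N'
    exact Ideal.pow_le_pow_right N'.le_succ (Ideal.Quotient.eq_zero_iff_mem.1 (key N'))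
  -- At the point `1` the product `φ * 1` is `φ`, so the value of `g` is `l` of the jet of `a`,
  -- which is nonzero.
  have h2 := hg V₁ hV₁ hV' k (1 : Pt M).overHom (Pt.le_overHom_preimage _ he₁)
  rw [hg0, map_zero] at h2
  rw [contract_conv_one (jetHom e N) U _ (le_jetHom_preimage e N heU), secVal_jetHom e N heU] at h2
  exact hl h2.symm

end Density

end ToricMonoid

namespace ToricMonoid

section Approximation

variable {k : Type u} [Field k] [IsAlgClosed k] {n : ℕ} {M : Over (Spec (.of k))} [MonObj M]
  [IsSeparated M.hom] [LocallyOfFiniteType M.hom]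

lemma exists_germ_fraction {X : Scheme.{u}} {U : X.Opens} (hU : IsAffineOpen U) {x : X}
    (hx : x ∈ U) (r : X.presheaf.stalk x) :
    ∃ a s : Γ(X, U), IsUnit (X.presheaf.germ U x hx s) ∧
      X.presheaf.germ U x hx s * r = X.presheaf.germ U x hx a := by
  let := X.presheaf.algebra_section_stalk ⟨x, hx⟩
  have := hU.isLocalization_stalk ⟨x, hx⟩
  obtain ⟨⟨a, s⟩, hs⟩ := IsLocalization.surj (hU.primeIdealOf ⟨x, hx⟩).asIdeal.primeCompl r
  refine ⟨a, s, IsLocalization.map_units (M := (hU.primeIdealOf ⟨x, hx⟩).asIdeal.primeCompl)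
    (X.presheaf.stalk x) s, ?_⟩
  rw [_root_.mul_comm]
  exact hs

lemma exists_pow_mul_eq_res [QuasiCompact M.hom] (q : Γ(M.left, ⊤))
    (v : Γ(M.left, M.left.basicOpen q)) :
    ∃ (N : ℕ) (b : Γ(M.left, ⊤)), M.left.presheaf.map (homOfLE (M.left.basicOpen_le q)).op q ^ N * v =
      M.left.presheaf.map (homOfLE (M.left.basicOpen_le q)).op b := by
  have : CompactSpace M.left := QuasiCompact.compactSpace_of_compactSpace M.hom
  have hqs : IsQuasiSeparated ((⊤ : M.left.Opens) : Set M.left) := by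
    have : QuasiSeparatedSpace M.left :=
      quasiSeparatedSpace_of_quasiSeparated M.hom
    exact isQuasiSeparated_univ
  have := isLocalization_basicOpen_of_qcqs (U := (⊤ : M.left.Opens)) isCompact_univ hqs q
  obtain ⟨⟨b, ⟨_, N, rfl⟩⟩, hb⟩ := IsLocalization.surj (Submonoid.powers q) v
  refine ⟨N, b, ?_⟩
  rw [_root_.mul_comm, ← map_pow]
  exact hb

variable [IsIntegral M.left] {j : splitTorus k n ⟶ M} [IsMonHom j] [IsOpenImmersion j.left]
  {e : Pt M}

/-- The monoid algebra is dense in the local ring at the idempotent. -/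
lemma exists_sub_lift_mem_pow [QuasiCompact M.hom] (h : IsCore j e) (N : ℕ)
    (r : M.left.presheaf.stalk e.toSpace) :
    ∃ a, r - AddMonoidAlgebra.lift k _ (charMonoid j e.toSpace) (charGerm h) a ∈
      IsLocalRing.maximalIdeal (M.left.presheaf.stalk e.toSpace) ^ N := by
  obtain ⟨U, q, hU, hVU, h1, he⟩ := exists_affine_of_core h
  have heU : e.toSpace ∈ U := by
    have h2 : (leftMul e).left e.toSpace ∈ U := hVU he
    rwa [leftMul_apply, h.idem] at h2
  have hε := isNilpotent_of_jetEv e N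
  have hunit {x : M.left.presheaf.stalk e.toSpace} (hx : IsUnit x) :
      jetEv e N (Ideal.Quotient.mk _ x) ≠ 0 :=
    (hx.map ((jetEv e N).toRingHom.comp (Ideal.Quotient.mk _))).ne_zero
  -- A subalgebra of jets is closed under division by its elements that are nonzero at `e`
  -- (`mem_of_mul_mem`). Germs are fractions of sections over `U`, whose jets come from sections
  -- over the nonvanishing locus of `q`; these are elements of the monoid algebra divided by powers
  -- of `q`.
  let L : Subalgebra k (jets e N) := ((Ideal.Quotient.mkₐ k _).comp
    (AddMonoidAlgebra.lift k _ (charMonoid j e.toSpace) (charGerm h))).range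
  let LV : Subalgebra k (jets e N) := ((Ideal.Quotient.mkₐ k _).comp
    (germAtₐ e.toSpace _ he)).range
  have hLU (a : Γ(M.left, U)) :
      (Ideal.Quotient.mk _ (germAt e.toSpace U heU a) : jets e N) ∈ LV :=
    exists_section_jet j hVU h1 he heU N a
  have hLV : (Ideal.Quotient.mk _ r : jets e N) ∈ LV := by
    obtain ⟨a, s, hs, hsr⟩ := exists_germ_fraction hU heU r
    refine mem_of_mul_mem hε LV (hLU s) (hunit hs) ?_
    rw [← map_mul]
    exact (congr_arg (Ideal.Quotient.mk _) hsr : (_ : jets e N) = _) ▸ hLU a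
  obtain ⟨v, hv⟩ := hLV
  obtain ⟨N', b, hb⟩ := exists_pow_mul_eq_res (monSec h q) v
  have hL : (Ideal.Quotient.mk _ r : jets e N) ∈ L := by
    obtain ⟨b', rfl⟩ := exists_monSec_eq h b
    refine mem_of_mul_mem (x := Ideal.Quotient.mk _
      (AddMonoidAlgebra.lift k _ (charMonoid j e.toSpace) (charGerm h) q ^ N')) hε L ?_
      (hunit (.pow _ ?_)) ?_
    · exact ⟨q ^ N', congr_arg (Ideal.Quotient.mk _) (map_pow
        (AddMonoidAlgebra.lift k _ (charMonoid j e.toSpace) (charGerm h)) q N')⟩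
    · rw [← germ_monSec]
      exact (isUnit_germAt e ⊤ _ _).2 ((e.mem_basicOpen ⊤ (TopologicalSpace.Opens.mem_top _) _).1 he)
    · refine ⟨b', ?_⟩
      have h2 := congr((Ideal.Quotient.mk _ (germAt e.toSpace _ he $hb) : jets e N))
      rw [map_mul, map_pow, germAt_res, germAt_res, germ_monSec, germ_monSec, map_mul] at h2
      rw [← hv]
      exact h2.symm
  obtain ⟨a, ha⟩ := hL
  refine ⟨a, Ideal.pow_le_pow_right N.le_succ ?_⟩
  rw [← Ideal.Quotient.eq]
  exact ha.symm

lemma ker_idemAct [QuasiCompact M.hom] (h : IsCore j e) :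
    RingHom.ker (idemAct h) = Ideal.span ((fun s ↦ charGerm h (.ofAdd s)) ''
      {s : charMonoid j e.toSpace | -(s : Fin n → ℤ) ∉ charMonoid j e.toSpace}) := by
  have := LocallyOfFiniteType.isLocallyNoetherian M.hom
  exact (isLocalToric h).ker_eq_span (exists_sub_lift_mem_pow h)

end Approximation

end ToricMonoid

namespace ToricMonoid

/-! ### Affineness of toric monoids. -/

section Affineness

variable {k : Type u} [Field k] [IsAlgClosed k] {n : ℕ} {M : Over (Spec (.of k))} [MonObj M]
  [IsSeparated M.hom] [LocallyOfFiniteType M.hom] [IsIntegral M.left]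
  {j : splitTorus k n ⟶ M} [IsMonHom j] [IsOpenImmersion j.left] {e : Pt M}

lemma monSec_injective (h : IsCore j e) : Function.Injective (monSec h) := by
  rw [injective_iff_map_eq_zero]
  intro a ha
  let ι' : AddMonoidAlgebra k (charMonoid j e.toSpace) →ₐ[k] AddMonoidAlgebra k (Fin n → ℤ) :=
    AddMonoidAlgebra.mapDomainAlgHom k k (charMonoid j e.toSpace).subtype
  have hι : Function.Injective ι' :=
    AddMonoidAlgebra.mapDomain_injective Subtype.val_injective
  refine hι ?_
  rw [map_zero]
  refine eq_zero_of_lift_eq_zero fun t ↦ ?_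
  have h1 : (AddMonoidAlgebra.lift k k _ t).comp ι' =
      AddMonoidAlgebra.lift k k (charMonoid j e.toSpace) (charVal h (tpt j t)) :=
    AddMonoidAlgebra.algHom_ext (fun χ ↦ by
      change AddMonoidAlgebra.lift k k _ t (AddMonoidAlgebra.mapDomain _ _) = _
      rw [AddMonoidAlgebra.mapDomain_single, AddMonoidAlgebra.lift_single,
        AddMonoidAlgebra.lift_single, charVal_tpt]
      rfl) (Subsingleton.elim _ _)
  refine (DFunLike.congr_fun h1 a).trans ?_
  rw [← ev_monSec, ha, map_zero]

/-- The translates of a function with nonzero invertible component generate the unit ideal. -/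
lemma span_translates_eq_top (h : IsCore j e) {a : AddMonoidAlgebra k (charMonoid j e.toSpace)}
    {s : charMonoid j e.toSpace} (hs : a.coeff s ≠ 0)
    (hs' : -(s : Fin n → ℤ) ∈ charMonoid j e.toSpace) :
    Ideal.span (Set.range fun t ↦ (leftMul (tpt j t)).left.appLE ⊤ ⊤ le_top (monSec h a)) = ⊤ := by
  classical
  set I := Ideal.span (Set.range fun t ↦
    (leftMul (tpt j t)).left.appLE ⊤ ⊤ le_top (monSec h a)) with hI
  let v : (Fin n → ℤ) →₀ Γ(M.left, ⊤) := Finsupp.embDomain ⟨_, Subtype.val_injective⟩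
    (Finsupp.onFinset a.coeff.support (fun s ↦ a.coeff s • charSec h (.ofAdd s))
      (by intro ψ h; simp only [Finsupp.mem_support_iff]; rintro h0; simp [h0] at h))
  -- An ideal containing all translates of a section contains its weight components; the one at the
  -- unit `s` is invertible.
  have hv : v s ∈ I.restrictScalars k := by
    refine Generic.apply_mem (k := k) (I.restrictScalars k)
      (Generic.of_forall fun (t : Multiplicative (Fin n → ℤ) →* k) ↦ ?_) s
    have h1 : (leftMul (tpt j t)).left.appLE ⊤ ⊤ le_top (monSec h a) ∈ I :=
      Ideal.subset_span ⟨t, rfl⟩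
    refine (congr_arg (· ∈ I) ?_ : (_ ∈ I) = (_ ∈ I)).mpr h1
    rw [Finsupp.sum_embDomain, Finsupp.onFinset_sum _ (by simp)]
    change _ = (leftMul (tpt j t)).left.appLE ⊤ ⊤ le_top (AddMonoidAlgebra.lift k _ _ _ a)
    rw [AddMonoidAlgebra.lift_apply, Finsupp.sum, map_sum]
    refine Finset.sum_congr rfl fun χ _ ↦ ?_
    rw [Algebra.smul_def, Algebra.smul_def, map_mul, appLE_charSec, charVal_tpt]
    have h2 := appLE_scalar (leftMul (tpt j t)) (W := ⊤) (V := ⊤) le_top (a.coeff χ)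
    change _ = (leftMul (tpt j t)).left.appLE ⊤ ⊤ le_top (scalar M ⊤ (a.coeff χ)) * _
    rw [h2]
    exact mul_left_comm _ _ _
  have hvs : v s = a.coeff s • charSec h (.ofAdd s) := Finsupp.embDomain_apply_self _ _ s
  rw [hvs] at hv
  have h1 : charSec h (.ofAdd s) ∈ I := by
    have := (I.restrictScalars k).smul_mem (a.coeff s)⁻¹ hv
    rwa [smul_smul, inv_mul_cancel₀ hs, one_smul] at this
  rw [Ideal.eq_top_iff_one]
  have h2 := I.mul_mem_right (charSec h (.ofAdd ⟨_, hs'⟩)) h1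
  rwa [← map_mul, ← ofAdd_add, show s + ⟨_, hs'⟩ = 0 from Subtype.ext (add_neg_cancel _), ofAdd_zero,
    map_one] at h2

lemma isIso_leftMul_tpt (j : splitTorus k n ⟶ M) [IsMonHom j]
    (t : Multiplicative (Fin n → ℤ) →* k) : IsIso (leftMul (tpt j t)).left := by
  obtain ⟨t', ht', ht''⟩ := exists_tpt_mul_eq_one j t
  have h1 := leftMul_leftMul (tpt j t) (tpt j t')
  have h2 := leftMul_leftMul (tpt j t') (tpt j t)
  rw [ht'', leftMul_one] at h1
  rw [ht', leftMul_one] at h2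
  exact ⟨(leftMul (tpt j t')).left, congr($(h1).left), congr($(h2).left)⟩

/-- Toric monoids are affine. -/
theorem isAffine_of_isCore [QuasiCompact M.hom] (h : IsCore j e) : IsAffine M.left := by
  classical
  obtain ⟨_, ⟨U, hU, rfl⟩, heU, -⟩ := M.left.isBasis_affineOpens.exists_subset_of_mem_open
    (Set.mem_univ e.toSpace) isOpen_univ
  have hloc := isLocalToric h
  have := LocallyOfFiniteType.isLocallyNoetherian M.hom
  obtain ⟨F, hF⟩ := (finiteType_sections (X := M) hU).out
  choose s b hs hsb using fun a : Γ(M.left, U) ↦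
    hloc.exists_global_fraction (ker_idemAct h) (germAt e.toSpace U heU a)
  -- Generators of `Γ(U)` have denominators dividing `q`, so the nonvanishing locus of `q` lies in
  -- `U` and is affine. As `π q ≠ 0`, some unit of the character monoid occurs in `q`, so the
  -- translates of `q` generate the unit ideal.
  let q := ∏ a ∈ F, s a
  have hq : idemAct h (AddMonoidAlgebra.lift k _ _ (charGerm h) q) ≠ 0 := by
    rw [map_prod, map_prod]
    exact Finset.prod_ne_zero_iff.2 fun a _ ↦ hs a
  let V := M.left.basicOpen (monSec h q)
  have hV : (V : Set M.left).Nonempty := by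
    rw [Set.nonempty_iff_ne_empty]
    intro h0
    have h1 : V = ⊥ := TopologicalSpace.Opens.ext h0
    rw [basicOpen_eq_bot_iff] at h1
    rw [← germ_monSec, h1, map_zero, map_zero] at hq
    exact hq rfl
  have hVU : V ≤ U := by
    refine le_preimage_of_fractions (𝟙 M) (O := U) hU (inter_nonempty ⟨_, heU⟩ hV) inf_le_left hF
      fun a ha ↦ ⟨monSec h (s a), monSec h (b a), ?_, fun x hx ↦ ?_⟩
    · have h1 : q = s a * ∏ a ∈ F.erase a, s a := (Finset.mul_prod_erase F s ha).symm
      change M.left.basicOpen _ ≤ _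
      rw [h1, map_mul, Scheme.basicOpen_mul]
      exact inf_le_left
    · exact ev_mul_eq_of_germ (X := M) heU (s := monSec h (s a)) (b := monSec h (b a))
        (by rw [germ_monSec, germ_monSec]; exact hsb a) x hx.1
  have hVaff : IsAffineOpen V := by
    have h1 := hU.basicOpen (M.left.presheaf.map (homOfLE le_top).op (monSec h q))
    rwa [Scheme.basicOpen_res, inf_eq_right.2 hVU] at h1
  obtain ⟨χ, hχ, hχ'⟩ := hloc.exists_unit_of_fixed hq
  refine isAffine_of_isAffineOpen_basicOpen _ (span_translates_eq_top h hχ hχ') ?_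
  rintro _ ⟨t, rfl⟩
  have h1 := Scheme.basicOpen_appLE (leftMul (tpt j t)).left ⊤ ⊤ le_top (monSec h q)
  rw [top_inf_eq] at h1
  have := isIso_leftMul_tpt j t
  refine (congr_arg IsAffineOpen h1).mpr ?_
  exact hVaff.preimage_of_isIso _

end Affineness

/-! ### The points of the monoid as homomorphisms to `k`. -/

section Points

variable {k : Type u} [Field k] [IsAlgClosed k] {n : ℕ} {M : Over (Spec (.of k))} [MonObj M]
  [IsSeparated M.hom] [LocallyOfFiniteType M.hom] [IsIntegral M.left] [IsAffine M.left]
  {j : splitTorus k n ⟶ M} [IsMonHom j] [IsOpenImmersion j.left] {e : Pt M}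

lemma exists_pt_ev {X : Over (Spec (.of k))} [IsAffine X.left] (g : Γ(X.left, ⊤) →ₐ[k] k) :
    ∃ x : Pt X, ∀ s, x.ev ⊤ (TopologicalSpace.Opens.mem_top _) s = g s := by
  have hU := isAffineOpen_top X.left
  let x : Pt X := Pt.mk (Spec.map (CommRingCat.ofHom g.toRingHom) ≫ hU.fromSpec) (by
    rw [Category.assoc, fromSpec_comp_hom, ← Spec.map_comp, ← CommRingCat.ofHom_comp]
    have h1 : g.toRingHom.comp (scalar X ⊤) = RingHom.id k := RingHom.ext g.commutes
    rw [h1]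
    exact Spec.map_id _)
  refine ⟨x, fun s ↦ ?_⟩
  have h1 := eq_specMap_fromSpec hU x.hom (x.le_preimage (TopologicalSpace.Opens.mem_top _))
  rw [show x.hom = _ ≫ hU.fromSpec from rfl, cancel_mono] at h1
  exact congr($(Spec.map_injective h1).hom s)

/-- The points of a toric monoid are the homomorphisms of its monoid of characters to `k`. -/
noncomputable def ptEquiv (h : IsCore j e) :
    Pt M ≃* (Multiplicative (charMonoid j e.toSpace) →* k) :=
  MulEquiv.ofBijective
    ({ toFun := charVal h
       map_one' := charVal_one h
       map_mul' := charVal_mul h } : Pt M →* (Multiplicative (charMonoid j e.toSpace) →* k)) (by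
    constructor
    · intro x y hxy
      have h1 : x.ev ⊤ (TopologicalSpace.Opens.mem_top _) =
          y.ev ⊤ (TopologicalSpace.Opens.mem_top _) := RingHom.ext fun f ↦ by
        obtain ⟨a, rfl⟩ := exists_monSec_eq h f
        rw [ev_monSec, ev_monSec, show charVal h x = charVal h y from hxy]
      refine Pt.ext_hom ?_
      rw [← eq_specMap_fromSpec (isAffineOpen_top M.left) x.hom
        (x.le_preimage (TopologicalSpace.Opens.mem_top _)),
        ← eq_specMap_fromSpec (isAffineOpen_top M.left) y.hom
        (y.le_preimage (TopologicalSpace.Opens.mem_top _))]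
      exact congr(Spec.map (CommRingCat.ofHom $h1) ≫ _)
    · intro ψ
      let E := AlgEquiv.ofBijective (monSec h) ⟨monSec_injective h, exists_monSec_eq h⟩
      obtain ⟨x, hx⟩ := exists_pt_ev ((AddMonoidAlgebra.lift k k _ ψ).comp E.symm.toAlgHom)
      refine ⟨x, MonoidHom.ext fun χ ↦ ?_⟩
      refine (hx (charSec h χ)).trans ?_
      have h1 : charSec h χ = E (AddMonoidAlgebra.single χ.toAdd 1) :=
        ((AddMonoidAlgebra.lift_single _ _ _).trans (one_smul _ _)).symm
      rw [h1, AlgHom.comp_apply]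
      change AddMonoidAlgebra.lift k k _ ψ (E.symm (E _)) = _
      rw [AlgEquiv.symm_apply_apply, AddMonoidAlgebra.lift_single, one_smul]
      rfl)

lemma isZariski_charVal (h : IsCore j e) : IsZariski fun x : Pt M ↦
    (AddMonoidAlgebra.lift k k (charMonoid j e.toSpace) (charVal h x)).toRingHom := by
  have hb (x : Pt M) (a) : AddMonoidAlgebra.lift k k (charMonoid j e.toSpace) (charVal h x) a = 0 ↔
      x.toSpace ∉ M.left.basicOpen (monSec h a) := by
    rw [x.mem_basicOpen ⊤ (TopologicalSpace.Opens.mem_top _), not_not, ev_monSec]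
  intro Z
  constructor
  · intro hZ
    refine ⟨{a | ∀ x ∈ Z, AddMonoidAlgebra.lift k k _ (charVal h x) a = 0}, ?_⟩
    refine Set.Subset.antisymm (fun x hx a ha ↦ ha x hx) fun x hx ↦ ?_
    by_contra hxZ
    obtain ⟨O, hO, hOZ⟩ := isOpen_induced_iff.1 hZ.isOpen_compl
    have hxO : x.toSpace ∈ O := by
      change x ∈ Pt.toSpace ⁻¹' O
      rw [hOZ]
      exact hxZ
    obtain ⟨_, ⟨_, ⟨f, rfl⟩, rfl⟩, hxf, hfO⟩ :=
      (isBasis_basicOpen M.left).exists_subset_of_mem_open hxO hO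
    obtain ⟨a, rfl⟩ := exists_monSec_eq h f
    refine (hb x a).1 (hx a fun y hy ↦ (hb y a).2 fun hya ↦ ?_) hxf
    have : y ∈ Pt.toSpace ⁻¹' O := hfO hya
    rw [hOZ] at this
    exact this hy
  · rintro ⟨I, rfl⟩
    rw [Set.ofPred_forall]
    refine isClosed_iInter fun a ↦ ?_
    rw [Set.ofPred_forall]
    refine isClosed_iInter fun _ ↦ isOpen_compl_iff.1
      (isOpen_induced_iff.2 ⟨_, (M.left.basicOpen (monSec h a)).2, ?_⟩)
    ext x
    exact ((not_congr (hb x a)).trans not_not).symm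

lemma isAffineToric [QuasiCompact M.hom] (h : IsCore j e) :
    IsAffineToric (charMonoid j e.toSpace) (ptEquiv h) := by
  have := LocallyOfFiniteType.isLocallyNoetherian M.hom
  exact ⟨(isLocalToric h).fg (ker_idemAct h), (isLocalToric h).closure_eq_top (ker_idemAct h),
    isZariski_charVal h⟩

end Points

end ToricMonoid

namespace ToricMonoid

/-! ### Group-like elements of monoid algebras. -/

section GroupLike

open AddMonoidAlgebra

variable {Ω : Type*} [CommRing Ω] {Q : Type*} [AddCommMonoid Q]

/-- Group-like elements of a monoid algebra. -/
def IsGroupLike (h : AddMonoidAlgebra Ω Q) : Prop :=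
  mapDomainAlgHom Ω Ω ((AddMonoidHom.id Q).prod (AddMonoidHom.id Q)) h =
    mapDomainAlgHom Ω Ω (AddMonoidHom.inl Q Q) h * mapDomainAlgHom Ω Ω (AddMonoidHom.inr Q Q) h

lemma algHom_ext_single {B S : Type*} [CommRing B] [Algebra Ω B] [AddCommMonoid S]
    {f g : AddMonoidAlgebra Ω S →ₐ[Ω] B} (h : ∀ s, f (single s 1) = g (single s 1)) : f = g :=
  AddMonoidAlgebra.algHom_ext h (Subsingleton.elim _ _)

lemma mapDomainAlgHom_single {P : Type*} [AddCommMonoid P] (f : Q →+ P) (q : Q) (r : Ω) :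
    mapDomainAlgHom Ω Ω f (single q r) = single (f q) r := mapDomain_single

lemma mapDomainAlgHom_mapDomainAlgHom {P R : Type*} [AddCommMonoid P] [AddCommMonoid R]
    (f : Q →+ P) (g : P →+ R) (x : AddMonoidAlgebra Ω Q) :
    mapDomainAlgHom Ω Ω g (mapDomainAlgHom Ω Ω f x) = mapDomainAlgHom Ω Ω (g.comp f) x :=
  (DFunLike.congr_fun (mapDomainAlgHom_comp f g) x).symm

/-- Group-like elements behave as characters: composing with the power map raises them to that
power. The induction applies `(q, q') ↦ (N + 1) • q + q'` to the group-like identity. -/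
lemma IsGroupLike.mapDomain_nsmul {h : AddMonoidAlgebra Ω Q} (hh : IsGroupLike h) (N : ℕ) :
    mapDomainAlgHom Ω Ω (nsmulAddMonoidHom (N + 1)) h = h ^ (N + 1) := by
  induction N with
  | zero =>
    rw [zero_add, pow_one, show nsmulAddMonoidHom (α := Q) 1 = AddMonoidHom.id Q from
      AddMonoidHom.ext one_nsmul, mapDomainAlgHom_id]
    rfl
  | succ N ih =>
    have h1 := congr_arg (mapDomainAlgHom Ω Ω
      ((nsmulAddMonoidHom (α := Q) (N + 1)).coprod (AddMonoidHom.id Q))) hh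
    rw [map_mul, mapDomainAlgHom_mapDomainAlgHom, mapDomainAlgHom_mapDomainAlgHom,
      mapDomainAlgHom_mapDomainAlgHom, AddMonoidHom.coprod_comp_inl, AddMonoidHom.coprod_comp_inr,
      ih, mapDomainAlgHom_id] at h1
    rw [pow_succ]
    refine Eq.trans (congr_arg (fun f ↦ mapDomainAlgHom Ω Ω f h) ?_) h1
    exact AddMonoidHom.ext fun q ↦ succ_nsmul q (N + 1)

/-- Invertible group-like elements over a sharp monoid are trivial. -/
lemma IsGroupLike.eq_one {h : AddMonoidAlgebra Ω Q} (hh : IsGroupLike h)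
    (hQ : ∀ q q' : Q, q + q' = 0 → q = 0) (hu : IsUnit h) : h = 1 := by
  classical
  have hQ' (q q' : Q) : q + q' = 0 ↔ q = 0 ∧ q' = 0 :=
    ⟨fun h ↦ ⟨hQ q q' h, hQ q' q (by rwa [add_comm])⟩, fun h ↦ by rw [h.1, h.2, add_zero]⟩
  -- `c` is evaluation at the zero point `q ↦ [q = 0]`, which is multiplicative because `Q` is
  -- sharp, and `κ` is the same evaluation in the second variable. Applying `κ` to the group-like
  -- identity gives `c h = h * c h`, and `c h` is invertible.
  let c : AddMonoidAlgebra Ω Q →ₐ[Ω] Ω := AddMonoidAlgebra.lift Ω Ω Q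
    { toFun := fun q ↦ if q.toAdd = 0 then 1 else 0
      map_one' := if_pos rfl
      map_mul' := fun q q' ↦ by
        rw [toAdd_mul]
        simp only [hQ', mul_ite, _root_.mul_one, mul_zero]
        split_ifs <;> simp_all }
  let κ : AddMonoidAlgebra Ω (Q × Q) →ₐ[Ω] AddMonoidAlgebra Ω Q := AddMonoidAlgebra.lift Ω _ (Q × Q)
    { toFun := fun q ↦ if q.toAdd.2 = 0 then single q.toAdd.1 1 else 0
      map_one' := if_pos rfl
      map_mul' := fun q q' ↦ by
        rw [toAdd_mul, Prod.snd_add, Prod.fst_add]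
        simp only [hQ', mul_ite, ite_mul, mul_zero, zero_mul]
        split_ifs <;> simp_all [single_mul_single] }
  have hc (q : Q) : c (single q 1) = if q = 0 then 1 else 0 :=
    (AddMonoidAlgebra.lift_single _ _ _).trans (one_smul _ _)
  have hκ (q : Q × Q) : κ (single q 1) = if q.2 = 0 then single q.1 1 else 0 :=
    (AddMonoidAlgebra.lift_single _ _ _).trans (one_smul _ _)
  have h1 : κ.comp (mapDomainAlgHom Ω Ω ((AddMonoidHom.id Q).prod (AddMonoidHom.id Q))) =
      (Algebra.ofId Ω _).comp c := algHom_ext_single fun q ↦ by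
    rw [AlgHom.comp_apply, AlgHom.comp_apply, mapDomainAlgHom_single, hκ, hc]
    change (if q = 0 then single q 1 else 0) = _
    split_ifs with hq
    · rw [hq, map_one]
      rfl
    · rw [map_zero]
  have h2 : κ.comp (mapDomainAlgHom Ω Ω (AddMonoidHom.inl Q Q)) = AlgHom.id Ω _ :=
    algHom_ext_single fun q ↦ by
      rw [AlgHom.comp_apply, mapDomainAlgHom_single, hκ]
      exact if_pos rfl
  have h3 : κ.comp (mapDomainAlgHom Ω Ω (AddMonoidHom.inr Q Q)) = (Algebra.ofId Ω _).comp c :=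
    algHom_ext_single fun q ↦ by
      rw [AlgHom.comp_apply, AlgHom.comp_apply, mapDomainAlgHom_single, hκ, hc]
      change (if q = 0 then single 0 1 else 0) = _
      split_ifs with hq
      · rw [map_one]
        rfl
      · rw [map_zero]
  have h4 := congr_arg κ hh
  rw [map_mul, ← AlgHom.comp_apply, ← AlgHom.comp_apply, ← AlgHom.comp_apply, h1, h2, h3] at h4
  have h5 : IsUnit ((Algebra.ofId Ω (AddMonoidAlgebra Ω Q)).comp c h) := hu.map _
  exact (h5.mul_right_cancel ((_root_.one_mul _).trans h4)).symm

end GroupLike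

/-! ### Forms of a monoid algebra over a smaller field. -/

section Form

open TensorProduct AddMonoidAlgebra

variable {F k A : Type u} [Field F] [Field k] [Algebra F k] [CommRing A] [Algebra F A]
  {S Q : Type} [AddCommMonoid S] [AddCommMonoid Q]

/-- A semigroup structure `op` on the functor of points of `A` over `F` whose extension of scalars
to `k` is the functor of points of the monoid algebra of `S`. -/
structure IsMonoidForm (θ : A →ₐ[F] AddMonoidAlgebra k S)
    (op : ∀ (B : Type u) [CommRing B] [Algebra F B],
      (A →ₐ[F] B) → (A →ₐ[F] B) → (A →ₐ[F] B)) : Prop where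
  exists_ext : ∀ (B : Type u) [CommRing B] [Algebra F B] [Algebra k B] [IsScalarTower F k B]
    (y : A →ₐ[F] B), ∃ ψ : AddMonoidAlgebra k S →ₐ[k] B, (ψ.restrictScalars F).comp θ = y
  ext_unique : ∀ (B : Type u) [CommRing B] [Algebra F B] [Algebra k B] [IsScalarTower F k B]
    (ψ ψ' : AddMonoidAlgebra k S →ₐ[k] B),
    (ψ.restrictScalars F).comp θ = (ψ'.restrictScalars F).comp θ → ψ = ψ'
  op_ext : ∀ (B : Type u) [CommRing B] [Algebra F B] [Algebra k B] [IsScalarTower F k B]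
    (ψ₁ ψ₂ ψ₃ : AddMonoidAlgebra k S →ₐ[k] B),
    (∀ s, ψ₃ (single s 1) = ψ₁ (single s 1) * ψ₂ (single s 1)) →
    op B ((ψ₁.restrictScalars F).comp θ) ((ψ₂.restrictScalars F).comp θ) =
      (ψ₃.restrictScalars F).comp θ
  op_comp : ∀ (B B' : Type u) [CommRing B] [Algebra F B] [CommRing B'] [Algebra F B']
    (f : B →ₐ[F] B') (x y : A →ₐ[F] B), op B' (f.comp x) (f.comp y) = f.comp (op B x y)

/-- A quotient of a monoid by the units and by torsion. -/
structure IsSharpQuotient (d : S →+ Q) : Prop where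
  torsion : ∀ s s', d s = d s' → ∃ N : ℕ, ∃ l l', IsAddUnit l ∧ IsAddUnit l' ∧
    (N + 1) • s + l = (N + 1) • s' + l'
  sharp : ∀ q q' : Q, q + q' = 0 → q = 0
  nsmul_injective : ∀ N : ℕ, Function.Injective fun q : Q ↦ (N + 1) • q

/-- The homomorphism of monoid algebras. -/
noncomputable abbrev monMap (k : Type*) [Field k] (d : S →+ Q) :
    AddMonoidAlgebra k S →ₐ[k] AddMonoidAlgebra k Q :=
  mapDomainAlgHom k k d

lemma apply_eq_zero_of_monMap {k B : Type*} [Field k] [CommRing B] [Algebra k B] {d : S →+ Q}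
    (G : AddMonoidAlgebra k S →ₐ[k] B)
    (hG : ∀ s s', d s = d s' → G (single s 1) = G (single s' 1)) {f : AddMonoidAlgebra k S}
    (hf : monMap k d f = 0) : G f = 0 := by
  classical
  have h1 (s : S) : Function.extend d (fun s ↦ G (single s 1)) 0 (d s) = G (single s 1) := by
    have : ∃ s', d s' = d s := ⟨s, rfl⟩
    rw [Function.extend_def, dif_pos this]
    exact hG _ _ this.choose_spec
  have h2 : G f = (f.coeff.mapDomain d).sum
      fun q c ↦ c • Function.extend d (fun s ↦ G (single s 1)) 0 q := by
    rw [Finsupp.sum_mapDomain_index (h := fun q c ↦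
      c • Function.extend d (fun s ↦ G (single s 1)) 0 q) (fun _ ↦ zero_smul _ _)
      (fun _ _ _ ↦ add_smul _ _ _)]
    simp only [h1]
    have h3 : G = AddMonoidAlgebra.lift k B S ((G : _ →* B).comp (AddMonoidAlgebra.of k S)) :=
      algHom_ext_single fun s ↦ by
        rw [AddMonoidAlgebra.lift_single, one_smul]
        rfl
    conv_lhs => rw [h3]
    rw [AddMonoidAlgebra.lift_apply]
    rfl
  have h4 : f.coeff.mapDomain d = 0 := congr_arg AddMonoidAlgebra.coeff hf
  rw [h2, h4, Finsupp.sum_zero_index]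

variable {θ : A →ₐ[F] AddMonoidAlgebra k S}
  {op : ∀ (B : Type u) [CommRing B] [Algebra F B], (A →ₐ[F] B) → (A →ₐ[F] B) → (A →ₐ[F] B)}
  {d : S →+ Q}

/-- The restriction of functions over `F` to the closed submonoid given by a quotient of the monoid
of characters. -/
noncomputable def quotMap (θ : A →ₐ[F] AddMonoidAlgebra k S) (d : S →+ Q) :
    A →ₐ[F] AddMonoidAlgebra k Q :=
  ((monMap k d).restrictScalars F).comp θ

lemma mapDomain_mapAlgHom {Ω P : Type*} [AddCommMonoid P] [CommRing Ω] [Algebra F Ω] (g : Q →+ P)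
    (f : k →ₐ[F] Ω) (x : AddMonoidAlgebra k Q) :
    mapAlgHom P f (mapDomainAlgHom k k g x) = mapDomainAlgHom Ω Ω g (mapAlgHom Q f x) := by
  induction x using AddMonoidAlgebra.induction_linear with
  | zero => simp
  | add x y hx hy => rw [map_add, map_add, map_add, map_add, hx, hy]
  | single q r =>
    rw [mapDomainAlgHom_single]
    simp [mapDomainAlgHom_single, mapAlgHom]

namespace IsMonoidForm

/-- Here `f` is a second embedding of `k`, in general not the structure map of `Ω`. Since `op` is
natural over `F`, transport along `f` preserves products of points, while these products are also
computed by characters through the structure map. Uniqueness of extensions compares the two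
computations. -/
lemma isGroupLike (h : IsMonoidForm θ op) {Ω : Type u} [CommRing Ω] [Algebra F Ω] [Algebra k Ω]
    [IsScalarTower F k Ω] (f : k →ₐ[F] Ω) {ψ : AddMonoidAlgebra k S →ₐ[k] AddMonoidAlgebra Ω Q}
    (hψ : (ψ.restrictScalars F).comp θ = (mapAlgHom Q f).comp (quotMap θ d)) (s : S) :
    IsGroupLike (ψ (single s 1)) := by
  let i (g : Q →+ Q × Q) : AddMonoidAlgebra Ω Q →ₐ[k] AddMonoidAlgebra Ω (Q × Q) :=
    (mapDomainAlgHom Ω Ω g).restrictScalars k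
  let i' (g : Q →+ Q × Q) : AddMonoidAlgebra k Q →ₐ[k] AddMonoidAlgebra k (Q × Q) :=
    mapDomainAlgHom k k g
  have key (g : Q →+ Q × Q) : (((i g).comp ψ).restrictScalars F).comp θ =
      (mapAlgHom (Q × Q) f).comp ((((i' g).comp (monMap k d)).restrictScalars F).comp θ) := by
    ext1 a
    have h1 := DFunLike.congr_fun hψ a
    exact (congr_arg (i g) h1).trans (mapDomain_mapAlgHom g f _).symm
  let Δ := (AddMonoidHom.id Q).prod (AddMonoidHom.id Q)
  have h1 := h.op_ext _ ((i' (.inl Q Q)).comp (monMap k d)) ((i' (.inr Q Q)).comp (monMap k d))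
    ((i' Δ).comp (monMap k d)) fun s ↦ by
      simp only [AlgHom.comp_apply, i', mapDomainAlgHom_single, single_mul_single]
      simp [Δ]
  have h2 := h.op_comp _ _ (mapAlgHom (Q × Q) f)
    ((((i' (.inl Q Q)).comp (monMap k d)).restrictScalars F).comp θ)
    ((((i' (.inr Q Q)).comp (monMap k d)).restrictScalars F).comp θ)
  rw [h1, ← key, ← key, ← key] at h2
  let ψ₃ : AddMonoidAlgebra k S →ₐ[k] AddMonoidAlgebra Ω (Q × Q) := AddMonoidAlgebra.lift k _ S
    ((((i (.inl Q Q)).comp ψ : _ →* _).comp (AddMonoidAlgebra.of k S)) *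
      (((i (.inr Q Q)).comp ψ : _ →* _).comp (AddMonoidAlgebra.of k S)))
  have hψ₃ (s : S) : ψ₃ (single s 1) =
      (i (.inl Q Q)).comp ψ (single s 1) * (i (.inr Q Q)).comp ψ (single s 1) :=
    (AddMonoidAlgebra.lift_single _ _ _).trans (one_smul _ _)
  rw [h.op_ext _ _ _ ψ₃ hψ₃] at h2
  have h3 := h.ext_unique _ _ _ h2
  exact (DFunLike.congr_fun h3 (single s 1)).symm.trans (hψ₃ s)

/-- Units of `S` give invertible group-like elements, which are 1. For `d s = d s'`, the torsion
relation makes the two elements equal after applying multiplication by `N + 1`, which is injective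
on `Q`. -/
lemma ext_eq (h : IsMonoidForm θ op) (hd : IsSharpQuotient d) {Ω : Type u} [CommRing Ω]
    [Algebra F Ω] [Algebra k Ω] [IsScalarTower F k Ω] (f : k →ₐ[F] Ω)
    {ψ : AddMonoidAlgebra k S →ₐ[k] AddMonoidAlgebra Ω Q}
    (hψ : (ψ.restrictScalars F).comp θ = (mapAlgHom Q f).comp (quotMap θ d)) {s s' : S}
    (hs : d s = d s') : ψ (single s 1) = ψ (single s' 1) := by
  have hadd (s s' : S) : ψ (single (s + s') 1) = ψ (single s 1) * ψ (single s' 1) := by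
    rw [← map_mul, single_mul_single, _root_.mul_one]
  have hnsmul (N : ℕ) (s : S) : ψ (single ((N + 1) • s) 1) =
      mapDomainAlgHom Ω Ω (nsmulAddMonoidHom (N + 1)) (ψ (single s 1)) := by
    rw [(h.isGroupLike f hψ s).mapDomain_nsmul, ← map_pow, single_pow, one_pow]
  have hunit (l : S) (hl : IsAddUnit l) : ψ (single l 1) = 1 := by
    refine (h.isGroupLike f hψ l).eq_one hd.sharp ?_
    obtain ⟨l', hl'⟩ := hl.exists_neg
    refine IsUnit.of_mul_eq_one (ψ (single l' 1)) ?_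
    rw [← hadd, hl']
    exact map_one ψ
  obtain ⟨N, l, l', hl, hl', e⟩ := hd.torsion s s' hs
  have h1 := congr_arg (fun s ↦ ψ (single s 1)) e
  simp only [hadd, hunit l hl, hunit l' hl', _root_.mul_one, hnsmul] at h1
  exact mapDomain_injective (hd.nsmul_injective N) h1

/-- The closed subscheme of the form over `F`. -/
noncomputable abbrev ideal (θ : A →ₐ[F] AddMonoidAlgebra k S) (d : S →+ Q) : Ideal A := RingHom.ker (quotMap θ d)

noncomputable def quotIncl (θ : A →ₐ[F] AddMonoidAlgebra k S) (d : S →+ Q) :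
    (A ⧸ ideal θ d) →ₐ[F] AddMonoidAlgebra k Q :=
  Ideal.kerLiftAlg (quotMap θ d)

lemma quotIncl_injective : Function.Injective (quotIncl θ d) := Ideal.kerLiftAlg_injective _

/-- The extension of scalars of the restriction to the closed subscheme. -/
lemma exists_restriction (h : IsMonoidForm θ op) (hd : IsSharpQuotient d) :
    ∃ ψ : AddMonoidAlgebra k S →ₐ[k] k ⊗[F] (A ⧸ ideal θ d),
      (ψ.restrictScalars F).comp θ =
        Algebra.TensorProduct.includeRight.comp (Ideal.Quotient.mkₐ F (ideal θ d)) ∧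
      ∀ s s', d s = d s' → ψ (single s 1) = ψ (single s' 1) := by
  obtain ⟨ψ, hψ⟩ := h.exists_ext (k ⊗[F] (A ⧸ ideal θ d))
    (Algebra.TensorProduct.includeRight.comp (Ideal.Quotient.mkₐ F (ideal θ d)))
  refine ⟨ψ, hψ, fun s s' hs ↦ ?_⟩
  -- By flatness the target embeds in `k ⊗[F] k[Q] = (k ⊗[F] k)[Q]`. The structure map is the left
  -- embedding of `k`, and `f` is the right one.
  let E := AddMonoidAlgebra.rTensorEquivAlgEquiv (M := Q) F k k k
  let j : k ⊗[F] (A ⧸ ideal θ d) →ₐ[k] AddMonoidAlgebra (k ⊗[F] k) Q :=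
    E.toAlgHom.comp (Algebra.TensorProduct.map (AlgHom.id k k) (quotIncl θ d))
  have hj : Function.Injective j := by
    refine E.injective.comp ?_
    exact Module.Flat.lTensor_preserves_injective_linearMap (M := k) (quotIncl θ d).toLinearMap
      quotIncl_injective
  refine hj (h.ext_eq hd (Algebra.TensorProduct.includeRight : k →ₐ[F] k ⊗[F] k) (ψ := j.comp ψ)
    ?_ hs)
  ext1 a
  have h1 := congr_arg j (DFunLike.congr_fun hψ a)
  refine h1.trans ?_
  change E (Algebra.TensorProduct.map _ _ (1 ⊗ₜ _)) = _
  rw [Algebra.TensorProduct.map_tmul]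
  refine (AddMonoidAlgebra.rTensorEquiv_tmulAlgEquiv _ _).trans ?_
  rw [map_one, one_smul]
  rfl

/-- The tensor product embeds in `k[Q]`: it is a quotient of `k[S]` by `ψ`, and `ψ` identifies
characters with the same image in `Q`, so it kills whatever dies in `k[Q]`. -/
lemma isReduced_tensor (h : IsMonoidForm θ op) (hd : IsSharpQuotient d)
    [IsReduced (AddMonoidAlgebra k Q)] : IsReduced (k ⊗[F] (A ⧸ ideal θ d)) := by
  obtain ⟨ψ, hψ, hψd⟩ := h.exists_restriction hd
  let c : k ⊗[F] (A ⧸ ideal θ d) →ₐ[k] AddMonoidAlgebra k Q :=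
    Algebra.TensorProduct.lift (Algebra.ofId k _) (quotIncl θ d) fun _ _ ↦ .all _ _
  have hc : c.comp ψ = monMap k d := by
    refine h.ext_unique _ _ _ ?_
    ext1 a
    refine (congr_arg c (DFunLike.congr_fun hψ a)).trans ?_
    refine (Algebra.TensorProduct.lift_tmul _ _ _ _ _).trans ?_
    rw [map_one, _root_.one_mul]
    rfl
  have hsurj : Function.Surjective ψ := by
    intro z
    induction z using TensorProduct.induction_on with
    | zero => exact ⟨0, map_zero _⟩
    | tmul κ a =>
      obtain ⟨a, rfl⟩ := Ideal.Quotient.mk_surjective a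
      refine ⟨κ • θ a, ?_⟩
      rw [map_smul, show ψ (θ a) = _ from DFunLike.congr_fun hψ a]
      exact (TensorProduct.smul_tmul' _ _ _).trans (by rw [smul_eq_mul, _root_.mul_one]; rfl)
    | add x y hx hy =>
      obtain ⟨x, rfl⟩ := hx
      obtain ⟨y, rfl⟩ := hy
      exact ⟨x + y, map_add _ _ _⟩
  refine isReduced_of_injective c ((injective_iff_map_eq_zero _).2 fun z hz ↦ ?_)
  obtain ⟨f, rfl⟩ := hsurj z
  exact apply_eq_zero_of_monMap ψ hψd ((DFunLike.congr_fun hc f).symm.trans hz)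

/-- A point vanishing on the ideal factors through the base change of the closed subscheme, where
`exists_restriction` has already identified the characters. -/
lemma forall_ideal_iff (h : IsMonoidForm θ op) (hd : IsSharpQuotient d)
    (ψ : AddMonoidAlgebra k S →ₐ[k] k) :
    (∀ a ∈ ideal θ d, ψ (θ a) = 0) ↔
      ∀ s s', d s = d s' → ψ (single s 1) = ψ (single s' 1) := by
  constructor
  · intro H
    obtain ⟨ψ₀, hψ₀, hψd⟩ := h.exists_restriction hd
    let y : (A ⧸ ideal θ d) →ₐ[F] k :=
      Ideal.Quotient.liftₐ _ ((ψ.restrictScalars F).comp θ) H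
    let c : k ⊗[F] (A ⧸ ideal θ d) →ₐ[k] k :=
      Algebra.TensorProduct.lift (AlgHom.id k k) y fun _ _ ↦ .all _ _
    have hc : c.comp ψ₀ = ψ := by
      refine h.ext_unique _ _ _ ?_
      ext1 a
      refine (congr_arg c (DFunLike.congr_fun hψ₀ a)).trans ?_
      refine (Algebra.TensorProduct.lift_tmul _ _ _ _ _).trans ?_
      rw [map_one, _root_.one_mul]
      rfl
    intro s s' hs
    rw [← hc, AlgHom.comp_apply, AlgHom.comp_apply, hψd s s' hs]
  · exact fun H a ha ↦ apply_eq_zero_of_monMap ψ H ha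

/-- The closed subscheme is stable under multiplication. -/
lemma op_eq_zero (h : IsMonoidForm θ op) (hd : IsSharpQuotient d) {a : A} (ha : a ∈ ideal θ d) :
    op ((A ⧸ ideal θ d) ⊗[F] (A ⧸ ideal θ d))
      (Algebra.TensorProduct.includeLeft.comp (Ideal.Quotient.mkₐ F (ideal θ d)))
      (Algebra.TensorProduct.includeRight.comp (Ideal.Quotient.mkₐ F (ideal θ d))) a = 0 := by
  obtain ⟨ψ₀, hψ₀, hψd⟩ := h.exists_restriction hd
  let J : (A ⧸ ideal θ d) ⊗[F] (A ⧸ ideal θ d) →ₐ[F]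
      AddMonoidAlgebra k Q ⊗[F] AddMonoidAlgebra k Q :=
    Algebra.TensorProduct.map (quotIncl θ d) (quotIncl θ d)
  have hJ : Function.Injective J := TensorProduct.map_injective_of_flat_flat
    (quotIncl θ d).toLinearMap (quotIncl θ d).toLinearMap quotIncl_injective quotIncl_injective
  refine hJ ?_
  rw [map_zero, ← AlgHom.comp_apply, ← h.op_comp]
  -- The `k`-structure is that of the left factor, so the left point is given by `monMap k d`. The
  -- right point carries the other `k`-structure and is reached through `ψ₀`, whose characters
  -- factor through `d` as well.
  let ψ₁ : AddMonoidAlgebra k S →ₐ[k] AddMonoidAlgebra k Q ⊗[F] AddMonoidAlgebra k Q :=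
    (Algebra.TensorProduct.includeLeft (S := k)).comp (monMap k d)
  let τ : k ⊗[F] (A ⧸ ideal θ d) →ₐ[k] AddMonoidAlgebra k Q ⊗[F] AddMonoidAlgebra k Q :=
    Algebra.TensorProduct.lift (Algebra.ofId k _)
      (Algebra.TensorProduct.includeRight.comp (quotIncl θ d)) fun _ _ ↦ .all _ _
  have h1 : J.comp (Algebra.TensorProduct.includeLeft.comp (Ideal.Quotient.mkₐ F (ideal θ d))) =
      (ψ₁.restrictScalars F).comp θ := by
    ext1 a
    refine (Algebra.TensorProduct.map_tmul _ _ _ _).trans ?_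
    rw [map_one]
    rfl
  have h2 : J.comp (Algebra.TensorProduct.includeRight.comp (Ideal.Quotient.mkₐ F (ideal θ d))) =
      ((τ.comp ψ₀).restrictScalars F).comp θ := by
    ext1 a
    refine (Algebra.TensorProduct.map_tmul _ _ _ _).trans ?_
    refine Eq.trans ?_ (congr_arg τ (DFunLike.congr_fun hψ₀ a)).symm
    refine Eq.trans ?_ (Algebra.TensorProduct.lift_tmul _ _ _ _ _).symm
    rw [map_one, map_one, _root_.one_mul]
    rfl
  let ψ₃ : AddMonoidAlgebra k S →ₐ[k] AddMonoidAlgebra k Q ⊗[F] AddMonoidAlgebra k Q :=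
    AddMonoidAlgebra.lift k _ S (((ψ₁ : _ →* _).comp (AddMonoidAlgebra.of k S)) *
      ((τ.comp ψ₀ : _ →* _).comp (AddMonoidAlgebra.of k S)))
  have hψ₃ (s : S) : ψ₃ (single s 1) = ψ₁ (single s 1) * τ.comp ψ₀ (single s 1) :=
    (AddMonoidAlgebra.lift_single _ _ _).trans (one_smul _ _)
  rw [h1, h2, h.op_ext _ _ _ ψ₃ hψ₃]
  refine apply_eq_zero_of_monMap (d := d) ψ₃ (fun s s' hs ↦ ?_) ha
  rw [hψ₃, hψ₃, AlgHom.comp_apply, AlgHom.comp_apply, hψd s s' hs, AlgHom.comp_apply,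
    AlgHom.comp_apply, mapDomainAlgHom_single, mapDomainAlgHom_single, hs]

end IsMonoidForm

end Form

end ToricMonoid

/-! ### Descent of affineness. -/

namespace ToricMonoid

/-- A quasi-compact separated scheme over a field is affine if it becomes affine over an
extension field. -/
lemma isAffine_of_isPullback {X Y S T : Scheme.{u}} {g : Y ⟶ X} {iY : Y ⟶ T} {iX : X ⟶ S}
    {f : T ⟶ S} (H : IsPullback g iY iX f) [IsAffine S] [IsAffine T] [IsAffine Y] [Flat f]
    [Surjective f] [CompactSpace X] [QuasiSeparatedSpace X] : IsAffine X := by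
  -- Flat base change identifies the canonical morphism `Y ⟶ Spec Γ(Y)`, an isomorphism, with a
  -- faithfully flat base change of `X ⟶ Spec Γ(X)`; isomorphisms descend.
  have h1 := isIso_pushoutSection_of_isQuasiSeparated_of_flat_right H (US := ⊤) (UT := ⊤) (UX := ⊤)
    (UY := ⊤) le_top le_top (by simp) (isAffineOpen_top S) (isAffineOpen_top T)
    CompactSpace.isCompact_univ (isQuasiSeparated_univ)
  have h2 := isPullback_SpecMap_of_isPushout _ _ _ _ ((isIso_pushoutSection_iff H _ _ _).mp h1)
  have h2 : IsPullback (Spec.map g.appTop) (Spec.map iY.appTop) (Spec.map iX.appTop)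
      (Spec.map f.appTop) := by
    have h (Z W : Scheme.{u}) (p : Z ⟶ W) (q) : p.appLE ⊤ ⊤ q = p.appTop :=
      Scheme.Hom.appLE_eq_app _
    convert h2 using 2 <;> exact (h _ _ _ _).symm
  have hbig : IsPullback g (iY ≫ T.toSpecΓ) (iX ≫ S.toSpecΓ) (Spec.map f.appTop) :=
    H.paste_vert (.of_vert_isIso ⟨Scheme.toSpecΓ_naturality f⟩)
  have hbig' : IsPullback g (Y.toSpecΓ ≫ Spec.map iY.appTop) (X.toSpecΓ ≫ Spec.map iX.appTop) (Spec.map f.appTop) := by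
    rw [← Scheme.toSpecΓ_naturality, ← Scheme.toSpecΓ_naturality]; exact hbig
  have hleft := IsPullback.of_bot hbig' (Scheme.toSpecΓ_naturality g) h2
  have hf : (@Surjective ⊓ @Flat ⊓ @QuasiCompact : MorphismProperty Scheme.{u}) (Spec.map g.appTop) := by
    have he : Spec.map f.appTop = inv T.toSpecΓ ≫ f ≫ S.toSpecΓ := by
      rw [Scheme.toSpecΓ_naturality, IsIso.inv_hom_id_assoc]
    have hs : Surjective (Spec.map f.appTop) := he ▸ inferInstance
    have hfl : Flat (Spec.map f.appTop) := he ▸ inferInstance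
    exact ⟨⟨MorphismProperty.of_isPullback h2.flip hs, MorphismProperty.of_isPullback h2.flip hfl⟩,
      inferInstance⟩
  have : MorphismProperty.isomorphisms Scheme.{u} X.toSpecΓ :=
    MorphismProperty.of_isPullback_of_descendsAlong (P := .isomorphisms Scheme.{u}) (Q := @Surjective ⊓ @Flat ⊓ @QuasiCompact) hleft.flip hf (inferInstanceAs (IsIso _))
  exact ⟨this⟩

end ToricMonoid

namespace ToricMonoid

/-! ### Semigroup laws on the points of an affine scheme. -/

section Spectra

variable {F : Type u} [Field F] {A B C : Type u} [CommRing A] [Algebra F A] [CommRing B]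
  [Algebra F B] [CommRing C] [Algebra F C]

/-- The algebra homomorphism corresponding to a morphism of spectra. -/
noncomputable def algOf (f : specOver F B ⟶ specOver F A) : A →ₐ[F] B where
  toRingHom := (Spec.preimage f.left).hom
  commutes' r := by
    have h : Spec.map (CommRingCat.ofHom (algebraMap F A) ≫ Spec.preimage f.left) =
        Spec.map (CommRingCat.ofHom (algebraMap F B)) :=
      (Spec.map_comp _ _).trans ((congr_arg (· ≫ _) (Spec.map_preimage f.left)).trans (Over.w f))
    exact congr($(Spec.map_injective h) r)

lemma specOverMap_algOf (f : specOver F B ⟶ specOver F A) : specOverMap (algOf f) = f :=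
  Over.OverMorphism.ext (Spec.map_preimage f.left)

lemma specOverMap_injective : Function.Injective
    (specOverMap : (A →ₐ[F] B) → (specOver F B ⟶ specOver F A)) := by
  intro f g h
  have h1 := Spec.map_injective congr(Over.Hom.left $h)
  ext a
  exact congr($h1 a)

lemma exists_specOver_iso (X : Over (Spec (.of F))) [IsAffine X.left] :
    ∃ (A : Type u) (_ : CommRing A) (_ : Algebra F A), Nonempty (specOver F A ≅ X) := by
  refine ⟨Γ(X.left, ⊤), inferInstance,
    (Spec.preimage (X.left.isoSpec.inv ≫ X.hom)).hom.toAlgebra, ⟨Over.isoMk X.left.isoSpec.symm ?_⟩⟩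
  exact (Spec.map_preimage (X.left.isoSpec.inv ≫ X.hom)).symm

variable {X : Over (Spec (.of F))}

/-- The operation on points of an affine scheme given by a morphism `X ⊗ X ⟶ X`. -/
noncomputable def pointOp (m : X ⊗ X ⟶ X) (ξ : specOver F A ≅ X) (B : Type u) [CommRing B]
    [Algebra F B] (x y : A →ₐ[F] B) : A →ₐ[F] B :=
  algOf (CartesianMonoidalCategory.lift (specOverMap x ≫ ξ.hom) (specOverMap y ≫ ξ.hom) ≫ m ≫ ξ.inv)

lemma specOverMap_pointOp (m : X ⊗ X ⟶ X) (ξ : specOver F A ≅ X) (x y : A →ₐ[F] B) :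
    specOverMap (pointOp m ξ B x y) ≫ ξ.hom =
      CartesianMonoidalCategory.lift (specOverMap x ≫ ξ.hom) (specOverMap y ≫ ξ.hom) ≫ m := by
  simp [pointOp, specOverMap_algOf]

lemma pointOp_comp (m : X ⊗ X ⟶ X) (ξ : specOver F A ≅ X) (f : B →ₐ[F] C) (x y : A →ₐ[F] B) :
    pointOp m ξ C (f.comp x) (f.comp y) = f.comp (pointOp m ξ B x y) := by
  refine specOverMap_injective ((cancel_mono ξ.hom).1 ?_)
  rw [specOverMap_pointOp, ← specOverMap_comp, ← specOverMap_comp, ← specOverMap_comp,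
    Category.assoc, Category.assoc, Category.assoc, specOverMap_pointOp,
    ← CartesianMonoidalCategory.comp_lift, Category.assoc]

end Spectra

/-! ### Extension of scalars in terms of points. -/

section Descent

variable {F k : Type u} [Field F] [Field k] [Algebra F k] {B C : Type u} [CommRing B] [Algebra k B]
  [Algebra F B] [IsScalarTower F k B] [CommRing C] [Algebra k C]
  [Algebra F C] [IsScalarTower F k C] {X Y : Over (Spec (.of F))}

/-- The morphism over the small field underlying a morphism to an extension of scalars. -/
noncomputable def descendHom (w : specOver k B ⟶ (baseChange F k).obj X) : specOver F B ⟶ X :=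
  Over.homMk (w.left ≫ Limits.pullback.fst _ _) (by
    have h : w.left ≫ Limits.pullback.snd _ _ = Spec.map (CommRingCat.ofHom (algebraMap k B)) :=
      Over.w w
    change (w.left ≫ Limits.pullback.fst _ _) ≫ X.hom =
      Spec.map (CommRingCat.ofHom (algebraMap F B))
    rw [Category.assoc, Limits.pullback.condition, reassoc_of% h]
    refine (Spec.map_comp _ _).symm.trans ?_
    rw [← CommRingCat.ofHom_comp, ← IsScalarTower.algebraMap_eq])

lemma descendHom_injective : Function.Injective
    (descendHom : (specOver k B ⟶ (baseChange F k).obj X) → (specOver F B ⟶ X)) := by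
  intro v w h
  refine Over.OverMorphism.ext (Limits.pullback.hom_ext congr(Over.Hom.left $h) ?_)
  exact (Over.w v).trans (Over.w w).symm

lemma descendHom_surjective : Function.Surjective
    (descendHom : (specOver k B ⟶ (baseChange F k).obj X) → (specOver F B ⟶ X)) := by
  intro v
  have h : v.left ≫ X.hom = Spec.map (CommRingCat.ofHom (algebraMap k B)) ≫
      Spec.map (CommRingCat.ofHom (algebraMap F k)) := by
    rw [← Spec.map_comp, ← CommRingCat.ofHom_comp, ← IsScalarTower.algebraMap_eq]
    exact Over.w v
  exact ⟨Over.homMk (Limits.pullback.lift v.left _ h) (Limits.pullback.lift_snd _ _ _),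
    Over.OverMorphism.ext (Limits.pullback.lift_fst _ _ _)⟩

lemma descendHom_specOverMap (ψ : B →ₐ[k] C) (w : specOver k B ⟶ (baseChange F k).obj X) :
    descendHom (specOverMap ψ ≫ w) = specOverMap (ψ.restrictScalars F) ≫ descendHom w :=
  Over.OverMorphism.ext (Category.assoc _ _ _)

lemma descendHom_map (w : specOver k B ⟶ (baseChange F k).obj X) (f : X ⟶ Y) :
    descendHom (w ≫ (baseChange F k).map f) = descendHom w ≫ f := by
  refine Over.OverMorphism.ext ?_
  have h : ((baseChange F k).map f).left ≫ Limits.pullback.fst _ _ =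
    Limits.pullback.fst _ _ ≫ f.left := Limits.pullback.lift_fst _ _ _
  change (w.left ≫ ((baseChange F k).map f).left) ≫ Limits.pullback.fst _ _ =
    (w.left ≫ Limits.pullback.fst _ _) ≫ f.left
  rw [Category.assoc, Category.assoc, h]

lemma descendHom_lift (v : specOver k B ⟶ (baseChange F k).obj X)
    (w : specOver k B ⟶ (baseChange F k).obj Y) :
    descendHom (CartesianMonoidalCategory.lift v w ≫
      Functor.LaxMonoidal.μ (baseChange F k) X Y) =
      CartesianMonoidalCategory.lift (descendHom v) (descendHom w) := by
  refine CartesianMonoidalCategory.hom_ext _ _ ?_ ?_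
  · rw [← descendHom_map, Category.assoc, Functor.Monoidal.μ_fst]
    simp
  · rw [← descendHom_map, Category.assoc, Functor.Monoidal.μ_snd]
    simp

/-- If an affine semigroup over an extension field is the spectrum of a monoid algebra with the
standard multiplication, then its form over the small field is a form of that monoid algebra. -/
lemma isMonoidForm {S : Type} [AddCommMonoid S] {A : Type u} [CommRing A] [Algebra F A]
    (m : X ⊗ X ⟶ X) (ξ : specOver F A ≅ X)
    (Ψ : specOver k (AddMonoidAlgebra k S) ≅ (baseChange F k).obj X)
    (hΨ : ∀ (B : Type u) [CommRing B] [Algebra k B] (ψ₁ ψ₂ ψ₃ : AddMonoidAlgebra k S →ₐ[k] B),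
      (∀ s, ψ₃ (.single s 1) = ψ₁ (.single s 1) * ψ₂ (.single s 1)) →
      CartesianMonoidalCategory.lift (specOverMap ψ₁ ≫ Ψ.hom) (specOverMap ψ₂ ≫ Ψ.hom) ≫
        Functor.LaxMonoidal.μ (baseChange F k) X X ≫ (baseChange F k).map m =
          specOverMap ψ₃ ≫ Ψ.hom) :
    IsMonoidForm (algOf (descendHom Ψ.hom ≫ ξ.inv)) (fun B _ _ ↦ pointOp m ξ B) := by
  set θ := algOf (descendHom Ψ.hom ≫ ξ.inv) with hθ
  have h0 : specOverMap θ ≫ ξ.hom = descendHom Ψ.hom := by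
    rw [hθ, specOverMap_algOf, Category.assoc, Iso.inv_hom_id, Category.comp_id]
  have h1 (B : Type u) [CommRing B] [Algebra k B] [Algebra F B] [IsScalarTower F k B]
      (ψ : AddMonoidAlgebra k S →ₐ[k] B) :
      specOverMap ((ψ.restrictScalars F).comp θ) ≫ ξ.hom = descendHom (specOverMap ψ ≫ Ψ.hom) := by
    rw [← specOverMap_comp, Category.assoc, h0, descendHom_specOverMap]
  refine ⟨?_, ?_, ?_, ?_⟩
  · intro B _ _ _ _ y
    obtain ⟨w, hw⟩ := descendHom_surjective (k := k) (specOverMap y ≫ ξ.hom)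
    refine ⟨algOf (w ≫ Ψ.inv), specOverMap_injective ((cancel_mono ξ.hom).1 ?_)⟩
    rw [h1, specOverMap_algOf, Category.assoc, Iso.inv_hom_id, Category.comp_id, hw]
  · intro B _ _ _ _ ψ ψ' h
    refine specOverMap_injective ((cancel_mono Ψ.hom).1 (descendHom_injective (F := F) ?_))
    rw [← h1, ← h1, h]
  · intro B _ _ _ _ ψ₁ ψ₂ ψ₃ h
    refine specOverMap_injective ((cancel_mono ξ.hom).1 ?_)
    rw [specOverMap_pointOp, h1, h1, h1, ← hΨ B ψ₁ ψ₂ ψ₃ h, ← Category.assoc, descendHom_map,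
      descendHom_lift]
  · intro B B' _ _ _ _ f x y
    exact pointOp_comp m ξ f x y

end Descent

end ToricMonoid

namespace ToricMonoid

/-! ### Closed subsemigroups defined by ideals. -/

section Subscheme

open TensorProduct

variable {F : Type u} [Field F] {A B C : Type u} [CommRing A] [Algebra F A] [CommRing B]
  [Algebra F B] [CommRing C] [Algebra F C] {X : Over (Spec (.of F))}

instance isIso_lift_specOverMap : IsIso (CartesianMonoidalCategory.lift
    (specOverMap (k := F) (Algebra.TensorProduct.includeLeft : B →ₐ[F] B ⊗[F] C))
    (specOverMap Algebra.TensorProduct.includeRight)) := by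
  have h : (CartesianMonoidalCategory.lift
      (specOverMap (k := F) (Algebra.TensorProduct.includeLeft : B →ₐ[F] B ⊗[F] C))
      (specOverMap Algebra.TensorProduct.includeRight)).left = (pullbackSpecIso F B C).inv := by
    refine Limits.pullback.hom_ext ?_ ?_
    · refine Eq.trans ?_ (pullbackSpecIso_inv_fst F B C).symm
      exact congr_arg Over.Hom.left (CartesianMonoidalCategory.lift_fst
        (specOverMap (k := F) (Algebra.TensorProduct.includeLeft : B →ₐ[F] B ⊗[F] C))
        (specOverMap Algebra.TensorProduct.includeRight))
    · refine Eq.trans ?_ (pullbackSpecIso_inv_snd F B C).symm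
      exact congr_arg Over.Hom.left (CartesianMonoidalCategory.lift_snd
        (specOverMap (k := F) (Algebra.TensorProduct.includeLeft : B →ₐ[F] B ⊗[F] C))
        (specOverMap Algebra.TensorProduct.includeRight))
  have : IsIso ((Over.forget (Spec (.of F))).map (CartesianMonoidalCategory.lift
      (specOverMap (k := F) (Algebra.TensorProduct.includeLeft : B →ₐ[F] B ⊗[F] C))
      (specOverMap Algebra.TensorProduct.includeRight))) := by
    change IsIso (CartesianMonoidalCategory.lift
      (specOverMap (k := F) (Algebra.TensorProduct.includeLeft : B →ₐ[F] B ⊗[F] C))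
      (specOverMap Algebra.TensorProduct.includeRight)).left
    rw [h]
    exact Iso.isIso_inv (pullbackSpecIso F B C)
  exact isIso_of_reflects_iso _ (Over.forget _)

/-- The closed subscheme of an affine scheme given by an ideal. -/
noncomputable def idealInclusion (ξ : specOver F A ≅ X) (I : Ideal A) : specOver F (A ⧸ I) ⟶ X :=
  specOverMap (Ideal.Quotient.mkₐ F I) ≫ ξ.hom

instance (ξ : specOver F A ≅ X) (I : Ideal A) : IsClosedImmersion (idealInclusion ξ I).left := by
  have h : IsClosedImmersion (Spec.map (CommRingCat.ofHom (Ideal.Quotient.mkₐ F I).toRingHom)) :=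
    .spec_of_surjective _ Ideal.Quotient.mk_surjective
  have h' : IsIso ((Over.forget _).map ξ.hom) := inferInstance
  have key {P Q R : Scheme.{u}} (a : P ⟶ Q) (b : Q ⟶ R) (_ : IsClosedImmersion a) (_ : IsIso b) :
    IsClosedImmersion (a ≫ b) := inferInstance
  exact key _ _ h h'

lemma exists_comp_idealInclusion_iff (ξ : specOver F A ≅ X) (I : Ideal A) (x : A →ₐ[F] B) :
    (∃ y, y ≫ idealInclusion ξ I = specOverMap x ≫ ξ.hom) ↔ ∀ a ∈ I, x a = 0 := by
  constructor
  · rintro ⟨y, hy⟩ a ha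
    rw [← specOverMap_algOf y, idealInclusion, ← Category.assoc, cancel_mono,
      specOverMap_comp] at hy
    rw [← specOverMap_injective hy]
    change algOf y (Ideal.Quotient.mk I a) = 0
    rw [Ideal.Quotient.eq_zero_iff_mem.2 ha, map_zero]
  · intro h
    refine ⟨specOverMap (Ideal.Quotient.liftₐ I x h), ?_⟩
    rw [idealInclusion, ← Category.assoc, specOverMap_comp]
    congr 2

lemma exists_mul_idealInclusion (m : X ⊗ X ⟶ X) (ξ : specOver F A ≅ X) (I : Ideal A)
    (hI : ∀ a ∈ I, pointOp m ξ ((A ⧸ I) ⊗[F] (A ⧸ I))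
      (Algebra.TensorProduct.includeLeft.comp (Ideal.Quotient.mkₐ F I))
      (Algebra.TensorProduct.includeRight.comp (Ideal.Quotient.mkₐ F I)) a = 0) :
    ∃ p, p ≫ idealInclusion ξ I = (idealInclusion ξ I ⊗ₘ idealInclusion ξ I) ≫ m := by
  obtain ⟨y, hy⟩ := (exists_comp_idealInclusion_iff ξ I _).2 hI
  let l := CartesianMonoidalCategory.lift
    (specOverMap (k := F) (Algebra.TensorProduct.includeLeft : A ⧸ I →ₐ[F] (A ⧸ I) ⊗[F] (A ⧸ I)))
    (specOverMap Algebra.TensorProduct.includeRight)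
  have : IsIso l := isIso_lift_specOverMap
  refine ⟨inv l ≫ y, ?_⟩
  rw [Category.assoc, IsIso.inv_comp_eq, hy, specOverMap_pointOp, ← Category.assoc,
    CartesianMonoidalCategory.lift_map]
  simp only [idealInclusion, ← Category.assoc, specOverMap_comp]

lemma isReduced_baseChange {k : Type u} [Field k] [Algebra F k] [IsReduced (k ⊗[F] B)] :
    IsReduced ((baseChange F k).obj (specOver F B)).left := by
  obtain ⟨e⟩ : Nonempty (Limits.pullback (Spec.map (CommRingCat.ofHom (algebraMap F B)))
      (Spec.map (CommRingCat.ofHom (algebraMap F k))) ≅ Spec (.of (k ⊗[F] B))) :=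
    ⟨Limits.pullbackSymmetry _ _ ≪≫ pullbackSpecIso F k B⟩
  have := isReduced_of_isOpenImmersion e.hom
  exact this

end Subscheme

section Defines

open TensorProduct

variable {F k : Type u} [Field F] [Field k] [Algebra F k] {M : Over (Spec (.of k))} [MonObj M]

instance isIso_toUnit_specOver : IsIso (CartesianMonoidalCategory.toUnit (specOver k k)) := by
  have h : IsIso ((Over.forget (Spec (.of k))).map
      (CartesianMonoidalCategory.toUnit (specOver k k))) :=
    inferInstanceAs (IsIso (Spec.map (𝟙 (CommRingCat.of k))))
  exact isIso_of_reflects_iso _ (Over.forget _)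

lemma Pt.exists_overHom_eq {X : Over (Spec (.of k))} (w : specOver k k ⟶ X) :
    ∃ y : Pt X, y.overHom = w :=
  ⟨inv (CartesianMonoidalCategory.toUnit (specOver k k)) ≫ w, IsIso.hom_inv_id_assoc _ w⟩

lemma Pt.overHom_injective {X : Over (Spec (.of k))} :
    Function.Injective (Pt.overHom : Pt X → (specOver k k ⟶ X)) :=
  fun _ _ h ↦ (cancel_epi (CartesianMonoidalCategory.toUnit (specOver k k))).1 h

lemma Pt.overHom_map {X Y : Over (Spec (.of k))} (f : X ⟶ Y) (x : Pt X) :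
    (Pt.map f x).overHom = x.overHom ≫ f :=
  (Category.assoc _ _ _).symm

lemma SemigroupForm.defines_of_ideal (Φ : SemigroupForm F M) {A : Type u} [CommRing A] [Algebra F A]
    (ξ : specOver F A ≅ Φ.obj) (I : Ideal A)
    (hI : ∀ a ∈ I, pointOp Φ.mul ξ ((A ⧸ I) ⊗[F] (A ⧸ I))
      (Algebra.TensorProduct.includeLeft.comp (Ideal.Quotient.mkₐ F I))
      (Algebra.TensorProduct.includeRight.comp (Ideal.Quotient.mkₐ F I)) a = 0)
    [IsReduced (k ⊗[F] (A ⧸ I))] {Z : Set (Pt M)}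
    (hZ : ∀ x : Pt M, x ∈ Z ↔ ∀ a ∈ I, algOf (descendHom (x.overHom ≫ Φ.iso.inv) ≫ ξ.inv) a = 0) :
    Φ.Defines Z := by
  obtain ⟨p, hp⟩ := exists_mul_idealInclusion Φ.mul ξ I hI
  refine ⟨_, idealInclusion ξ I, p, inferInstance, hp, isReduced_baseChange, fun x ↦ ?_⟩
  rw [hZ, ← exists_comp_idealInclusion_iff, specOverMap_algOf, Category.assoc, Iso.inv_hom_id,
    Category.comp_id]
  constructor
  · rintro ⟨y, hy⟩
    obtain ⟨w, rfl⟩ := descendHom_surjective (k := k) y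
    obtain ⟨z, rfl⟩ := Pt.exists_overHom_eq w
    rw [← descendHom_map] at hy
    refine ⟨z, Pt.overHom_injective ?_⟩
    rw [Pt.overHom_map, ← Category.assoc, ← Iso.eq_comp_inv]
    exact descendHom_injective hy
  · rintro ⟨y, rfl⟩
    refine ⟨descendHom y.overHom, ?_⟩
    rw [← descendHom_map, Pt.overHom_map]
    simp

end Defines

end ToricMonoid

namespace ToricMonoid

/-! ### The quotient of the monoid of characters by units and torsion. -/

section SharpQuotient

variable {n : ℕ} (S : AddSubmonoid (Fin n → ℤ))

/-- The homomorphism from a monoid of characters to its rational span modulo the units. -/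
def toUnitQuotient : S →+ (Fin n → ℚ) ⧸ unitSpan S :=
  (unitSpan S).mkQ.toAddMonoidHom.comp ((toQ n).comp S.subtype)

/-- The quotient of a monoid of characters by the units and by torsion. -/
abbrev sharpQuotient : Type := AddMonoidHom.mrange (toUnitQuotient S)

/-- The quotient map. -/
def toSharpQuotient : S →+ sharpQuotient S := (toUnitQuotient S).mrangeRestrict

variable {S}

lemma toSharpQuotient_eq_iff {s s' : S} :
    toSharpQuotient S s = toSharpQuotient S s' ↔ toQ n s - toQ n s' ∈ unitSpan S :=
  Subtype.ext_iff.trans (Submodule.Quotient.eq _)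

lemma toSharpQuotient_eq_zero_iff {s : S} :
    toSharpQuotient S s = 0 ↔ -(s : Fin n → ℤ) ∈ S := by
  rw [← toQ_mem_unitSpan, ← map_zero (toSharpQuotient S), toSharpQuotient_eq_iff,
    ZeroMemClass.coe_zero, map_zero, sub_zero]

/-- Only units of `S` map to zero, which gives sharpness; multiplication by `N + 1` is injective
because the target lies in a rational vector space. -/
lemma isSharpQuotient : IsSharpQuotient (toSharpQuotient S) := by
  refine ⟨fun s s' h ↦ ?_, ?_, fun N q q' h ↦ ?_⟩
  · obtain ⟨m, hm, l, l', hl, hl', e⟩ :=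
      exists_nsmul_eq_of_mem_unitSpan (toSharpQuotient_eq_iff.1 h)
    obtain ⟨N, rfl⟩ := Nat.exists_eq_succ_of_ne_zero hm
    have hu (l : S) (hl : -(l : Fin n → ℤ) ∈ S) : IsAddUnit l :=
      IsAddUnit.of_add_eq_zero ⟨_, hl⟩ (Subtype.ext (add_neg_cancel _))
    exact ⟨N, l, l', hu l hl, hu l' hl', e⟩
  · intro q q' h
    obtain ⟨s, rfl⟩ := (toUnitQuotient S).mrangeRestrict_surjective q
    obtain ⟨s', rfl⟩ := (toUnitQuotient S).mrangeRestrict_surjective q'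
    refine toSharpQuotient_eq_zero_iff.2 ?_
    have h1 : toSharpQuotient S (s + s') = 0 := (map_add _ _ _).trans h
    have h2 := S.add_mem (toSharpQuotient_eq_zero_iff.1 h1) s'.2
    rwa [AddSubmonoid.coe_add, neg_add, neg_add_cancel_right] at h2
  · have h1 : (N + 1) • (q : (Fin n → ℚ) ⧸ unitSpan S) = (N + 1) • (q' : (Fin n → ℚ) ⧸ unitSpan S) :=
      congr_arg Subtype.val h
    rw [← Nat.cast_smul_eq_nsmul ℚ, ← Nat.cast_smul_eq_nsmul ℚ] at h1
    exact Subtype.ext (smul_right_injective _ (by positivity) h1)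

/-- Embedding into a rational vector space gives unique sums, which provides the reducedness of the
monoid algebra; the same holds for `S × S`. -/
instance : TwoUniqueSums (sharpQuotient S) :=
  .of_injective_addHom (AddMonoidHom.mrange (toUnitQuotient S)).subtype.toAddHom
    Subtype.val_injective inferInstance

instance : TwoUniqueSums (S × S) :=
  .of_injective_addHom (((toQ n).comp S.subtype).prodMap ((toQ n).comp S.subtype)).toAddHom
    (Function.Injective.prodMap ((toQ_injective n).comp Subtype.val_injective)
      ((toQ_injective n).comp Subtype.val_injective)) inferInstance

end SharpQuotient

end ToricMonoid

namespace ToricMonoid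

/-! ### The multiplication in coordinates, and the conclusion over `F`. -/

section Universal

open AddMonoidAlgebra

variable {k : Type u} [Field k] {M : Over (Spec (.of k))} [MonObj M]

lemma Pt.overHom_mul (x y : Pt M) :
    CartesianMonoidalCategory.lift x.overHom y.overHom ≫ μ[M] = (x * y).overHom := by
  change _ = CartesianMonoidalCategory.toUnit _ ≫ CartesianMonoidalCategory.lift x.toHom y.toHom ≫ μ[M]
  rw [← Category.assoc, CartesianMonoidalCategory.comp_lift]
  rfl

/-- The multiplication on the spectrum of a monoid algebra is determined by its effect on rational
points. -/
lemma lift_comp_mul_eq [IsAlgClosed k] [LocallyOfFiniteType M.hom] [IsSeparated M.hom]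
    {S : Type} [AddCommMonoid S] [AddMonoid.FG S] [TwoUniqueSums (S × S)]
    (Ψ : specOver k (AddMonoidAlgebra k S) ⟶ M)
    (hΨ : ∀ ψ₁ ψ₂ ψ₃ : AddMonoidAlgebra k S →ₐ[k] k,
      (∀ s, ψ₃ (single s 1) = ψ₁ (single s 1) * ψ₂ (single s 1)) →
      CartesianMonoidalCategory.lift (specOverMap ψ₁ ≫ Ψ) (specOverMap ψ₂ ≫ Ψ) ≫ μ[M] =
        specOverMap ψ₃ ≫ Ψ) {B : Type u} [CommRing B] [Algebra k B]
    {ψ₁ ψ₂ ψ₃ : AddMonoidAlgebra k S →ₐ[k] B}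
    (hψ : ∀ s, ψ₃ (single s 1) = ψ₁ (single s 1) * ψ₂ (single s 1)) :
    CartesianMonoidalCategory.lift (specOverMap ψ₁ ≫ Ψ) (specOverMap ψ₂ ≫ Ψ) ≫ μ[M] =
      specOverMap ψ₃ ≫ Ψ := by
  let u₁ : AddMonoidAlgebra k S →ₐ[k] AddMonoidAlgebra k (S × S) :=
    mapDomainAlgHom k k (AddMonoidHom.inl S S)
  let u₂ : AddMonoidAlgebra k S →ₐ[k] AddMonoidAlgebra k (S × S) :=
    mapDomainAlgHom k k (AddMonoidHom.inr S S)
  let u₃ : AddMonoidAlgebra k S →ₐ[k] AddMonoidAlgebra k (S × S) :=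
    mapDomainAlgHom k k ((AddMonoidHom.id S).prod (AddMonoidHom.id S))
  have hu (s : S) : u₃ (single s 1) = u₁ (single s 1) * u₂ (single s 1) := by
    simp only [u₁, u₂, u₃, mapDomainAlgHom_single, single_mul_single]
    simp
  have hcomp {C : Type u} [CommRing C] [Algebra k C] (f : AddMonoidAlgebra k (S × S) →ₐ[k] C) :
      specOverMap f ≫ CartesianMonoidalCategory.lift (specOverMap u₁ ≫ Ψ) (specOverMap u₂ ≫ Ψ) ≫
        μ[M] = CartesianMonoidalCategory.lift (specOverMap (f.comp u₁) ≫ Ψ)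
          (specOverMap (f.comp u₂) ≫ Ψ) ≫ μ[M] := by
    rw [← Category.assoc, CartesianMonoidalCategory.comp_lift, ← Category.assoc, ← Category.assoc,
      specOverMap_comp, specOverMap_comp]
  -- The universal pair of points lives over `k[S × S]`, which is reduced and of finite type, so the
  -- identity can be checked on rational points.
  have huniv : CartesianMonoidalCategory.lift (specOverMap u₁ ≫ Ψ) (specOverMap u₂ ≫ Ψ) ≫ μ[M] =
      specOverMap u₃ ≫ Ψ := by
    have h1 : LocallyOfFiniteType (specOver k (AddMonoidAlgebra k (S × S))).hom := by
      change LocallyOfFiniteType (Spec.map _)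
      rw [HasRingHomProperty.Spec_iff (P := @LocallyOfFiniteType)]
      exact RingHom.finiteType_algebraMap.2 inferInstance
    have h2 : IsReduced (specOver k (AddMonoidAlgebra k (S × S))).left :=
      inferInstanceAs (IsReduced (Spec (.of (AddMonoidAlgebra k (S × S)))))
    refine hom_ext_of_pt ⊤ dense_univ fun x _ ↦ Pt.overHom_injective ?_
    rw [Pt.overHom_map, Pt.overHom_map, ← specOverMap_algOf x.overHom, hcomp, ← Category.assoc,
      specOverMap_comp]
    refine hΨ _ _ _ fun s ↦ ?_
    rw [AlgHom.comp_apply, hu, map_mul]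
    rfl
  let f : AddMonoidAlgebra k (S × S) →ₐ[k] B := AddMonoidAlgebra.lift k B (S × S)
    { toFun := fun s ↦ ψ₁ (single s.toAdd.1 1) * ψ₂ (single s.toAdd.2 1)
      map_one' := (congr_arg₂ _ (map_one ψ₁) (map_one ψ₂)).trans (_root_.one_mul _)
      map_mul' := fun s s' ↦ by
        rw [_root_.mul_mul_mul_comm, ← map_mul, ← map_mul, single_mul_single, single_mul_single,
          _root_.mul_one]
        rfl }
  have hf (s : S × S) : f (single s 1) = ψ₁ (single s.1 1) * ψ₂ (single s.2 1) :=
    (AddMonoidAlgebra.lift_single _ _ _).trans (one_smul _ _)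
  have h1 : f.comp u₁ = ψ₁ := algHom_ext_single fun s ↦ by
    rw [AlgHom.comp_apply, mapDomainAlgHom_single, hf]
    exact (congr_arg _ (map_one ψ₂)).trans (_root_.mul_one _)
  have h2 : f.comp u₂ = ψ₂ := algHom_ext_single fun s ↦ by
    rw [AlgHom.comp_apply, mapDomainAlgHom_single, hf]
    exact (congr_arg (· * _) (map_one ψ₁)).trans (_root_.one_mul _)
  have h3 : f.comp u₃ = ψ₃ := algHom_ext_single fun s ↦ by
    rw [AlgHom.comp_apply, mapDomainAlgHom_single, hf, hψ]
    rfl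
  rw [← h1, ← h2, ← hcomp, huniv, ← Category.assoc, specOverMap_comp, h3]

end Universal

section Coordinates

variable {k : Type u} [Field k] [IsAlgClosed k] {n : ℕ} {M : Over (Spec (.of k))} [MonObj M]
  [IsSeparated M.hom] [LocallyOfFiniteType M.hom] [IsIntegral M.left] [IsAffine M.left]
  {j : splitTorus k n ⟶ M} [IsMonHom j] [IsOpenImmersion j.left] {e : Pt M}

/-- An affine toric monoid is the spectrum of the algebra of its monoid of characters. -/
lemma exists_specOver_charMonoid_iso (h : IsCore j e) :
    ∃ Ψ : specOver k (AddMonoidAlgebra k (charMonoid j e.toSpace)) ≅ M,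
      ∀ x : Pt M, x.overHom = specOverMap (AddMonoidAlgebra.lift k k _ (charVal h x)) ≫ Ψ.hom := by
  have hU := isAffineOpen_top M.left
  let Θ : specOver k Γ(M.left, ⊤) ⟶ M := Over.homMk hU.fromSpec (fromSpec_comp_hom hU)
  have hΘ : IsIso Θ := by
    have : IsIso ((Over.forget (Spec (.of k))).map Θ) := by
      change IsIso hU.fromSpec
      rw [IsAffineOpen.fromSpec_top]
      infer_instance
    exact isIso_of_reflects_iso _ (Over.forget _)
  let E := AlgEquiv.ofBijective (monSec h) ⟨monSec_injective h, exists_monSec_eq h⟩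
  let Ξ : specOver k (AddMonoidAlgebra k (charMonoid j e.toSpace)) ≅ specOver k Γ(M.left, ⊤) :=
    { hom := specOverMap E.symm.toAlgHom
      inv := specOverMap E.toAlgHom
      hom_inv_id := by
        rw [specOverMap_comp, ← specOverMap_id]
        exact congr_arg specOverMap (AlgHom.ext E.symm_apply_apply)
      inv_hom_id := by
        rw [specOverMap_comp, ← specOverMap_id]
        exact congr_arg specOverMap (AlgHom.ext E.apply_symm_apply) }
  refine ⟨Ξ ≪≫ asIso Θ, fun x ↦ ?_⟩
  have h1 : x.overHom = specOverMap (x.evₐ ⊤ (TopologicalSpace.Opens.mem_top _)) ≫ Θ := by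
    refine Over.OverMorphism.ext (x.overHom_left.trans ?_)
    exact (eq_specMap_fromSpec hU x.hom (x.le_preimage (TopologicalSpace.Opens.mem_top _))).symm
  rw [h1]
  change _ = specOverMap _ ≫ specOverMap E.symm.toAlgHom ≫ Θ
  rw [← Category.assoc, specOverMap_comp]
  congr 2
  ext1 f
  obtain ⟨a, rfl⟩ := exists_monSec_eq h f
  refine (ev_monSec h x a).trans ?_
  change _ = AddMonoidAlgebra.lift k k _ _ (E.symm (E a))
  rw [AlgEquiv.symm_apply_apply]

lemma coordinates_mul (h : IsCore j e)
    {Ψ : specOver k (AddMonoidAlgebra k (charMonoid j e.toSpace)) ≅ M}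
    (hΨ : ∀ x : Pt M, x.overHom =
      specOverMap (AddMonoidAlgebra.lift k k _ (charVal h x)) ≫ Ψ.hom)
    (ψ₁ ψ₂ ψ₃ : AddMonoidAlgebra k (charMonoid j e.toSpace) →ₐ[k] k)
    (hψ : ∀ s, ψ₃ (.single s 1) = ψ₁ (.single s 1) * ψ₂ (.single s 1)) :
    CartesianMonoidalCategory.lift (specOverMap ψ₁ ≫ Ψ.hom) (specOverMap ψ₂ ≫ Ψ.hom) ≫ μ[M] =
      specOverMap ψ₃ ≫ Ψ.hom := by
  have key (ψ : AddMonoidAlgebra k (charMonoid j e.toSpace) →ₐ[k] k) (x : Pt M)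
      (hx : x.overHom = specOverMap ψ ≫ Ψ.hom) :
      AddMonoidAlgebra.lift k k _ (charVal h x) = ψ := by
    rw [hΨ, cancel_mono] at hx
    exact specOverMap_injective hx
  obtain ⟨x, hx⟩ := Pt.exists_overHom_eq (specOverMap ψ₁ ≫ Ψ.hom)
  obtain ⟨y, hy⟩ := Pt.exists_overHom_eq (specOverMap ψ₂ ≫ Ψ.hom)
  rw [← hx, ← hy, Pt.overHom_mul, hΨ, charVal_mul]
  congr 2
  refine algHom_ext_single fun s ↦ ?_
  rw [hψ, ← key ψ₁ x hx, ← key ψ₂ y hy, AddMonoidAlgebra.lift_single, AddMonoidAlgebra.lift_single,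
    AddMonoidAlgebra.lift_single, one_smul, one_smul, one_smul]
  rfl

end Coordinates

end ToricMonoid

namespace ToricMonoid

section

variable {k : Type u} [Field k] [IsAlgClosed k] {n : ℕ} {M : Over (Spec (.of k))} [MonObj M]
  [IsSeparated M.hom] [LocallyOfFiniteType M.hom] [IsIntegral M.left] [IsAffine M.left]
  {j : splitTorus k n ⟶ M} [IsMonHom j] [IsOpenImmersion j.left] {e : Pt M}

lemma SemigroupForm.isAffine {F : Type u} [Field F] [Algebra F k] (Φ : SemigroupForm F M) :
    IsAffine Φ.obj.left := by
  obtain ⟨i⟩ : Nonempty (Limits.pullback Φ.obj.hom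
      (Spec.map (CommRingCat.ofHom (algebraMap F k))) ≅ M.left) :=
    ⟨(Over.forget _).mapIso Φ.iso⟩
  have h3 := IsAffine.of_isIso i.hom
  have h4 := Φ.quasiCompact
  have h5 := Φ.isSeparated
  have h6 : CompactSpace Φ.obj.left := QuasiCompact.compactSpace_of_compactSpace Φ.obj.hom
  have h7 : QuasiSeparatedSpace Φ.obj.left :=
    quasiSeparatedSpace_of_quasiSeparated Φ.obj.hom
  have h8 : Surjective (Spec.map (CommRingCat.ofHom (algebraMap F k))) := inferInstance
  have h9 : Flat (Spec.map (CommRingCat.ofHom (algebraMap F k))) := inferInstance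
  exact isAffine_of_isPullback (.of_hasPullback Φ.obj.hom
    (Spec.map (CommRingCat.ofHom (algebraMap F k))))

/-- The central submonoid of a toric monoid is defined over every field over which the toric monoid
is defined. -/
lemma SemigroupForm.defines_centralSubmonoid [QuasiCompact M.hom] (h : IsCore j e) {F : Type u}
    [Field F] [Algebra F k] (Φ : SemigroupForm F M) :
    Φ.Defines (centralSubmonoid (ptEquiv h) : Set (Pt M)) := by
  have := Φ.isAffine
  obtain ⟨A, _, _, ⟨ξ⟩⟩ := exists_specOver_iso Φ.obj
  obtain ⟨Ψ, hΨ⟩ := exists_specOver_charMonoid_iso h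
  have : AddMonoid.FG (charMonoid j e.toSpace) :=
    (AddMonoid.fg_iff_addSubmonoid_fg _).2 (isAffineToric h).fg
  have hform := isMonoidForm Φ.mul ξ (Ψ ≪≫ Φ.iso.symm) fun B _ _ ψ₁ ψ₂ ψ₃ hψ ↦ by
    have h1 := lift_comp_mul_eq Ψ.hom (coordinates_mul h hΨ) hψ
    rw [← cancel_mono Φ.iso.hom, Category.assoc, Category.assoc, Φ.iso_mul, ← Category.assoc,
      CartesianMonoidalCategory.lift_map]
    simpa using h1
  set θ := algOf (descendHom (Ψ ≪≫ Φ.iso.symm).hom ≫ ξ.inv) with hθ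
  have hd := isSharpQuotient (S := charMonoid j e.toSpace)
  have hred := hform.isReduced_tensor hd
  refine Φ.defines_of_ideal ξ (IsMonoidForm.ideal θ (toSharpQuotient (charMonoid j e.toSpace)))
    (fun a ha ↦ hform.op_eq_zero hd ha) fun x ↦ ?_
  have hx : algOf (descendHom (x.overHom ≫ Φ.iso.inv) ≫ ξ.inv) =
      ((AddMonoidAlgebra.lift k k _ (charVal h x)).restrictScalars F).comp θ := by
    refine specOverMap_injective ?_
    rw [specOverMap_algOf, ← specOverMap_comp, hθ, specOverMap_algOf, hΨ, Category.assoc,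
      descendHom_specOverMap, Category.assoc]
    rfl
  rw [hx]
  refine Iff.trans ?_ (hform.forall_ideal_iff hd (AddMonoidAlgebra.lift k k _ (charVal h x))).symm
  refine forall₂_congr fun s s' ↦ ?_
  rw [toSharpQuotient_eq_iff, AddMonoidAlgebra.lift_single, AddMonoidAlgebra.lift_single, one_smul,
    one_smul]
  rfl

end

end ToricMonoid

/-! ### The main theorem. -/

theorem mainTheorem10 (k : Type u) [Field k] [IsAlgClosed k]
    (M : Over (Spec (.of k))) [MonObj M] (hM : ToricMonoid.IsToricMonoid M) :
    (∃ e₀ : ToricMonoid.Idempotents (ToricMonoid.Pt M), ∀ f, ToricMonoid.IdemLE e₀ f) ∧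
    ∀ e₀ : ToricMonoid.Idempotents (ToricMonoid.Pt M), (∀ f, ToricMonoid.IdemLE e₀ f) →
      -- (i) every maximal chain of idempotents has length `dim T₀`
      (∃ d : ℕ, topologicalKrullDim (ToricMonoid.neutralIsotropy (e₀ : ToricMonoid.Pt M)) = d ∧
        ∀ C : Set (ToricMonoid.Idempotents (ToricMonoid.Pt M)),
          IsMaxChain ToricMonoid.IdemLE C → C.encard = d + 1) ∧
      -- (ii) the closure of `T₀` is the smallest closed irreducible subsemigroup containing `E(M)`
      IsLeast {A : Set (ToricMonoid.Pt M) | ToricMonoid.IsClosedIrreducibleSubsemigroup A ∧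
          ∀ f : ToricMonoid.Pt M, IsIdempotentElem f → f ∈ A}
        (closure (ToricMonoid.neutralIsotropy (e₀ : ToricMonoid.Pt M))) ∧
      -- (iii) the closure of `T₀` is the largest closed irreducible subsemigroup with a zero
      IsGreatest {A : Set (ToricMonoid.Pt M) | ToricMonoid.IsClosedIrreducibleSubsemigroup A ∧
          ToricMonoid.HasZeroElement A}
        (closure (ToricMonoid.neutralIsotropy (e₀ : ToricMonoid.Pt M))) ∧
      -- (iv) the closure of `T₀` is defined over `F` if `M` is
      ∀ (F : Type u) [Field F] [Algebra F k] (Φ : ToricMonoid.SemigroupForm F M),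
        Φ.Defines (closure (ToricMonoid.neutralIsotropy (e₀ : ToricMonoid.Pt M))) := by
  classical
  have := hM.isSeparated
  have := hM.locallyOfFiniteType
  have := hM.quasiCompact
  have := hM.isReduced
  have := hM.irreducibleSpace
  have : IsIntegral M.left := isIntegral_of_irreducibleSpace_of_isReduced _
  obtain ⟨n, j, _, _, -⟩ := hM.unitGroup_isTorus
  obtain ⟨e, he, hZ⟩ := ToricMonoid.exists_idempotent j
  have h : ToricMonoid.IsCore j e := ⟨he, hZ⟩
  have := ToricMonoid.isAffine_of_isCore h
  have hφ := ToricMonoid.isAffineToric h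
  refine ⟨ToricMonoid.exists_smallest (ToricMonoid.ptEquiv h), fun e₀ he₀ ↦ ?_⟩
  rw [hφ.closure_neutralIsotropy he₀]
  exact ⟨hφ.exists_dim he₀, hφ.isLeast, hφ.isGreatest,
    fun F _ _ Φ ↦ Φ.defines_centralSubmonoid h⟩
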